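/- **The surfaces $X_g$, $g\ge 3$.** Let $\alpha=\alpha_g$ be the unique positive root of $x^g+x^{g-1}+\cdots+x-1$. In $\mathbb R^2$ put $$P_0=\Bigl(\tfrac{1-\alpha^g}{2},\tfrac{\alpha^2}{1-\alpha}\Bigr),\quad P_1=\Bigl(-\tfrac{\alpha^{g-1}+\alpha^g}{2},\tfrac{\alpha-\alpha^2+\alpha^3}{1-\alpha}\Bigr),\quad P_g=\Bigl(1+\tfrac{\alpha-\alpha^g}{2},\tfrac{3\alpha-1-\alpha^2}{1-\alpha}\Bigr),\quad P_i=\Bigl(\tfrac{\alpha-\alpha^i}{1-\alpha},\tfrac{\alpha}{1-\alpha}\Bigr)\ (2\le i\le g-1),$$ $$Q_0=\Bigl(-\tfrac{\alpha^g}{2},\alpha\Bigr),\qquad Q_i=\Bigl(\tfrac{2\alpha-\alpha^i-\alpha^{i+1}}{2(1-\alpha)},\tfrac{\alpha-\alpha^{g-i+2}}{1-\alpha}\Bigr)\ (1\le i\le g).$$ For $1\le i\le g$ let $T_i=P_0Q_iQ_{i-1}$ and $T_{g+i}=P_iQ_{i-1}Q_i$; primes denote reflection in the horizontal axis. Glue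 the $T_k$ along their common edges $P_0Q_i$ and $Q_{i-1}Q_i$, likewise the $T'_k$, and glue by translation the edge pairs $P_0Q_0\sim Q'_gP'_0$, $P_1Q_1\sim Q'_{g-1}P'_g$, $P_1Q_0\sim P_{g-1}Q_{g-1}$, $P_gQ_g\sim P_2Q_1$, $P_iQ_i\sim Q'_iP'_{i+1}$ ($2\le i\le g-2$), together with their mirror images. The result is the genus $g$ Arnoux–Yoccoz surface $(X_g,\omega_g)$, with $\omega_g$ induced by $dz$. **The surface $X_\infty$.** Take the closed rectangles $R^+=[0,1]\times[\frac12,1]$ and $R^-=[-\frac12,\frac12]\times[0,\frac12]$. They are joined along $[0,\frac12]\times\{\frac12\}$. The following pairs of boundary edges are glued by translation: * $[\frac12,1]\times\{\frac12\}$ of $R^+$ with $[-\frac12,0]\times\{\frac12\}$ of $R^-$; * for $n\ge1$, $A_n$: $[1-2\cdot2^{-n},\,1-\frac32 2^{-n}]\times\{1\}$ with $[\frac12-\frac32 2^{-n},\,\frac12-2^{-n}]\times\{0\}$; * for $n\ge1$, $B_n$: $[1-\frac32 2^{-n},\,1-2^{-n}]\times\{1\}$ with $[\frac12-2\cdot2^{-n},\,\frac12-\frac32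 2^{-n}]\times\{0\}$; * $C'_n$: for odd $n\ge1$, $\{0\}\times[\frac23+\frac16 2^{-n},\frac23+\frac23 2^{-n}]$ on the left of $R^+$ with $\{\frac12\}\times[2^{-n-1},2^{-n}]$ on the right of $R^-$; for even $n\ge2$, $\{0\}\times[\frac23-\frac23 2^{-n},\frac23-\frac16 2^{-n}]$ with $\{1\}\times[1-2^{-n},1-2^{-n-1}]$, both on $R^+$; * $C''_n$, $n\ge1$: the image of the pair $C'_n$ under the glide reflection $(x,y)\mapsto(x-\frac12,1-y)$, which maps $R^+$ to $R^-$ and, with its inverse on $R^-$, exchanges the two rectangles. (All edges with label $A_n,B_n,C'_n,C''_n$ have length $2^{-n-1}$.) Before gluing, the endpoints of all the edges, and the limits of such endpoints, are removed. The result is the translation surface $(X_\infty,\omega_\infty)$, with $\omega_\infty$ induced by $dz$. **Metrics and the sets $U_g$.** For $3\le n\le\infty$, $|\omega_n|$ denotes the flat metric on $X_n$, with distance $d_n$ equal to the infimum of the $|\omega_n|$-lengths of the paths between two points. For $3\le g<\infty$ let $U_g\subset X_\infty$ be the set of points that do not lie on an edge $A_n$ or $B_n$ with $n>\lfloor g/2\rfloor$,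 nor on an edge $C'_n$ or $C''_n$ with $n>\lfloor (g-1)/2\rfloor$. **Theorem.** The sets $U_g$ are open and dense in $X_\infty$, $U_g\subset U_{g+1}$, and $\bigcup_{g\ge3}U_g=X_\infty$. There are piecewise-affine topological embeddings $\iota_g:U_g\to X_g$ $(g\ge3)$, each with finitely many affine pieces, such that the metrics $\iota_g^*|\omega_g|$ converge to $|\omega_\infty|$ uniformly on compact subsets of $X_\infty$: for every compact $K\subset X_\infty$ and every $\varepsilon>0$ there is $N$ such that for all $g\ge N$ one has $K\subset U_g$ and $$(1-\varepsilon)\,d_\infty(x,y)\le d_g(\iota_g(x),\iota_g(y))\le(1+\varepsilon)\,d_\infty(x,y)\qquad\text{for all }x,y\in K.$$ -/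

import Mathlib

open Topology Set

/-! ### Translation surfaces glued from plane pieces

The plane is `ℂ`.  A surface is glued from a family of plane pieces along edges; every gluing is the
restriction of a translation, so that `dz` descends to a 1-form `ω` on the quotient, and the flat
metric `|ω|` is the length metric that `|dz|` induces there. -/

/-- Plane pieces (given by the points that belong to the surface) and edge gluings: `glue i a b j c d`
means that the edge from `a` to `b` of piece `i` is glued by translation to the edge from `c` to `d`
of piece `j`. -/
structure TranslationGluing where
  Piece : Type
  region : Piece → Set ℂ
  glue : Piece → ℂ → ℂ → Piece → ℂ → ℂ → Prop
  translation : ∀ i a b j c d, glue i a b j c d → b - a = d - c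

namespace TranslationGluing

variable (G : TranslationGluing)

/-- The disjoint union of the pieces. -/
abbrev Pt : Type := Σ i : G.Piece, ↥(G.region i)

/-- Identification of a point of an edge with its translate on the partner edge. -/
def Rel (p q : G.Pt) : Prop :=
  ∃ a b c d, G.glue p.1 a b q.1 c d ∧
    (p.2 : ℂ) ∈ segment ℝ a b ∧ (q.2 : ℂ) = (p.2 : ℂ) + (c - a)

/-- The glued surface: the quotient by the equivalence relation generated by `Rel`.  The topology is
the quotient topology of the disjoint union of the pieces. -/
def Surface : Type := Quot G.Rel

instance : TopologicalSpace G.Surface :=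
  inferInstanceAs (TopologicalSpace (Quot G.Rel))

variable {G}

/-- The point of the surface represented by the point `z` of piece `i`. -/
def pt (i : G.Piece) (z : ℂ) (hz : z ∈ G.region i) : G.Surface := Quot.mk _ ⟨i, z, hz⟩

/-- `PolyPath x y ℓ`: some path from `x` to `y` in the surface that consists of finitely many straight
segments, each contained in one piece, has `|ω|`-length `ℓ`. -/
inductive PolyPath : G.Surface → G.Surface → ℝ → Prop
  | refl (x : G.Surface) : PolyPath x x 0
  | cons (i : G.Piece) (p q : ℂ) (hp : p ∈ G.region i) (hq : q ∈ G.region i)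
      (hpq : segment ℝ p q ⊆ G.region i) (y : G.Surface) (l : ℝ)
      (h : PolyPath (pt i q hq) y l) : PolyPath (pt i p hp) y (dist p q + l)

/-- The distance of the flat metric `|ω|`: the infimum of the lengths of the piecewise straight paths
between two points (`∞` if there is none). -/
noncomputable def flatDist (x y : G.Surface) : ENNReal :=
  ⨅ (l : ℝ) (_ : PolyPath x y l), ENNReal.ofReal l

/-- `f : U → H` is piecewise affine: `U` is covered by finitely many convex polygons, each in one piece
of `G`, and on (the part in `U` of) each polygon `f` is given, in the plane coordinates of that piece
and of one piece of `H`, by a real affine map. -/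
def IsPiecewiseAffine {G H : TranslationGluing} {U : Set G.Surface} (f : U → H.Surface) : Prop :=
  ∃ (n : ℕ) (i : Fin n → G.Piece) (S : Fin n → Finset ℂ) (j : Fin n → H.Piece)
    (A : Fin n → (ℂ →ᵃ[ℝ] ℂ)),
    (∀ (i₀ : G.Piece) (p : ℂ) (hp : p ∈ G.region i₀), pt i₀ p hp ∈ U →
      ∃ k, i k = i₀ ∧ p ∈ convexHull ℝ (S k : Set ℂ)) ∧
    (∀ (k : Fin n) (p : ℂ) (hp : p ∈ G.region (i k)) (hU : pt (i k) p hp ∈ U),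
      p ∈ convexHull ℝ (S k : Set ℂ) →
      ∃ hq : A k p ∈ H.region (j k), f ⟨pt (i k) p hp, hU⟩ = pt (j k) (A k p) hq)

end TranslationGluing

/-! ### The Arnoux–Yoccoz surfaces of finite genus `g ≥ 3` -/

namespace ArnouxYoccoz

/-- `α` (depending on `g ≥ 1`): the unique positive root of `x ^ g + ⋯ + x - 1`. -/
noncomputable def alpha (g : ℕ) : ℝ :=
  Classical.epsilon fun x : ℝ => 0 < x ∧ ∑ i ∈ Finset.Icc 1 g, x ^ i = 1

theorem alpha_spec {g : ℕ} (hg : 1 ≤ g) :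
    0 < alpha g ∧ ∑ i ∈ Finset.Icc 1 g, alpha g ^ i = 1 := by
  have hex : ∃ x : ℝ, 0 < x ∧ ∑ i ∈ Finset.Icc 1 g, x ^ i = 1 := by
    have hc : ContinuousOn (fun x : ℝ => ∑ i ∈ Finset.Icc 1 g, x ^ i) (Icc 0 1) := by fun_prop
    have h0 : ∑ i ∈ Finset.Icc 1 g, (0 : ℝ) ^ i = 0 :=
      Finset.sum_eq_zero fun i hi => zero_pow (by have := (Finset.mem_Icc.1 hi).1; omega)
    have h1 : (1 : ℝ) ≤ ∑ i ∈ Finset.Icc 1 g, (1 : ℝ) ^ i := by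
      simp; exact_mod_cast hg
    obtain ⟨x, hx, hx1⟩ := intermediate_value_Icc (zero_le_one' ℝ) hc
      (show (1 : ℝ) ∈ Icc _ _ from ⟨by simp only [h0]; norm_num, h1⟩)
    refine ⟨x, lt_of_le_of_ne hx.1 ?_, hx1⟩
    rintro rfl
    simp only [h0] at hx1
    norm_num at hx1
  exact Classical.epsilon_spec hex

/-- The points `P_0, …, P_g`. -/
noncomputable def P (g i : ℕ) : ℂ :=
  let α := alpha g
  if i = 0 then ⟨(1 - α ^ g) / 2, α ^ 2 / (1 - α)⟩
  else if i = 1 then ⟨-(α ^ (g - 1) + α ^ g) / 2, (α - α ^ 2 + α ^ 3) / (1 - α)⟩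
  else if i = g then ⟨1 + (α - α ^ g) / 2, (3 * α - 1 - α ^ 2) / (1 - α)⟩
  else ⟨(α - α ^ i) / (1 - α), α / (1 - α)⟩

/-- The points `Q_0, …, Q_g`. -/
noncomputable def Q (g i : ℕ) : ℂ :=
  let α := alpha g
  if i = 0 then ⟨-α ^ g / 2, α⟩
  else ⟨(2 * α - α ^ i - α ^ (i + 1)) / (2 * (1 - α)), (α - α ^ (g - i + 2)) / (1 - α)⟩

/-- The identity for `m = false`, the reflection in the horizontal axis for `m = true`. -/
noncomputable def mir (m : Bool) (z : ℂ) : ℂ := if m then (starRingEnd ℂ) z else z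

/-- The closed triangles: `(false, k)` is `T_k` and `(true, k)` its mirror image `T'_k`,
`1 ≤ k ≤ 2 g`, where `T_i = P_0 Q_i Q_{i-1}` and `T_{g+i} = P_i Q_{i-1} Q_i` for `1 ≤ i ≤ g`. -/
noncomputable def triangle (g : ℕ) (t : Bool × ℕ) : Set ℂ :=
  if 1 ≤ t.2 ∧ t.2 ≤ g then
    convexHull ℝ {mir t.1 (P g 0), mir t.1 (Q g t.2), mir t.1 (Q g (t.2 - 1))}
  else if g < t.2 ∧ t.2 ≤ 2 * g then
    convexHull ℝ {mir t.1 (P g (t.2 - g)), mir t.1 (Q g (t.2 - g - 1)), mir t.1 (Q g (t.2 - g))}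
  else ∅

/-- The edge gluings of the triangles; each stands for itself and its mirror image. -/
inductive Glue (g : ℕ) : Bool × ℕ → ℂ → ℂ → Bool × ℕ → ℂ → ℂ → Prop
  /-- `T_i` and `T_{i+1}` share the edge `P_0 Q_i`. -/
  | fan (m : Bool) (i : ℕ) (h : 1 ≤ i) (h' : i + 1 ≤ g) :
      Glue g (m, i) (mir m (P g 0)) (mir m (Q g i)) (m, i + 1) (mir m (P g 0)) (mir m (Q g i))
  /-- `T_i` and `T_{g+i}` share the edge `Q_{i-1} Q_i`. -/
  | outer (m : Bool) (i : ℕ) (h : 1 ≤ i) (h' : i ≤ g) :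
      Glue g (m, i) (mir m (Q g (i - 1))) (mir m (Q g i))
        (m, g + i) (mir m (Q g (i - 1))) (mir m (Q g i))
  /-- `P_0 Q_0` and `Q'_g P'_0`. -/
  | base (m : Bool) :
      Glue g (m, 1) (mir m (P g 0)) (mir m (Q g 0)) (!m, g) (mir (!m) (Q g g)) (mir (!m) (P g 0))
  /-- `P_1 Q_1` and `Q'_{g-1} P'_g`. -/
  | corner (m : Bool) :
      Glue g (m, g + 1) (mir m (P g 1)) (mir m (Q g 1))
        (!m, 2 * g) (mir (!m) (Q g (g - 1))) (mir (!m) (P g g))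
  /-- `P_1 Q_0` and `P_{g-1} Q_{g-1}`. -/
  | left (m : Bool) :
      Glue g (m, g + 1) (mir m (P g 1)) (mir m (Q g 0))
        (m, 2 * g - 1) (mir m (P g (g - 1))) (mir m (Q g (g - 1)))
  /-- `P_g Q_g` and `P_2 Q_1`. -/
  | right (m : Bool) :
      Glue g (m, 2 * g) (mir m (P g g)) (mir m (Q g g)) (m, g + 2) (mir m (P g 2)) (mir m (Q g 1))
  /-- `P_i Q_i` and `Q'_i P'_{i+1}`, `2 ≤ i ≤ g - 2`. -/
  | step (m : Bool) (i : ℕ) (h : 2 ≤ i) (h' : i + 2 ≤ g) :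
      Glue g (m, g + i) (mir m (P g i)) (mir m (Q g i))
        (!m, g + i + 1) (mir (!m) (Q g i)) (mir (!m) (P g (i + 1)))

theorem mir_sub_mir (m : Bool) (z w : ℂ) : mir m z - mir m w = mir m (z - w) := by
  cases m <;> simp [mir]

theorem mir_not_eq (m : Bool) {z w : ℂ} (hre : z.re = w.re) (him : z.im = -w.im) :
    mir m z = mir (!m) w := by
  cases m <;> apply Complex.ext <;> simp [mir, hre, him]

theorem alpha_pow {g : ℕ} (hg : 1 ≤ g) : alpha g ^ (g + 1) = 2 * alpha g - 1 := by
  have h := (alpha_spec hg).2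
  have key : ∀ n : ℕ, ∀ x : ℝ, (1 - x) * ∑ i ∈ Finset.Icc 1 n, x ^ i = x - x ^ (n + 1) := by
    intro n x
    induction n with
    | zero => simp
    | succ n ih => rw [Finset.sum_Icc_succ_top (by omega), mul_add, ih]; ring
  have := key g (alpha g)
  rw [h] at this
  linarith

theorem alpha_ne_one {g : ℕ} (hg : 3 ≤ g) : 1 - alpha g ≠ 0 := by
  intro h
  have h1 : alpha g = 1 := by linarith
  have h2 := (alpha_spec (g := g) (by omega)).2
  rw [h1] at h2
  simp at h2
  omega

theorem glue_translation {g : ℕ} (hg : 3 ≤ g) (i : Bool × ℕ) (a b : ℂ) (j : Bool × ℕ) (c d : ℂ)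
    (h : Glue g i a b j c d) : b - a = d - c := by
  have h1 := alpha_ne_one hg
  have h2 := alpha_pow (g := g) (by omega)
  have h0 := (alpha_spec (g := g) (by omega)).1.ne'
  cases h with
  | fan => rfl
  | outer => rfl
  | base m =>
    rw [mir_sub_mir, mir_sub_mir]
    obtain ⟨k, rfl⟩ : ∃ k, g = k + 3 := ⟨g - 3, by omega⟩
    apply mir_not_eq
    · simp [P, Q]
      generalize alpha (k + 3) = x at *
      field_simp
      ring_nf at h2 ⊢
      linarith
    · simp [P, Q]
      generalize alpha (k + 3) = x at *
      field_simp
  | corner m =>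
    rw [mir_sub_mir, mir_sub_mir]
    obtain ⟨k, rfl⟩ : ∃ k, g = k + 3 := ⟨g - 3, by omega⟩
    apply mir_not_eq
    · simp [P, Q]
      generalize alpha (k + 3) = x at *
      field_simp
      ring_nf at h2 ⊢
      linarith
    · simp [P, Q]
      generalize alpha (k + 3) = x at *
      field_simp
      ring_nf at h2 ⊢
      linarith
  | left m =>
    rw [mir_sub_mir, mir_sub_mir]
    obtain ⟨k, rfl⟩ : ∃ k, g = k + 3 := ⟨g - 3, by omega⟩
    congr 1
    apply Complex.ext
    · simp [P, Q]
      generalize alpha (k + 3) = x at *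
      field_simp
      ring_nf at h2 ⊢
    · simp [P, Q]
      generalize alpha (k + 3) = x at *
      field_simp
      ring_nf at h2 ⊢
  | right m =>
    rw [mir_sub_mir, mir_sub_mir]
    obtain ⟨k, rfl⟩ : ∃ k, g = k + 3 := ⟨g - 3, by omega⟩
    congr 1
    apply Complex.ext
    · simp [P, Q]
      generalize alpha (k + 3) = x at *
      field_simp
      ring_nf at h2 ⊢
      linarith
    · simp [P, Q]
      generalize alpha (k + 3) = x at *
      field_simp
      ring_nf at h2 ⊢
      linarith
  | step m i hi hi' =>
    rw [mir_sub_mir, mir_sub_mir]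
    obtain ⟨k, rfl⟩ : ∃ k, g = i + 2 + k := ⟨g - (i + 2), by omega⟩
    have e1 : i ≠ 0 := by omega
    have e2 : i ≠ 1 := by omega
    have e3 : i ≠ i + 2 + k := by omega
    have e4 : i + 1 ≠ i + 2 + k := by omega
    apply mir_not_eq
    · simp [P, Q, e1, e2, e3, e4]
      generalize alpha (i + 2 + k) = x at *
      field_simp
      ring
    · simp [P, Q, e1, e2, e3, e4]

/-- The Arnoux–Yoccoz surface `(X_g, ω_g)`. -/
noncomputable def surface (g : ℕ) (hg : 3 ≤ g) : TranslationGluing where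
  Piece := Bool × ℕ
  region := triangle g
  glue := Glue g
  translation := glue_translation hg

/-! ### The limit surface -/

/-- The two closed rectangles: `true` is the upper one, `[0, 1] × [1/2, 1]`, and `false` the lower one,
`[-1/2, 1/2] × [0, 1/2]`. -/
def rectangle (i : Bool) : Set ℂ :=
  if i then {z | z.re ∈ Icc 0 1 ∧ z.im ∈ Icc (1 / 2) 1}
  else {z | z.re ∈ Icc (-1 / 2) (1 / 2) ∧ z.im ∈ Icc 0 (1 / 2)}

/-- Labels of the pairs of edges: the segment along which the two rectangles touch, the pair of
unlabelled edges, and the pairs `A_n`, `B_n`, `C'_n`, `C''_n`, `n ≥ 1`. -/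
inductive Label
  | touch
  | unlabelled
  | A (n : ℕ)
  | B (n : ℕ)
  | C' (n : ℕ)
  | C'' (n : ℕ)

/-- The pairs of edges.  Those labelled `A_n`, `B_n`, `C'_n`, `C''_n` have length `1 / 2 ^ (n + 1)`. -/
inductive LimitEdge : Label → Bool → ℂ → ℂ → Bool → ℂ → ℂ → Prop
  | touch : LimitEdge .touch true ⟨0, 1 / 2⟩ ⟨1 / 2, 1 / 2⟩ false ⟨0, 1 / 2⟩ ⟨1 / 2, 1 / 2⟩
  | unlabelled :
      LimitEdge .unlabelled true ⟨1 / 2, 1 / 2⟩ ⟨1, 1 / 2⟩ false ⟨-1 / 2, 1 / 2⟩ ⟨0, 1 / 2⟩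
  /-- The first half of the `n`-th interval of the top, the second half at the bottom. -/
  | A (n : ℕ) (hn : 1 ≤ n) : LimitEdge (.A n)
      true ⟨1 - 2 * (1 / 2) ^ n, 1⟩ ⟨1 - (3 / 2) * (1 / 2) ^ n, 1⟩
      false ⟨1 / 2 - (3 / 2) * (1 / 2) ^ n, 0⟩ ⟨1 / 2 - (1 / 2) ^ n, 0⟩
  /-- The second half of the `n`-th interval of the top, the first half at the bottom. -/
  | B (n : ℕ) (hn : 1 ≤ n) : LimitEdge (.B n)
      true ⟨1 - (3 / 2) * (1 / 2) ^ n, 1⟩ ⟨1 - (1 / 2) ^ n, 1⟩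
      false ⟨1 / 2 - 2 * (1 / 2) ^ n, 0⟩ ⟨1 / 2 - (3 / 2) * (1 / 2) ^ n, 0⟩
  /-- On the left side of the upper rectangle the edges of odd index lie above the height `2/3`; their
  partners are on the right side of the lower rectangle. -/
  | C'_odd (n : ℕ) (hn : Odd n) : LimitEdge (.C' n)
      true ⟨0, 2 / 3 + (1 / 6) * (1 / 2) ^ n⟩ ⟨0, 2 / 3 + (2 / 3) * (1 / 2) ^ n⟩
      false ⟨1 / 2, (1 / 2) * (1 / 2) ^ n⟩ ⟨1 / 2, (1 / 2) ^ n⟩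
  /-- The edges of even index lie below the height `2/3`; their partners are on the right side of the
  same rectangle. -/
  | C'_even (n : ℕ) (hn : 1 ≤ n) (hn' : Even n) : LimitEdge (.C' n)
      true ⟨0, 2 / 3 - (2 / 3) * (1 / 2) ^ n⟩ ⟨0, 2 / 3 - (1 / 6) * (1 / 2) ^ n⟩
      true ⟨1, 1 - (1 / 2) ^ n⟩ ⟨1, 1 - (1 / 2) * (1 / 2) ^ n⟩
  /-- The image of `C'_n` under the glide reflection `(x, y) ↦ (x - 1/2, 1 - y)`, `n` odd. -/
  | C''_odd (n : ℕ) (hn : Odd n) : LimitEdge (.C'' n)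
      false ⟨-1 / 2, 1 / 3 - (2 / 3) * (1 / 2) ^ n⟩ ⟨-1 / 2, 1 / 3 - (1 / 6) * (1 / 2) ^ n⟩
      true ⟨1, 1 - (1 / 2) ^ n⟩ ⟨1, 1 - (1 / 2) * (1 / 2) ^ n⟩
  /-- The image of `C'_n` under the glide reflection `(x, y) ↦ (x - 1/2, 1 - y)`, `n` even. -/
  | C''_even (n : ℕ) (hn : 1 ≤ n) (hn' : Even n) : LimitEdge (.C'' n)
      false ⟨-1 / 2, 1 / 3 + (1 / 6) * (1 / 2) ^ n⟩ ⟨-1 / 2, 1 / 3 + (2 / 3) * (1 / 2) ^ n⟩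
      false ⟨1 / 2, (1 / 2) * (1 / 2) ^ n⟩ ⟨1 / 2, (1 / 2) ^ n⟩

/-- The endpoints of the edges on the boundary of a rectangle. -/
def edgeEndpoints (i : Bool) : Set ℂ :=
  {v | ∃ l a b j c d, (LimitEdge l i a b j c d ∨ LimitEdge l j c d i a b) ∧ (v = a ∨ v = b)}

theorem limitEdge_translation (l : Label) (i : Bool) (a b : ℂ) (j : Bool) (c d : ℂ)
    (h : LimitEdge l i a b j c d) : b - a = d - c := by
  cases h <;> apply Complex.ext <;> simp <;> ring

/-- The surface `(X_∞, ω_∞)`: the two closed rectangles without the endpoints of the edges and the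
limits of such endpoints, with the two edges of each pair identified by translation. -/
def limitSurface : TranslationGluing where
  Piece := Bool
  region i := rectangle i \ closure (edgeEndpoints i)
  glue i a b j c d := ∃ l, LimitEdge l i a b j c d
  translation := fun i a b j c d ⟨l, h⟩ => limitEdge_translation l i a b j c d h

/-- The pairs of edges that are identified in `U_g`. -/
def Label.Kept (g : ℕ) : Label → Prop
  | .touch => True
  | .unlabelled => True
  | .A n => n ≤ g / 2
  | .B n => n ≤ g / 2
  | .C' n => n ≤ (g - 1) / 2
  | .C'' n => n ≤ (g - 1) / 2

/-- The subset `U_g` of `X_∞`: only the edges `A_n`, `B_n` with `n ≤ ⌊g/2⌋` and `C'_n`, `C''_n` with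
`n ≤ ⌊(g-1)/2⌋` are glued; the points of the other edges are left out. -/
def U (g : ℕ) : Set limitSurface.Surface :=
  {x | ∀ l i a b j c d, LimitEdge l i a b j c d → ¬ l.Kept g →
    ∀ (z : ℂ) (hz : z ∈ limitSurface.region i), z ∈ segment ℝ a b →
      x ≠ TranslationGluing.pt (G := limitSurface) i z hz}

end ArnouxYoccoz

open Topology Set
noncomputable section
open Filter Metric MeasureTheory
open ENNReal (ofReal ofReal_add ofReal_le_ofReal mul_iInf_of_ne iInf_add add_iInf)
open Complex (abs_im_le_norm abs_re_le_norm dist_eq_re_im sub_im sub_re norm_le_abs_re_add_abs_im imLm reLm dist_conj_conj)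
open AffineMap (lineMap lineMap_apply lineMap_apply_zero lineMap_apply_one)
open Finset (range mem_range sum_congr sum_le_sum sum_range_succ sum_range_add sum_le_sum_of_subset_of_nonneg sum_sub_distrib sum_pair sum_Icc_succ_top sum_eq_single sum_range_one)

/-! ### Piecewise linear functions and polygons -/

/-- A function on the plane that is affine on each of finitely many closed polyhedra, which cover the
plane. -/
def IsPL {E : Type*} [AddCommGroup E] [Module ℝ E] (f : ℂ → E) : Prop :=
  ∃ (ι : Type) (_ : Fintype ι) (H : ι → List (ℂ →ᵃ[ℝ] ℝ)) (A : ι → (ℂ →ᵃ[ℝ] E)),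
    ∀ z, (∃ i, ∀ a ∈ H i, 0 ≤ a z) ∧ ∀ i, (∀ a ∈ H i, 0 ≤ a z) → f z = A i z

namespace IsPL

variable {E E' : Type*} [AddCommGroup E] [Module ℝ E] [AddCommGroup E'] [Module ℝ E']

lemma affine (A : ℂ →ᵃ[ℝ] E) : IsPL (fun z => A z) :=
  ⟨Unit, inferInstance, fun _ => [], fun _ => A, fun z => ⟨⟨(), by simp⟩, by simp⟩⟩

lemma const (c : E) : IsPL (fun _ => c) := affine (AffineMap.const ℝ ℂ c)

lemma pair_map {f : ℂ → E} {g : ℂ → E'} {E'' : Type*} [AddCommGroup E''] [Module ℝ E'']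
    (hf : IsPL f) (hg : IsPL g) (L : E →ₗ[ℝ] E'') (L' : E' →ₗ[ℝ] E'') :
    IsPL (fun z => L (f z) + L' (g z)) := by
  obtain ⟨ι, _, H, A, h⟩ := hf; obtain ⟨κ, _, H', A', h'⟩ := hg
  refine ⟨ι × κ, inferInstance, fun i => H i.1 ++ H' i.2,
    fun i => L.toAffineMap.comp (A i.1) + L'.toAffineMap.comp (A' i.2), fun z => ⟨?_, ?_⟩⟩
  · obtain ⟨i, hi⟩ := (h z).1; obtain ⟨j, hj⟩ := (h' z).1; refine ⟨(i, j), fun a ha => ?_⟩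
    rcases List.mem_append.1 ha with ha | ha
    exacts [hi a ha, hj a ha]
  · rintro ⟨i, j⟩ hij; have hi := (h z).2 i fun a ha => hij a (List.mem_append_left _ ha)
    have hj := (h' z).2 j fun a ha => hij a (List.mem_append_right _ ha)
    simp [hi, hj]

lemma add {f g : ℂ → E} (hf : IsPL f) (hg : IsPL g) : IsPL (fun z => f z + g z) := by
  simpa using hf.pair_map hg LinearMap.id LinearMap.id

lemma sub {f g : ℂ → E} (hf : IsPL f) (hg : IsPL g) : IsPL (fun z => f z - g z) := by
  simpa [sub_eq_add_neg] using hf.pair_map hg LinearMap.id (-LinearMap.id)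

lemma const_mul {f : ℂ → ℝ} (hf : IsPL f) (c : ℝ) : IsPL (fun z => c * f z) := by
  have := hf.pair_map hf (c • LinearMap.id) (0 : ℝ →ₗ[ℝ] ℝ)
  simpa only [LinearMap.smul_apply, LinearMap.id_apply, LinearMap.zero_apply, add_zero,
    smul_eq_mul] using this

lemma neg {f : ℂ → ℝ} (hf : IsPL f) : IsPL (fun z => - f z) := by simpa using hf.const_mul (-1)

lemma max {f g : ℂ → ℝ} (hf : IsPL f) (hg : IsPL g) : IsPL (fun z => max (f z) (g z)) := by
  obtain ⟨ι, _, H, A, h⟩ := hf; obtain ⟨κ, _, H', A', h'⟩ := hg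
  refine ⟨(ι × κ) × Bool, inferInstance,
    fun i => (if i.2 then A i.1.1 - A' i.1.2 else A' i.1.2 - A i.1.1) :: (H i.1.1 ++ H' i.1.2),
    fun i => if i.2 then A i.1.1 else A' i.1.2, fun z => ⟨?_, ?_⟩⟩
  · obtain ⟨i, hi⟩ := (h z).1; obtain ⟨j, hj⟩ := (h' z).1
    rcases le_total (A i z) (A' j z) with hle | hle
    · refine ⟨((i, j), false), fun a ha => ?_⟩; rcases List.mem_cons.1 ha with rfl | ha
      · simpa using hle
      rcases List.mem_append.1 ha with ha | ha
      exacts [hi a ha, hj a ha]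
    · refine ⟨((i, j), true), fun a ha => ?_⟩; rcases List.mem_cons.1 ha with rfl | ha
      · simpa using hle
      rcases List.mem_append.1 ha with ha | ha
      exacts [hi a ha, hj a ha]
  · rintro ⟨⟨i, j⟩, b⟩ hij
    have hi := (h z).2 i fun a ha => hij a (List.mem_cons_of_mem _ (List.mem_append_left _ ha))
    have hj := (h' z).2 j fun a ha => hij a (List.mem_cons_of_mem _ (List.mem_append_right _ ha))
    have h0 := hij _ (List.mem_cons_self ..); cases b
    · simp at h0 ⊢; rw [hi, hj, max_eq_right h0]
    · simp at h0 ⊢; rw [hi, hj, max_eq_left h0]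

lemma min {f g : ℂ → ℝ} (hf : IsPL f) (hg : IsPL g) : IsPL (fun z => min (f z) (g z)) := by
  have := (hf.neg.max hg.neg).neg; simpa [max_neg_neg] using this

lemma sum {α : Type*} (s : Finset α) {f : α → ℂ → ℝ} (hf : ∀ i, IsPL (f i)) :
    IsPL (fun z => ∑ i ∈ s, f i z) := by
  classical
  induction s using Finset.induction_on with
  | empty => simpa using const (0 : ℝ)
  | insert a s ha ih => simpa [Finset.sum_insert ha] using (hf a).add ih

lemma comp {f : ℂ → E} {T : ℂ → ℂ} (hf : IsPL f) (hT : IsPL T) : IsPL (fun z => f (T z)) := by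
  obtain ⟨ι, _, H, A, h⟩ := hf; obtain ⟨κ, _, H', A', h'⟩ := hT
  refine ⟨ι × κ, inferInstance, fun i => (H i.1).map (fun a => a.comp (A' i.2)) ++ H' i.2,
    fun i => (A i.1).comp (A' i.2), fun z => ⟨?_, ?_⟩⟩
  · obtain ⟨j, hj⟩ := (h' z).1; have e := (h' z).2 j hj; obtain ⟨i, hi⟩ := (h (T z)).1
    refine ⟨(i, j), fun a ha => ?_⟩; rcases List.mem_append.1 ha with ha | ha
    · obtain ⟨b, hb, rfl⟩ := List.mem_map.1 ha; simpa [← e] using hi b hb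
    · exact hj a ha
  · rintro ⟨i, j⟩ hij; have e := (h' z).2 j fun a ha => hij a (List.mem_append_right _ ha)
    have := (h (T z)).2 i fun a ha => by
      have := hij (a.comp (A' j)) (List.mem_append_left _ (List.mem_map_of_mem ha))
      simpa [← e] using this
    simpa [← e] using this

lemma re : IsPL (fun z : ℂ => z.re) := affine reLm.toAffineMap

lemma im : IsPL (fun z : ℂ => z.im) := affine imLm.toAffineMap

lemma mk {f g : ℂ → ℝ} (hf : IsPL f) (hg : IsPL g) : IsPL (fun z => (⟨f z, g z⟩ : ℂ)) := by
  have := hf.pair_map hg Complex.ofRealCLM.toLinearMap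
    ((Complex.I : ℂ) • Complex.ofRealCLM.toLinearMap)
  convert this using 2 with z
  apply Complex.ext <;> simp

end IsPL

lemma abs_re_sub_le (z w : ℂ) : |z.re - w.re| ≤ dist z w :=
  (abs_re_le_norm (z - w)).trans_eq (dist_eq_norm z w).symm

lemma abs_im_sub_le (z w : ℂ) : |z.im - w.im| ≤ dist z w :=
  (abs_im_le_norm (z - w)).trans_eq (dist_eq_norm z w).symm

lemma finite_extremePoints_polyhedron (H : List (ℂ →ᵃ[ℝ] ℝ)) :
    (extremePoints ℝ {z : ℂ | ∀ a ∈ H, 0 ≤ a z}).Finite := by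
  classical
  set K := {z : ℂ | ∀ a ∈ H, 0 ≤ a z} with hK
  let act : ℂ → Finset (ℂ →ᵃ[ℝ] ℝ) := fun z => H.toFinset.filter fun a => a z = 0
  have hinj : Set.InjOn act (extremePoints ℝ K) := by
    intro x hx y hy hxy; by_contra hne; have hxK : ∀ a ∈ H, 0 ≤ a x := hx.1
    have hyK : ∀ a ∈ H, 0 ≤ a y := hy.1
    have hev : ∀ᶠ t : ℝ in 𝓝 0, ∀ a ∈ H, 0 ≤ a (lineMap x y t) := by
      have : ∀ a ∈ H.toFinset, ∀ᶠ t : ℝ in 𝓝 0, 0 ≤ a (lineMap x y t) := by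
        intro a ha; have haH := List.mem_toFinset.1 ha
        have e : ∀ t : ℝ, a (lineMap x y t) = a x + t * (a y - a x) := by
          intro t; rw [AffineMap.apply_lineMap, lineMap_apply]; simp [add_comm]
        rcases (hxK a haH).eq_or_lt with h0 | h0
        · have : a ∈ act x := by simp [act, haH, ← h0]
          rw [hxy] at this; have hy0 : a y = 0 := (Finset.mem_filter.1 this).2
          exact Eventually.of_forall fun t => by rw [e, ← h0, hy0]; simp
        · have hc : Continuous fun t : ℝ => a x + t * (a y - a x) := by fun_prop
          have := hc.continuousAt.eventually (lt_mem_nhds (by simpa using h0 : (0 : ℝ) < a x + 0 * (a y - a x)))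
          filter_upwards [this] with t ht
          rw [e]; exact ht.le
      have := (eventually_all_finset H.toFinset).2 this
      filter_upwards [this] with t ht a ha using ht a (List.mem_toFinset.2 ha)
    obtain ⟨δ, hδ, hb⟩ := Metric.eventually_nhds_iff.1 hev
    have h1 : lineMap x y (δ / 2) ∈ K := hb (by simp [abs_of_pos hδ]; linarith)
    have h2 : lineMap x y (-(δ / 2)) ∈ K := hb (by simp [abs_of_pos hδ]; linarith)
    have hmid : x ∈ openSegment ℝ (lineMap x y (δ / 2) : ℂ) (lineMap x y (-(δ / 2))) := by
      refine ⟨1 / 2, 1 / 2, by norm_num, by norm_num, by norm_num, ?_⟩; simp [lineMap_apply]; ring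
    have := hx.2 h1 h2 hmid
    have h3 : ((δ / 2 : ℝ) : ℂ) * (y - x) = 0 := by
      have h4 := this; rw [lineMap_apply] at h4; simp at h4; rcases h4 with h4 | h4
      · exact absurd h4 hδ.ne'
      · simp [h4]
    rcases mul_eq_zero.1 h3 with h4 | h4
    · have : δ / 2 = 0 := by exact_mod_cast h4
      linarith
    · exact hne (sub_eq_zero.1 h4).symm
  have himg : (act '' extremePoints ℝ K).Finite :=
    (Finset.finite_toSet H.toFinset.powerset).subset (by
      rintro _ ⟨x, -, rfl⟩; exact Finset.mem_powerset.2 (Finset.filter_subset _ _))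
  exact himg.of_finite_image hinj

lemma exists_finset_convexHull_eq_polyhedron (H : List (ℂ →ᵃ[ℝ] ℝ))
    (hb : Bornology.IsBounded {z : ℂ | ∀ a ∈ H, 0 ≤ a z}) :
    ∃ S : Finset ℂ, convexHull ℝ (S : Set ℂ) = {z : ℂ | ∀ a ∈ H, 0 ≤ a z} := by
  have hfin := finite_extremePoints_polyhedron H
  have hcl : IsClosed {z : ℂ | ∀ a ∈ H, 0 ≤ a z} := by
    simp only [ofPred_forall]
    exact isClosed_iInter fun a => isClosed_iInter fun _ =>
      isClosed_le continuous_const (AffineMap.continuous_of_finiteDimensional a)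
  have hconv : Convex ℝ {z : ℂ | ∀ a ∈ H, 0 ≤ a z} := by
    simp only [ofPred_forall]; refine convex_iInter fun a => convex_iInter fun _ => ?_
    exact (convex_Ici (0 : ℝ)).affine_preimage a
  have hcpt : IsCompact {z : ℂ | ∀ a ∈ H, 0 ≤ a z} := isCompact_of_isClosed_isBounded hcl hb
  refine ⟨hfin.toFinset, ?_⟩; rw [hfin.coe_toFinset]
  have := closure_convexHull_extremePoints hcpt hconv
  rwa [(hfin.isClosed_convexHull ℝ).closure_eq] at this

/-! ### Paths -/

section Curves

variable {X : Type*} {D : X → X → ENNReal}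

/-- A curve that is Lipschitz at each parameter is Lipschitz. -/
lemma le_ofReal_mul_of_eventually (htri : ∀ x y z, D x z ≤ D x y + D y z) {γ : ℝ → X} {c a b : ℝ}
    (hc : 0 ≤ c) (hab : a ≤ b) (h0 : D (γ a) (γ a) = 0)
    (h : ∀ t ∈ Icc a b, ∀ᶠ s in 𝓝[Icc a b] t, D (γ t) (γ s) ≤ ofReal (c * |s - t|) ∧
      D (γ s) (γ t) ≤ ofReal (c * |s - t|)) :
    D (γ a) (γ b) ≤ ofReal (c * (b - a)) := by
  set S := {t | D (γ a) (γ t) ≤ ofReal (c * (t - a))} with hS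
  have hsub : Icc a b ⊆ S := by
    refine IsClosed.Icc_subset_of_forall_exists_gt ?_ ?_ ?_
    · refine isClosed_of_closure_subset fun t ht => ?_
      have htI : t ∈ Icc a b := closure_minimal inter_subset_right isClosed_Icc ht
      refine ⟨?_, htI⟩; have hfr : ∃ᶠ s in 𝓝 t, s ∈ S ∩ Icc a b := mem_closure_iff_frequently.1 ht
      have hev : ∀ᶠ s in 𝓝 t, s ∈ Icc a b → D (γ s) (γ t) ≤ ofReal (c * |s - t|) := by
        have := h t htI; rw [eventually_nhdsWithin_iff] at this
        filter_upwards [this] with s hs hsI using (hs hsI).2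
      have hfr2 : ∃ᶠ s in 𝓝 t, D (γ a) (γ t) ≤ ofReal (c * (s - a)) + ofReal (c * |s - t|) := by
        refine (hfr.and_eventually hev).mono ?_; rintro s ⟨⟨h1, h2⟩, h3⟩
        exact (htri _ (γ s) _).trans (add_le_add h1 (h3 h2))
      have hlim : Tendsto (fun s => ofReal (c * (s - a)) +
          ofReal (c * |s - t|)) (𝓝 t) (𝓝 (ofReal (c * (t - a)))) := by
        have h1 : Continuous fun s : ℝ => ofReal (c * (s - a)) + ofReal (c * |s - t|) :=
          (ENNReal.continuous_ofReal.comp (by fun_prop)).add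
            (ENNReal.continuous_ofReal.comp (by fun_prop))
        have := h1.tendsto t; simpa using this
      exact ge_of_tendsto_of_frequently hlim hfr2
    · simp [hS, h0]
    · rintro t ⟨htS, hta, htb⟩ y hy
      have hev : ∀ᶠ s in 𝓝[>] t, s ∈ Icc a b → D (γ t) (γ s) ≤ ofReal (c * |s - t|) := by
        have := h t ⟨hta, htb.le⟩; rw [eventually_nhdsWithin_iff] at this
        exact (this.filter_mono nhdsWithin_le_nhds).mono fun s hs hsI => (hs hsI).1
      have hev2 : ∀ᶠ s in 𝓝[>] t, s ∈ Ioc t (min y b) := Ioc_mem_nhdsGT (lt_min hy htb)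
      obtain ⟨s, hs1, hs2⟩ := (hev.and hev2).exists
      refine ⟨s, ?_, hs2.1, hs2.2.trans (min_le_left _ _)⟩
      have h1 := hs1 ⟨hta.trans hs2.1.le, hs2.2.trans (min_le_right _ _)⟩
      rw [abs_of_pos (sub_pos.2 hs2.1)] at h1
      calc D (γ a) (γ s) ≤ D (γ a) (γ t) + D (γ t) (γ s) := htri _ _ _
        _ ≤ ofReal (c * (t - a)) + ofReal (c * (s - t)) := add_le_add htS h1
        _ = ofReal (c * (s - a)) := by
          rw [← ofReal_add (mul_nonneg hc (sub_nonneg.2 hta))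
            (mul_nonneg hc (sub_nonneg.2 hs2.1.le))]
          congr 1; ring
  exact hsub ⟨hab, le_rfl⟩

end Curves

/-! ### The flat distance -/

namespace TranslationGluing

variable {G : TranslationGluing}

lemma PolyPath.nonneg {x y : G.Surface} {l : ℝ} (h : PolyPath x y l) : 0 ≤ l := by
  induction h with
  | refl => exact le_rfl
  | cons => positivity

lemma PolyPath.trans {x y z : G.Surface} {l m : ℝ} (h : PolyPath x y l) (h' : PolyPath y z m) :
    PolyPath x z (l + m) := by
  induction h with
  | refl => simpa using h'
  | cons i p q hp hq hpq y l h ih => rw [add_assoc]; exact PolyPath.cons i p q hp hq hpq _ _ (ih h')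

lemma PolyPath.single {i : G.Piece} {p q : ℂ} (hp : p ∈ G.region i) (hq : q ∈ G.region i)
    (hpq : segment ℝ p q ⊆ G.region i) : PolyPath (pt i p hp) (pt i q hq) (dist p q) := by
  simpa using PolyPath.cons i p q hp hq hpq _ 0 (PolyPath.refl _)

lemma PolyPath.symm {x y : G.Surface} {l : ℝ} (h : PolyPath x y l) : PolyPath y x l := by
  induction h with
  | refl x => exact PolyPath.refl x
  | cons i p q hp hq hpq y l h ih =>
    rw [add_comm, dist_comm]; exact ih.trans (PolyPath.single hq hp (by rwa [segment_symm]))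

lemma flatDist_le {x y : G.Surface} {l : ℝ} (h : PolyPath x y l) : flatDist x y ≤ ofReal l :=
  iInf₂_le l h

lemma flatDist_self (x : G.Surface) : flatDist x x = 0 := by
  simpa using flatDist_le (PolyPath.refl x)

lemma flatDist_comm (x y : G.Surface) : flatDist x y = flatDist y x :=
  le_antisymm (le_iInf₂ fun _ h => flatDist_le h.symm) (le_iInf₂ fun _ h => flatDist_le h.symm)

lemma flatDist_triangle (x y z : G.Surface) : flatDist x z ≤ flatDist x y + flatDist y z := by
  unfold flatDist; simp only [iInf_add, add_iInf]
  refine le_iInf₂ fun m h' => le_iInf₂ fun l h => ?_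
  rw [← ofReal_add h.nonneg h'.nonneg]; exact flatDist_le (h.trans h')

lemma flatDist_pt_le {i : G.Piece} {p q : ℂ} (hp : p ∈ G.region i) (hq : q ∈ G.region i)
    (hpq : segment ℝ p q ⊆ G.region i) :
    flatDist (pt i p hp) (pt i q hq) ≤ ofReal (dist p q) :=
  flatDist_le (PolyPath.single hp hq hpq)

end TranslationGluing

open TranslationGluing

namespace ArnouxYoccoz

/-! ### The limit surface in a uniform chart

Both rectangles are parametrized by the upper one, the lower one through the glide reflection. -/

/-- The parametrization of the rectangle `!f` by the upper rectangle. -/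
def chart (f : Bool) (z : ℂ) : ℂ := if f then ⟨z.re - 1 / 2, 1 - z.im⟩ else z

/-- The inverse of `chart f`. -/
def unchart (f : Bool) (z : ℂ) : ℂ := if f then ⟨z.re + 1 / 2, 1 - z.im⟩ else z

lemma unchart_chart (f : Bool) (z : ℂ) : unchart f (chart f z) = z := by
  cases f <;> simp [chart, unchart]

lemma chart_unchart (f : Bool) (z : ℂ) : chart f (unchart f z) = z := by
  cases f <;> simp [chart, unchart]

lemma dist_chart (f : Bool) (z w : ℂ) : dist (chart f z) (chart f w) = dist z w := by
  cases f
  · simp [chart]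
  · simp only [chart, dist_eq_re_im, if_true]; congr 1; ring

lemma chart_lineMap (f : Bool) (a b : ℂ) (t : ℝ) :
    chart f (lineMap a b t) = lineMap (chart f a) (chart f b) t := by
  cases f
  · simp [chart]
  · apply Complex.ext <;> simp [chart, lineMap_apply] <;> ring

lemma continuous_chart (f : Bool) : Continuous (chart f) :=
  (Isometry.of_dist_eq (dist_chart f)).continuous

lemma continuous_unchart (f : Bool) : Continuous (unchart f) := by
  refine (Isometry.of_dist_eq fun z w => ?_).continuous
  rw [← dist_chart f, chart_unchart, chart_unchart]

/-- `chart f` as a homeomorphism. -/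
def chartHomeo (f : Bool) : ℂ ≃ₜ ℂ where
  toFun := chart f
  invFun := unchart f
  left_inv := unchart_chart f
  right_inv := chart_unchart f
  continuous_toFun := continuous_chart f
  continuous_invFun := continuous_unchart f

/-- The upper rectangle. -/
def rect : Set ℂ := {z | z.re ∈ Icc 0 1 ∧ z.im ∈ Icc (1 / 2) 1}

lemma rectangle_eq (f : Bool) : rectangle (!f) = chart f '' rect := by
  ext z; constructor
  · intro hz; refine ⟨unchart f z, ?_, chart_unchart f z⟩; cases f
    · simpa [rectangle, rect, unchart] using hz
    · simp [rectangle, rect, unchart] at hz ⊢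
      refine ⟨⟨?_, ?_⟩, ?_, ?_⟩ <;> linarith [hz.1.1, hz.1.2, hz.2.1, hz.2.2]
  · rintro ⟨w, hw, rfl⟩; cases f
    · simpa [rectangle, rect, chart] using hw
    · simp [rectangle, rect, chart] at hw ⊢
      refine ⟨⟨?_, ?_⟩, ?_, ?_⟩ <;> linarith [hw.1.1, hw.1.2, hw.2.1, hw.2.2]

/-- The heights of the endpoints of edges on the left side. -/
def leftNode (m : ℕ) : ℝ := 2 / 3 + 1 / 3 * (-1 / 2) ^ m

lemma leftNode_add_two (m : ℕ) : leftNode (m + 2) = 2 / 3 + 1 / 12 * (-1 / 2) ^ m := by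
  rw [leftNode, pow_add]; ring

lemma abs_leftNode_sub (m : ℕ) : |leftNode m - 2 / 3| = 1 / 3 * (1 / 2) ^ m := by
  rw [leftNode, add_sub_cancel_left, abs_mul, abs_pow]; norm_num [abs_div]

/-- The edges on the boundary of the upper rectangle: `top false m`, `top true m` are the two halves of
the `m`-th interval of the top. -/
inductive Slot
  | bot (b : Bool)
  | top (b : Bool) (m : ℕ)
  | right (m : ℕ)
  | left (m : ℕ)

namespace Slot

/-- The initial point of an edge. -/
def lo : Slot → ℂ
  | bot b => ⟨if b then 1 / 2 else 0, 1 / 2⟩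
  | top b m => ⟨1 - (if b then 3 / 4 else 1) * (1 / 2) ^ m, 1⟩
  | right m => ⟨1, 1 - (1 / 2) ^ (m + 1)⟩
  | left m => ⟨0, leftNode m⟩

/-- The end point of an edge. -/
def hi : Slot → ℂ
  | bot b => ⟨if b then 1 else 1 / 2, 1 / 2⟩
  | top b m => ⟨1 - (if b then 1 / 2 else 3 / 4) * (1 / 2) ^ m, 1⟩
  | right m => ⟨1, 1 - (1 / 2) ^ (m + 2)⟩
  | left m => ⟨0, leftNode (m + 2)⟩

/-- The point with parameter `t` on an edge. -/
def at' (s : Slot) (t : ℝ) : ℂ := lineMap s.lo s.hi t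

/-- The index of an edge within its side. -/
def idx : Slot → ℕ
  | bot _ => 0
  | top _ m => m
  | right m => m
  | left m => m

/-- The sheet of the partner of an edge of the sheet `f`. -/
def pf (f : Bool) : Slot → Bool
  | bot _ => !f
  | top _ _ => !f
  | right m => xor f (m % 2 == 0)
  | left m => xor f (m % 2 == 0)

/-- The partner of an edge. -/
def ps : Slot → Slot
  | bot b => bot (!b)
  | top b m => top (!b) m
  | right m => left m
  | left m => right m

/-- The edges that are glued in `U g`. -/
def Kept (g : ℕ) : Slot → Prop
  | bot _ => True
  | top _ m => m < g / 2
  | right m => m < (g - 1) / 2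
  | left m => m < (g - 1) / 2

@[simp] theorem ps_ps (s : Slot) : s.ps.ps = s := by cases s <;> simp [ps]

@[simp] theorem pf_ps (f : Bool) (s : Slot) : s.ps.pf (s.pf f) = f := by
  cases s <;> simp [ps, pf]

@[simp] theorem kept_ps (g : ℕ) (s : Slot) : s.ps.Kept g ↔ s.Kept g := by
  cases s <;> simp [ps, Kept]

lemma at'_zero (s : Slot) : s.at' 0 = s.lo := by simp [at']

lemma at'_one (s : Slot) : s.at' 1 = s.hi := by simp [at']

lemma at'_re (s : Slot) (t : ℝ) : (s.at' t).re = s.lo.re + t * (s.hi.re - s.lo.re) := by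
  simp [at', lineMap_apply]; ring

lemma at'_im (s : Slot) (t : ℝ) : (s.at' t).im = s.lo.im + t * (s.hi.im - s.lo.im) := by
  simp [at', lineMap_apply]; ring

/-- The length of an edge. -/
def len : Slot → ℝ
  | bot _ => 1 / 2
  | top _ m => 1 / 4 * (1 / 2) ^ m
  | right m => 1 / 4 * (1 / 2) ^ m
  | left m => 1 / 4 * (1 / 2) ^ m

@[simp] theorem len_ps (s : Slot) : s.ps.len = s.len := by cases s <;> simp [ps, len]

lemma len_pos (s : Slot) : 0 < s.len := by cases s <;> simp [len]

lemma len_le (s : Slot) : s.len ≤ 1 / 2 * (1 / 2) ^ s.idx := by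
  have h : ∀ m : ℕ, (0 : ℝ) < (1 / 2) ^ m := fun m => by positivity
  cases s with
  | bot b => simp [len, idx]
  | top b m => simp only [len, idx]; linarith [h m]
  | right m => simp only [len, idx]; linarith [h m]
  | left m => simp only [len, idx]; linarith [h m]

lemma dist_lo_hi (s : Slot) : dist s.lo s.hi = s.len := by
  have h : ∀ m : ℕ, (0 : ℝ) < (1 / 2) ^ m := fun m => by positivity
  cases s with
  | bot b =>
    cases b <;> simp only [lo, hi, len, dist_eq_re_im] <;>
      (apply (Real.sqrt_eq_iff_mul_self_eq (by positivity) (by norm_num)).2; norm_num)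
  | top b m =>
    cases b <;> simp only [lo, hi, len, dist_eq_re_im] <;>
      (apply (Real.sqrt_eq_iff_mul_self_eq (by positivity) (by positivity)).2; norm_num; ring)
  | right m =>
    simp only [lo, hi, len, dist_eq_re_im]
    apply (Real.sqrt_eq_iff_mul_self_eq (by positivity) (by positivity)).2; rw [pow_add, pow_add]; ring
  | left m =>
    simp only [lo, hi, len, dist_eq_re_im, leftNode_add_two]
    apply (Real.sqrt_eq_iff_mul_self_eq (by positivity) (by positivity)).2; rw [leftNode]
    have : ((-1 / 2 : ℝ) ^ m) * ((-1 / 2 : ℝ) ^ m) = (1 / 2) ^ m * (1 / 2) ^ m := by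
      rw [← mul_pow, ← mul_pow]; norm_num
    linear_combination (1 / 16 : ℝ) * this

lemma dist_at' (s : Slot) (t u : ℝ) : dist (s.at' t) (s.at' u) = |t - u| * s.len := by
  rw [at', at', dist_lineMap_lineMap, dist_lo_hi, Real.dist_eq]

end Slot

lemma leftNode_mem (m : ℕ) : leftNode m ∈ Icc (1 / 2 : ℝ) 1 := by
  rcases m with _ | m
  · norm_num [leftNode]
  · have := abs_le.1 (abs_leftNode_sub (m + 1)).le
    have h : (1 / 2 : ℝ) ^ m ≤ 1 := pow_le_one₀ (by norm_num) (by norm_num); rw [pow_succ] at this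
    constructor <;> linarith [this.1, this.2]

lemma leftNode_of_even {m : ℕ} (hm : Even m) : leftNode m = 2 / 3 + 2 / 3 * (1 / 2) ^ (m + 1) ∧
    leftNode (m + 2) = 2 / 3 + 1 / 6 * (1 / 2) ^ (m + 1) := by
  have e : (-1 / 2 : ℝ) ^ m = (1 / 2) ^ m := by rw [← hm.neg_pow]; norm_num
  rw [leftNode_add_two, leftNode, e]; constructor <;> ring

lemma leftNode_of_odd {m : ℕ} (hm : Odd m) : leftNode m = 2 / 3 - 2 / 3 * (1 / 2) ^ (m + 1) ∧
    leftNode (m + 2) = 2 / 3 - 1 / 6 * (1 / 2) ^ (m + 1) := by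
  have e : (-1 / 2 : ℝ) ^ m = -(1 / 2) ^ m := by rw [← hm.neg_pow]; norm_num
  rw [leftNode_add_two, leftNode, e]; constructor <;> ring

/-- `LimitEdge` in terms of `Slot`. -/
lemma LimitEdge.exists_slot {l : Label} {i j : Bool} {a b c d : ℂ} (h : LimitEdge l i a b j c d) :
    ∃ (f : Bool) (s : Slot), i = !f ∧ j = !(s.pf f) ∧ (∀ g, l.Kept g ↔ s.Kept g) ∧
      ((a = chart f s.lo ∧ b = chart f s.hi ∧
        c = chart (s.pf f) s.ps.lo ∧ d = chart (s.pf f) s.ps.hi) ∨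
       (a = chart f s.hi ∧ b = chart f s.lo ∧
        c = chart (s.pf f) s.ps.hi ∧ d = chart (s.pf f) s.ps.lo)) := by
  cases h with
  | touch =>
    refine ⟨false, .bot false, rfl, rfl, fun g => by simp [Label.Kept, Slot.Kept], Or.inl ?_⟩
    simp only [chart, Slot.lo, Slot.hi, Slot.pf, Slot.ps]; norm_num
  | unlabelled =>
    refine ⟨false, .bot true, rfl, rfl, fun g => by simp [Label.Kept, Slot.Kept], Or.inl ?_⟩
    simp only [chart, Slot.lo, Slot.hi, Slot.pf, Slot.ps]; norm_num
  | A n hn =>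
    obtain ⟨m, rfl⟩ : ∃ m, n = m + 1 := ⟨n - 1, by omega⟩
    refine ⟨false, .top false m, rfl, rfl, fun g => by simp only [Label.Kept, Slot.Kept]; omega,
      Or.inl ?_⟩
    simp [chart, Slot.lo, Slot.hi, Slot.pf, Slot.ps, pow_succ]; refine ⟨?_, ?_, ?_, ?_⟩ <;> ring
  | B n hn =>
    obtain ⟨m, rfl⟩ : ∃ m, n = m + 1 := ⟨n - 1, by omega⟩
    refine ⟨false, .top true m, rfl, rfl, fun g => by simp only [Label.Kept, Slot.Kept]; omega,
      Or.inl ?_⟩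
    simp [chart, Slot.lo, Slot.hi, Slot.pf, Slot.ps, pow_succ]; refine ⟨?_, ?_, ?_, ?_⟩ <;> ring
  | C'_odd n hn | C''_odd n hn =>
    obtain ⟨m, rfl⟩ : ∃ m, n = m + 1 := ⟨n - 1, by have := hn.pos; omega⟩
    have hm : Even m := by rwa [Nat.odd_add_one, Nat.not_odd_iff_even] at hn
    refine ⟨_, .left m, (Bool.not_not _).symm, by simp [Slot.pf, Nat.even_iff.1 hm],
      fun g => by simp only [Label.Kept, Slot.Kept]; omega, ?_⟩
    simp only [chart, Slot.lo, Slot.hi, Slot.pf, Slot.ps, Nat.even_iff.1 hm, leftNode_of_even hm,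
      pow_succ _ (m + 1)]
    generalize (1 / 2 : ℝ) ^ (m + 1) = r
    first
    | left; and_intros <;> apply Complex.ext <;> simp <;> ring1
    | right; and_intros <;> apply Complex.ext <;> simp <;> ring1
  | C'_even n hn hn' | C''_even n hn hn' =>
    obtain ⟨m, rfl⟩ : ∃ m, n = m + 1 := ⟨n - 1, by omega⟩
    have hm : Odd m := by rwa [Nat.even_add_one, Nat.not_even_iff_odd] at hn'
    refine ⟨_, .left m, (Bool.not_not _).symm, by simp [Slot.pf, Nat.odd_iff.1 hm],
      fun g => by simp only [Label.Kept, Slot.Kept]; omega, ?_⟩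
    simp only [chart, Slot.lo, Slot.hi, Slot.pf, Slot.ps, Nat.odd_iff.1 hm, leftNode_of_odd hm,
      pow_succ _ (m + 1)]
    generalize (1 / 2 : ℝ) ^ (m + 1) = r
    first
    | left; and_intros <;> apply Complex.ext <;> simp <;> ring1
    | right; and_intros <;> apply Complex.ext <;> simp <;> ring1


/-- The two edges of the pair that contains the edge `s` of the sheet `f` are identified. -/
def Linked (f : Bool) (s : Slot) : Prop := ∃ l : Label, (∀ g, l.Kept g ↔ s.Kept g) ∧
    (LimitEdge l (!f) (chart f s.lo) (chart f s.hi)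
        (!(s.pf f)) (chart (s.pf f) s.ps.lo) (chart (s.pf f) s.ps.hi) ∨
      LimitEdge l (!f) (chart f s.hi) (chart f s.lo)
        (!(s.pf f)) (chart (s.pf f) s.ps.hi) (chart (s.pf f) s.ps.lo) ∨
      LimitEdge l (!(s.pf f)) (chart (s.pf f) s.ps.lo) (chart (s.pf f) s.ps.hi)
        (!f) (chart f s.lo) (chart f s.hi) ∨
      LimitEdge l (!(s.pf f)) (chart (s.pf f) s.ps.hi) (chart (s.pf f) s.ps.lo)
        (!f) (chart f s.hi) (chart f s.lo))

lemma Linked.symm {f : Bool} {s : Slot} (h : Linked f s) : Linked (s.pf f) s.ps := by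
  obtain ⟨l, hl, h⟩ := h; refine ⟨l, fun g => (hl g).trans (Slot.kept_ps g s).symm, ?_⟩
  simp only [Slot.ps_ps, Slot.pf_ps]; tauto

lemma linked_left (f : Bool) (m : ℕ) : Linked f (.left m) := by
  cases f <;> rcases Nat.even_or_odd m with hm | hm
  · refine ⟨.C' (m + 1), fun g => by simp only [Label.Kept, Slot.Kept]; omega, Or.inr (Or.inl ?_)⟩
    convert LimitEdge.C'_odd (m + 1) hm.add_one using 1
    all_goals simp [Slot.pf, Slot.ps, Slot.lo, Slot.hi, chart, Nat.even_iff.1 hm, leftNode_of_even hm,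
      pow_succ _ (m + 1), mul_comm]
    all_goals norm_num
  · refine ⟨.C' (m + 1), fun g => by simp only [Label.Kept, Slot.Kept]; omega, Or.inl ?_⟩
    convert LimitEdge.C'_even (m + 1) (by omega) hm.add_one using 1
    all_goals simp [Slot.pf, Slot.ps, Slot.lo, Slot.hi, chart, Nat.odd_iff.1 hm, leftNode_of_odd hm,
      pow_succ _ (m + 1), mul_comm]
  · refine ⟨.C'' (m + 1), fun g => by simp only [Label.Kept, Slot.Kept]; omega, Or.inl ?_⟩
    convert LimitEdge.C''_odd (m + 1) hm.add_one using 1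
    all_goals simp [Slot.pf, Slot.ps, Slot.lo, Slot.hi, chart, Nat.even_iff.1 hm, leftNode_of_even hm,
      pow_succ _ (m + 1), mul_comm]
    all_goals and_intros <;> ring
  · refine ⟨.C'' (m + 1), fun g => by simp only [Label.Kept, Slot.Kept]; omega, Or.inr (Or.inl ?_)⟩
    convert LimitEdge.C''_even (m + 1) (by omega) hm.add_one using 1
    all_goals simp [Slot.pf, Slot.ps, Slot.lo, Slot.hi, chart, Nat.odd_iff.1 hm, leftNode_of_odd hm,
      pow_succ _ (m + 1), mul_comm]
    all_goals and_intros <;> ring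

lemma linked (f : Bool) (s : Slot) : Linked f s := by
  have key : ∀ b, Linked false (.bot b) ∧ ∀ m, Linked false (.top b m) := by
    intro b; cases b
    · refine ⟨⟨.touch, fun g => by simp [Label.Kept, Slot.Kept], Or.inl ?_⟩,
        fun m => ⟨.A (m + 1), fun g => by simp only [Label.Kept, Slot.Kept]; omega, Or.inl ?_⟩⟩
      · convert LimitEdge.touch using 1
        all_goals norm_num [Slot.pf, Slot.ps, Slot.lo, Slot.hi, chart]
      · convert LimitEdge.A (m + 1) (by omega) using 1
        all_goals simp [Slot.pf, Slot.ps, Slot.lo, Slot.hi, chart]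
        all_goals rw [pow_succ]; ring
    · refine ⟨⟨.unlabelled, fun g => by simp [Label.Kept, Slot.Kept], Or.inl ?_⟩,
        fun m => ⟨.B (m + 1), fun g => by simp only [Label.Kept, Slot.Kept]; omega, Or.inl ?_⟩⟩
      · convert LimitEdge.unlabelled using 1
        all_goals norm_num [Slot.pf, Slot.ps, Slot.lo, Slot.hi, chart]
      · convert LimitEdge.B (m + 1) (by omega) using 1
        all_goals simp [Slot.pf, Slot.ps, Slot.lo, Slot.hi, chart]
        all_goals rw [pow_succ]; ring
  cases s with
  | left m => exact linked_left f m
  | right m => simpa [Slot.pf, Slot.ps] using (linked_left ((Slot.right m).pf f) m).symm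
  | bot b =>
    cases f
    · exact (key b).1
    · simpa [Slot.pf, Slot.ps] using (key (!b)).1.symm
  | top b m =>
    cases f
    · exact (key b).2 m
    · simpa [Slot.pf, Slot.ps] using ((key (!b)).2 m).symm

/-- The endpoints of the edges in the uniform chart. -/
def endpoints : Set ℂ := {v | ∃ s : Slot, v = s.lo ∨ v = s.hi}

lemma edgeEndpoints_eq (f : Bool) : edgeEndpoints (!f) = chart f '' endpoints := by
  have inj : ∀ f f' : Bool, (!f) = !f' → f = f' := by decide
  apply Subset.antisymm
  · rintro v ⟨l, a, b, j, c, d, h | h, hv⟩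
    · obtain ⟨f', s, hf, -, -, h⟩ := h.exists_slot; obtain rfl := inj _ _ hf
      rcases h with ⟨rfl, rfl, -⟩ | ⟨rfl, rfl, -⟩ <;> rcases hv with rfl | rfl
      exacts [⟨_, ⟨s, Or.inl rfl⟩, rfl⟩, ⟨_, ⟨s, Or.inr rfl⟩, rfl⟩, ⟨_, ⟨s, Or.inr rfl⟩, rfl⟩,
        ⟨_, ⟨s, Or.inl rfl⟩, rfl⟩]
    · generalize hi : (!f) = i at h
      obtain ⟨f', s, -, hf, -, h⟩ := h.exists_slot; rw [← hi] at hf; obtain rfl := inj _ _ hf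
      rcases h with ⟨-, -, rfl, rfl⟩ | ⟨-, -, rfl, rfl⟩ <;> rcases hv with rfl | rfl
      exacts [⟨_, ⟨s.ps, Or.inl rfl⟩, rfl⟩, ⟨_, ⟨s.ps, Or.inr rfl⟩, rfl⟩,
        ⟨_, ⟨s.ps, Or.inr rfl⟩, rfl⟩, ⟨_, ⟨s.ps, Or.inl rfl⟩, rfl⟩]
  · rintro _ ⟨v, ⟨s, hv⟩, rfl⟩; obtain ⟨l, -, h | h | h | h⟩ := linked f s
    · exact ⟨l, _, _, _, _, _, Or.inl h, by rcases hv with rfl | rfl <;> simp⟩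
    · exact ⟨l, _, _, _, _, _, Or.inl h, by rcases hv with rfl | rfl <;> simp⟩
    · exact ⟨l, _, _, _, _, _, Or.inr h, by rcases hv with rfl | rfl <;> simp⟩
    · exact ⟨l, _, _, _, _, _, Or.inr h, by rcases hv with rfl | rfl <;> simp⟩

/-- The points that are removed. -/
def removed : Set ℂ := closure endpoints

/-- The upper rectangle without the removed points. -/
def good : Set ℂ := rect \ removed

lemma region_eq (f : Bool) : limitSurface.region (!f) = chart f '' good := by
  change rectangle (!f) \ closure (edgeEndpoints (!f)) = _
  rw [rectangle_eq, edgeEndpoints_eq, good, image_sdiff (f := chart f) (chartHomeo f).injective, removed]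
  congr 1; exact ((chartHomeo f).image_closure endpoints).symm

lemma chart_mem_region {f : Bool} {v : ℂ} (hv : v ∈ good) :
    chart f v ∈ limitSurface.region (!f) := by
  rw [region_eq]; exact ⟨v, hv, rfl⟩

/-- The point of the limit surface with coordinate `v` in the sheet `f`. -/
def X (f : Bool) (v : ℂ) (hv : v ∈ good) : limitSurface.Surface :=
  pt (G := limitSurface) (!f) (chart f v) (chart_mem_region hv)

lemma exists_eq_X (i : Bool) (z : ℂ) (hz : z ∈ limitSurface.region i) :
    ∃ (f : Bool) (v : ℂ) (hv : v ∈ good), i = !f ∧ z = chart f v ∧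
      pt (G := limitSurface) i z hz = X f v hv := by
  obtain ⟨f, rfl⟩ : ∃ f, i = !f := ⟨!i, by simp⟩; have hz' := hz; rw [region_eq] at hz'
  obtain ⟨v, hv, rfl⟩ := hz'; exact ⟨f, v, hv, rfl, rfl, rfl⟩

lemma X_surjective (x : limitSurface.Surface) : ∃ f v hv, x = X f v hv := by
  induction x using Quot.ind with
  | mk p => obtain ⟨f, v, hv, -, -, h⟩ := exists_eq_X p.1 p.2 p.2.2; exact ⟨f, v, hv, h⟩

lemma chart_segment {f : Bool} {s : Slot} {z : ℂ} (hz : z ∈ segment ℝ (chart f s.lo) (chart f s.hi)) :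
    ∃ t ∈ Icc (0 : ℝ) 1, z = chart f (s.at' t) := by
  rw [segment_eq_image_lineMap] at hz; obtain ⟨t, ht, rfl⟩ := hz
  exact ⟨t, ht, (chart_lineMap f _ _ t).symm⟩

lemma chart_at' (f : Bool) (s : Slot) (t : ℝ) :
    chart f (s.at' t) = chart f s.lo + t * (chart f s.hi - chart f s.lo) := by
  rw [Slot.at', chart_lineMap, lineMap_apply]; simp [add_comm]

lemma chart_at'_rev (f : Bool) (s : Slot) (t : ℝ) :
    chart f (s.at' t) = chart f s.hi + (1 - t) * (chart f s.lo - chart f s.hi) := by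
  rw [chart_at']; ring

lemma rel_limit {i j : Bool} {z w : ℂ} {a b c d : ℂ} {l : Label} (h : LimitEdge l i a b j c d)
    (hz : z ∈ segment ℝ a b) (hw : w = z + (c - a)) :
    ∃ (f : Bool) (s : Slot) (t : ℝ), t ∈ Icc (0 : ℝ) 1 ∧ i = !f ∧ j = !(s.pf f) ∧
      z = chart f (s.at' t) ∧ w = chart (s.pf f) (s.ps.at' t) ∧ ∀ g, l.Kept g ↔ s.Kept g := by
  have htr := limitEdge_translation _ _ _ _ _ _ _ h; obtain ⟨f, s, hi, hj, hk, h⟩ := h.exists_slot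
  rcases h with ⟨rfl, rfl, rfl, rfl⟩ | ⟨rfl, rfl, rfl, rfl⟩
  · obtain ⟨t, ht, rfl⟩ := chart_segment hz; refine ⟨f, s, t, ht, hi, hj, rfl, ?_, hk⟩
    rw [hw, chart_at', chart_at', htr]; ring
  · rw [segment_symm] at hz; obtain ⟨t, ht, rfl⟩ := chart_segment hz
    refine ⟨f, s, t, ht, hi, hj, rfl, ?_, hk⟩; rw [hw, chart_at'_rev, chart_at'_rev, htr]; ring

lemma chart_injective (f : Bool) : Function.Injective (chart f) := (chartHomeo f).injective

lemma at'_mem_segment (f : Bool) (s : Slot) {t : ℝ} (ht : t ∈ Icc 0 1) :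
    chart f (s.at' t) ∈ segment ℝ (chart f s.lo) (chart f s.hi) := by
  rw [segment_eq_image_lineMap]; exact ⟨t, ht, (chart_lineMap f _ _ t).symm⟩

/-- Gluing along an edge. -/
lemma X_at' (f : Bool) (s : Slot) {t : ℝ} (ht : t ∈ Icc 0 1) (h : s.at' t ∈ good)
    (h' : s.ps.at' t ∈ good) : X f (s.at' t) h = X (s.pf f) (s.ps.at' t) h' := by
  have hm := at'_mem_segment f s ht; have hm' := at'_mem_segment (s.pf f) s.ps ht
  have e := chart_at' f s t; have e' := chart_at' (s.pf f) s.ps t; have er := chart_at'_rev f s t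
  have er' := chart_at'_rev (s.pf f) s.ps t; obtain ⟨l, -, hl⟩ := linked f s
  have htr : chart f s.hi - chart f s.lo = chart (s.pf f) s.ps.hi - chart (s.pf f) s.ps.lo := by
    rcases hl with h | h | h | h <;> have := limitEdge_translation _ _ _ _ _ _ _ h
    · exact this
    · linear_combination -this
    · exact this.symm
    · linear_combination this
  rcases hl with h | h | h | h
  · refine Quot.sound ⟨_, _, _, _, ⟨l, h⟩, hm, ?_⟩
    change chart (s.pf f) (s.ps.at' t) = chart f (s.at' t) + _
    rw [e, e', htr]; ring
  · refine Quot.sound ⟨_, _, _, _, ⟨l, h⟩, by rwa [segment_symm], ?_⟩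
    change chart (s.pf f) (s.ps.at' t) = chart f (s.at' t) + _
    rw [er, er', ← neg_sub (chart f s.hi), htr]; ring
  · refine (Quot.sound ⟨_, _, _, _, ⟨l, h⟩, hm', ?_⟩).symm
    change chart f (s.at' t) = chart (s.pf f) (s.ps.at' t) + _
    rw [e, e', htr]; ring
  · refine (Quot.sound ⟨_, _, _, _, ⟨l, h⟩, by rwa [segment_symm], ?_⟩).symm
    change chart f (s.at' t) = chart (s.pf f) (s.ps.at' t) + _
    rw [er, er', ← neg_sub (chart f s.hi), htr]; ring

/-- Functions on the limit surface from functions on the sheets. -/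
lemma exists_lift {β : Sort*} (Φ : Bool → ℂ → β)
    (hΦ : ∀ f (s : Slot), ∀ t ∈ Icc (0 : ℝ) 1, s.at' t ∈ good → s.ps.at' t ∈ good →
      Φ f (s.at' t) = Φ (s.pf f) (s.ps.at' t)) :
    ∃ φ : limitSurface.Surface → β, ∀ f v hv, φ (X f v hv) = Φ f v := by
  refine ⟨Quot.lift (fun p => Φ (!p.1) (unchart (!p.1) p.2)) ?_, ?_⟩
  · rintro ⟨i, z, hz⟩ ⟨j, w, hw⟩ ⟨a, b, c, d, ⟨l, h⟩, hs, ht⟩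
    obtain ⟨f, s, t, htI, rfl, rfl, e1, e2, -⟩ := rel_limit h hs ht
    change z = _ at e1
    change w = _ at e2
    subst e1 e2; rw [region_eq] at hz hw; obtain ⟨v, hv, e⟩ := hz; obtain ⟨v', hv', e'⟩ := hw
    have := chart_injective _ e; have := chart_injective _ e'; subst v v'
    simp only [Bool.not_not, unchart_chart]; exact hΦ f s t htI hv hv'
  · intro f v hv
    change Φ (!!f) (unchart (!!f) (chart f v)) = _
    rw [Bool.not_not, unchart_chart]

/-- Open sets of the limit surface in terms of the sheets. -/
lemma isOpen_limit_iff {O : Set limitSurface.Surface} :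
    IsOpen O ↔ ∀ f, IsOpen {v : good | X f v v.2 ∈ O} := by
  have h1 : IsOpen O ↔ IsOpen ((Quot.mk limitSurface.Rel) ⁻¹' O) := Iff.rfl
  rw [h1, isOpen_sigma_iff]
  have key : ∀ f : Bool, IsOpen (Sigma.mk (β := fun i => ↥(limitSurface.region i)) (!f) ⁻¹'
      ((Quot.mk limitSurface.Rel) ⁻¹' O)) ↔ IsOpen {v : good | X f v v.2 ∈ O} := by
    intro f
    let e : good ≃ₜ limitSurface.region (!f) :=
      ((chartHomeo f).image good).trans (Homeomorph.setCongr (region_eq f).symm)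
    rw [← e.isOpen_preimage]; rfl
  constructor
  · intro h f; exact (key f).1 (h (!f))
  · intro h i; obtain ⟨f, rfl⟩ : ∃ f : Bool, i = !f := ⟨Bool.not i, (Bool.not_not i).symm⟩
    exact (key f).2 (h f)

lemma continuous_limit_iff {β : Type*} [TopologicalSpace β] {φ : limitSurface.Surface → β} :
    Continuous φ ↔ ∀ f, Continuous fun v : good => φ (X f v v.2) := by
  simp only [continuous_def, isOpen_limit_iff]
  exact ⟨fun h f s hs => h s hs f, fun h s hs f => h f s hs⟩


lemma half_pow_le_or (m n : ℕ) : m = n ∨ ((1 / 2 : ℝ) ^ m ≤ 1 / 2 * (1 / 2) ^ n) ∨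
    ((1 / 2 : ℝ) ^ n ≤ 1 / 2 * (1 / 2) ^ m) := by
  have key : ∀ m n : ℕ, n < m → (1 / 2 : ℝ) ^ m ≤ 1 / 2 * (1 / 2) ^ n := by
    intro m n h; obtain ⟨k, rfl⟩ := Nat.exists_eq_add_of_lt h; rw [pow_succ, pow_add]
    have h1 : (1 / 2 : ℝ) ^ k ≤ 1 := pow_le_one₀ (by norm_num) (by norm_num)
    have h2 : (0 : ℝ) < (1 / 2) ^ n := by positivity
    nlinarith
  rcases lt_trichotomy m n with h | h | h
  · exact Or.inr (Or.inr (key _ _ h))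
  · exact Or.inl h
  · exact Or.inr (Or.inl (key _ _ h))

lemma leftNode_cases (m n : ℕ) : m = n ∨ ((leftNode m - 2 / 3) * (leftNode n - 2 / 3) < 0) ∨
    (0 < (leftNode m - 2 / 3) * (leftNode n - 2 / 3) ∧
      (|leftNode m - 2 / 3| ≤ 1 / 4 * |leftNode n - 2 / 3| ∨
       |leftNode n - 2 / 3| ≤ 1 / 4 * |leftNode m - 2 / 3|)) := by
  have key : ∀ m n : ℕ, n < m → ((leftNode m - 2 / 3) * (leftNode n - 2 / 3) < 0) ∨
    (0 < (leftNode m - 2 / 3) * (leftNode n - 2 / 3) ∧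
      |leftNode m - 2 / 3| ≤ 1 / 4 * |leftNode n - 2 / 3|) := by
    intro m n h; obtain ⟨k, rfl⟩ := Nat.exists_eq_add_of_lt h
    have e : (leftNode (n + k + 1) - 2 / 3) * (leftNode n - 2 / 3) =
        1 / 9 * (-1 / 2) ^ (k + 1) * ((-1 / 2) ^ n) ^ 2 := by
      rw [leftNode, leftNode]; ring
    have hn : (0 : ℝ) < ((-1 / 2) ^ n) ^ 2 := by
      have : ((-1 / 2 : ℝ)) ^ n ≠ 0 := pow_ne_zero _ (by norm_num); positivity
    rcases Nat.even_or_odd (k + 1) with hk | hk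
    · right; refine ⟨?_, ?_⟩
      · have : (0 : ℝ) < (-1 / 2) ^ (k + 1) := hk.pow_pos (by norm_num); rw [e]; positivity
      · rw [abs_leftNode_sub, abs_leftNode_sub]
        obtain ⟨j, rfl⟩ : ∃ j, k = j + 1 := ⟨k - 1, by
          rcases k with _ | k
          · simp at hk
          · omega⟩
        have h1 : (1 / 2 : ℝ) ^ j ≤ 1 := pow_le_one₀ (by norm_num) (by norm_num)
        have h2 : (0 : ℝ) < (1 / 2) ^ n := by positivity
        have : (1 / 2 : ℝ) ^ (n + (j + 1) + 1) = 1 / 4 * (1 / 2) ^ n * (1 / 2) ^ j := by ring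
        rw [this]; nlinarith
    · left; have : (-1 / 2 : ℝ) ^ (k + 1) < 0 := hk.pow_neg (by norm_num); rw [e]; nlinarith
  rcases lt_trichotomy m n with h | h | h
  · rcases key _ _ h with h | h
    · right; left; linarith
    · right; right; exact ⟨by linarith [h.1], Or.inr h.2⟩
  · exact Or.inl h
  · rcases key _ _ h with h | h
    · right; left; linarith
    · right; right; exact ⟨by linarith [h.1], Or.inl h.2⟩

/-- The endpoints of edges, side by side. -/
lemma endpoints_cases {e : ℂ} (he : e ∈ endpoints) :
    (e.im = 1 / 2 ∧ (e.re = 0 ∨ e.re = 1 / 2 ∨ e.re = 1)) ∨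
    (e.im = 1 ∧ ∃ n : ℕ, e.re = 1 - (1 / 2) ^ n ∨ e.re = 1 - 3 / 4 * (1 / 2) ^ n) ∨
    (e.re = 1 ∧ ∃ n : ℕ, e.im = 1 - (1 / 2) ^ (n + 1)) ∨
    (e.re = 0 ∧ ∃ n : ℕ, e.im = leftNode n) := by
  obtain ⟨s, rfl | rfl⟩ := he
  · cases s with
    | bot b => left; cases b <;> simp [Slot.lo]
    | top b m =>
      right; left; refine ⟨rfl, m, ?_⟩; cases b <;> simp [Slot.lo]
    | right m => right; right; left; exact ⟨rfl, m, rfl⟩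
    | left m => right; right; right; exact ⟨rfl, m, rfl⟩
  · cases s with
    | bot b => left; cases b <;> simp [Slot.hi]
    | top b m =>
      right; left; cases b
      · exact ⟨rfl, m, by simp [Slot.hi]⟩
      · exact ⟨rfl, m + 1, Or.inl (by simp only [Slot.hi, if_true, pow_succ]; ring)⟩
    | right m => right; right; left; exact ⟨rfl, m + 1, rfl⟩
    | left m => right; right; right; exact ⟨rfl, m + 2, rfl⟩

lemma Slot.lo_mem_endpoints (s : Slot) : s.lo ∈ endpoints := ⟨s, Or.inl rfl⟩
lemma Slot.hi_mem_endpoints (s : Slot) : s.hi ∈ endpoints := ⟨s, Or.inr rfl⟩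

lemma endpoints_subset_rect : endpoints ⊆ rect := by
  have hp : ∀ n : ℕ, (0 : ℝ) < (1 / 2) ^ n ∧ (1 / 2 : ℝ) ^ n ≤ 1 := fun n =>
    ⟨by positivity, pow_le_one₀ (by norm_num) (by norm_num)⟩
  intro e he
  change e.re ∈ Icc _ _ ∧ e.im ∈ Icc _ _
  rcases endpoints_cases he with ⟨h, h' | h' | h'⟩ | ⟨h, n, h' | h'⟩ | ⟨h, n, h'⟩ | ⟨h, n, h'⟩ <;>
    rw [h, h']
  · norm_num
  · norm_num
  · norm_num
  · exact ⟨⟨by linarith [hp n], by linarith [hp n]⟩, by norm_num⟩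
  · exact ⟨⟨by linarith [hp n], by linarith [hp n]⟩, by norm_num⟩
  · rw [pow_succ]; exact ⟨by norm_num, by linarith [hp n], by linarith [hp n]⟩
  · exact ⟨by norm_num, leftNode_mem n⟩

lemma convex_rect : Convex ℝ rect := by
  have : rect = Icc (0 : ℝ) 1 ×ℂ Icc (1 / 2 : ℝ) 1 := rfl; rw [this]
  exact ((convex_Icc _ _).linear_preimage reLm).inter ((convex_Icc _ _).linear_preimage imLm)

lemma isClosed_rect : IsClosed rect := by
  have : rect = Icc (0 : ℝ) 1 ×ℂ Icc (1 / 2 : ℝ) 1 := rfl; rw [this]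
  exact isClosed_Icc.reProdIm isClosed_Icc

lemma Slot.at'_mem_rect (s : Slot) {t : ℝ} (ht : t ∈ Icc 0 1) : s.at' t ∈ rect := by
  have := convex_rect.segment_subset (endpoints_subset_rect s.lo_mem_endpoints)
    (endpoints_subset_rect s.hi_mem_endpoints)
  rw [segment_eq_image_lineMap] at this; exact this ⟨t, ht, rfl⟩

lemma removed_subset_rect : removed ⊆ rect := closure_minimal endpoints_subset_rect isClosed_rect

/-- An interval without a point in its interior. -/
lemma mul_min_le_abs {a b e : ℝ} {t : ℝ} (ht : t ∈ Icc 0 1)  (h : (e - a) * (b - e) ≤ 0) :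
    |b - a| * min t (1 - t) ≤ |a + t * (b - a) - e| := by
  have h0 := ht.1; have h1 := ht.2; have m1 := min_le_left t (1 - t)
  have m2 := min_le_right t (1 - t); rcases le_total a b with hab | hab
  · rw [abs_of_nonneg (sub_nonneg.2 hab)]; rcases le_total e a with he | he
    · refine le_trans ?_ (le_abs_self _); nlinarith
    · have : b ≤ e ∨ e = a := by
        by_contra! hc; have : a < e := lt_of_le_of_ne he (Ne.symm hc.2)
        nlinarith [mul_pos (sub_pos.2 this) (sub_pos.2 hc.1)]
      rcases this with he | rfl
      · refine le_trans ?_ (neg_le_abs _); nlinarith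
      · refine le_trans ?_ (le_abs_self _); nlinarith
  · rw [abs_of_nonpos (sub_nonpos.2 hab)]; rcases le_total a e with he | he
    · refine le_trans ?_ (neg_le_abs _); nlinarith
    · have : e ≤ b ∨ e = a := by
        by_contra! hc; have : e < a := lt_of_le_of_ne he hc.2
        nlinarith [mul_pos (sub_pos.2 this) (sub_pos.2 hc.1)]
      rcases this with he | rfl
      · refine le_trans ?_ (le_abs_self _); nlinarith
      · refine le_trans ?_ (neg_le_abs _); nlinarith

lemma Slot.len_mul_le_dist (s : Slot) {t : ℝ} (ht : t ∈ Icc 0 1) {e : ℂ}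
    (he : e ∈ endpoints) : s.len * min t (1 - t) ≤ dist (s.at' t) e := by
  have hp : ∀ n : ℕ, (0 : ℝ) < (1 / 2) ^ n ∧ (1 / 2 : ℝ) ^ n ≤ 1 := fun n =>
    ⟨by positivity, pow_le_one₀ (by norm_num) (by norm_num)⟩
  have hmin : min t (1 - t) ≤ 1 / 2 := by
    rcases le_total t (1 / 2) with h | h
    · exact (min_le_left _ _).trans h
    · exact (min_le_right _ _).trans (by linarith)
  have hmin0 : 0 ≤ min t (1 - t) := le_min ht.1 (sub_nonneg.2 ht.2)
  have hre := abs_re_sub_le (s.at' t) e; have him := abs_im_sub_le (s.at' t) e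
  have hlen : s.len * min t (1 - t) ≤ 1 / 4 := by
    have h1 : s.len ≤ 1 / 2 := s.len_le.trans (by linarith [hp s.idx]); nlinarith [s.len_pos]
  have hfar : ∀ d : ℝ, 1 / 4 ≤ d → d ≤ dist (s.at' t) e → s.len * min t (1 - t) ≤ dist (s.at' t) e :=
    fun d h h' => (hlen.trans h).trans h'
  have hR : |s.hi.re - s.lo.re| = s.len → (e.re - s.lo.re) * (s.hi.re - e.re) ≤ 0 →
      s.len * min t (1 - t) ≤ dist (s.at' t) e := by
    intro h' h; refine le_trans ?_ hre; rw [Slot.at'_re, ← h']; exact mul_min_le_abs ht h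
  have hI : |s.hi.im - s.lo.im| = s.len → (e.im - s.lo.im) * (s.hi.im - e.im) ≤ 0 →
      s.len * min t (1 - t) ≤ dist (s.at' t) e := by
    intro h' h; refine le_trans ?_ him; rw [Slot.at'_im, ← h']; exact mul_min_le_abs ht h
  have hC := endpoints_cases he; have hq := hp s.idx; rw [Slot.at'_re] at hre
  rw [Slot.at'_im] at him
  cases s with
  | bot b =>
    replace hR := hR (by cases b <;> simp [Slot.lo, Slot.hi, Slot.len] <;> norm_num)
    rcases hC with ⟨h, h' | h' | h'⟩ | ⟨h, -⟩ | ⟨h, -⟩ | ⟨h, -⟩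
    · apply hR; rw [h']; cases b <;> norm_num [Slot.lo, Slot.hi]
    · apply hR; rw [h']; cases b <;> norm_num [Slot.lo, Slot.hi]
    · apply hR; rw [h']; cases b <;> norm_num [Slot.lo, Slot.hi]
    · refine hfar _ ?_ him; rw [h]; norm_num [Slot.lo, Slot.hi]
    · apply hR; rw [h]; cases b <;> norm_num [Slot.lo, Slot.hi]
    · apply hR; rw [h]; cases b <;> norm_num [Slot.lo, Slot.hi]
  | top b m =>
    replace hR := hR (by
      rw [abs_of_nonneg] <;> cases b <;> simp only [Slot.lo, Slot.hi, Slot.len] <;> norm_num <;> ring)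
    simp only [Slot.idx] at hq; rcases hC with ⟨h, -⟩ | ⟨h, n, h' | h'⟩ | ⟨h, -⟩ | ⟨h, -⟩
    · refine hfar _ ?_ him; rw [h]; norm_num [Slot.lo, Slot.hi]
    iterate 2
      have hn := hp n; apply hR; rw [h']
      rcases half_pow_le_or m n with rfl | h1 | h1 <;> cases b <;>
        simp only [Slot.lo, Slot.hi, if_true, Bool.false_eq_true, if_false] <;> nlinarith
    all_goals apply hR; rw [h]; cases b <;> simp only [Slot.lo, Slot.hi] <;> norm_num <;> nlinarith
  | right m =>
    simp only [Slot.idx] at hq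
    replace hI := hI (by
      rw [abs_of_nonneg] <;> simp only [Slot.lo, Slot.hi, Slot.len, pow_succ] <;> linarith)
    rcases hC with ⟨h, -⟩ | ⟨h, -⟩ | ⟨h, n, h'⟩ | ⟨h, -⟩
    iterate 2 apply hI; rw [h]; simp only [Slot.lo, Slot.hi, pow_succ]; nlinarith
    · apply hI; rw [h']; have hn := hp n; simp only [Slot.lo, Slot.hi, pow_succ]
      rcases half_pow_le_or m n with rfl | h1 | h1 <;> nlinarith
    · refine hfar _ ?_ hre; rw [h]; norm_num [Slot.lo, Slot.hi]
  | left m =>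
    have e2 : leftNode (m + 2) = 1 / 4 * (leftNode m - 2 / 3) + 2 / 3 := by
      rw [leftNode_add_two, leftNode]; ring
    replace hI := hI (by
      simp only [Slot.lo, Slot.hi, Slot.len]
      rw [show leftNode (m + 2) - leftNode m = -(3 / 4) * (leftNode m - 2 / 3) by linarith, abs_mul,
        abs_leftNode_sub]
      norm_num; ring)
    have hm := leftNode_mem m; have hm2 := leftNode_mem (m + 2)
    rcases hC with ⟨h, -⟩ | ⟨h, -⟩ | ⟨h, -⟩ | ⟨h, n, h'⟩
    · apply hI; rw [h]; simp only [Slot.lo, Slot.hi]; nlinarith [hm.1, hm2.1]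
    · apply hI; rw [h]; simp only [Slot.lo, Slot.hi]; nlinarith [hm.2, hm2.2]
    · refine hfar _ ?_ hre; rw [h]; norm_num [Slot.lo, Slot.hi]
    · apply hI; rw [h']; simp only [Slot.lo, Slot.hi]
      rcases leftNode_cases m n with rfl | h1 | ⟨h1, h2⟩
      · simp
      all_goals
        rw [e2, ← sub_add_cancel (leftNode m) (2 / 3), ← sub_add_cancel (leftNode n) (2 / 3),
          add_sub_cancel_right]
        generalize leftNode m - 2 / 3 = x at *
        generalize leftNode n - 2 / 3 = y at *
      · nlinarith [sq_nonneg x, sq_nonneg y]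
      · rcases pos_and_pos_or_neg_and_neg_of_mul_pos h1 with ⟨a, b⟩ | ⟨a, b⟩
        · rw [abs_of_pos a, abs_of_pos b] at h2; rcases h2 with h2 | h2 <;> nlinarith
        · rw [abs_of_neg a, abs_of_neg b] at h2; rcases h2 with h2 | h2 <;> nlinarith

/-- The distance of a point of an edge to the removed points. -/
lemma Slot.infDist_at' (s : Slot) {t : ℝ} (ht : t ∈ Icc 0 1) :
    infDist (s.at' t) removed = s.len * min t (1 - t) := by
  rw [removed, infDist_closure]; apply le_antisymm
  · have h1 := infDist_le_dist_of_mem (x := s.at' t) s.lo_mem_endpoints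
    have h2 := infDist_le_dist_of_mem (x := s.at' t) s.hi_mem_endpoints
    rw [← s.at'_zero, s.dist_at', sub_zero, abs_of_nonneg ht.1] at h1
    rw [← s.at'_one, s.dist_at', abs_sub_comm, abs_of_nonneg (sub_nonneg.2 ht.2)] at h2
    rcases le_total t (1 - t) with h | h
    · rw [min_eq_left h]; linarith
    · rw [min_eq_right h]; linarith
  · exact (le_infDist ⟨_, s.lo_mem_endpoints⟩).2 fun e he => s.len_mul_le_dist ht he

lemma isClosed_removed : IsClosed removed := isClosed_closure

lemma removed_nonempty : removed.Nonempty :=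
  ⟨_, subset_closure (Slot.lo_mem_endpoints (.bot false))⟩

lemma infDist_removed_pos {v : ℂ} : 0 < infDist v removed ↔ v ∉ removed :=
  (isClosed_removed.notMem_iff_infDist_pos removed_nonempty).symm

lemma Slot.at'_mem_good_iff (s : Slot) {t : ℝ} (ht : t ∈ Icc 0 1) :
    s.at' t ∈ good ↔ t ∈ Ioo (0 : ℝ) 1 := by
  rw [good, Set.mem_sdiff, ← infDist_removed_pos, s.infDist_at' ht]; constructor
  · rintro ⟨-, h⟩; have := lt_min_iff.1 (pos_of_mul_pos_right h s.len_pos.le)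
    exact ⟨this.1, by linarith [this.2]⟩
  · intro h; exact ⟨s.at'_mem_rect ht, mul_pos s.len_pos (lt_min h.1 (by linarith [h.2]))⟩


/-- The side of the rectangle that contains a given open edge. -/
lemma Slot.side_of_mem (s : Slot) {u : ℝ} (hu : u ∈ Ioo (0 : ℝ) 1) : match s with
    | .bot _ => (s.at' u).im = 1 / 2
    | .top _ _ => (s.at' u).im = 1
    | .right _ => (s.at' u).re = 1 ∧ 1 / 2 < (s.at' u).im ∧ (s.at' u).im < 1
    | .left _ => (s.at' u).re = 0 ∧ 1 / 2 < (s.at' u).im ∧ (s.at' u).im < 1 := by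
  cases s with
  | bot b => simp [Slot.at'_im, Slot.lo, Slot.hi]
  | top b m => simp [Slot.at'_im, Slot.lo, Slot.hi]
  | right m =>
    simp only [Slot.at'_im, Slot.at'_re, Slot.lo, Slot.hi, pow_succ]
    have h1 : (0 : ℝ) < (1 / 2) ^ m := by positivity
    have h2 : (1 / 2 : ℝ) ^ m ≤ 1 := pow_le_one₀ (by norm_num) (by norm_num)
    refine ⟨by ring, ?_, ?_⟩ <;> nlinarith [hu.1, hu.2]
  | left m =>
    simp only [Slot.at'_im, Slot.at'_re, Slot.lo, Slot.hi]
    have h1 := leftNode_mem m; have h2 := leftNode_mem (m + 2)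
    have h3 : leftNode m ≠ leftNode (m + 2) := by
      intro e; rw [leftNode_add_two, leftNode] at e
      have : (-1 / 2 : ℝ) ^ m ≠ 0 := pow_ne_zero _ (by norm_num); exact this (by linarith)
    refine ⟨by ring, ?_⟩
    rcases lt_or_gt_of_ne h3 with h3 | h3 <;> constructor <;>
      nlinarith [h1.1, h1.2, h2.1, h2.2, hu.1, hu.2]

/-- A point that is not removed lies on at most one edge. -/
lemma Slot.eq_of_at'_eq {s s' : Slot} {t t' : ℝ} (ht : t ∈ Ioo (0 : ℝ) 1) (ht' : t' ∈ Ioo (0 : ℝ) 1)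
    (h : s.at' t = s'.at' t') : s = s' := by
  have hp : ∀ n : ℕ, (0 : ℝ) < (1 / 2) ^ n := fun n => by positivity
  have k := s.side_of_mem ht; have k' := s'.side_of_mem ht'; rw [h] at k
  have hre := congrArg Complex.re h; have him := congrArg Complex.im h
  rw [Slot.at'_re, Slot.at'_re] at hre; rw [Slot.at'_im, Slot.at'_im] at him
  cases s <;> cases s' <;> dsimp only at k k' <;> try (exfalso; linarith)
  case bot.bot b b' =>
    cases b <;> cases b' <;> simp [Slot.lo, Slot.hi] at hre ⊢ <;> linarith [ht.1, ht.2, ht'.1, ht'.2]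
  case top.top b m b' m' =>
    have h2 := hp m'; rcases half_pow_le_or m m' with rfl | h | h <;> cases b <;> cases b' <;>
      simp only [Slot.lo, Slot.hi, if_true, Bool.false_eq_true, if_false] at hre ⊢ <;> exfalso <;>
      nlinarith [ht.1, ht.2, ht'.1, ht'.2]
  case right.right m m' =>
    have h1 := hp m; have h2 := hp m'
    simp only [Slot.lo, Slot.hi, pow_succ] at him
    rcases half_pow_le_or m m' with rfl | h | h
    · rfl
    all_goals exfalso; nlinarith [ht.1, ht.2, ht'.1, ht'.2]
  case left.left m m' =>
    have e : ∀ n, leftNode (n + 2) = 1 / 4 * (leftNode n - 2 / 3) + 2 / 3 := fun n => by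
      rw [leftNode_add_two, leftNode]; ring
    simp only [Slot.lo, Slot.hi, e] at him; rcases leftNode_cases m m' with rfl | h1 | h1
    · rfl
    all_goals
      exfalso
      obtain ⟨x, hx⟩ : ∃ x, leftNode m = x + 2 / 3 := ⟨_, (sub_add_cancel _ _).symm⟩
      obtain ⟨y, hy⟩ : ∃ y, leftNode m' = y + 2 / 3 := ⟨_, (sub_add_cancel _ _).symm⟩
      simp only [hx, hy, add_sub_cancel_right] at h1 him
      have hxy : x * (1 - 3 / 4 * t) = y * (1 - 3 / 4 * t') := by linarith
      have a1 : 0 < 1 - 3 / 4 * t := by linarith [ht.2]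
      have a2 : 0 < 1 - 3 / 4 * t' := by linarith [ht'.2]
    · have : (x * (1 - 3 / 4 * t)) * (y * (1 - 3 / 4 * t')) < 0 := by
        have := mul_pos a1 a2; nlinarith
      rw [hxy] at this; nlinarith [mul_self_nonneg (y * (1 - 3 / 4 * t'))]
    · obtain ⟨h1, h2⟩ := h1
      rcases pos_and_pos_or_neg_and_neg_of_mul_pos h1 with ⟨a, b⟩ | ⟨a, b⟩ <;>
        simp only [abs_of_pos, abs_of_neg, a, b] at h2 <;>
        rcases h2 with h2 | h2 <;> nlinarith [ht.1, ht.2, ht'.1, ht'.2]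

/-! ### Points near the boundary, the sets `U g` -/

/-- The point lies on an edge that is not glued in `U g`. -/
def Dropped (g : ℕ) (v : ℂ) : Prop := ∃ s : Slot, ∃ t ∈ Icc (0 : ℝ) 1, v = s.at' t ∧ ¬ s.Kept g

lemma dropped_at'_iff {g : ℕ} {s : Slot} {t : ℝ} (ht : t ∈ Icc 0 1) (h : s.at' t ∈ good) :
    Dropped g (s.at' t) ↔ ¬ s.Kept g := by
  constructor
  · rintro ⟨s', t', ht', e, hk⟩; have h' := h; rw [e, s'.at'_mem_good_iff ht'] at h'
    rw [s.at'_mem_good_iff ht] at h; rwa [Slot.eq_of_at'_eq h h' e]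
  · intro hk; exact ⟨s, t, ht, rfl, hk⟩

lemma X_mem_U {g : ℕ} {f : Bool} {v : ℂ} {hv : v ∈ good} : X f v hv ∈ U g ↔ ¬ Dropped g v := by
  obtain ⟨φ, hφ⟩ := exists_lift (fun _ v => Dropped g v) (fun f s t ht h h' => by
    rw [dropped_at'_iff ht h, dropped_at'_iff ht h', Slot.kept_ps])
  constructor
  · rintro h ⟨s, t, ht, rfl, hk⟩; obtain ⟨l, hl, hL⟩ := linked f s
    have hv' : s.ps.at' t ∈ good := by
      rw [s.ps.at'_mem_good_iff ht, ← s.at'_mem_good_iff ht]; exact hv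
    have hk' : ¬ l.Kept g := fun h => hk ((hl g).1 h)
    rcases hL with hL | hL | hL | hL
    · exact h l _ _ _ _ _ _ hL hk' _ (chart_mem_region hv) (at'_mem_segment f s ht) rfl
    · refine h l _ _ _ _ _ _ hL hk' _ (chart_mem_region hv) ?_ rfl
      rw [segment_symm]; exact at'_mem_segment f s ht
    · exact h l _ _ _ _ _ _ hL hk' _ (chart_mem_region hv') (at'_mem_segment _ s.ps ht)
        (X_at' f s ht hv hv')
    · refine h l _ _ _ _ _ _ hL hk' _ (chart_mem_region hv') ?_ (X_at' f s ht hv hv')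
      rw [segment_symm]; exact at'_mem_segment _ s.ps ht
  · intro h l i a b j c d hL hk z hz hs e
    obtain ⟨f', s, t, ht, rfl, -, rfl, -, hl⟩ := rel_limit hL hs rfl; have hz' := hz
    rw [region_eq] at hz'; obtain ⟨w, hw, e'⟩ := hz'; obtain rfl := chart_injective _ e'
    change X f v hv = X f' (s.at' t) hw at e
    have := congrArg φ e; rw [hφ, hφ] at this
    exact h (this.mpr ⟨s, t, ht, rfl, fun h => hk ((hl g).2 h)⟩)

lemma Slot.le_idx_of_not_kept {s : Slot} {g : ℕ} (h : ¬ s.Kept g) : (g - 1) / 2 ≤ s.idx := by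
  cases s <;> simp [Kept, idx] at h ⊢ <;> omega

lemma Slot.kept_mono {s : Slot} {g g' : ℕ} (hg : g ≤ g') (h : s.Kept g) : s.Kept g' := by
  cases s <;> simp only [Kept] at h ⊢ <;> omega

lemma Slot.kept_of_idx_lt {s : Slot} {g : ℕ} (h : s.idx < (g - 1) / 2) : s.Kept g := by
  by_contra h'; exact absurd (Slot.le_idx_of_not_kept h') (by omega)

lemma Slot.finite_idx_le (n : ℕ) : {s : Slot | s.idx ≤ n}.Finite := by
  have h : {s : Slot | s.idx ≤ n} ⊆ (bot '' univ) ∪ (image2 top univ (Iic n)) ∪ (right '' Iic n) ∪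
      (left '' Iic n) := by
    intro s hs
    cases s with
    | bot b => exact Or.inl (Or.inl (Or.inl ⟨b, trivial, rfl⟩))
    | top b m => exact Or.inl (Or.inl (Or.inr ⟨b, trivial, m, hs, rfl⟩))
    | right m => exact Or.inl (Or.inr ⟨m, hs, rfl⟩)
    | left m => exact Or.inr ⟨m, hs, rfl⟩
  refine Finite.subset ?_ h
  exact (((finite_univ.image _).union (finite_univ.image2 _ (finite_Iic n))).union
    ((finite_Iic n).image _)).union ((finite_Iic n).image _)

lemma Slot.infDist_le_len {s : Slot} {t : ℝ} (ht : t ∈ Icc 0 1) :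
    infDist (s.at' t) removed ≤ s.len := by
  rw [s.infDist_at' ht]; have := s.len_pos
  have h : min t (1 - t) ≤ 1 := (min_le_left _ _).trans ht.2; nlinarith

lemma isClosed_dropped (g : ℕ) : IsClosed ({v | Dropped g v} ∪ removed) := by
  rw [← isOpen_compl_iff, isOpen_iff_mem_nhds]; intro v hv
  simp only [mem_compl_iff, mem_union, mem_ofPred_eq, not_or] at hv
  set ρ := infDist v removed with hρ; have hρ0 : 0 < ρ := infDist_removed_pos.2 hv.2
  obtain ⟨n, hn⟩ := exists_pow_lt_of_lt_one hρ0 (show (1 / 2 : ℝ) < 1 by norm_num)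
  have h1 : ∀ᶠ w in 𝓝 v, ρ / 2 < infDist w removed :=
    (continuous_infDist_pt removed).continuousAt.eventually (lt_mem_nhds (half_lt_self hρ0))
  have h2 : ∀ᶠ w in 𝓝 v, ∀ s ∈ {s : Slot | s.idx ≤ n}, ¬ s.Kept g → w ∉ s.at' '' Icc 0 1 := by
    refine (eventually_all_finite (Slot.finite_idx_le n)).2 fun s _ => ?_
    by_cases hk : s.Kept g
    · exact Eventually.of_forall fun w h => absurd hk h
    · have hc : IsClosed (s.at' '' Icc 0 1) :=
        (isCompact_Icc.image (AffineMap.lineMap_continuous)).isClosed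
      have : v ∉ s.at' '' Icc 0 1 := by rintro ⟨t, ht, e⟩; exact hv.1 ⟨s, t, ht, e.symm, hk⟩
      filter_upwards [hc.isOpen_compl.mem_nhds this] with w hw _ using hw
  filter_upwards [h1, h2] with w hw1 hw2
  rintro (⟨s, t, ht, rfl, hk⟩ | hw)
  · refine hw2 s ?_ hk ⟨t, ht, rfl⟩; by_contra hlt
    have h3 := (Slot.infDist_le_len ht).trans s.len_le
    have h4 : (1 / 2 : ℝ) ^ s.idx ≤ (1 / 2) ^ n :=
      pow_le_pow_of_le_one (by norm_num) (by norm_num) (by omega)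
    linarith
  · rw [infDist_zero_of_mem hw] at hw1; linarith

/-- The distance to the removed points, as a function on the limit surface. -/
lemma exists_height : ∃ h : limitSurface.Surface → ℝ,
    (∀ f v hv, h (X f v hv) = infDist v removed) ∧ Continuous h ∧ (∀ x, 0 < h x) ∧
    ∀ x y l, PolyPath x y l → h x ≤ h y + l := by
  obtain ⟨h, hh⟩ := exists_lift (fun _ v => infDist v removed) (fun f s t ht _ _ => by
    rw [s.infDist_at' ht, s.ps.infDist_at' ht, Slot.len_ps])
  refine ⟨h, hh, ?_, ?_, ?_⟩
  · rw [continuous_limit_iff]; intro f; simp only [hh]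
    exact (continuous_infDist_pt removed).comp continuous_subtype_val
  · intro x; obtain ⟨f, v, hv, rfl⟩ := X_surjective x; rw [hh]; exact infDist_removed_pos.2 hv.2
  · intro x y l hl
    induction hl with
    | refl => simp
    | cons i p q hp hq hpq y l _ ih =>
      obtain ⟨f, v, hv, e, rfl, e1⟩ := exists_eq_X i p hp
      obtain ⟨f', v', hv', e', rfl, e2⟩ := exists_eq_X i q hq
      have : f = f' := by
        have := e.symm.trans e'
        revert this
        cases f <;> cases f' <;> decide
      subst this; rw [e1, hh]; rw [e2, hh] at ih; rw [dist_chart]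
      have := infDist_le_infDist_add_dist (s := removed) (x := v) (y := v'); linarith

lemma isOpen_U (g : ℕ) : IsOpen (U g) := by
  rw [isOpen_limit_iff]; intro f; simp only [X_mem_U]
  have : {v : good | ¬ Dropped g v} = Subtype.val ⁻¹' ({v | Dropped g v} ∪ removed)ᶜ := by
    ext v; simp [v.2.2]
  rw [this]; exact (isClosed_dropped g).isOpen_compl.preimage continuous_subtype_val

lemma U_mono (g : ℕ) : U g ⊆ U (g + 1) := by
  intro x hx; obtain ⟨f, v, hv, rfl⟩ := X_surjective x; rw [X_mem_U] at hx ⊢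
  rintro ⟨s, t, ht, e, hk⟩; exact hx ⟨s, t, ht, e, fun h => hk (Slot.kept_mono (by omega) h)⟩

/-- The interior of the upper rectangle. -/
def openRect : Set ℂ := {z | z.re ∈ Ioo 0 1 ∧ z.im ∈ Ioo (1 / 2) 1}

lemma isOpen_openRect : IsOpen openRect :=
  (isOpen_Ioo.preimage Complex.continuous_re).inter (isOpen_Ioo.preimage Complex.continuous_im)

lemma openRect_subset_rect : openRect ⊆ rect := fun _ h =>
  ⟨Ioo_subset_Icc_self h.1, Ioo_subset_Icc_self h.2⟩

lemma Slot.at'_notMem_openRect (s : Slot) (t : ℝ) : s.at' t ∉ openRect := by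
  rintro ⟨h1, h2⟩
  cases s with
  | bot b => simp [at'_im, lo, hi] at h2
  | top b m => simp [at'_im, lo, hi] at h2
  | right m => simp [at'_re, lo, hi] at h1
  | left m => simp [at'_re, lo, hi] at h1

lemma openRect_subset_good : openRect ⊆ good := by
  refine fun v hv => ⟨openRect_subset_rect hv, ?_⟩
  have h : removed ⊆ openRectᶜ := by
    refine closure_minimal ?_ isOpen_openRect.isClosed_compl; rintro _ ⟨s, rfl | rfl⟩
    · rw [← s.at'_zero]; exact s.at'_notMem_openRect 0
    · rw [← s.at'_one]; exact s.at'_notMem_openRect 1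
  exact fun h' => h h' hv

lemma not_dropped_of_mem_openRect {g : ℕ} {v : ℂ} (hv : v ∈ openRect) : ¬ Dropped g v := by
  rintro ⟨s, t, -, rfl, -⟩; exact s.at'_notMem_openRect t hv

/-- The centre of the upper rectangle. -/
def center : ℂ := ⟨1 / 2, 3 / 4⟩

lemma lineMap_center_mem {v : ℂ} (hv : v ∈ rect) {t : ℝ} (ht : t ∈ Ioc (0 : ℝ) 1) :
    lineMap v center t ∈ openRect := by
  obtain ⟨⟨h1, h2⟩, h3, h4⟩ := hv
  have e1 : (lineMap v center t : ℂ).re = v.re + t * (1 / 2 - v.re) := by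
    simp [lineMap_apply, center]; ring
  have e2 : (lineMap v center t : ℂ).im = v.im + t * (3 / 4 - v.im) := by
    simp [lineMap_apply, center]; ring
  have := ht.1; have := ht.2; refine ⟨?_, ?_⟩
  · rw [e1]; constructor <;> nlinarith
  · rw [e2]; constructor <;> nlinarith

lemma eventually_lineMap_center (v : ℂ) {P : ℂ → Prop} (h : ∀ᶠ w in 𝓝 v, P w) :
    ∀ᶠ t in 𝓝[>] (0 : ℝ), P (lineMap v center t) := by
  have h1 : Tendsto (fun t : ℝ => (lineMap v center t : ℂ)) (𝓝[>] 0) (𝓝 v) := by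
    have := ((AffineMap.lineMap_continuous (p := v) (q := center) (R := ℝ)).tendsto 0)
    rw [lineMap_apply_zero] at this; exact this.mono_left nhdsWithin_le_nhds
  exact h1.eventually h

lemma dense_U (g : ℕ) : Dense (U g) := by
  rw [dense_iff_inter_open]; rintro O hO ⟨x, hx⟩; obtain ⟨f, v, hv, rfl⟩ := X_surjective x
  have h := isOpen_limit_iff.1 hO f; obtain ⟨W, hW, e⟩ := h
  have hvW : v ∈ W := by
    have : (⟨v, hv⟩ : good) ∈ Subtype.val ⁻¹' W := by rw [e]; exact hx
    exact this
  obtain ⟨t, h1, h2⟩ := ((eventually_lineMap_center v (hW.mem_nhds hvW)).and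
    (Ioc_mem_nhdsGT (zero_lt_one' ℝ))).exists
  have hm := lineMap_center_mem hv.1 h2
  refine ⟨X f _ (openRect_subset_good hm), ?_, X_mem_U.2 (not_dropped_of_mem_openRect hm)⟩
  have : (⟨_, openRect_subset_good hm⟩ : good) ∈ Subtype.val ⁻¹' W := h1; rw [e] at this; exact this

lemma exists_mem_U (x : limitSurface.Surface) : ∃ g, 3 ≤ g ∧ x ∈ U g := by
  obtain ⟨f, v, hv, rfl⟩ := X_surjective x
  by_cases h : ∃ s : Slot, ∃ t ∈ Icc (0 : ℝ) 1, v = s.at' t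
  · obtain ⟨s, t, ht, rfl⟩ := h; refine ⟨2 * s.idx + 3, by omega, ?_⟩
    rw [X_mem_U, dropped_at'_iff ht hv, not_not]; exact Slot.kept_of_idx_lt (by omega)
  · refine ⟨3, le_rfl, ?_⟩; rw [X_mem_U]; rintro ⟨s, t, ht, e, -⟩; exact h ⟨s, t, ht, e⟩

lemma not_dropped_of_lt_infDist {g : ℕ} {v : ℂ}
    (h : (1 / 2) ^ ((g - 1) / 2) < infDist v removed) : ¬ Dropped g v := by
  rintro ⟨s, t, ht, rfl, hk⟩; have h3 := (Slot.infDist_le_len ht).trans s.len_le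
  have h4 : (1 / 2 : ℝ) ^ s.idx ≤ (1 / 2) ^ ((g - 1) / 2) :=
    pow_le_pow_of_le_one (by norm_num) (by norm_num) (Slot.le_idx_of_not_kept hk)
  have : (0 : ℝ) < (1 / 2) ^ s.idx := by positivity
  linarith

/-- A pseudo-distance on the punctured rectangle that is bounded by the euclidean one along segments. -/
lemma le_of_segment_subset {S : Set ℂ} (hoS : openRect ⊆ S) (hSr : S ⊆ rect)
    {D : ℂ → ℂ → ENNReal} (htri : ∀ u ∈ S, ∀ v ∈ S, ∀ w ∈ S,
    D u w ≤ D u v + D v w) {C : ℝ} (hC : 0 ≤ C)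
    (h : ∀ u ∈ S, ∀ v ∈ S, segment ℝ u v ⊆ S → D u v ≤ ofReal (C * dist u v))
    {u v : ℂ} (hu : u ∈ S) (hv : v ∈ S) : D u v ≤ ofReal (C * dist u v) := by
  have key : ∀ t ∈ Ioc (0 : ℝ) 1, D u v ≤ ofReal (C * (t * dist u center) +
      C * dist (lineMap u center t : ℂ) (lineMap v center t) +
      C * (t * dist v center)) := by
    intro t ht; have hu' := lineMap_center_mem (hSr hu) ht
    have hv' := lineMap_center_mem (hSr hv) ht
    have hs : ∀ w ∈ S, segment ℝ w (lineMap w center t) ⊆ S := by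
      intro w hw; rw [segment_eq_image_lineMap]; rintro _ ⟨s, hs, rfl⟩
      rw [AffineMap.lineMap_lineMap_right]; rcases hs.1.eq_or_lt with rfl | h0
      · simpa using hw
      · exact hoS (lineMap_center_mem (hSr hw) ⟨mul_pos h0 ht.1, by nlinarith [hs.2, ht.2, ht.1]⟩)
    have hconv : Convex ℝ openRect := ((convex_Ioo _ _).linear_preimage reLm).inter
      ((convex_Ioo _ _).linear_preimage imLm)
    have d1 := h _ hu _ (hoS hu') (hs _ hu)
    have d2 := h _ (hoS hu') _ (hoS hv') ((hconv.segment_subset hu' hv').trans hoS)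
    have d3 := h _ (hoS hv') _ hv (by rw [segment_symm]; exact hs _ hv)
    rw [dist_left_lineMap, Real.norm_of_nonneg ht.1.le] at d1
    rw [dist_lineMap_left, Real.norm_of_nonneg ht.1.le] at d3
    calc D u v ≤ _ := htri _ hu _ (hoS hu') _ hv
      _ ≤ _ := add_le_add d1 (htri _ (hoS hu') _ (hoS hv') _ hv)
      _ ≤ _ := add_le_add le_rfl (add_le_add d2 d3)
      _ = _ := by
        rw [← ofReal_add (by positivity) (by have := ht.1; positivity),
          ← ofReal_add (by have := ht.1; positivity) (by have := ht.1; positivity), add_assoc]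
  have hc : Continuous fun t : ℝ => ofReal (C * (t * dist u center) +
      C * dist (lineMap u center t : ℂ) (lineMap v center t) +
      C * (t * dist v center)) := by
    refine ENNReal.continuous_ofReal.comp ?_; fun_prop
  have hlim := (hc.tendsto 0).mono_left (nhdsWithin_le_nhds (s := Ioi 0))
  simp only [zero_mul, mul_zero, lineMap_apply_zero, zero_add, add_zero] at hlim
  refine ge_of_tendsto hlim ?_
  filter_upwards [Ioc_mem_nhdsGT (zero_lt_one' ℝ)] with t ht using key t ht

/-- Points of one sheet are at most as far apart as in the plane. -/
lemma flatDist_X_le (f : Bool) {u v : ℂ} (hu : u ∈ good) (hv : v ∈ good) :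
    flatDist (X f u hu) (X f v hv) ≤ ofReal (dist u v) := by
  classical
  let D : ℂ → ℂ → ENNReal := fun u v =>
    if h : u ∈ good ∧ v ∈ good then flatDist (X f u h.1) (X f v h.2) else 0
  have hD : ∀ u v (hu : u ∈ good) (hv : v ∈ good), D u v = flatDist (X f u hu) (X f v hv) :=
    fun u v hu hv => dif_pos ⟨hu, hv⟩
  have := le_of_segment_subset openRect_subset_good sdiff_subset (D := D) (C := 1) (fun u hu v hv w hw => by
    rw [hD u w hu hw, hD u v hu hv, hD v w hv hw]; exact flatDist_triangle _ _ _) zero_le_one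
    (fun u hu v hv hs => by
      rw [hD u v hu hv, one_mul, ← dist_chart f]; refine flatDist_pt_le _ _ ?_
      rw [region_eq, segment_eq_image_lineMap]; rintro _ ⟨t, ht, rfl⟩
      refine ⟨_, hs ?_, chart_lineMap f u v t⟩
      rw [segment_eq_image_lineMap]; exact ⟨t, ht, rfl⟩) hu hv
  rwa [hD u v hu hv, one_mul] at this


/-! ### Points near the removed points -/

lemma le_ofReal_of_forall {A : ENNReal} {a b : ℝ}
    (h : ∀ t ∈ Ioo (0 : ℝ) 1, A ≤ ofReal (a + t * b)) : A ≤ ofReal a := by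
  have hc : Continuous fun t : ℝ => ofReal (a + t * b) :=
    ENNReal.continuous_ofReal.comp (by fun_prop)
  have hlim := (hc.tendsto 0).mono_left (nhdsWithin_le_nhds (s := Ioi 0))
  simp only [zero_mul, add_zero] at hlim; refine ge_of_tendsto hlim ?_
  filter_upwards [Ioo_mem_nhdsGT (zero_lt_one' ℝ)] with t ht using h t ht

/-- A distance function on the limit surface that is bounded on each sheet by a multiple of the
euclidean distance. -/
structure SheetBound (g : ℕ) (D : limitSurface.Surface → limitSurface.Surface → ENNReal) (C : ℝ) :
    Prop where
  nonneg : 0 ≤ C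
  symm : ∀ x y, D x y = D y x
  triangle : ∀ x ∈ U g, ∀ y ∈ U g, ∀ z ∈ U g, D x z ≤ D x y + D y z
  le : ∀ f u v hu hv, X f u hu ∈ U g → X f v hv ∈ U g →
    D (X f u hu) (X f v hv) ≤ ofReal (C * dist u v)

/-- Points of the sheet `f` close to `V` are close to points of the sheet `f'` close to `W`. -/
def Near (g : ℕ) (D : limitSurface.Surface → limitSurface.Surface → ENNReal) (C δ : ℝ)
    (f : Bool) (V : ℂ) (f' : Bool) (W : ℂ) : Prop :=
  ∀ p q hp hq, X f p hp ∈ U g → X f' q hq ∈ U g →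
    D (X f p hp) (X f' q hq) ≤ ofReal (C * (dist p V + dist q W + δ))

namespace Near

variable {g : ℕ} {D : limitSurface.Surface → limitSurface.Surface → ENNReal} {C : ℝ}
  (H : SheetBound g D C)

include H

lemma mono {δ δ' : ℝ} {f f' : Bool} {V W : ℂ} (h : Near g D C δ f V f' W) (hδ : δ ≤ δ') :
    Near g D C δ' f V f' W := fun p q hp hq h1 h2 =>
  (h p q hp hq h1 h2).trans (ofReal_le_ofReal (mul_le_mul_of_nonneg_left (by linarith) H.nonneg))

lemma symm {δ : ℝ} {f f' : Bool} {V W : ℂ} (h : Near g D C δ f V f' W) :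
    Near g D C δ f' W f V := fun p q hp hq h1 h2 => by
  rw [H.symm, add_comm (dist p W)]; exact h q p hq hp h2 h1

lemma of_dist {δ : ℝ} (f : Bool) {V W : ℂ} (h : dist V W ≤ δ) : Near g D C δ f V f W :=
  fun p q hp hq h1 h2 => by
  refine (H.le f p q hp hq h1 h2).trans (ofReal_le_ofReal (mul_le_mul_of_nonneg_left ?_ H.nonneg))
  have := dist_triangle4 p V W q; rw [dist_comm W q] at this; linarith

lemma trans {δ δ' : ℝ} {f f' f'' : Bool} {V W Z : ℂ} (hW : W ∈ rect) (hδ : 0 ≤ δ) (hδ' : 0 ≤ δ')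
    (h : Near g D C δ f V f' W) (h' : Near g D C δ' f' W f'' Z) :
    Near g D C (δ + δ') f V f'' Z := by
  intro p q hp hq h1 h2; refine le_ofReal_of_forall (b := 2 * (C * dist W center)) fun t ht => ?_
  have hm := lineMap_center_mem hW (Ioo_subset_Ioc_self ht); have hg := openRect_subset_good hm
  have hU : X f' _ hg ∈ U g := X_mem_U.2 (not_dropped_of_mem_openRect hm)
  have e1 := h p _ hp hg h1 hU; have e2 := h' _ q hg hq hU h2
  have hd : dist (lineMap W center t : ℂ) W = t * dist W center := by
    rw [dist_lineMap_left, Real.norm_of_nonneg ht.1.le]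
  rw [hd] at e1 e2; refine (H.triangle _ h1 _ hU _ h2).trans ((add_le_add e1 e2).trans ?_)
  have := ht.1; have := H.nonneg; rw [← ofReal_add (by positivity) (by positivity)]
  exact ofReal_le_ofReal (le_of_eq (by ring))

lemma link_lo {f : Bool} {s : Slot} (hs : s.Kept g) : Near g D C 0 f s.lo (s.pf f) s.ps.lo := by
  intro p q hp hq h1 h2; refine le_ofReal_of_forall (b := 2 * (C * s.len)) fun t ht => ?_
  have htI := Ioo_subset_Icc_self ht; have hg := (s.at'_mem_good_iff htI).2 ht
  have hg' := (s.ps.at'_mem_good_iff htI).2 ht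
  have hU : X f _ hg ∈ U g := X_mem_U.2 (by rw [dropped_at'_iff htI hg]; exact not_not.2 hs)
  have hU' := hU; rw [X_at' f s htI hg hg'] at hU'; have e1 := H.le f _ _ hp hg h1 hU
  have e2 := H.le _ _ _ hg' hq hU' h2; rw [← X_at' f s htI hg hg'] at e2
  have d1 := dist_triangle p s.lo (s.at' t); have d2 := dist_triangle (s.ps.at' t) s.ps.lo q
  rw [← s.at'_zero, s.dist_at', zero_sub, abs_neg, abs_of_pos ht.1, s.at'_zero] at d1
  rw [← s.ps.at'_zero, s.ps.dist_at', sub_zero, abs_of_pos ht.1, s.ps.at'_zero, Slot.len_ps,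
    dist_comm s.ps.lo q] at d2
  refine (H.triangle _ h1 _ hU _ h2).trans ((add_le_add e1 e2).trans ?_); have hC := H.nonneg
  rw [← ofReal_add (by positivity) (by positivity)]; refine ofReal_le_ofReal ?_; nlinarith

lemma link_hi {f : Bool} {s : Slot} (hs : s.Kept g) : Near g D C 0 f s.hi (s.pf f) s.ps.hi := by
  intro p q hp hq h1 h2; refine le_ofReal_of_forall (b := 2 * (C * s.len)) fun u hu => ?_
  obtain ⟨t, ht, rfl⟩ : ∃ t ∈ Ioo (0 : ℝ) 1, u = 1 - t :=
    ⟨1 - u, ⟨by linarith [hu.2], by linarith [hu.1]⟩, by ring⟩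
  have htI := Ioo_subset_Icc_self ht; have hg := (s.at'_mem_good_iff htI).2 ht
  have hg' := (s.ps.at'_mem_good_iff htI).2 ht
  have hU : X f _ hg ∈ U g := X_mem_U.2 (by rw [dropped_at'_iff htI hg]; exact not_not.2 hs)
  have hU' := hU; rw [X_at' f s htI hg hg'] at hU'; have e1 := H.le f _ _ hp hg h1 hU
  have e2 := H.le _ _ _ hg' hq hU' h2; rw [← X_at' f s htI hg hg'] at e2
  have d1 := dist_triangle p s.hi (s.at' t); have d2 := dist_triangle (s.ps.at' t) s.ps.hi q
  rw [← s.at'_one, s.dist_at', abs_of_pos hu.1, s.at'_one] at d1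
  rw [← s.ps.at'_one, s.ps.dist_at', abs_sub_comm, abs_of_pos hu.1, s.ps.at'_one, Slot.len_ps,
    dist_comm s.ps.hi q] at d2
  refine (H.triangle _ h1 _ hU _ h2).trans ((add_le_add e1 e2).trans ?_); have hC := H.nonneg
  rw [← ofReal_add (by positivity) (by positivity)]; refine ofReal_le_ofReal ?_; nlinarith

omit H in
lemma top_mem (m : ℕ) : (⟨1 - (1 / 2) ^ m, 1⟩ : ℂ) ∈ rect := by
  have := endpoints_subset_rect (Slot.lo_mem_endpoints (.top false m)); simpa [Slot.lo] using this

omit H in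
lemma right_mem (m : ℕ) : (⟨1, 1 - (1 / 2) ^ (m + 1)⟩ : ℂ) ∈ rect :=
  endpoints_subset_rect (Slot.lo_mem_endpoints (.right m))

omit H in
lemma left_mem (m : ℕ) : (⟨0, leftNode m⟩ : ℂ) ∈ rect :=
  endpoints_subset_rect (Slot.lo_mem_endpoints (.left m))

omit H in
lemma one_mem : (⟨1, 1⟩ : ℂ) ∈ rect := by constructor <;> norm_num

omit H in
lemma two_thirds_mem : (⟨0, 2 / 3⟩ : ℂ) ∈ rect := by constructor <;> norm_num

omit H in
lemma dist_re {a b c : ℝ} : dist (⟨a, c⟩ : ℂ) ⟨b, c⟩ = |a - b| := by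
  rw [Complex.dist_of_im_eq (z := ⟨a, c⟩) (w := ⟨b, c⟩) rfl, Real.dist_eq]

omit H in
lemma dist_im {a b c : ℝ} : dist (⟨c, a⟩ : ℂ) ⟨c, b⟩ = |a - b| := by
  rw [Complex.dist_of_re_eq (z := ⟨c, a⟩) (w := ⟨c, b⟩) rfl, Real.dist_eq]

omit H in
lemma half_pow_le {m n : ℕ} (h : m ≤ n) : (1 / 2 : ℝ) ^ n ≤ (1 / 2) ^ m :=
  pow_le_pow_of_le_one (by norm_num) (by norm_num) h

omit H in
lemma half_pow_pos (n : ℕ) : (0 : ℝ) < (1 / 2) ^ n := by positivity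

variable {M : ℕ} (hM : M ≤ (g - 1) / 2) (hM3 : 3 ≤ M)

include hM in
lemma top (f : Bool) (m : ℕ) : Near g D C ((1 / 2) ^ M) f ⟨1 - (1 / 2) ^ m, 1⟩ f ⟨1, 1⟩ := by
  rcases le_total M m with h | h
  · refine of_dist H f ?_; rw [dist_re, abs_sub_comm, sub_sub_cancel, abs_of_pos (half_pow_pos m)]
    exact half_pow_le h
  · induction h using Nat.decreasingInduction with
    | self =>
      refine of_dist H f ?_; rw [dist_re, abs_sub_comm, sub_sub_cancel, abs_of_pos (half_pow_pos M)]
    | of_succ m hm ih =>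
      have hk : ∀ b, (Slot.top b m).Kept g := fun b => Slot.kept_of_idx_lt (hm.trans_le hM)
      have h1 := link_lo H (f := f) (hk false); have h2 := link_hi H (f := !f) (hk false)
      simp only [Slot.lo, Slot.hi, Slot.ps, Slot.pf, Bool.not_false, if_true, Bool.false_eq_true,
        if_false, Bool.not_not, one_mul] at h1 h2
      have hm' := endpoints_subset_rect (Slot.hi_mem_endpoints (.top false m))
      simp only [Slot.hi, Bool.false_eq_true, if_false] at hm'
      have h3 := trans H hm' le_rfl le_rfl h1 h2
      have e : (1 : ℝ) - 1 / 2 * (1 / 2) ^ m = 1 - (1 / 2) ^ (m + 1) := by rw [pow_succ]; ring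
      rw [e] at h3; have := trans H (top_mem _) (by norm_num) (half_pow_pos M).le h3 ih
      simpa using this

include hM in
lemma right (f : Bool) (m : ℕ) (hm1 : 1 ≤ m) :
    Near g D C ((1 / 2) ^ M) f ⟨1, 1 - (1 / 2) ^ (m + 1)⟩ f ⟨1, 1⟩ := by
  rcases le_total M (m + 1) with h | h
  · refine of_dist H f ?_; rw [dist_im, abs_sub_comm, sub_sub_cancel, abs_of_pos (half_pow_pos _)]
    exact half_pow_le h
  · obtain ⟨K, rfl⟩ : ∃ K, M = K + 1 := ⟨M - 1, by omega⟩; have h' : m ≤ K := by omega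
    induction h' using Nat.decreasingInduction with
    | self =>
      refine of_dist H f ?_; rw [dist_im, abs_sub_comm, sub_sub_cancel, abs_of_pos (half_pow_pos _)]
    | of_succ m hm ih =>
      obtain ⟨n, rfl⟩ : ∃ n, m = n + 1 := ⟨m - 1, by omega⟩; have ih := ih (by omega) (by omega)
      have h1 := link_hi H (f := f) (s := .right n) (Slot.kept_of_idx_lt (by simp [Slot.idx]; omega))
      have h2 := (link_lo H (f := f) (s := .right (n + 2))
        (Slot.kept_of_idx_lt (by simp [Slot.idx]; omega))).symm H
      have e : (n + 2) % 2 = n % 2 := by omega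
      simp only [Slot.lo, Slot.hi, Slot.ps, Slot.pf, e] at h1 h2
      have h3 := trans H (left_mem _) le_rfl le_rfl h1 h2
      have := trans H (right_mem _) (by norm_num) (half_pow_pos _).le h3 ih; simpa using this

include hM in
lemma left_right (f : Bool) {m : ℕ} (hm : m < M) :
    Near g D C 0 f ⟨0, leftNode m⟩ (xor f (m % 2 == 0)) ⟨1, 1 - (1 / 2) ^ (m + 1)⟩ :=
  link_lo H (f := f) (s := .left m) (Slot.kept_of_idx_lt (hm.trans_le hM))

include hM hM3 in
lemma two_thirds (f f' : Bool) : Near g D C (3 * (1 / 2) ^ M) f ⟨0, 2 / 3⟩ f' ⟨1, 1⟩ := by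
  have key : ∀ m, m < M → M ≤ m + 2 →
      Near g D C (3 * (1 / 2) ^ M) f ⟨0, 2 / 3⟩ (xor f (m % 2 == 0)) ⟨1, 1⟩ := by
    intro m h1 h2
    have h3 := trans H (right_mem _) le_rfl (half_pow_pos _).le (left_right H hM f h1)
      (right H hM _ m (by omega))
    have h4 : Near g D C (2 * (1 / 2) ^ M) f ⟨0, 2 / 3⟩ f ⟨0, leftNode m⟩ := by
      refine of_dist H f ?_; rw [dist_im, abs_sub_comm, abs_leftNode_sub]
      have : (1 / 2 : ℝ) ^ (m + 2) ≤ (1 / 2) ^ M := half_pow_le h2; rw [pow_add] at this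
      linarith [half_pow_pos M]
    have := half_pow_pos M
    exact mono H (trans H (left_mem _) (by positivity) (by positivity) h4 h3) (by linarith)
  obtain ⟨N, rfl⟩ : ∃ N, M = N + 2 := ⟨M - 2, by omega⟩; have h1 := key N (by omega) le_rfl
  have h2 := key (N + 1) (by omega) (by omega); rcases Nat.mod_two_eq_zero_or_one N with h | h
  · have h' : (N + 1) % 2 = 1 := by omega
    rw [h] at h1; rw [h'] at h2; cases f <;> cases f' <;> first | simpa using h1 | simpa using h2
  · have h' : (N + 1) % 2 = 0 := by omega
    rw [h] at h1; rw [h'] at h2; cases f <;> cases f' <;> first | simpa using h1 | simpa using h2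

include hM hM3 in
lemma one_one (f f' : Bool) : Near g D C (6 * (1 / 2) ^ M) f ⟨1, 1⟩ f' ⟨1, 1⟩ := by
  have := half_pow_pos M
  exact mono H (trans H two_thirds_mem (by positivity) (by positivity)
    ((two_thirds H hM hM3 f f).symm H) (two_thirds H hM hM3 f f')) (by linarith)

include hM hM3 in
lemma of_endpoint (f f' : Bool) {e : ℂ} (he : e ∈ endpoints) :
    Near g D C (7 * (1 / 2) ^ M) f e f' ⟨1, 1⟩ := by
  have hp := half_pow_pos M
  have h1 : ∀ {f'' δ V}, 0 ≤ δ → δ ≤ (1 / 2) ^ M → Near g D C δ f V f'' ⟨1, 1⟩ →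
      Near g D C (7 * (1 / 2) ^ M) f V f' ⟨1, 1⟩ := fun h0 h h' =>
    mono H (trans H one_mem h0 (by positivity) h' (one_one H hM hM3 _ f')) (by linarith)
  have h2 : ∀ {f'' V W}, W ∈ rect → Near g D C 0 f V f'' W →
      Near g D C ((1 / 2) ^ M) f'' W f'' ⟨1, 1⟩ → Near g D C (7 * (1 / 2) ^ M) f V f' ⟨1, 1⟩ :=
    fun hW h h' => h1 (by positivity) (by simp) (trans H hW le_rfl hp.le h h')
  have l0 : leftNode 0 = 1 := by norm_num [leftNode]
  have l1 : leftNode 1 = 1 / 2 := by norm_num [leftNode]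
  have hleft : ∀ n, Near g D C (7 * (1 / 2) ^ M) f ⟨0, leftNode n⟩ f' ⟨1, 1⟩ := by
    intro n; rcases n.eq_zero_or_pos with rfl | hn
    · rw [l0]; have := top H hM f 0; rw [pow_zero, sub_self] at this; exact h1 hp.le le_rfl this
    · rcases lt_or_ge n M with h | h
      · exact h2 (right_mem n) (left_right H hM f h) (right H hM _ n hn)
      · have h3 : Near g D C ((1 / 2) ^ M) f ⟨0, leftNode n⟩ f ⟨0, 2 / 3⟩ := by
          refine of_dist H f ?_; rw [dist_im, abs_leftNode_sub]
          linarith [half_pow_le h, half_pow_pos n]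
        exact mono H (trans H two_thirds_mem hp.le (by positivity) h3
          (two_thirds H hM hM3 f f')) (by linarith)
  have hmid : ∀ n, Near g D C (7 * (1 / 2) ^ M) f ⟨1 - 3 / 4 * (1 / 2) ^ n, 1⟩ f' ⟨1, 1⟩ := by
    intro n; rcases lt_or_ge n M with h | h
    · have := link_lo H (f := f) (s := .top true n) (Slot.kept_of_idx_lt (h.trans_le hM))
      simp only [Slot.lo, Slot.ps, Slot.pf, Bool.not_true, if_true, Bool.false_eq_true,
        if_false, one_mul] at this
      exact h2 (top_mem n) this (top H hM _ n)
    · refine h1 hp.le le_rfl (of_dist H f ?_)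
      rw [dist_re, abs_sub_comm, sub_sub_cancel, abs_of_pos (by linarith [half_pow_pos n])]
      linarith [half_pow_le h, half_pow_pos n]
  have hr0 : ∀ f, Near g D C 0 f ⟨1, 1 / 2⟩ (!f) ⟨0, 1⟩ := by
    intro f; have := (left_right H hM (!f) (m := 0) (by omega)).symm H; rw [l0] at this
    norm_num at this; cases f <;> simpa using this
  have ht0 : ∀ f, Near g D C ((1 / 2) ^ M) f ⟨0, 1⟩ f ⟨1, 1⟩ := by
    intro f; have := top H hM f 0; rwa [pow_zero, sub_self] at this
  have m01 : (⟨0, 1⟩ : ℂ) ∈ rect := by constructor <;> norm_num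
  have m12 : (⟨0, 1 / 2⟩ : ℂ) ∈ rect := by constructor <;> norm_num
  obtain ⟨x, y⟩ := e
  rcases endpoints_cases he with ⟨h, h' | h' | h'⟩ | ⟨h, n, h' | h'⟩ | ⟨h, n, h'⟩ | ⟨h, n, h'⟩ <;>
    simp only at h h' <;> subst h h'
  · have := hleft 1; rwa [l1] at this
  · have h3 := link_lo H (f := f) (s := .bot true) trivial
    simp only [Slot.lo, Slot.ps, Slot.pf, Bool.not_true, if_true, Bool.false_eq_true,
        if_false] at h3
    have h4 := left_right H hM (!f) (m := 1) (by omega); rw [l1] at h4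
    exact h2 (right_mem 1) (by simpa using trans H m12 le_rfl le_rfl h3 h4) (right H hM _ 1 le_rfl)
  · exact h2 m01 (hr0 f) (ht0 _)
  · exact h1 hp.le le_rfl (top H hM f n)
  · exact hmid n
  · rcases n.eq_zero_or_pos with rfl | hn
    · have := h2 m01 (hr0 f) (ht0 _); norm_num at this ⊢; exact this
    · exact h1 hp.le le_rfl (right H hM f n hn)
  · exact hleft n

end Near

/-- Points close to the removed points are close to each other. -/
lemma SheetBound.le_of_infDist_lt {g : ℕ}
    {D : limitSurface.Surface → limitSurface.Surface → ENNReal} {C : ℝ} (H : SheetBound g D C) {M : ℕ}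
    (hM : M ≤ (g - 1) / 2) (hM3 : 3 ≤ M) {r : ℝ} {f f' : Bool} {p q : ℂ} {hp : p ∈ good}
    {hq : q ∈ good} (hpU : X f p hp ∈ U g) (hqU : X f' q hq ∈ U g)
    (hpr : infDist p removed < r) (hqr : infDist q removed < r) :
    D (X f p hp) (X f' q hq) ≤ ofReal (C * (2 * r + 14 * (1 / 2) ^ M)) := by
  rw [removed, infDist_closure, infDist_lt_iff ⟨_, Slot.lo_mem_endpoints (.bot true)⟩] at hpr hqr
  obtain ⟨V, hV, hpV⟩ := hpr; obtain ⟨W, hW, hqW⟩ := hqr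
  have h1 := Near.of_endpoint H hM hM3 f false hV
  have h2 := (Near.of_endpoint H hM hM3 f' false hW).symm H; have hp' := Near.half_pow_pos M
  have := Near.trans H Near.one_mem (by positivity) (by positivity) h1 h2 p q hp hq hpU hqU
  refine this.trans (ofReal_le_ofReal (mul_le_mul_of_nonneg_left ?_ H.nonneg)); linarith

end ArnouxYoccoz

/-! ### Comparison of length metrics away from a small set -/

section

variable {S : Type*} {D : S → S → ENNReal} {e : S → ENNReal}

lemma le_ofReal_of_exit (htri : ∀ x y z, D x z ≤ D x y + D y z) (he : ∀ x y, e x ≤ D x y + e y)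
    {γ : ℝ → S} {η : ℝ → ℝ} {c r r' T : ℝ} (hc : 0 ≤ c) (hr : r < r') (hT : 0 ≤ T)
    (hη : ContinuousOn η (Icc 0 T))
    (hloc : ∀ t ∈ Icc 0 T, r < η t → ∀ᶠ s in 𝓝[Icc 0 T] t,
      D (γ t) (γ s) ≤ ofReal (c * |s - t|) ∧ D (γ s) (γ t) ≤ ofReal (c * |s - t|))
    (hsmall : ∀ t ∈ Icc 0 T, η t ≤ r' → e (γ t) = 0) (hηT : η T ≤ r') :
    e (γ 0) ≤ ofReal (c * T) := by
  have h00 : (0 : ℝ) ∈ Icc 0 T := ⟨le_rfl, hT⟩; rcases le_or_gt (η 0) r' with h0 | h0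
  · rw [hsmall 0 h00 h0]; exact zero_le
  have hcl : IsCompact (Icc 0 T ∩ η ⁻¹' Iic r') :=
    isCompact_Icc.of_isClosed_subset (hη.preimage_isClosed_of_isClosed isClosed_Icc isClosed_Iic)
      inter_subset_left
  obtain ⟨t0, ⟨ht0, ht0r⟩, hmin⟩ := hcl.exists_isLeast ⟨T, ⟨hT, le_rfl⟩, hηT⟩
  have hsub : Icc 0 t0 ⊆ Icc 0 T := Icc_subset_Icc le_rfl ht0.2
  have hrt0 : r < η t0 := by
    by_contra! hle
    obtain ⟨s, hs, hsr⟩ := intermediate_value_Icc' ht0.1 (hη.mono hsub)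
      (show r' ∈ Icc (η t0) (η 0) from ⟨hle.trans hr.le, h0.le⟩)
    have : t0 ≤ s := hmin ⟨hsub hs, hsr.le⟩; obtain rfl : s = t0 := le_antisymm hs.2 this; linarith
  have hgt : ∀ t ∈ Icc 0 t0, r < η t := by
    intro t ht; rcases ht.2.eq_or_lt with rfl | h
    · exact hrt0
    · by_contra! hle; exact absurd (hmin ⟨hsub ht, hle.trans hr.le⟩) (not_le.2 h)
  have hD0 : D (γ 0) (γ 0) = 0 := by
    have := ((hloc 0 h00 (hgt 0 ⟨le_rfl, ht0.1⟩)).self_of_nhdsWithin h00).1; simpa using this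
  have := le_ofReal_mul_of_eventually htri (γ := γ) hc ht0.1 hD0 fun t ht =>
    (hloc t (hsub ht) (hgt t ht)).filter_mono (nhdsWithin_mono _ hsub)
  calc e (γ 0) ≤ D (γ 0) (γ t0) + e (γ t0) := he _ _
    _ = D (γ 0) (γ t0) := by rw [hsmall t0 ht0 ht0r, add_zero]
    _ ≤ _ := this
    _ ≤ _ := ofReal_le_ofReal (mul_le_mul_of_nonneg_left (by linarith [ht0.2]) hc)

lemma curve_dichotomy (htri : ∀ x y z, D x z ≤ D x y + D y z) (he : ∀ x y, e x ≤ D x y + e y)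
    {γ : ℝ → S} {η : ℝ → ℝ} {c r r' : ℝ} (hc : 0 ≤ c) (hr : r < r')
    (hη : ContinuousOn η (Icc 0 1))
    (hloc : ∀ t ∈ Icc (0 : ℝ) 1, r < η t → ∀ᶠ s in 𝓝[Icc 0 1] t,
      D (γ t) (γ s) ≤ ofReal (c * |s - t|) ∧ D (γ s) (γ t) ≤ ofReal (c * |s - t|))
    (hsmall : ∀ t ∈ Icc (0 : ℝ) 1, η t ≤ r' → e (γ t) = 0) :
    D (γ 0) (γ 1) ≤ ofReal c ∨ e (γ 0) + e (γ 1) ≤ ofReal c := by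
  by_cases h : ∃ t ∈ Icc (0 : ℝ) 1, η t ≤ r'
  · right; obtain ⟨T, hT, hηT⟩ := h
    have hsub : Icc 0 T ⊆ Icc (0 : ℝ) 1 := Icc_subset_Icc le_rfl hT.2
    have h1 := le_ofReal_of_exit htri he (γ := γ) hc hr hT.1 (hη.mono hsub)
      (fun t ht htr => (hloc t (hsub ht) htr).filter_mono (nhdsWithin_mono _ hsub))
      (fun t ht => hsmall t (hsub ht)) hηT
    have hmap : MapsTo (fun t : ℝ => 1 - t) (Icc 0 (1 - T)) (Icc 0 1) := fun t ht =>
      ⟨by linarith [ht.2, hT.1], by linarith [ht.1]⟩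
    have h2 := le_ofReal_of_exit htri he (γ := fun t => γ (1 - t)) (η := fun t => η (1 - t)) hc hr
      (T := 1 - T) (by linarith [hT.2]) (hη.comp (by fun_prop) hmap)
      (fun t ht htr => by
        have := hloc (1 - t) (hmap ht) htr
        have ht' : Tendsto (fun s : ℝ => 1 - s) (𝓝[Icc 0 (1 - T)] t) (𝓝[Icc 0 1] (1 - t)) :=
          (Continuous.continuousWithinAt (by fun_prop)).tendsto_nhdsWithin hmap
        filter_upwards [ht'.eventually this] with s hs
        have e : |1 - s - (1 - t)| = |s - t| := by rw [abs_sub_comm]; congr 1; ring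
        rwa [e] at hs)
      (fun t ht => hsmall _ (hmap ht)) (by simpa using hηT)
    simp only [sub_zero] at h2
    calc e (γ 0) + e (γ 1) ≤ _ := add_le_add h1 h2
      _ = ofReal c := by
        rw [← ofReal_add (mul_nonneg hc hT.1) (mul_nonneg hc (by linarith [hT.2]))]; congr 1; ring
  · left
    push Not at h
    have hD0 : D (γ 0) (γ 0) = 0 := by
      have h00 : (0 : ℝ) ∈ Icc (0 : ℝ) 1 := ⟨le_rfl, zero_le_one⟩
      have := ((hloc 0 h00 (hr.trans (h 0 h00))).self_of_nhdsWithin h00).1; simpa using this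
    simpa using le_ofReal_mul_of_eventually htri (γ := γ) hc zero_le_one hD0 fun t ht =>
      hloc t ht (hr.trans (h t ht))

end

/-- A path is at least as long as the distance `D` between its endpoints, up to the factor `c`, unless
it meets the set where `e` vanishes. -/
lemma TranslationGluing.PolyPath.dichotomy {G : TranslationGluing}
    {D : G.Surface → G.Surface → ENNReal} {e : G.Surface → ENNReal}
    (htri : ∀ x y z, D x z ≤ D x y + D y z) (hsymm : ∀ x y, D x y = D y x)
    (he : ∀ x y, e x ≤ D x y + e y) (hself : ∀ x, D x x = 0 ∨ e x = 0)
    (η : G.Piece → ℂ → ℝ) (hη : ∀ i, ContinuousOn (η i) (G.region i)) {c r r' : ℝ} (hc : 0 ≤ c)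
    (hr : r < r')
    (hloc : ∀ i z (hz : z ∈ G.region i), r < η i z → ∀ᶠ w in 𝓝[G.region i] z,
      ∀ hw : w ∈ G.region i, D (pt i z hz) (pt i w hw) ≤ ofReal (c * dist z w))
    (hsmall : ∀ i z (hz : z ∈ G.region i), η i z ≤ r' → e (pt i z hz) = 0)
    {x y : G.Surface} {l : ℝ} (h : PolyPath x y l) :
    D x y ≤ ofReal (c * l) ∨ e x + e y ≤ ofReal (c * l) := by
  induction h with
  | refl x =>
    rcases hself x with h | h
    · left; simp [h]
    · right; simp [h]
  | cons i p q hp hq hpq y l hl ih =>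
    have hseg : ∀ t ∈ Icc (0 : ℝ) 1, (lineMap p q t : ℂ) ∈ G.region i := by
      intro t ht; apply hpq; rw [segment_eq_image_lineMap]; exact ⟨t, ht, rfl⟩
    have h1 : D (pt i p hp) (pt i q hq) ≤ ofReal (c * dist p q) ∨
        e (pt i p hp) + e (pt i q hq) ≤ ofReal (c * dist p q) := by
      let π : ℝ → ℝ := fun t => max 0 (min 1 t)
      have hπ : ∀ t, π t ∈ Icc (0 : ℝ) 1 := fun t =>
        ⟨le_max_left _ _, max_le zero_le_one (min_le_left _ _)⟩
      have hπ' : ∀ t ∈ Icc (0 : ℝ) 1, π t = t := fun t ht => by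
        simp only [π]; rw [min_eq_right ht.2, max_eq_right ht.1]
      let γ : ℝ → G.Surface := fun t => pt i (lineMap p q (π t)) (hseg _ (hπ t))
      have hγ : ∀ t (ht : t ∈ Icc (0 : ℝ) 1), γ t = pt i (lineMap p q t) (hseg t ht) := by
        intro t ht; have := hπ' t ht; simp only [γ, this]
      have hmaps : MapsTo (fun t : ℝ => (lineMap p q t : ℂ)) (Icc 0 1) (G.region i) := hseg
      have hcont : Continuous fun t : ℝ => (lineMap p q t : ℂ) :=
        AffineMap.lineMap_continuous
      have key := curve_dichotomy htri he (γ := γ) (η := fun t => η i (lineMap p q t))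
        (c := c * dist p q) (r := r) (r' := r') (by positivity) hr
        ((hη i).comp hcont.continuousOn hmaps)
        (fun t ht htr => by
          have h2 := hloc i _ (hseg t ht) htr
          have h3 : Tendsto (fun t : ℝ => (lineMap p q t : ℂ)) (𝓝[Icc 0 1] t)
              (𝓝[G.region i] (lineMap p q t)) :=
            hcont.continuousWithinAt.tendsto_nhdsWithin hmaps
          filter_upwards [h3.eventually h2, self_mem_nhdsWithin] with s hs hsI
          have h4 := hs (hseg s hsI)
          rw [dist_lineMap_lineMap, Real.dist_eq, abs_sub_comm, mul_left_comm, mul_comm] at h4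
          rw [hγ t ht, hγ s hsI, hsymm (pt i (lineMap p q s) _)]
          have e : c * dist p q * |s - t| = |s - t| * dist p q * c := by ring
          have e' : c * (|s - t| * dist p q) = |s - t| * dist p q * c := by ring
          rw [e]; refine ⟨?_, ?_⟩ <;> refine h4.trans (ofReal_le_ofReal (le_of_eq (by ring))))
        (fun t ht htr => by rw [hγ t ht]; exact hsmall i _ _ htr)
      rw [hγ 0 (by simp), hγ 1 (by simp)] at key; simpa using key
    have hadd : ofReal (c * (dist p q + l)) =
        ofReal (c * dist p q) + ofReal (c * l) := by
      rw [mul_add, ofReal_add (by positivity) (mul_nonneg hc hl.nonneg)]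
    rw [hadd]; rcases h1 with h1 | h1 <;> rcases ih with ih | ih
    · left; exact (htri _ _ _).trans (add_le_add h1 ih)
    · right
      calc _ ≤ D (pt i p hp) (pt i q hq) + e (pt i q hq) + e y := by gcongr; exact he _ _
        _ = D (pt i p hp) (pt i q hq) + (e (pt i q hq) + e y) := add_assoc _ _ _
        _ ≤ _ := add_le_add h1 ih
    · right
      calc e (pt i p hp) + e y ≤ e (pt i p hp) + (D y (pt i q hq) + e (pt i q hq)) := by
            gcongr; exact he _ _
        _ = (e (pt i p hp) + e (pt i q hq)) + D (pt i q hq) y := by rw [hsymm y]; ring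
        _ ≤ _ := add_le_add h1 ih
    · right
      calc e (pt i p hp) + e y ≤ (e (pt i p hp) + e (pt i q hq)) + (e (pt i q hq) + e y) := by
            gcongr
            · exact le_self_add
            · exact le_add_self
        _ ≤ _ := add_le_add h1 ih

/-! ### Piecewise linear functions of one variable -/

/-- The function that is affine with slope `σ j` on the interval `[u j, v j]`, `j < n`, and constant
between these intervals. -/
def clampSum (n : ℕ) (u v σ : ℕ → ℝ) (y : ℝ) : ℝ := ∑ j ∈ range n, σ j * max (u j) (min (v j) y)

/-- The intervals `[u j, v j]`, `j < n`, do not overlap. -/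
structure Nonoverlapping (n : ℕ) (u v : ℕ → ℝ) : Prop where
  le : ∀ j < n, u j ≤ v j
  disj : ∀ i < n, ∀ j < n, i ≠ j → v i ≤ u j ∨ v j ≤ u i

lemma clamp_sub_eq_volume {u v y y' : ℝ} (huv : u ≤ v) (hy : y ≤ y') :
    max u (min v y') - max u (min v y) = volume.real (Ioo u v ∩ Ioo y y') := by
  rw [Ioo_inter_Ioo, Real.volume_real_Ioo]; simp only [max_def, min_def]; split_ifs <;> linarith

lemma sum_clamp_sub_le {n : ℕ} {u v : ℕ → ℝ} (h : Nonoverlapping n u v) {y y' : ℝ} (hy : y ≤ y') :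
    ∑ j ∈ range n, (max (u j) (min (v j) y') - max (u j) (min (v j) y)) ≤ y' - y := by
  have h1 : ∀ j ∈ range n, max (u j) (min (v j) y') - max (u j) (min (v j) y) =
      volume.real (Ioo (u j) (v j) ∩ Ioo y y') := fun j hj =>
    clamp_sub_eq_volume (h.le j (mem_range.1 hj)) hy
  have hfin : ∀ b ∈ range n, volume (Ioo (u b) (v b) ∩ Ioo y y') ≠ ⊤ :=
    fun b _ => ((measure_mono inter_subset_right).trans_lt (by simp)).ne
  rw [sum_congr rfl h1, ← measureReal_biUnion_finset _ _ hfin]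
  · calc _ ≤ volume.real (Ioo y y') := by
          refine measureReal_mono ?_ (by simp); exact iUnion₂_subset fun _ _ => inter_subset_right
      _ = y' - y := by rw [Real.volume_real_Ioo, max_eq_left (sub_nonneg.2 hy)]
  · intro i hi j hj hij; refine Disjoint.mono inter_subset_left inter_subset_left ?_
    rw [Set.disjoint_left]; intro z hz hz'
    rcases h.disj i (by simpa using hi) j (by simpa using hj) hij with h | h
    · linarith [hz.2, hz'.1]
    · linarith [hz.1, hz'.2]
  · intro i _; exact measurableSet_Ioo.inter measurableSet_Ioo

lemma clamp_mono {u v y y' : ℝ} (hy : y ≤ y') : max u (min v y) ≤ max u (min v y') :=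
  max_le_max le_rfl (min_le_min le_rfl hy)

lemma clampSum_sub_le {n : ℕ} {u v σ : ℕ → ℝ} (h : Nonoverlapping n u v) {y y' c : ℝ} (hy : y ≤ y')
    (hc : 0 ≤ c) (hσ : ∀ j < n, u j < y' → y < v j → σ j ≤ c) :
    clampSum n u v σ y' - clampSum n u v σ y ≤ c * (y' - y) := by
  refine le_trans ?_ (mul_le_mul_of_nonneg_left (sum_clamp_sub_le h hy) hc)
  rw [clampSum, clampSum, ← sum_sub_distrib, Finset.mul_sum]; refine sum_le_sum fun j hj => ?_
  have hj' := mem_range.1 hj; rw [← mul_sub]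
  by_cases h1 : u j < y' ∧ y < v j
  · exact mul_le_mul_of_nonneg_right (hσ j hj' h1.1 h1.2) (sub_nonneg.2 (clamp_mono hy))
  · have hle := h.le j hj'
    have : max (u j) (min (v j) y') - max (u j) (min (v j) y) = 0 := by
      rw [not_and_or, not_lt, not_lt] at h1; rcases h1 with h1 | h1
      · rw [max_eq_left ((min_le_right _ _).trans h1),
          max_eq_left ((min_le_right _ _).trans (hy.trans h1)), sub_self]
      · rw [min_eq_left h1, min_eq_left (h1.trans hy), sub_self]
    rw [this]; simp

lemma clampSum_neg {n : ℕ} {u v σ : ℕ → ℝ} (y : ℝ) :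
    clampSum n u v (fun j => -σ j) y = -clampSum n u v σ y := by
  simp [clampSum]

lemma le_clampSum_sub {n : ℕ} {u v σ : ℕ → ℝ} (h : Nonoverlapping n u v) {y y' c : ℝ} (hy : y ≤ y')
    (hc : 0 ≤ c) (hσ : ∀ j < n, u j < y' → y < v j → -c ≤ σ j) :
    -c * (y' - y) ≤ clampSum n u v σ y' - clampSum n u v σ y := by
  have := clampSum_sub_le (σ := fun j => -σ j) h hy hc fun j hj h1 h2 => by linarith [hσ j hj h1 h2]
  rw [clampSum_neg, clampSum_neg] at this; linarith

lemma abs_clampSum_sub_le {n : ℕ} {u v σ : ℕ → ℝ} (h : Nonoverlapping n u v) {y y' c : ℝ}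
    (hc : 0 ≤ c) (hσ : ∀ j < n, u j < max y y' → min y y' < v j → |σ j| ≤ c) :
    |clampSum n u v σ y' - clampSum n u v σ y| ≤ c * |y' - y| := by
  rcases le_total y y' with hy | hy
  · rw [max_eq_right hy, min_eq_left hy] at hσ; rw [abs_of_nonneg (sub_nonneg.2 hy), abs_le]
    exact ⟨by linarith [le_clampSum_sub h hy hc fun j hj h1 h2 => (abs_le.1 (hσ j hj h1 h2)).1],
      clampSum_sub_le h hy hc fun j hj h1 h2 => (abs_le.1 (hσ j hj h1 h2)).2⟩
  · rw [max_eq_left hy, min_eq_right hy] at hσ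
    rw [abs_sub_comm, abs_sub_comm y', abs_of_nonneg (sub_nonneg.2 hy), abs_le]
    exact ⟨by linarith [le_clampSum_sub h hy hc fun j hj h1 h2 => (abs_le.1 (hσ j hj h1 h2)).1],
      clampSum_sub_le h hy hc fun j hj h1 h2 => (abs_le.1 (hσ j hj h1 h2)).2⟩

lemma clampSum_sub_eq {n : ℕ} {u v σ : ℕ → ℝ} (h : Nonoverlapping n u v) {i : ℕ} (hi : i < n)
    {y y' : ℝ} (hy : y ∈ Icc (u i) (v i)) (hy' : y' ∈ Icc (u i) (v i)) :
    clampSum n u v σ y' - clampSum n u v σ y = σ i * (y' - y) := by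
  rw [clampSum, clampSum, ← sum_sub_distrib, sum_eq_single i]
  · rw [min_eq_right hy.2, min_eq_right hy'.2, max_eq_right hy.1, max_eq_right hy'.1]; ring
  · intro j hj hij; have hj' := mem_range.1 hj; rcases h.disj i hi j hj' hij.symm with h1 | h1
    · rw [max_eq_left ((min_le_right _ _).trans (hy.2.trans h1)),
        max_eq_left ((min_le_right _ _).trans (hy'.2.trans h1)), sub_self]
    · rw [min_eq_left (h1.trans hy.1), min_eq_left (h1.trans hy'.1), sub_self]
  · intro h; exact absurd (mem_range.2 hi) h

lemma IsPL.clampSum {f : ℂ → ℝ} (hf : IsPL f) (n : ℕ) (u v σ : ℕ → ℝ) :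
    IsPL (fun z => clampSum n u v σ (f z)) := by
  unfold _root_.clampSum
  exact IsPL.sum _ fun j => IsPL.const_mul ((IsPL.const _).max ((IsPL.const _).min hf)) _

/-! ### Lipschitz functions on subsets of the plane -/

/-- `f` is Lipschitz on `S` with constant `c`. -/
def LipOn (S : Set ℂ) (c : ℝ) (f : ℂ → ℝ) : Prop := ∀ z ∈ S, ∀ w ∈ S, |f z - f w| ≤ c * dist z w

namespace LipOn

variable {S : Set ℂ} {c c' : ℝ} {f f' : ℂ → ℝ}

lemma mono (h : LipOn S c f) (hc : c ≤ c') : LipOn S c' f := fun z hz w hw =>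
  (h z hz w hw).trans (mul_le_mul_of_nonneg_right hc dist_nonneg)

lemma congr (h : LipOn S c f) (he : ∀ z ∈ S, f' z = f z) : LipOn S c f' := fun z hz w hw => by
  rw [he z hz, he w hw]; exact h z hz w hw

lemma const (r : ℝ) : LipOn S 0 (fun _ => r) := fun z _ w _ => by simp

lemma re : LipOn S 1 Complex.re := fun z _ w _ => (one_mul (dist z w)).symm ▸ abs_re_sub_le z w

lemma im : LipOn S 1 Complex.im := fun z _ w _ => (one_mul (dist z w)).symm ▸ abs_im_sub_le z w

lemma add (h : LipOn S c f) (h' : LipOn S c' f') : LipOn S (c + c') (fun z => f z + f' z) :=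
  fun z hz w hw => by
  have e : f z + f' z - (f w + f' w) = (f z - f w) + (f' z - f' w) := by ring
  rw [e, add_mul]; exact (abs_add_le _ _).trans (add_le_add (h z hz w hw) (h' z hz w hw))

lemma neg (h : LipOn S c f) : LipOn S c (fun z => -f z) := fun z hz w hw => by
  have e : -f z - -f w = -(f z - f w) := by ring
  rw [e, abs_neg]; exact h z hz w hw

lemma sub (h : LipOn S c f) (h' : LipOn S c' f') : LipOn S (c + c') (fun z => f z - f' z) := by
  simpa [sub_eq_add_neg] using h.add h'.neg

lemma const_mul (h : LipOn S c f) (r : ℝ) : LipOn S (|r| * c) (fun z => r * f z) :=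
  fun z hz w hw => by
  rw [← mul_sub, abs_mul, mul_assoc]; exact mul_le_mul_of_nonneg_left (h z hz w hw) (abs_nonneg _)

lemma max (h : LipOn S c f) (h' : LipOn S c f') : LipOn S c (fun z => max (f z) (f' z)) :=
  fun z hz w hw => (abs_max_sub_max_le_max _ _ _ _).trans (max_le (h z hz w hw) (h' z hz w hw))

lemma min (h : LipOn S c f) (h' : LipOn S c f') : LipOn S c (fun z => min (f z) (f' z)) :=
  fun z hz w hw => (abs_min_sub_min_le_max _ _ _ _).trans (max_le (h z hz w hw) (h' z hz w hw))

lemma abs (h : LipOn S c f) : LipOn S c (fun z => |f z|) := fun z hz w hw =>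
  (abs_abs_sub_abs_le_abs_sub _ _).trans (h z hz w hw)

lemma comp_real {φ : ℝ → ℝ} {K : ℝ} (hK : 0 ≤ K) (h : LipOn S c f)
    (hφ : ∀ z ∈ S, ∀ w ∈ S, |φ (f z) - φ (f w)| ≤ K * |f z - f w|) :
    LipOn S (K * c) (fun z => φ (f z)) := fun z hz w hw => by
  rw [mul_assoc]; exact (hφ z hz w hw).trans (mul_le_mul_of_nonneg_left (h z hz w hw) hK)

end LipOn

/-! ### Shears -/

/-- A continuous function on the line that increases at least with a fixed positive slope is a
bijection. -/
lemma bijective_of_slope {f : ℝ → ℝ} (hf : Continuous f) {m : ℝ} (hm : 0 < m)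
    (h : ∀ x y, x ≤ y → m * (y - x) ≤ f y - f x) : Function.Bijective f := by
  have hmono : StrictMono f := fun x y hxy => by have := h x y hxy.le; nlinarith
  refine ⟨hmono.injective, fun c => ?_⟩
  have h1 : f (-(|c - f 0| / m)) ≤ c := by
    have := h (-(|c - f 0| / m)) 0 (by have := abs_nonneg (c - f 0); simp; positivity)
    rw [zero_sub, neg_neg, mul_div_cancel₀ _ hm.ne'] at this; linarith [neg_abs_le (c - f 0)]
  have h2 : c ≤ f (|c - f 0| / m) := by
    have := h 0 (|c - f 0| / m) (by positivity); rw [sub_zero, mul_div_cancel₀ _ hm.ne'] at this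
    linarith [le_abs_self (c - f 0)]
  exact mem_range_of_exists_le_of_exists_ge hf ⟨_, h1⟩ ⟨_, h2⟩

/-- The vertical shear with second component `f`. -/
def vShear (f : ℂ → ℝ) (z : ℂ) : ℂ := ⟨z.re, f z⟩

/-- The horizontal shear with first component `f`. -/
def hShear (f : ℂ → ℝ) (z : ℂ) : ℂ := ⟨f z, z.im⟩

lemma exists_homeo_of_antilipschitz {T : ℂ → ℂ} (hT : Continuous T) {c : ℝ} (hc : 0 < c)
    (h : ∀ z w, c * dist z w ≤ dist (T z) (T w)) (hs : Function.Surjective T) :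
    ∃ e : ℂ ≃ₜ ℂ, ⇑e = T := by
  have ha : AntilipschitzWith (Real.toNNReal c⁻¹) T := by
    refine AntilipschitzWith.of_le_mul_dist fun z w => ?_
    rw [Real.coe_toNNReal _ (inv_nonneg.2 hc.le)]; have := h z w
    rw [inv_mul_eq_div, le_div_iff₀ hc]; linarith
  have hi : IsInducing T := by
    have hcl := ha.injective; refine Topology.isInducing_iff_nhds.2 fun z => le_antisymm ?_ ?_
    · exact (hT.tendsto z).le_comap
    · have := ha.comap_nhds_le z; exact this
  exact ⟨(Equiv.ofBijective T ⟨ha.injective, hs⟩).toHomeomorphOfIsInducing hi, rfl⟩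

lemma LipOn.continuous {f : ℂ → ℝ} {C : ℝ} (hf : LipOn univ C f) : Continuous f :=
  LipschitzWith.continuous (K := Real.toNNReal C) <| LipschitzWith.of_dist_le_mul fun z w => by
    rw [Real.dist_eq]
    exact (hf z trivial w trivial).trans
      (mul_le_mul_of_nonneg_right (Real.le_coe_toNNReal C) dist_nonneg)

lemma exists_homeo_vShear {f : ℂ → ℝ} {C m : ℝ} (hf : LipOn univ C f) (hC : 0 ≤ C) (hm : 0 < m)
    (h : ∀ x y y' : ℝ, y ≤ y' → m * (y' - y) ≤ f ⟨x, y'⟩ - f ⟨x, y⟩) :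
    ∃ e : ℂ ≃ₜ ℂ, ⇑e = vShear f := by
  have hfc := hf.continuous
  have hpair : ∀ x : ℝ, Continuous fun y : ℝ => (⟨x, y⟩ : ℂ) := fun x => by
    have : (fun y : ℝ => (⟨x, y⟩ : ℂ)) = fun y : ℝ => (x : ℂ) + y * Complex.I := by
      funext y; apply Complex.ext <;> simp
    rw [this]; fun_prop
  have hv : Continuous (vShear f) := by
    have : vShear f = fun z => (z.re : ℂ) + f z * Complex.I := by
      funext z; apply Complex.ext <;> simp [vShear]
    rw [this]; fun_prop
  refine exists_homeo_of_antilipschitz hv (c := (1 + (1 + C) / m)⁻¹) (by positivity) ?_ ?_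
  · rintro ⟨x, y⟩ ⟨x', y'⟩; set d := dist (vShear f ⟨x, y⟩) (vShear f ⟨x', y'⟩) with hd
    have h1 : |x - x'| ≤ d := abs_re_sub_le (vShear f ⟨x, y⟩) (vShear f ⟨x', y'⟩)
    have h2 : |f ⟨x, y⟩ - f ⟨x', y'⟩| ≤ d := abs_im_sub_le (vShear f ⟨x, y⟩) (vShear f ⟨x', y'⟩)
    have h3 : |f ⟨x, y'⟩ - f ⟨x', y'⟩| ≤ C * |x - x'| := by
      have := hf ⟨x, y'⟩ trivial ⟨x', y'⟩ trivial
      rwa [Complex.dist_of_im_eq (z := ⟨x, y'⟩) (w := ⟨x', y'⟩) rfl, Real.dist_eq] at this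
    have h4 : m * |y - y'| ≤ |f ⟨x, y⟩ - f ⟨x, y'⟩| := by
      rcases le_total y y' with hy | hy
      · rw [abs_sub_comm y, abs_of_nonneg (sub_nonneg.2 hy), abs_sub_comm]
        exact (h x y y' hy).trans (le_abs_self _)
      · rw [abs_of_nonneg (sub_nonneg.2 hy)]; exact (h x y' y hy).trans (le_abs_self _)
    have h5 : |f ⟨x, y⟩ - f ⟨x, y'⟩| ≤ d + C * d := by
      have := abs_sub_le (f ⟨x, y⟩) (f ⟨x', y'⟩) (f ⟨x, y'⟩); rw [abs_sub_comm (f ⟨x', y'⟩)] at this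
      nlinarith
    have h6 : |y - y'| ≤ (1 + C) / m * d := by rw [div_mul_eq_mul_div, le_div_iff₀ hm]; linarith
    have h7 : dist (⟨x, y⟩ : ℂ) ⟨x', y'⟩ ≤ |x - x'| + |y - y'| := by
      rw [dist_eq_norm]; exact norm_le_abs_re_add_abs_im _
    rw [inv_mul_eq_div, div_le_iff₀ (by positivity)]; linarith
  · rintro ⟨x, c⟩
    obtain ⟨y, hy⟩ := (bijective_of_slope (f := fun y => f ⟨x, y⟩) (hfc.comp (hpair x)) hm (h x)).2 c
    exact ⟨⟨x, y⟩, by simp only [vShear]; rw [← hy]⟩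

lemma exists_homeo_hShear {f : ℂ → ℝ} {C m : ℝ} (hf : LipOn univ C f) (hC : 0 ≤ C) (hm : 0 < m)
    (h : ∀ x x' y : ℝ, x ≤ x' → m * (x' - x) ≤ f ⟨x', y⟩ - f ⟨x, y⟩) :
    ∃ e : ℂ ≃ₜ ℂ, ⇑e = hShear f := by
  have hd : ∀ z w : ℂ, dist (⟨z.im, z.re⟩ : ℂ) ⟨w.im, w.re⟩ = dist z w := fun z w => by
    rw [dist_eq_re_im, dist_eq_re_im, add_comm]
  have hsc : Continuous fun z : ℂ => (⟨z.im, z.re⟩ : ℂ) := (Isometry.of_dist_eq hd).continuous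
  let s : ℂ ≃ₜ ℂ :=
    { toFun := fun z => ⟨z.im, z.re⟩, invFun := fun z => ⟨z.im, z.re⟩, left_inv := fun _ => rfl
      right_inv := fun _ => rfl, continuous_toFun := hsc, continuous_invFun := hsc }
  obtain ⟨e, he⟩ := exists_homeo_vShear (f := fun z => f ⟨z.im, z.re⟩) (C := C)
    (fun z _ w _ => by rw [← hd z w]; exact hf _ trivial _ trivial) hC hm
    (fun x y y' hy => h y y' x hy)
  refine ⟨(s.trans e).trans s, ?_⟩; funext z; simp [he, s, vShear, hShear]

/-! ### Piecewise linear functions with prescribed values -/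

/-- The function that runs from `bs j` to `bt j` as the argument runs from `s j` to `t j`, `j < n`, and
that is constant elsewhere; it is determined up to a constant. -/
def edgeSum (n : ℕ) (s t bs bt : ℕ → ℝ) (y : ℝ) : ℝ :=
  clampSum n (fun j => min (s j) (t j)) (fun j => max (s j) (t j))
    (fun j => (bt j - bs j) / (t j - s j)) y

/-- The intervals between `s j` and `t j` do not overlap. -/
def EdgesDisjoint (n : ℕ) (s t : ℕ → ℝ) : Prop :=
  ∀ i < n, ∀ j < n, i ≠ j → max (s i) (t i) ≤ min (s j) (t j) ∨ max (s j) (t j) ≤ min (s i) (t i)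

lemma EdgesDisjoint.nonoverlapping {n : ℕ} {s t : ℕ → ℝ} (h : EdgesDisjoint n s t) :
    Nonoverlapping n (fun j => min (s j) (t j)) (fun j => max (s j) (t j)) :=
  ⟨fun _ _ => min_le_max, h⟩

lemma EdgesDisjoint.edgeSum_sub {n : ℕ} {s t : ℕ → ℝ} (h : EdgesDisjoint n s t) {j : ℕ} (hj : j < n)
    (hst : s j ≠ t j) (bs bt : ℕ → ℝ) {θ : ℝ} (hθ : θ ∈ Icc 0 1) :
    edgeSum n s t bs bt (s j + θ * (t j - s j)) - edgeSum n s t bs bt (s j) =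
      θ * (bt j - bs j) := by
  rw [edgeSum, edgeSum, clampSum_sub_eq h.nonoverlapping hj]
  · have : t j - s j ≠ 0 := sub_ne_zero.2 hst.symm; rw [add_sub_cancel_left]; field_simp
  · exact ⟨min_le_left _ _, le_max_left _ _⟩
  · rcases le_total (s j) (t j) with h | h
    · simp only [min_eq_left h, max_eq_right h]; constructor <;> nlinarith [hθ.1, hθ.2]
    · simp only [min_eq_right h, max_eq_left h]; constructor <;> nlinarith [hθ.1, hθ.2]

lemma EdgesDisjoint.edgeSum_end_sub {n : ℕ} {s t : ℕ → ℝ} (h : EdgesDisjoint n s t) {j : ℕ}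
    (hj : j < n) (hst : s j ≠ t j) (bs bt : ℕ → ℝ) :
    edgeSum n s t bs bt (t j) - edgeSum n s t bs bt (s j) = bt j - bs j := by
  have := h.edgeSum_sub hj hst bs bt (θ := 1) (by simp); simpa using this

/-! ### The numbers that describe the surface of genus `g` -/

/-- `a` is the root of `x ^ g + ⋯ + x = 1`, `g = k + N + 1`, `k = ⌊g / 2⌋`, `N = ⌊(g - 1) / 2⌋`. -/
structure Par where
  a : ℝ
  k : ℕ
  N : ℕ
  ha : a ^ (k + N + 2) = 2 * a - 1
  half_lt : 1 / 2 < a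
  le_a : a ≤ 11 / 20
  hN : 1 ≤ N
  hNk : N ≤ k
  hkN : k ≤ N + 1
  le_a' : 2 ≤ k → a ≤ 13 / 25

namespace Par

variable (p : Par)

/-- The genus. -/
def g : ℕ := p.k + p.N + 1

/-- `2 a - 1 = a ^ (g + 1)`. -/
def x : ℝ := 2 * p.a - 1

lemma a_pos : 0 < p.a := by linarith [p.half_lt]
lemma a_lt_one : p.a < 1 := by linarith [p.le_a]
lemma one_sub_pos : 0 < 1 - p.a := by linarith [p.le_a]
lemma x_pos : 0 < p.x := by unfold x; linarith [p.half_lt]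
lemma x_le : p.x ≤ 1 / 10 := by unfold x; linarith [p.le_a]
lemma a_pow : p.a ^ (p.g + 1) = p.x := p.ha
lemma hk : 1 ≤ p.k := p.hN.trans p.hNk

lemma apos (n : ℕ) : 0 < p.a ^ n := pow_pos p.a_pos n
lemma ale (n : ℕ) : p.a ^ n ≤ 1 := pow_le_one₀ p.a_pos.le p.a_lt_one.le
lemma amono {m n : ℕ} (h : m ≤ n) : p.a ^ n ≤ p.a ^ m :=
  pow_le_pow_of_le_one p.a_pos.le p.a_lt_one.le h

lemma pow_le_num (n : ℕ) : p.a ^ n ≤ (11 / 20) ^ n := pow_le_pow_left₀ p.a_pos.le p.le_a n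

lemma four_le : 4 ≤ p.g + 1 := by have := p.hN; have := p.hk; unfold g; omega

lemma mul_pow_le (n : ℕ) (hn : 4 ≤ n) : n * p.a ^ n ≤ 3 / 8 := by
  induction n, hn using Nat.le_induction with
  | base =>
    have := p.pow_le_num 4; norm_num at this ⊢; linarith
  | succ n hn ih =>
    have h1 : (4 : ℝ) ≤ n := by exact_mod_cast hn
    have h2 := p.apos n; have h3 := p.le_a; push_cast
    have : ((n : ℝ) + 1) * p.a ≤ n := by nlinarith
    calc ((n : ℝ) + 1) * p.a ^ (n + 1) = (((n : ℝ) + 1) * p.a) * p.a ^ n := by ring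
      _ ≤ n * p.a ^ n := mul_le_mul_of_nonneg_right this h2.le
      _ ≤ _ := ih

lemma g_mul_x_le : ((p.g + 1 : ℕ) : ℝ) * p.x ≤ 3 / 8 := by
  rw [← p.a_pow]; exact p.mul_pow_le _ p.four_le

lemma one_add_pow_mul_le {x : ℝ} (hx : 0 ≤ x) (n : ℕ) (hnx : n * x ≤ 1) :
    (1 + x) ^ n * (1 - n * x) ≤ 1 := by
  induction n with
  | zero => simp
  | succ n ih =>
    push_cast at hnx ⊢; have h0 : (0 : ℝ) ≤ n := Nat.cast_nonneg n; have h1 := ih (by nlinarith)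
    have h2 : 0 ≤ (1 + x) ^ n := by positivity
    have h3 : (1 + x) * (1 - (n + 1) * x) ≤ 1 - n * x := by nlinarith [mul_nonneg h0 (sq_nonneg x)]
    calc (1 + x) ^ (n + 1) * (1 - (n + 1) * x) = (1 + x) ^ n * ((1 + x) * (1 - (n + 1) * x)) := by ring
      _ ≤ (1 + x) ^ n * (1 - n * x) := mul_le_mul_of_nonneg_left h3 h2
      _ ≤ 1 := h1

lemma two_mul_a : 2 * p.a = 1 + p.x := by unfold x; ring

lemma two_a_pow_le {n : ℕ} (hn : n ≤ p.g + 1) : (2 * p.a) ^ n ≤ 8 / 5 := by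
  have h1 : (n : ℝ) * p.x ≤ 3 / 8 := le_trans
    (mul_le_mul_of_nonneg_right (by exact_mod_cast hn) p.x_pos.le) p.g_mul_x_le
  have h2 := one_add_pow_mul_le p.x_pos.le n (by linarith); rw [p.two_mul_a]
  have : 0 < (1 + p.x) ^ n := by have := p.x_pos; positivity
  nlinarith

lemma one_le_two_a_pow (n : ℕ) : 1 ≤ (2 * p.a) ^ n := one_le_pow₀ (by linarith [p.half_lt])

/-- A bound for the difference between `2 a` and `1` that tends to `0`. -/
def s : ℝ := 8 * (p.g + 1) * p.x

lemma two_a_pow_sub_le {n : ℕ} (hn : n ≤ p.g + 1) : 4 * ((2 * p.a) ^ n - 1) ≤ p.s := by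
  have key : ∀ n : ℕ, (1 + p.x) ^ n - 1 ≤ n * p.x * (1 + p.x) ^ n := by
    intro n; have hx := p.x_pos
    induction n with
    | zero => simp
    | succ n ih =>
      have h1 : (1 : ℝ) ≤ (1 + p.x) ^ n := one_le_pow₀ (by linarith)
      have h0 : (0 : ℝ) ≤ n := Nat.cast_nonneg n; rw [pow_succ]; push_cast
      nlinarith [mul_nonneg (mul_nonneg h0 hx.le) (mul_nonneg hx.le (zero_le_one.trans h1)),
        mul_nonneg hx.le (mul_nonneg hx.le (zero_le_one.trans h1))]
  have h := key n; rw [← p.two_mul_a] at h; have h2 := p.two_a_pow_le hn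
  have h3 : (n : ℝ) ≤ p.g + 1 := by exact_mod_cast hn
  have h4 : (n : ℝ) * p.x ≤ (p.g + 1) * p.x := mul_le_mul_of_nonneg_right h3 p.x_pos.le
  have h5 : (0 : ℝ) ≤ n * p.x := mul_nonneg (Nat.cast_nonneg n) p.x_pos.le; unfold s; nlinarith

lemma x_le_s : 8 * p.x ≤ p.s := by
  unfold s; have := p.x_pos; have : (0 : ℝ) ≤ p.g := Nat.cast_nonneg _; nlinarith

/-- The transition slope. -/
def lam : ℝ := 1 / (p.k + 1)

lemma lam_pos : 0 < p.lam := by unfold lam; positivity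

lemma lam_le : p.lam ≤ 1 / 2 := by
  unfold lam; have : (1 : ℝ) ≤ p.k := by exact_mod_cast p.hk
  rw [div_le_div_iff₀ (by linarith) (by norm_num)]; linarith

lemma succ_mul_pow_le (hk2 : 2 ≤ p.k) : (p.k + 1) * p.a ^ (p.k + 1) ≤ 11 / 26 := by
  have h := p.le_a' hk2; have h0 := p.a_pos
  have key : ∀ n : ℕ, 2 ≤ n → ((n : ℝ) + 1) * p.a ^ (n + 1) ≤ 11 / 26 := by
    intro n hn
    induction n, hn using Nat.le_induction with
    | base =>
      have := pow_le_pow_left₀ h0.le h 3; norm_num at this ⊢; linarith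
    | succ n hn ih =>
      have h1 : (2 : ℝ) ≤ n := by exact_mod_cast hn
      have h2 := p.apos (n + 1); push_cast; have : ((n : ℝ) + 1 + 1) * p.a ≤ n + 1 := by nlinarith
      calc ((n : ℝ) + 1 + 1) * p.a ^ (n + 1 + 1) = (((n : ℝ) + 1 + 1) * p.a) * p.a ^ (n + 1) := by ring
        _ ≤ (n + 1) * p.a ^ (n + 1) := mul_le_mul_of_nonneg_right this h2.le
        _ ≤ _ := ih
  exact key _ hk2

lemma k_eq_one (h : ¬ 2 ≤ p.k) : p.k = 1 ∧ p.N = 1 := by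
  have := p.hk; have := p.hN; have := p.hNk; omega

/-- The bumps at the ends of the vertical sides are small compared to the transition slope. -/
lemma bump_le : (p.a ^ (p.k + 1) - p.x) / (1 - p.a) ≤ p.lam := by
  rw [lam, div_le_div_iff₀ p.one_sub_pos (by positivity)]
  by_cases h : 2 ≤ p.k
  · have h1 := p.succ_mul_pow_le h; have h2 := p.le_a' h; have h3 := p.x_pos
    have h4 : (0 : ℝ) ≤ p.k := Nat.cast_nonneg _; nlinarith
  · obtain ⟨h1, h2⟩ := p.k_eq_one h; have := p.ha; rw [h1, h2] at this; unfold x; rw [h1]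
    norm_num at this ⊢; nlinarith [p.half_lt, p.le_a]

lemma depth_le : p.a ^ (p.N + 3) / (1 - p.a) ≤ p.lam / 2 := by
  rw [lam, div_div, div_le_div_iff₀ p.one_sub_pos (by positivity)]
  by_cases h : 2 ≤ p.k
  · have h1 := p.succ_mul_pow_le h; have h2 := p.le_a' h
    have h3 : p.a ^ (p.N + 3) ≤ p.a ^ (p.k + 1 + 1) := p.amono (by have := p.hkN; omega)
    have h4 : (0 : ℝ) ≤ p.k := Nat.cast_nonneg _; have h5 := p.apos (p.k + 1)
    rw [pow_succ _ (p.k + 1)] at h3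
    have h6 : ((p.k : ℝ) + 1) * p.a ^ (p.N + 3) ≤ 11 / 26 * p.a := by nlinarith [p.a_pos]
    nlinarith
  · obtain ⟨h1, h2⟩ := p.k_eq_one h; have := p.ha; rw [h1, h2] at this; rw [h1, h2]
    norm_num at this ⊢; nlinarith [p.half_lt, p.le_a]

/-- The lengths of the leftover parts of the horizontal and of the vertical side. -/
def w : ℝ := (1 / 2) ^ p.k
def h : ℝ := (1 / 2) ^ (p.N + 1)

lemma w_pos : 0 < p.w := by unfold w; positivity
lemma h_pos : 0 < p.h := by unfold h; positivity
lemma w_le : p.w ≤ 1 / 2 := by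
  unfold w
  calc _ ≤ (1 / 2 : ℝ) ^ 1 := pow_le_pow_of_le_one (by norm_num) (by norm_num) p.hk
    _ = _ := by norm_num
lemma h_le : p.h ≤ 1 / 4 := by
  unfold h
  calc _ ≤ (1 / 2 : ℝ) ^ 2 :=
        pow_le_pow_of_le_one (by norm_num) (by norm_num) (by have := p.hN; omega)
    _ = _ := by norm_num

lemma w_le_h : p.w ≤ 2 * p.h := by
  unfold w h
  calc _ ≤ (1 / 2 : ℝ) ^ p.N := pow_le_pow_of_le_one (by norm_num) (by norm_num) p.hNk
    _ = _ := by rw [pow_succ]; ring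

lemma h_le_w : p.h ≤ p.w := by
  unfold w h; exact pow_le_pow_of_le_one (by norm_num) (by norm_num) p.hkN

lemma half_pow_eq (n : ℕ) : p.a ^ n = (1 / 2) ^ n * (2 * p.a) ^ n := by
  rw [← mul_pow]; congr 1; ring

def Y : ℝ := p.a / (1 - p.a)
def M : ℝ := p.x / (1 - p.a)
def κ : ℝ := 2 * p.a ^ 2 / (1 - p.a)
def e0 : ℝ := p.a * p.x / (1 - p.a)
def p0 : ℝ := (1 - p.a ^ p.g) / 2

lemma Y_eq : p.Y = 1 + p.M := by unfold Y M x; field_simp [p.one_sub_pos.ne']; ring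

lemma M_pos : 0 < p.M := div_pos p.x_pos p.one_sub_pos
lemma e0_pos : 0 < p.e0 := div_pos (mul_pos p.a_pos p.x_pos) p.one_sub_pos

lemma M_le_x : p.M ≤ 20 / 9 * p.x := by
  unfold M; rw [div_le_iff₀ p.one_sub_pos]; nlinarith [p.x_pos, p.le_a]

lemma e0_le_x : p.e0 ≤ 5 / 4 * p.x := by
  unfold e0; rw [div_le_iff₀ p.one_sub_pos]; nlinarith [p.x_pos, p.le_a, p.half_lt]

lemma κ_ge : 1 ≤ p.κ := by unfold κ; rw [le_div_iff₀ p.one_sub_pos]; nlinarith [p.half_lt]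

lemma κ_le : p.κ ≤ 3 / 2 := by
  unfold κ; rw [div_le_iff₀ p.one_sub_pos]; nlinarith [p.half_lt, p.le_a]

lemma κ_sub_le : p.κ - 1 ≤ 6 * p.x := by
  unfold κ x; rw [sub_le_iff_le_add, div_le_iff₀ p.one_sub_pos]; nlinarith [p.half_lt, p.le_a]

lemma a_pow_g : p.a * p.a ^ p.g = p.x := by rw [← p.a_pow, pow_succ']

lemma a_pow_g_le : p.a ^ p.g ≤ 2 * p.x := by nlinarith [p.a_pow_g, p.half_lt, p.apos p.g]

lemma p0_le : p.p0 ≤ 1 / 2 := by unfold p0; linarith [p.apos p.g]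
lemma p0_ge : 2 / 5 ≤ p.p0 := by unfold p0; linarith [p.a_pow_g_le, p.x_le]

lemma M_div_w : p.M / p.w ≤ 1 / 2 := by
  have h0 := p.w_pos; rw [div_le_iff₀ h0, M, div_le_iff₀ p.one_sub_pos]
  by_cases h : 2 ≤ p.k
  · have h1 : p.x ≤ 8 / 5 * (1 / 8 * p.w) := by
      rw [← p.a_pow, p.half_pow_eq, mul_comm]
      have e : (1 / 2 : ℝ) ^ (p.g + 1) ≤ 1 / 8 * p.w := by
        have : (1 / 2 : ℝ) ^ p.N ≤ 1 / 2 := by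
          calc _ ≤ (1 / 2 : ℝ) ^ 1 := pow_le_pow_of_le_one (by norm_num) (by norm_num) p.hN
            _ = _ := by norm_num
        have e : (1 / 2 : ℝ) ^ (p.g + 1) = (1 / 2) ^ p.N * p.w * (1 / 4) := by unfold w g; ring
        rw [e]; nlinarith
      exact mul_le_mul (p.two_a_pow_le le_rfl) e (by positivity) (by norm_num)
    have := p.le_a' h; nlinarith
  · obtain ⟨h1, h2⟩ := p.k_eq_one h; unfold w x; rw [h1]; linarith [p.le_a]

end Par

open ArnouxYoccoz

/-! ### The families of edges -/

lemma edgesDisjoint_of_monotone {n : ℕ} {s t u : ℕ → ℝ} (hs : ∀ j < n, s j = u j)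
    (ht : ∀ j < n, t j = u (j + 1)) (hu : ∀ j < n, u j ≤ u (j + 1)) : EdgesDisjoint n s t := by
  have key : ∀ i j, i < j → j < n → u (i + 1) ≤ u j := by
    intro i j hij hj
    induction j, hij using Nat.le_induction with
    | base => exact le_rfl
    | succ m hm ih => exact (ih (by omega)).trans (hu m (by omega))
  intro i hi j hj hij
  rw [hs i hi, hs j hj, ht i hi, ht j hj, min_eq_left (hu i hi), min_eq_left (hu j hj),
    max_eq_right (hu i hi), max_eq_right (hu j hj)]
  rcases lt_or_gt_of_ne hij with h | h
  · exact Or.inl (key i j h hj)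
  · exact Or.inr (key j i h hi)

/-- The nodes `1 - c / 2 ^ j`, `j ≤ n`, and `1`. -/
def dyadicEnd (n : ℕ) (c : ℝ) (j : ℕ) : ℝ := if j < n then 1 - c * (1 / 2) ^ (j + 1) else 1

lemma dyadic_lt {n : ℕ} {c : ℝ} (hc : 0 < c) (j : ℕ) : 1 - c * (1 / 2) ^ j < dyadicEnd n c j := by
  have h : (0 : ℝ) < (1 / 2) ^ j := by positivity
  unfold dyadicEnd; split_ifs
  · rw [pow_succ]; nlinarith
  · nlinarith

lemma dyadic_disjoint (n : ℕ) {c : ℝ} (hc : 0 < c) :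
    EdgesDisjoint (n + 1) (fun j => 1 - c * (1 / 2) ^ j) (dyadicEnd n c) := by
  refine edgesDisjoint_of_monotone (u := fun j => if j ≤ n then 1 - c * (1 / 2) ^ j else 1) ?_ ?_ ?_
  · intro j hj; rw [if_pos (by omega)]
  · intro j hj; simp only [dyadicEnd]; congr 1
  · intro j hj; rw [if_pos (by omega)]; have := dyadic_lt (n := n) hc j
    refine this.le.trans (le_of_eq ?_); simp only [dyadicEnd]; congr 1

lemma leftNode_even_le {i j : ℕ} (hi : Even i) (hij : i < j) : leftNode j ≤ leftNode (i + 2) := by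
  have h1 := (abs_le.1 (abs_leftNode_sub j).le).2
  have e : leftNode (i + 2) - 2 / 3 = 1 / 3 * (1 / 2) ^ (i + 2) := by
    rw [leftNode]; have : Even (i + 2) := by simpa [parity_simps] using hi
    rw [show (-1 / 2 : ℝ) = -(1 / 2) by norm_num, this.neg_pow]; ring
  rcases Nat.lt_or_ge (i + 1) j with h | h
  · have : (1 / 2 : ℝ) ^ j ≤ (1 / 2) ^ (i + 2) := pow_le_pow_of_le_one (by norm_num) (by norm_num) h
    linarith
  · obtain rfl : j = i + 1 := by omega
    have : (0 : ℝ) < (1 / 2) ^ (i + 2) := by positivity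
    have h2 : leftNode (i + 1) - 2 / 3 = -(1 / 3 * (1 / 2) ^ (i + 1)) := by
      rw [leftNode]; have : Odd (i + 1) := hi.add_one
      rw [show (-1 / 2 : ℝ) = -(1 / 2) by norm_num, this.neg_pow]; ring
    have : (0 : ℝ) < (1 / 2) ^ (i + 1) := by positivity
    linarith

lemma leftNode_odd_le {i j : ℕ} (hi : Odd i) (hij : i < j) : leftNode (i + 2) ≤ leftNode j := by
  have h1 := (abs_le.1 (abs_leftNode_sub j).le).1
  have e : leftNode (i + 2) - 2 / 3 = -(1 / 3 * (1 / 2) ^ (i + 2)) := by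
    rw [leftNode]; have : Odd (i + 2) := by rw [Nat.odd_add]; simp [hi]
    rw [show (-1 / 2 : ℝ) = -(1 / 2) by norm_num, this.neg_pow]; ring
  rcases Nat.lt_or_ge (i + 1) j with h | h
  · have : (1 / 2 : ℝ) ^ j ≤ (1 / 2) ^ (i + 2) := pow_le_pow_of_le_one (by norm_num) (by norm_num) h
    linarith
  · obtain rfl : j = i + 1 := by omega
    have h2 : leftNode (i + 1) - 2 / 3 = (1 / 3 * (1 / 2) ^ (i + 1)) := by
      rw [leftNode]; have : Even (i + 1) := hi.add_one
      rw [show (-1 / 2 : ℝ) = -(1 / 2) by norm_num, this.neg_pow]; ring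
    have : (0 : ℝ) < (1 / 2) ^ (i + 1) := by positivity
    have : (0 : ℝ) < (1 / 2) ^ (i + 2) := by positivity
    linarith

/-- The index of the end point of the `m`-th edge of the left side, the last one being the leftover
interval. -/
def leftEndIdx (n m : ℕ) : ℕ := if m < n then m + 2 else m + 1

lemma leftNode_ne (m n : ℕ) (h : m ≠ n) : leftNode m ≠ leftNode n := by
  intro e; rcases leftNode_cases m n with h1 | h1 | ⟨h1, h2⟩
  · exact h h1
  · rw [e] at h1; nlinarith [mul_self_nonneg (leftNode n - 2 / 3)]
  · rw [e] at h1 h2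
    have h3 : 0 < |leftNode n - 2 / 3| := abs_pos.2 fun h0 => by rw [h0] at h1; simp at h1
    rcases h2 with h2 | h2 <;> linarith

lemma left_disjoint (n : ℕ) :
    EdgesDisjoint (n + 1) leftNode (fun m => leftNode (leftEndIdx n m)) := by
  have key : ∀ i < n + 1, ∀ j < n + 1, i < j →
      max (leftNode i) (leftNode (leftEndIdx n i)) ≤ min (leftNode j) (leftNode (leftEndIdx n j)) ∨
      max (leftNode j) (leftNode (leftEndIdx n j)) ≤ min (leftNode i) (leftNode (leftEndIdx n i)) := by
    intro i hi j hj hij; have e : leftEndIdx n i = i + 2 := if_pos (by omega)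
    have hj' : i < leftEndIdx n j := by unfold leftEndIdx; split_ifs <;> omega
    rw [e]; rcases Nat.even_or_odd i with hi' | hi'
    · right; have h2 := leftNode_even_le hi' (show i < i + 1 by omega)
      have h3 : leftNode (i + 2) ≤ leftNode i := by
        rw [leftNode_add_two, leftNode]; have := hi'.pow_nonneg (-1 / 2 : ℝ); linarith
      rw [min_eq_right h3]; exact max_le (leftNode_even_le hi' hij) (leftNode_even_le hi' hj')
    · left
      have h3 : leftNode i ≤ leftNode (i + 2) := by
        rw [leftNode_add_two, leftNode]; have := hi'.pow_neg (show (-1 / 2 : ℝ) < 0 by norm_num)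
        linarith
      rw [max_eq_right h3]; exact le_min (leftNode_odd_le hi' hij) (leftNode_odd_le hi' hj')
  intro i hi j hj hij; rcases lt_or_gt_of_ne hij with h | h
  · exact key i hi j hj h
  · exact (key j hj i hi h).symm

/-- Values along a chain of edges. -/
lemma EdgesDisjoint.edgeSum_chain {n : ℕ} {s t bs bt : ℕ → ℝ} (h : EdgesDisjoint n s t)
    (hst : ∀ j < n, s j ≠ t j) {b u : ℕ → ℝ} (hs : ∀ j < n, s j = u j) (ht : ∀ j < n, t j = u (j + 1))
    (hbs : ∀ j < n, bs j = b j) (hbt : ∀ j < n, bt j = b (j + 1)) {j : ℕ} (hj : j ≤ n) :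
    edgeSum n s t bs bt (u j) - edgeSum n s t bs bt (u 0) = b j - b 0 := by
  induction j with
  | zero => simp
  | succ j ih =>
    have h1 := ih (by omega)
    have h2 := h.edgeSum_end_sub (j := j) (by omega) (hst j (by omega)) bs bt
    rw [hs j (by omega), ht j (by omega), hbs j (by omega), hbt j (by omega)] at h2; linarith

/-- The displacement along the `j`-th of a dyadic sequence of edges. -/
lemma edgeSum_dyadic (n : ℕ) {c : ℝ} (hc : 0 < c) (b : ℕ → ℝ) (d : ℝ) {j : ℕ} (hj : j ≤ n) {θ : ℝ}
    (hθ : θ ∈ Icc 0 1) :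
    edgeSum (n + 1) (fun i => 1 - c * (1 / 2) ^ i) (dyadicEnd n c) b
        (fun i => if i < n then b (i + 1) else d)
        (1 - c * (1 / 2) ^ j + θ * (dyadicEnd n c j - (1 - c * (1 / 2) ^ j))) -
      edgeSum (n + 1) (fun i => 1 - c * (1 / 2) ^ i) (dyadicEnd n c) b
        (fun i => if i < n then b (i + 1) else d) (1 - c) =
      b j + θ * ((if j < n then b (j + 1) else d) - b j) - b 0 := by
  have hd := dyadic_disjoint n hc
  have h1 := hd.edgeSum_sub (by omega : j < n + 1) (dyadic_lt (n := n) hc j).ne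
    b (fun i => if i < n then b (i + 1) else d) hθ
  have h2 := hd.edgeSum_chain (fun j _ => (dyadic_lt (n := n) hc j).ne)
    (bs := b) (bt := fun i => if i < n then b (i + 1) else d)
    (u := fun j => if j ≤ n then 1 - c * (1 / 2) ^ j else 1) (b := fun j => if j ≤ n then b j else d)
    (fun j hj => by rw [if_pos (by omega)]) (fun j hj => by simp only [dyadicEnd]; congr 1)
    (fun j hj => by rw [if_pos (by omega)]) (fun j hj => by beta_reduce; congr 1)
    (j := j) (by omega)
  simp only [if_pos hj, if_pos n.zero_le, pow_zero, mul_one] at h2; linear_combination h1 + h2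

/-- Values along the left side. -/
lemma edgeSum_left (n : ℕ) (b : ℕ → ℝ) {m : ℕ} (hm : m ≤ n + 1) :
    edgeSum (n + 1) leftNode (fun m => leftNode (leftEndIdx n m)) b (fun m => b (leftEndIdx n m))
      (leftNode m) -
    edgeSum (n + 1) leftNode (fun m => leftNode (leftEndIdx n m)) b (fun m => b (leftEndIdx n m))
      (leftNode 0) = b m - b 0 := by
  set E := edgeSum (n + 1) leftNode (fun m => leftNode (leftEndIdx n m)) b
    (fun m => b (leftEndIdx n m)) with hE
  have h1 : ∀ m < n + 1, E (leftNode (leftEndIdx n m)) - E (leftNode m) = b (leftEndIdx n m) - b m := by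
    intro m hm
    exact (left_disjoint n).edgeSum_end_sub hm
      (leftNode_ne _ _ (by unfold leftEndIdx; split_ifs <;> omega)) _ _
  have h2 : ∀ i ≤ n + 1, E (leftNode (n + 1 - i)) - b (n + 1 - i) = E (leftNode (n + 1)) - b (n + 1) := by
    intro i
    induction i using Nat.strong_induction_on with
    | _ i ih =>
      intro hi; rcases i with _ | _ | i
      · rfl
      · have := h1 n (by omega); rw [show leftEndIdx n n = n + 1 by simp [leftEndIdx]] at this
        simp only [zero_add, Nat.add_sub_cancel]; linarith
      · have h3 := ih i (by omega) (by omega); have h4 := h1 (n + 1 - (i + 1 + 1)) (by omega)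
        rw [show leftEndIdx n (n + 1 - (i + 1 + 1)) = n + 1 - i by
          unfold leftEndIdx; rw [if_pos (by omega)]; omega] at h4
        linarith
  have h3 := h2 (n + 1 - m) (by omega); have h4 := h2 (n + 1) le_rfl
  rw [show n + 1 - (n + 1 - m) = m by omega] at h3; rw [Nat.sub_self] at h4; linarith

namespace Par

variable (p : Par)

/-- Abscissae of the points `P_{i + 1}` and `Q_i`. -/
def ptx (i : ℕ) : ℝ := (p.a - p.a ^ (i + 1)) / (1 - p.a)
def qx (i : ℕ) : ℝ := (2 * p.a - p.a ^ i - p.a ^ (i + 1)) / (2 * (1 - p.a))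

/-- The depth of the dent at `Q_i`. -/
def dep (i : ℕ) : ℝ := p.a ^ (p.g + 2) / p.a ^ i / (1 - p.a)

/-- The coordinates of `Q_{g - j}`. -/
def rqx (j : ℕ) : ℝ := (2 * p.a - (1 + p.a) * (p.a ^ p.g / p.a ^ j)) / (2 * (1 - p.a))
def rqy (j : ℕ) : ℝ := (p.a - p.a ^ (j + 2)) / (1 - p.a)

/-- The coordinates of the vertices of the left side. -/
def lmx (m : ℕ) : ℝ := (p.x - p.x / p.a ^ m) / (2 * (1 - p.a))
def lmy (m : ℕ) : ℝ := p.a + (p.a ^ 3 + p.a ^ 2 * (-p.a) ^ m) / (1 - p.a ^ 2)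

/-- The height function without corrections. -/
def A (y : ℝ) : ℝ := p.a + p.κ / 2 * (2 * y - 1)

lemma ptx_succ (i : ℕ) : p.ptx (i + 1) = p.ptx i + p.a ^ (i + 1) := by
  unfold ptx; field_simp [p.one_sub_pos.ne']; ring

lemma qx_succ (i : ℕ) : p.qx (i + 1) = p.ptx i + p.a ^ (i + 1) / 2 := by
  unfold ptx qx; field_simp [p.one_sub_pos.ne']; ring

lemma ptx_zero : p.ptx 0 = 0 := by simp [ptx]

lemma ptx_mono {i j : ℕ} (h : i ≤ j) : p.ptx i ≤ p.ptx j := by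
  unfold ptx; have := p.amono (show i + 1 ≤ j + 1 by omega)
  exact div_le_div_of_nonneg_right (by linarith) p.one_sub_pos.le

lemma rqx_eq {j : ℕ} (hj : j ≤ p.g) : p.rqx j = p.qx (p.g - j) := by
  unfold rqx qx; have : p.a ^ p.g = p.a ^ (p.g - j) * p.a ^ j := by rw [← pow_add]; congr 1; omega
  rw [this, mul_div_cancel_right₀ _ (p.apos j).ne']; ring

lemma rqx_N : p.rqx p.N = p.ptx p.k + p.a ^ (p.k + 1) / 2 := by
  rw [p.rqx_eq (by unfold g; omega), ← p.qx_succ]; congr 1; unfold g; omega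

lemma rqx_sub (j : ℕ) : p.rqx (j + 1) - p.rqx j = -((1 + p.a) / 2 * (p.a ^ p.g / p.a ^ (j + 1))) := by
  unfold rqx; have := p.a_pos.ne'; have := (p.apos j).ne'; rw [pow_succ]
  field_simp [p.one_sub_pos.ne']; ring

lemma lmx_zero : p.lmx 0 = 0 := by simp [lmx]

lemma one_sub_sq : 1 - p.a ^ 2 = (1 - p.a) * (1 + p.a) := by ring

lemma one_add_pos : 0 < 1 + p.a := by linarith [p.a_pos]

lemma lmy_zero : p.lmy 0 = p.Y := by
  unfold lmy Y; rw [p.one_sub_sq]; field_simp [p.one_sub_pos.ne', p.one_add_pos.ne']; ring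

lemma A_one : p.A 1 = p.Y := by unfold A κ Y; field_simp [p.one_sub_pos.ne']; ring

lemma A_half : p.A (1 / 2) = p.a := by unfold A; ring

/-- Edges of the top. -/
def phiSum (t : ℝ) : ℝ := edgeSum (p.k + 1) (fun i => 1 - 1 * (1 / 2) ^ i) (dyadicEnd p.k 1)
    (fun i => p.ptx i - (1 - (1 / 2) ^ i))
    (fun i => if i < p.k then p.ptx (i + 1) - (1 - (1 / 2) ^ (i + 1)) else 0) t

/-- The horizontal displacement of the top. -/
def phi (t : ℝ) : ℝ := p.phiSum t - p.phiSum 0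

/-- The displacement of the end of the last edge of the top. -/
def phiw : ℝ := p.ptx p.k - (1 - p.w)

/-- Edges of the right side. -/
def rightSum (b : ℕ → ℝ) (c t : ℝ) : ℝ :=
  edgeSum (p.N + 1) (fun i => 1 - 1 / 2 * (1 / 2) ^ i) (dyadicEnd p.N (1 / 2)) b
    (fun i => if i < p.N then b (i + 1) else c) t

/-- Edges of the left side. -/
def leftSum (b : ℕ → ℝ) (t : ℝ) : ℝ :=
  edgeSum (p.N + 1) leftNode (fun m => leftNode (leftEndIdx p.N m)) b
    (fun m => b (leftEndIdx p.N m)) t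

def re_ (j : ℕ) : ℝ := p.rqy j - p.A (1 - 1 / 2 * (1 / 2) ^ j)
def le_ (m : ℕ) : ℝ := p.lmy m - p.A (leftNode m)

/-- The right side: abscissa, and vertical displacement. -/
def Rx (y : ℝ) : ℝ := p.rqx 0 + (p.rightSum p.rqx (p.ptx p.k) y -
  p.rightSum p.rqx (p.ptx p.k) (1 / 2))
def eR (y : ℝ) : ℝ := p.rightSum p.re_ 0 y - p.rightSum p.re_ 0 (1 / 2)

/-- The left side: abscissa, and vertical displacement. -/
def Lx (y : ℝ) : ℝ := p.leftSum p.lmx y - p.leftSum p.lmx 1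
def eL (y : ℝ) : ℝ := p.leftSum p.le_ y - p.leftSum p.le_ 1

/-- The nodes of the dents of the top and their heights. -/
def dentx (j : ℕ) : ℝ := if j % 2 = 0 then p.ptx (j / 2) else p.qx (j / 2 + 1)
def denty (j : ℕ) : ℝ := if j % 2 = 0 then 0 else -p.dep (j / 2 + 1)
def tauSum (t : ℝ) : ℝ :=
  edgeSum (2 * p.k) p.dentx (fun j => p.dentx (j + 1)) p.denty (fun j => p.denty (j + 1)) t
def tau (t : ℝ) : ℝ := p.tauSum t - p.tauSum 0

lemma phi_edge {i : ℕ} (hi : i < p.k) {θ : ℝ} (hθ : θ ∈ Icc 0 1) :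
    let t := 1 - (1 / 2) ^ i + θ * (1 / 2) ^ (i + 1)
    t + p.phi t = p.ptx i + θ * p.a ^ (i + 1) := by
  have h1 := edgeSum_dyadic p.k one_pos (fun i => p.ptx i - (1 - (1 / 2) ^ i)) 0 hi.le hθ
  change p.phiSum _ - p.phiSum _ = _ at h1
  simp only [dyadicEnd, if_pos hi, pow_zero, one_mul, sub_self, p.ptx_zero] at h1
  have e : 1 - (1 / 2 : ℝ) ^ i + θ * (1 - (1 / 2) ^ (i + 1) - (1 - (1 / 2) ^ i)) =
      1 - (1 / 2) ^ i + θ * (1 / 2) ^ (i + 1) := by rw [pow_succ]; ring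
  rw [e, p.ptx_succ] at h1; simp only [phi]
  have e2 : (1 / 2 : ℝ) ^ i = 2 * (1 / 2) ^ (i + 1) := by rw [pow_succ]; ring
  linear_combination h1 + θ * e2

lemma phi_last {θ : ℝ} (hθ : θ ∈ Icc 0 1) : p.phi (1 - θ * p.w) = θ * p.phiw := by
  have h1 := edgeSum_dyadic p.k one_pos (fun i => p.ptx i - (1 - (1 / 2) ^ i)) 0 le_rfl (θ := 1 - θ)
    ⟨by linarith [hθ.2], by linarith [hθ.1]⟩
  change p.phiSum _ - p.phiSum _ = _ at h1
  simp only [dyadicEnd, lt_irrefl, if_false, pow_zero, one_mul, sub_self, p.ptx_zero] at h1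
  have e : 1 - (1 / 2 : ℝ) ^ p.k + (1 - θ) * (1 - (1 - (1 / 2) ^ p.k)) = 1 - θ * p.w := by
    unfold w; ring
  rw [e] at h1; simp only [phi, phiw, w] at h1 ⊢; linear_combination h1

lemma rightSum_edge (b : ℕ → ℝ) (c : ℝ) {j : ℕ} (hj : j < p.N) {θ : ℝ} (hθ : θ ∈ Icc 0 1) :
    p.rightSum b c (1 - (1 / 2) ^ (j + 1) + θ * (1 / 2) ^ (j + 2)) - p.rightSum b c (1 / 2) =
      b j + θ * (b (j + 1) - b j) - b 0 := by
  have h1 := edgeSum_dyadic p.N one_half_pos b c hj.le hθ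
  change p.rightSum b c _ - p.rightSum b c _ = _ at h1
  simp only [dyadicEnd, if_pos hj] at h1; convert h1 using 3 <;> ring

lemma rightSum_last (b : ℕ → ℝ) (c : ℝ) {θ : ℝ} (hθ : θ ∈ Icc 0 1) :
    p.rightSum b c (1 - p.h + θ * p.h) - p.rightSum b c (1 / 2) =
      b p.N + θ * (c - b p.N) - b 0 := by
  have h1 := edgeSum_dyadic p.N one_half_pos b c le_rfl hθ
  change p.rightSum b c _ - p.rightSum b c _ = _ at h1
  simp only [dyadicEnd, lt_irrefl, if_false] at h1
  simp only [h]; convert h1 using 3 <;> ring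

lemma leftSum_sub (b : ℕ → ℝ) {m : ℕ} (hm : m ≤ p.N) {θ : ℝ} (hθ : θ ∈ Icc 0 1) :
    p.leftSum b (leftNode m + θ * (leftNode (leftEndIdx p.N m) - leftNode m)) - p.leftSum b 1 =
      b m + θ * (b (leftEndIdx p.N m) - b m) - b 0 := by
  have h1 := (left_disjoint p.N).edgeSum_sub (by omega : m < p.N + 1)
    (leftNode_ne _ _ (by unfold leftEndIdx; split_ifs <;> omega)) b (fun m => b (leftEndIdx p.N m)) hθ
  have h2 := edgeSum_left p.N b (m := m) (by omega)
  have l0 : leftNode 0 = 1 := by norm_num [leftNode]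
  rw [l0] at h2; unfold leftSum; linear_combination h1 + h2

lemma leftSum_edge (b : ℕ → ℝ) {m : ℕ} (hm : m < p.N) {θ : ℝ} (hθ : θ ∈ Icc 0 1) :
    p.leftSum b (leftNode m + θ * (leftNode (m + 2) - leftNode m)) - p.leftSum b 1 =
      b m + θ * (b (m + 2) - b m) - b 0 := by
  have h1 := p.leftSum_sub b hm.le hθ; rwa [show leftEndIdx p.N m = m + 2 from if_pos hm] at h1

lemma leftSum_last (b : ℕ → ℝ) {θ : ℝ} (hθ : θ ∈ Icc 0 1) :
    p.leftSum b (leftNode p.N + θ * (leftNode (p.N + 1) - leftNode p.N)) - p.leftSum b 1 =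
      b p.N + θ * (b (p.N + 1) - b p.N) - b 0 := by
  have h1 := p.leftSum_sub b le_rfl hθ; simpa only [leftEndIdx, lt_irrefl, if_false] using h1

lemma dentx_lt (j : ℕ) : p.dentx j < p.dentx (j + 1) := by
  unfold dentx; rcases Nat.mod_two_eq_zero_or_one j with h | h
  · have h' : (j + 1) % 2 = 1 := by omega
    have e : (j + 1) / 2 = j / 2 := by omega
    rw [if_pos h, if_neg (by omega), e, p.qx_succ]; linarith [p.apos (j / 2 + 1)]
  · have h' : (j + 1) % 2 = 0 := by omega
    have e : (j + 1) / 2 = j / 2 + 1 := by omega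
    rw [if_neg (by omega), if_pos h', e, p.qx_succ, p.ptx_succ]; linarith [p.apos (j / 2 + 1)]

lemma dent_disjoint (n : ℕ) : EdgesDisjoint n p.dentx (fun j => p.dentx (j + 1)) :=
  edgesDisjoint_of_monotone (u := p.dentx) (fun _ _ => rfl) (fun _ _ => rfl)
    fun j _ => (p.dentx_lt j).le

lemma tau_edge {j : ℕ} (hj : j < 2 * p.k) {θ : ℝ} (hθ : θ ∈ Icc 0 1) :
    p.tau (p.dentx j + θ * (p.dentx (j + 1) - p.dentx j)) =
      p.denty j + θ * (p.denty (j + 1) - p.denty j) := by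
  have h1 := (p.dent_disjoint (2 * p.k)).edgeSum_sub hj (p.dentx_lt j).ne p.denty
    (fun j => p.denty (j + 1)) hθ
  have h2 := (p.dent_disjoint (2 * p.k)).edgeSum_chain (fun j _ => (p.dentx_lt j).ne) (bs := p.denty)
    (bt := fun j => p.denty (j + 1)) (u := p.dentx) (b := p.denty) (fun _ _ => rfl) (fun _ _ => rfl)
    (fun _ _ => rfl) (fun _ _ => rfl) hj.le
  change p.tauSum _ - p.tauSum _ = _ at h1
  change p.tauSum _ - p.tauSum _ = _ at h2
  have e0 : p.dentx 0 = 0 := by simp [dentx, p.ptx_zero]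
  have e1 : p.denty 0 = 0 := by simp [denty]
  rw [e0, e1] at h2; unfold tau; linear_combination h1 + h2

end Par

namespace EdgesDisjoint

variable {n : ℕ} {s t : ℕ → ℝ}

lemma slope_eq {s t σ d : ℝ} (h : d = σ * (t - s)) : d / (t - s) = if t - s = 0 then 0 else σ := by
  split_ifs with h0
  · rw [h0, div_zero]
  · rw [h]; field_simp

lemma abs_edgeSum_sub_le (h : EdgesDisjoint n s t) {bs bt σ : ℕ → ℝ}
    (hσ : ∀ j < n, bt j - bs j = σ j * (t j - s j)) {y y' c : ℝ} (hc : 0 ≤ c)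
    (hb : ∀ j < n, min (s j) (t j) < max y y' → min y y' < max (s j) (t j) → |σ j| ≤ c) :
    |edgeSum n s t bs bt y' - edgeSum n s t bs bt y| ≤ c * |y' - y| := by
  refine abs_clampSum_sub_le h.nonoverlapping hc fun j hj h1 h2 => ?_
  rw [slope_eq (hσ j hj)]; split_ifs
  · simpa using hc
  · exact hb j hj h1 h2

lemma le_edgeSum_sub (h : EdgesDisjoint n s t) {bs bt σ : ℕ → ℝ}
    (hσ : ∀ j < n, bt j - bs j = σ j * (t j - s j)) {y y' c : ℝ} (hc : 0 ≤ c) (hy : y ≤ y')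
    (hb : ∀ j < n, -c ≤ σ j) :
    -c * (y' - y) ≤ edgeSum n s t bs bt y' - edgeSum n s t bs bt y := by
  refine le_clampSum_sub h.nonoverlapping hy hc fun j hj h1 h2 => ?_
  rw [slope_eq (hσ j hj)]; split_ifs
  · simpa using hc
  · exact hb j hj

lemma edgeSum_sub_le (h : EdgesDisjoint n s t) {bs bt σ : ℕ → ℝ}
    (hσ : ∀ j < n, bt j - bs j = σ j * (t j - s j)) {y y' c : ℝ} (hc : 0 ≤ c) (hy : y ≤ y')
    (hb : ∀ j < n, σ j ≤ c) :
    edgeSum n s t bs bt y' - edgeSum n s t bs bt y ≤ c * (y' - y) := by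
  refine clampSum_sub_le h.nonoverlapping hy hc fun j hj h1 h2 => ?_
  rw [slope_eq (hσ j hj)]; split_ifs
  · exact hc
  · exact hb j hj

end EdgesDisjoint

lemma exists_left_edge (n : ℕ) {y : ℝ} (hy : y ∈ Icc (1 / 2 : ℝ) 1) :
    ∃ m ≤ n, ∃ θ ∈ Icc (0 : ℝ) 1,
      y = leftNode m + θ * (leftNode (leftEndIdx n m) - leftNode m) := by
  have key : ∀ i m, m + i = n → y ∈ uIcc (leftNode m) (leftNode (m + 1)) → ∃ m ≤ n,
      y ∈ uIcc (leftNode m) (leftNode (leftEndIdx n m)) := by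
    intro i
    induction i with
    | zero =>
      intro m hm h; obtain rfl : m = n := by omega
      exact ⟨m, le_rfl, by simpa [leftEndIdx] using h⟩
    | succ i ih =>
      intro m hm h; rcases uIcc_subset_uIcc_union_uIcc (b := leftNode (m + 2)) h with h | h
      · exact ⟨m, by omega, by rwa [leftEndIdx, if_pos (by omega)]⟩
      · rw [uIcc_comm] at h; exact ih (m + 1) (by omega) h
  obtain ⟨m, hm, h⟩ := key n 0 (by omega) (by
    rw [uIcc_comm, uIcc_of_le] <;> norm_num [leftNode]
    exact ⟨by norm_num; linarith [hy.1], hy.2⟩)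
  rw [← segment_eq_uIcc, segment_eq_image'] at h; obtain ⟨θ, hθ, h⟩ := h
  exact ⟨m, hm, θ, hθ, h.symm⟩

lemma exists_dyadic_edge (n : ℕ) (c : ℝ) {y : ℝ} (hy : y ∈ Icc (1 - c) 1) :
    ∃ j ≤ n, ∃ θ ∈ Icc (0 : ℝ) 1,
      y = 1 - c * (1 / 2) ^ j + θ * (dyadicEnd n c j - (1 - c * (1 / 2) ^ j)) := by
  have key : ∀ i m, m + i = n → y ∈ uIcc (1 - c * (1 / 2) ^ m) 1 → ∃ m ≤ n,
      y ∈ uIcc (1 - c * (1 / 2) ^ m) (dyadicEnd n c m) := by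
    intro i
    induction i with
    | zero =>
      intro m hm h; obtain rfl : m = n := by omega
      exact ⟨m, le_rfl, by simpa [dyadicEnd] using h⟩
    | succ i ih =>
      intro m hm h; rcases uIcc_subset_uIcc_union_uIcc (b := 1 - c * (1 / 2) ^ (m + 1)) h with h | h
      · exact ⟨m, by omega, by rwa [dyadicEnd, if_pos (by omega)]⟩
      · exact ih (m + 1) (by omega) h
  obtain ⟨m, hm, h⟩ := key n 0 (by omega) (by
    rw [uIcc_of_le] <;> simp only [pow_zero, mul_one]
    · exact hy
    · linarith [hy.1, hy.2])
  rw [← segment_eq_uIcc, segment_eq_image'] at h; obtain ⟨θ, hθ, h⟩ := h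
  exact ⟨m, hm, θ, hθ, h.symm⟩

namespace Par

variable (p : Par)

/-- The slopes of the sides. -/
def sig (m : ℕ) : ℝ :=
  if m < p.N then 2 * (1 + p.a) * 2 ^ m * (p.x / p.a ^ (m + 2)) else 2 ^ p.N * (p.x / p.a ^ (p.N + 1))

/-- The slopes of the vertical displacements of the sides. -/
def mu (m : ℕ) : ℝ :=
  if m < p.N then p.κ * ((1 - p.x) * (2 * p.a) ^ m - 1) else p.κ * ((2 * p.a) ^ p.N - 1)

lemma a_ne : p.a ≠ 0 := p.a_pos.ne'

lemma sig_nonneg (m : ℕ) : 0 ≤ p.sig m := by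
  have := p.x_pos; have := p.a_pos; unfold sig; split_ifs <;> positivity

lemma mul_inv_pow_le (n : ℕ) : p.x / p.a ^ n ≤ p.x * 2 ^ n := by
  rw [div_le_iff₀ (p.apos n), mul_assoc, ← mul_pow]; have := p.one_le_two_a_pow n; have := p.x_pos
  nlinarith

lemma sig_le (m : ℕ) (hm : m ≤ p.N) : p.sig m ≤ 16 * p.x * 4 ^ m := by
  have h4 : (4 : ℝ) ^ m = 2 ^ m * 2 ^ m := by rw [← mul_pow]; norm_num
  have hx := p.x_pos; have h2 : (0 : ℝ) < 2 ^ m := by positivity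
  unfold sig; split_ifs with h
  · have h1 := p.mul_inv_pow_le (m + 2)
    calc 2 * (1 + p.a) * 2 ^ m * (p.x / p.a ^ (m + 2))
        ≤ 2 * (1 + p.a) * 2 ^ m * (p.x * (2 ^ m * 2 ^ 2)) :=
          mul_le_mul_of_nonneg_left (by rwa [← pow_add]) (by have := p.a_pos; positivity)
      _ = (8 * (1 + p.a)) * p.x * 4 ^ m := by rw [h4]; ring
      _ ≤ _ := by
        have : 0 < p.x * 4 ^ m := by positivity
        nlinarith [p.a_lt_one]
  · obtain rfl : m = p.N := by omega
    have h1 := p.mul_inv_pow_le (p.N + 1)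
    calc 2 ^ p.N * (p.x / p.a ^ (p.N + 1)) ≤ 2 ^ p.N * (p.x * 2 ^ (p.N + 1)) :=
          mul_le_mul_of_nonneg_left h1 h2.le
      _ = 2 * p.x * 4 ^ p.N := by rw [h4, pow_succ]; ring
      _ ≤ _ := by
        have : 0 < p.x * 4 ^ p.N := by positivity
        nlinarith

lemma x_div_pow {n m : ℕ} (h : n + m = p.g + 1) : p.x / p.a ^ n = p.a ^ m := by
  rw [← p.a_pow, ← h, pow_add]; field_simp [p.a_ne]

lemma two_a_pow_N_le : (2 * p.a) ^ p.N ≤ 16 / 13 := by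
  have h1 : (p.N : ℝ) * p.x ≤ 3 / 16 := by
    have h2 : (2 * (p.N : ℝ)) ≤ ((p.g + 1 : ℕ) : ℝ) := by
      have := p.hNk
      exact_mod_cast (by unfold g; omega : 2 * p.N ≤ p.g + 1)
    nlinarith [p.g_mul_x_le, p.x_pos]
  have h2 := one_add_pow_mul_le p.x_pos.le p.N (by linarith); rw [← p.two_mul_a] at h2
  have := p.one_le_two_a_pow p.N; nlinarith

lemma sig_last_le : (1 + p.a) * 2 ^ p.N * p.a ^ (p.k + 1) ≤ 1 := by
  have ha := p.a_pos
  have e : (1 + p.a) * 2 ^ p.N * p.a ^ (p.k + 1) ≤ (1 + p.a) * 2 ^ p.N * p.a ^ (p.N + 1) :=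
    mul_le_mul_of_nonneg_left (p.amono (by have := p.hNk; omega)) (by positivity)
  have e2 : (1 + p.a) * 2 ^ p.N * p.a ^ (p.N + 1) = (1 + p.a) * p.a * (2 * p.a) ^ p.N := by
    rw [mul_pow, pow_succ]; ring
  by_cases h : 2 ≤ p.k
  · have h1 := p.le_a' h; have h2 := p.two_a_pow_N_le
    have h3 : (1 + p.a) * p.a ≤ 4 / 5 := by nlinarith
    rw [e2] at e; have := p.one_le_two_a_pow p.N; nlinarith
  · obtain ⟨h1, h2⟩ := p.k_eq_one h; rw [h1, h2]; have h3 := p.le_a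
    have h4 : p.a ^ 2 ≤ 121 / 400 := by nlinarith
    norm_num; nlinarith

lemma sig_le_one (m : ℕ) : p.sig m ≤ 1 := by
  have ha := p.a_pos; have hl := p.sig_last_le; unfold sig; split_ifs with h
  · rw [p.x_div_pow (n := m + 2) (m := p.k + p.N - m) (by unfold g; omega)]
    have e1 : (2 : ℝ) ^ p.N = 2 ^ (p.N - 1 - m) * (2 * 2 ^ m) := by
      rw [← pow_succ', ← pow_add]; congr 1; omega
    have e2 : p.a ^ (p.k + p.N - m) ≤ p.a ^ (p.k + 1) := p.amono (by omega)
    have e3 : (1 : ℝ) ≤ 2 ^ (p.N - 1 - m) := one_le_pow₀ (by norm_num)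
    have e4 : (0 : ℝ) < 2 ^ m := by positivity
    have e5 := p.apos (p.k + 1)
    calc 2 * (1 + p.a) * 2 ^ m * p.a ^ (p.k + p.N - m) ≤ 2 * (1 + p.a) * 2 ^ m * p.a ^ (p.k + 1) :=
          mul_le_mul_of_nonneg_left e2 (by positivity)
      _ = 1 * ((1 + p.a) * (2 * 2 ^ m) * p.a ^ (p.k + 1)) := by ring
      _ ≤ 2 ^ (p.N - 1 - m) * ((1 + p.a) * (2 * 2 ^ m) * p.a ^ (p.k + 1)) :=
          mul_le_mul_of_nonneg_right e3 (by positivity)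
      _ = (1 + p.a) * 2 ^ p.N * p.a ^ (p.k + 1) := by rw [e1]; ring
      _ ≤ 1 := hl
  · rw [p.x_div_pow (n := p.N + 1) (m := p.k + 1) (by unfold g; omega)]
    have : 0 < 2 ^ p.N * p.a ^ (p.k + 1) := by positivity
    nlinarith

lemma neg_le_mu (m : ℕ) : -(p.κ * p.x) ≤ p.mu m := by
  have h1 := p.κ_ge; have h2 := p.x_pos; have h3 := p.x_le; unfold mu; split_ifs
  · have := p.one_le_two_a_pow m; have : 1 - p.x ≤ (1 - p.x) * (2 * p.a) ^ m := by nlinarith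
    nlinarith
  · have := p.one_le_two_a_pow p.N; nlinarith

lemma mu_le {m : ℕ} (hm : m ≤ p.N) {c : ℝ} (hc : ∀ n ≤ p.g + 1, (2 * p.a) ^ n - 1 ≤ c) :
    p.mu m ≤ 3 / 2 * c := by
  have h0 := p.κ_ge; have h1 := p.κ_le; have h2 := p.x_pos
  have e : ∀ n ≤ p.N, n ≤ p.g + 1 := fun n hn => by unfold g; omega
  unfold mu; split_ifs
  · have h3 := p.one_le_two_a_pow m; have h4 := hc m (e m hm)
    have h5 : (1 - p.x) * (2 * p.a) ^ m - 1 ≤ (2 * p.a) ^ m - 1 := by nlinarith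
    nlinarith
  · have h3 := p.one_le_two_a_pow p.N; have h4 := hc p.N (e p.N le_rfl); nlinarith

lemma abs_mu_le {m : ℕ} (hm : m ≤ p.N) : |p.mu m| ≤ 9 / 10 := by
  rw [abs_le]; have h1 := p.neg_le_mu m
  have h2 := p.mu_le hm (c := 3 / 5) fun n hn => by linarith [p.two_a_pow_le hn]
  constructor <;> nlinarith [p.κ_ge, p.κ_le, p.x_le, p.x_pos]

lemma abs_mu_le_s {m : ℕ} (hm : m ≤ p.N) : |p.mu m| ≤ p.s / 2 := by
  rw [abs_le]; have h1 := p.neg_le_mu m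
  have h2 := p.mu_le hm (c := p.s / 4) fun n hn => by linarith [p.two_a_pow_sub_le hn]
  constructor <;> nlinarith [p.κ_ge, p.κ_le, p.x_le, p.x_pos, p.x_le_s]

lemma dyadicEnd_sub (n j : ℕ) (c : ℝ) :
    dyadicEnd n c j - (1 - c * (1 / 2) ^ j) = if j < n then c * (1 / 2) ^ (j + 1) else c * (1 / 2) ^ j := by
  unfold dyadicEnd; split_ifs
  · rw [pow_succ]; ring
  · ring

lemma two_mul_half_pow (n : ℕ) : (2 : ℝ) ^ n * (1 / 2) ^ n = 1 := by rw [← mul_pow]; norm_num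

lemma rqx_end_sub {j : ℕ} (hj : j ≤ p.N) :
    (if j < p.N then p.rqx (j + 1) else p.ptx p.k) - p.rqx j =
      -p.sig j * (dyadicEnd p.N (1 / 2) j - (1 - 1 / 2 * (1 / 2) ^ j)) := by
  rw [dyadicEnd_sub, sig]; have h2 := two_mul_half_pow j; split_ifs with h
  · rw [p.rqx_sub, ← p.a_pow_g]; have := p.a_ne
    have e : p.a * p.a ^ p.g / p.a ^ (j + 2) = p.a ^ p.g / p.a ^ (j + 1) := by
      rw [pow_succ _ (j + 1)]; field_simp
    rw [e, pow_succ (1 / 2 : ℝ)]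
    linear_combination ((1 + p.a) / 2 * (p.a ^ p.g / p.a ^ (j + 1))) * h2
  · obtain rfl : j = p.N := by omega
    rw [p.rqx_N, p.x_div_pow (n := p.N + 1) (m := p.k + 1) (by unfold g; omega)]
    linear_combination (p.a ^ (p.k + 1) / 2) * h2

lemma re_eq (j : ℕ) : p.re_ j = -(p.κ / 2) * (p.a ^ j - (1 / 2) ^ j) := by
  unfold re_ rqy A κ; field_simp [p.one_sub_pos.ne']; ring

lemma one_sub_x : 1 - p.x = 2 * (1 - p.a) := by unfold x; ring

lemma re_end_sub {j : ℕ} (hj : j ≤ p.N) : (if j < p.N then p.re_ (j + 1) else 0) - p.re_ j =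
      p.mu j * (dyadicEnd p.N (1 / 2) j - (1 - 1 / 2 * (1 / 2) ^ j)) := by
  rw [dyadicEnd_sub, mu]; have h2 := p.half_pow_eq j; split_ifs with h
  · rw [p.re_eq, p.re_eq, p.one_sub_x, pow_succ p.a, pow_succ (1 / 2 : ℝ), h2]; ring
  · obtain rfl : j = p.N := by omega
    rw [p.re_eq, h2]; ring

lemma neg_half_pow (m : ℕ) : (-1 / 2 : ℝ) ^ m = (-1) ^ m * (1 / 2) ^ m := by
  rw [← mul_pow]; norm_num

lemma leftNode_end_sub {m n : ℕ} : leftNode (leftEndIdx n m) - leftNode m =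
    if m < n then -(1 / 4) * (-1 / 2) ^ m else -(1 / 2) * (-1 / 2) ^ m := by
  unfold leftEndIdx; split_ifs
  · rw [leftNode_add_two, leftNode]; ring
  · rw [leftNode, leftNode, pow_succ]; ring

lemma neg_one_pow_mul (m : ℕ) : (-1 : ℝ) ^ m * (-1) ^ m = 1 := by rw [← mul_pow]; norm_num

lemma lmx_end_sub {m : ℕ} (hm : m ≤ p.N) : p.lmx (leftEndIdx p.N m) - p.lmx m =
      (-1) ^ m * p.sig m * (leftNode (leftEndIdx p.N m) - leftNode m) := by
  rw [leftNode_end_sub, sig, neg_half_pow]; have h2 := two_mul_half_pow m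
  have h3 := neg_one_pow_mul m; have ha := p.a_ne; have h1 := p.one_sub_pos.ne'
  unfold leftEndIdx lmx; split_ifs with h
  · have e : (p.x - p.x / p.a ^ (m + 2)) / (2 * (1 - p.a)) - (p.x - p.x / p.a ^ m) / (2 * (1 - p.a)) =
        -((1 + p.a) / 2 * (p.x / p.a ^ (m + 2))) := by
      rw [pow_add]; field_simp; ring
    rw [e]
    linear_combination (1 + p.a) / 2 * (p.x / p.a ^ (m + 2)) * ((-1) ^ m * (-1) ^ m) * h2 +
      (1 + p.a) / 2 * (p.x / p.a ^ (m + 2)) * h3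
  · obtain rfl : m = p.N := by omega
    have e : (p.x - p.x / p.a ^ (p.N + 1)) / (2 * (1 - p.a)) -
        (p.x - p.x / p.a ^ p.N) / (2 * (1 - p.a)) = -(1 / 2 * (p.x / p.a ^ (p.N + 1))) := by
      rw [pow_add]; field_simp; ring
    rw [e]
    linear_combination 1 / 2 * (p.x / p.a ^ (p.N + 1)) * ((-1) ^ p.N * (-1) ^ p.N) * h2 +
      1 / 2 * (p.x / p.a ^ (p.N + 1)) * h3

lemma le_eq (m : ℕ) : p.le_ m =
    p.a ^ 2 / (3 * (1 - p.a ^ 2)) * (p.x + 3 * (-p.a) ^ m - (3 + p.x) * (-1 / 2) ^ m) := by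
  have h1 := p.one_sub_pos.ne'; have h2 := p.one_add_pos.ne'; unfold le_ lmy A κ leftNode x
  rw [p.one_sub_sq]; field_simp; ring

lemma le_end_sub {m : ℕ} (hm : m ≤ p.N) : p.le_ (leftEndIdx p.N m) - p.le_ m =
      p.mu m * (leftNode (leftEndIdx p.N m) - leftNode m) := by
  rw [leftNode_end_sub, mu]; have h1 := p.one_sub_pos.ne'; have h2 := p.one_add_pos.ne'
  have h3 : (-p.a) ^ m = (-1 / 2) ^ m * (2 * p.a) ^ m := by rw [← mul_pow]; congr 1; ring
  rw [p.le_eq, p.le_eq]; unfold leftEndIdx; split_ifs with h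
  · rw [pow_add, pow_add (-1 / 2 : ℝ), h3, p.one_sub_sq]; unfold κ x; field_simp; ring
  · obtain rfl : m = p.N := by omega
    rw [pow_add, pow_add (-1 / 2 : ℝ), h3, p.one_sub_sq]; unfold κ x; field_simp; ring

end Par

lemma lerp_nonneg {u v θ : ℝ} (hu : 0 ≤ u) (hv : 0 ≤ v) (hθ : θ ∈ Icc (0 : ℝ) 1) :
    0 ≤ u + θ * (v - u) := by
  have h1 := mul_nonneg hθ.1 hv; have h2 := mul_nonneg (sub_nonneg.2 hθ.2) hu; linarith

lemma lerp_le {u v c θ : ℝ} (hu : u ≤ c) (hv : v ≤ c) (hθ : θ ∈ Icc (0 : ℝ) 1) :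
    u + θ * (v - u) ≤ c := by
  have := lerp_nonneg (sub_nonneg.2 hu) (sub_nonneg.2 hv) hθ; linarith

lemma le_lerp {u v c θ : ℝ} (hu : c ≤ u) (hv : c ≤ v) (hθ : θ ∈ Icc (0 : ℝ) 1) :
    c ≤ u + θ * (v - u) := by
  have := lerp_nonneg (sub_nonneg.2 hu) (sub_nonneg.2 hv) hθ; linarith

lemma exists_chain_edge {u : ℕ → ℝ} {n : ℕ} {y : ℝ} (h0 : u 0 ≤ y) (hn : y ≤ u n) (hpos : 0 < n) :
    ∃ j < n, ∃ θ ∈ Icc (0 : ℝ) 1, y = u j + θ * (u (j + 1) - u j) := by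
  have key : ∃ j < n, u j ≤ y ∧ y ≤ u (j + 1) := by
    by_contra hcon
    push Not at hcon
    have : ∀ j ≤ n, u j ≤ y := by
      intro j
      induction j with
      | zero => exact fun _ => h0
      | succ j ih => exact fun hj => (hcon j (by omega) (ih (by omega))).le
    have h1 := hcon (n - 1) (by omega) (this _ (by omega)); rw [Nat.sub_add_cancel hpos] at h1
    linarith
  obtain ⟨j, hj, h1, h2⟩ := key
  have h : y ∈ segment ℝ (u j) (u (j + 1)) := by rw [segment_eq_Icc (h1.trans h2)]; exact ⟨h1, h2⟩
  rw [segment_eq_image'] at h; obtain ⟨θ, hθ, h⟩ := h; exact ⟨j, hj, θ, hθ, h.symm⟩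

namespace Par

variable (p : Par)

/-! ### The horizontal displacement of the top -/

/-- The values of `phi` at the nodes. -/
def phin (i : ℕ) : ℝ := p.ptx i - (1 - (1 / 2) ^ i)

lemma phin_succ (i : ℕ) : p.phin (i + 1) - p.phin i = p.a ^ (i + 1) - (1 / 2) ^ (i + 1) := by
  unfold phin; rw [p.ptx_succ, pow_succ (1 / 2 : ℝ)]; ring

lemma half_pow_le (i : ℕ) : (1 / 2 : ℝ) ^ i ≤ p.a ^ i :=
  pow_le_pow_left₀ (by norm_num) p.half_lt.le i

lemma phin_nonneg (i : ℕ) : 0 ≤ p.phin i := by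
  induction i with
  | zero => simp [phin, p.ptx_zero]
  | succ i ih => linarith [p.phin_succ i, p.half_pow_le (i + 1)]

lemma ptx_eq (i : ℕ) : p.ptx i = 1 + p.M - p.a ^ (i + 1) / (1 - p.a) := by
  rw [← p.Y_eq]; unfold ptx Y; ring

lemma phin_le (i : ℕ) : p.phin i ≤ p.M := by
  unfold phin; rw [p.ptx_eq]
  have h : (1 / 2 : ℝ) ^ i ≤ p.a ^ (i + 1) / (1 - p.a) := by
    rw [le_div_iff₀ p.one_sub_pos, pow_succ]; have := p.half_pow_le i; have := p.half_lt
    have : (0 : ℝ) < (1 / 2) ^ i := by positivity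
    nlinarith
  linarith

lemma phiw_eq : p.phiw = p.phin p.k := rfl

lemma phiw_nonneg : 0 ≤ p.phiw := p.phin_nonneg _

lemma phiw_le : p.phiw ≤ p.M := p.phin_le _

lemma phiw_div_w_le : p.phiw / p.w ≤ p.M / p.w := div_le_div_of_nonneg_right p.phiw_le p.w_pos.le

lemma phiw_div_w_add_lam : p.phiw / p.w + p.lam ≤ 9 / 10 := by
  by_cases h : 2 ≤ p.k
  · have h1 := p.M_div_w
    have h2 : p.lam ≤ 1 / 3 := by
      unfold lam; have : (2 : ℝ) ≤ p.k := by exact_mod_cast h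
      rw [div_le_div_iff₀ (by linarith) (by norm_num)]; linarith
    linarith [p.phiw_div_w_le]
  · obtain ⟨h1, h2⟩ := p.k_eq_one h
    have e : p.phiw / p.w = 2 * p.a - 1 := by
      rw [phiw_eq, h1]; have := p.phin_succ 0; have h0 : p.phin 0 = 0 := by simp [phin, p.ptx_zero]
      rw [h0] at this; unfold w; rw [h1]; norm_num at this ⊢; linarith
    have := p.lam_le; rw [e]; linarith [p.le_a]

lemma phi_zero : p.phi 0 = 0 := sub_self _

/-- The slopes of `phi`. -/
def phs (i : ℕ) : ℝ := if i < p.k then (2 * p.a) ^ (i + 1) - 1 else -(p.phiw / p.w)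

lemma phi_end_sub (i : ℕ) (hi : i < p.k + 1) :
    (if i < p.k then p.ptx (i + 1) - (1 - (1 / 2) ^ (i + 1)) else 0) - (p.ptx i - (1 - (1 / 2) ^ i)) =
      p.phs i * (dyadicEnd p.k 1 i - (1 - 1 * (1 / 2) ^ i)) := by
  rw [dyadicEnd_sub, phs]; split_ifs with h
  · have := p.phin_succ i; rw [p.half_pow_eq] at this; unfold phin at this; linarith
  · obtain rfl : i = p.k := by omega
    have := p.w_pos.ne'; have hw : (1 / 2 : ℝ) ^ p.k = p.w := rfl
    have e : p.ptx p.k - (1 - p.w) = p.phiw := rfl; rw [hw, e, one_mul]; field_simp; ring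

lemma abs_phi_sub_le {c : ℝ} (hc : ∀ n ≤ p.g + 1, (2 * p.a) ^ n - 1 ≤ c) (hw : p.M / p.w ≤ c)
    (y y' : ℝ) : |p.phi y' - p.phi y| ≤ c * |y' - y| := by
  have h0 : 0 ≤ c := le_trans (div_nonneg p.M_pos.le p.w_pos.le) hw
  have := (dyadic_disjoint p.k (zero_lt_one' ℝ)).abs_edgeSum_sub_le p.phi_end_sub (y := y) (y' := y')
    h0 fun j hj _ _ => by
      unfold phs; split_ifs
      · rw [abs_of_nonneg (by linarith [p.one_le_two_a_pow (j + 1)])]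
        exact hc _ (by unfold g; omega)
      · rw [abs_neg, abs_of_nonneg (div_nonneg p.phiw_nonneg p.w_pos.le)]
        exact p.phiw_div_w_le.trans hw
  convert this using 2
  unfold phi phiSum; ring

lemma le_phi_sub {y y' : ℝ} (hy : y ≤ y') : -(p.phiw / p.w) * (y' - y) ≤ p.phi y' - p.phi y := by
  have h0 : 0 ≤ p.phiw / p.w := div_nonneg p.phiw_nonneg p.w_pos.le
  have := (dyadic_disjoint p.k (zero_lt_one' ℝ)).le_edgeSum_sub p.phi_end_sub h0 hy fun j hj => by
      unfold phs; split_ifs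
      · linarith [p.one_le_two_a_pow (j + 1)]
      · exact le_rfl
  convert this using 1
  unfold phi phiSum; ring

lemma phi_mem {t : ℝ} (ht : t ∈ Icc 0 1) : p.phi t ∈ Icc 0 p.M := by
  obtain ⟨i, hi, θ, hθ, rfl⟩ := exists_dyadic_edge p.k 1 (y := t) (by simpa using ht)
  rw [dyadicEnd_sub]; split_ifs with h
  · have h1 := p.phi_edge h hθ
    have e : p.phi (1 - 1 * (1 / 2) ^ i + θ * (1 * (1 / 2) ^ (i + 1))) =
        p.phin i + θ * (p.phin (i + 1) - p.phin i) := by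
      rw [p.phin_succ, one_mul, one_mul]; unfold phin; linarith
    rw [e]
    exact ⟨le_lerp (p.phin_nonneg _) (p.phin_nonneg _) hθ, lerp_le (p.phin_le _) (p.phin_le _) hθ⟩
  · obtain rfl : i = p.k := by omega
    have e : 1 - 1 * (1 / 2) ^ p.k + θ * (1 * (1 / 2) ^ p.k) = 1 - (1 - θ) * p.w := by unfold w; ring
    have hθ' : 1 - θ ∈ Icc (0 : ℝ) 1 := ⟨by linarith [hθ.2], by linarith [hθ.1]⟩
    rw [e, p.phi_last hθ']; have h1 := p.phiw_nonneg; have h2 := p.phiw_le; constructor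
    · exact mul_nonneg hθ'.1 h1
    · nlinarith [hθ'.2]

/-! ### The right side -/

lemma re_zero : p.re_ 0 = 0 := by rw [p.re_eq]; simp

lemma exists_right {y : ℝ} (hy : y ∈ Icc (1 / 2 : ℝ) 1) : ∃ j ≤ p.N, ∃ θ ∈ Icc (0 : ℝ) 1,
    y = 1 - (1 / 2) ^ (j + 1) + θ * (if j < p.N then (1 / 2) ^ (j + 2) else (1 / 2) ^ (j + 1)) ∧
    p.Rx y = p.rqx j + θ * ((if j < p.N then p.rqx (j + 1) else p.ptx p.k) - p.rqx j) ∧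
    p.eR y = p.re_ j + θ * ((if j < p.N then p.re_ (j + 1) else 0) - p.re_ j) := by
  obtain ⟨j, hj, θ, hθ, rfl⟩ := exists_dyadic_edge p.N (1 / 2) (y := y)
    (by norm_num; exact ⟨by linarith [hy.1], hy.2⟩)
  refine ⟨j, hj, θ, hθ, ?_⟩; rw [dyadicEnd_sub]
  have e1 : (1 / 2 : ℝ) * (1 / 2) ^ j = (1 / 2) ^ (j + 1) := by rw [pow_succ]; ring
  have e2 : (1 / 2 : ℝ) * (1 / 2) ^ (j + 1) = (1 / 2) ^ (j + 2) := by rw [pow_succ _ (j + 1)]; ring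
  rw [e1, e2]; refine ⟨rfl, ?_⟩; split_ifs with h
  · unfold Rx eR; rw [p.rightSum_edge _ _ h hθ, p.rightSum_edge _ _ h hθ, p.re_zero]
    constructor <;> ring
  · obtain rfl : j = p.N := by omega
    have e : (1 / 2 : ℝ) ^ (p.N + 1) = p.h := rfl; rw [e]; unfold Rx eR
    rw [p.rightSum_last _ _ hθ, p.rightSum_last _ _ hθ, p.re_zero]; constructor <;> ring

lemma a_pow_sub_le (m : ℕ) : p.a ^ m - (1 / 2) ^ m ≤ p.x := by
  induction m with
  | zero => simpa using p.x_pos.le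
  | succ m ih =>
    have e : p.a ^ (m + 1) - (1 / 2) ^ (m + 1) = p.a * (p.a ^ m - (1 / 2) ^ m) +
        p.x / 2 * (1 / 2) ^ m := by unfold x; rw [pow_succ, pow_succ]; ring
    rw [e]; rcases m with _ | m
    · simp; linarith [p.x_pos]
    · have h1 : (1 / 2 : ℝ) ^ (m + 1) ≤ 1 / 2 := by
        rw [pow_succ]; have : (1 / 2 : ℝ) ^ m ≤ 1 := pow_le_one₀ (by norm_num) (by norm_num)
        linarith
      have h2 := p.a_pos; have h3 := p.le_a; have h4 := p.x_pos; nlinarith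

lemma re_mem (j : ℕ) : p.re_ j ∈ Icc (-p.M) 0 := by
  rw [p.re_eq]; have h1 := p.a_pow_sub_le j; have h2 := p.half_pow_le j; have h3 := p.κ_ge
  have h4 := p.κ_le
  have h5 : p.x ≤ p.M := by unfold M; rw [le_div_iff₀ p.one_sub_pos]; nlinarith [p.x_pos, p.a_pos]
  constructor <;> nlinarith

lemma eR_mem {y : ℝ} (hy : y ∈ Icc (1 / 2 : ℝ) 1) : p.eR y ∈ Icc (-p.M) 0 := by
  obtain ⟨j, hj, θ, hθ, -, -, h⟩ := p.exists_right hy; rw [h]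
  have h0 : (if j < p.N then p.re_ (j + 1) else 0) ∈ Icc (-p.M) 0 := by
    split_ifs
    · exact p.re_mem _
    · exact ⟨by linarith [p.M_pos], le_rfl⟩
  exact ⟨le_lerp (p.re_mem j).1 h0.1 hθ, lerp_le (p.re_mem j).2 h0.2 hθ⟩

lemma abs_Rx_sub_le {c y y' : ℝ} (hc : 0 ≤ c)
    (h : ∀ j ≤ p.N, 1 - (1 / 2) ^ (j + 1) < max y y' → p.sig j ≤ c) :
    |p.Rx y' - p.Rx y| ≤ c * |y' - y| := by
  have := (dyadic_disjoint p.N (show (0 : ℝ) < 1 / 2 by norm_num)).abs_edgeSum_sub_le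
    (fun j hj => p.rqx_end_sub (Nat.lt_succ_iff.1 hj)) (y := y) (y' := y') hc fun j hj h1 _ => by
      rw [abs_neg, abs_of_nonneg (p.sig_nonneg j)]; refine h j (by omega) ?_
      rw [min_eq_left (dyadic_lt (by norm_num) j).le] at h1; rw [pow_succ]; linarith
  convert this using 2
  unfold Rx rightSum; ring

lemma Rx_antitone {y y' : ℝ} (hy : y ≤ y') : p.Rx y' ≤ p.Rx y := by
  have := (dyadic_disjoint p.N (show (0 : ℝ) < 1 / 2 by norm_num)).edgeSum_sub_le
    (fun j hj => p.rqx_end_sub (Nat.lt_succ_iff.1 hj)) le_rfl hy fun j hj => by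
      linarith [p.sig_nonneg j]
  unfold Rx rightSum; linarith

lemma le_Rx_sub {y y' : ℝ} (hy : y ≤ y') : -(y' - y) ≤ p.Rx y' - p.Rx y := by
  have := p.abs_Rx_sub_le zero_le_one (y := y) (y' := y') fun j hj _ => p.sig_le_one j
  rw [abs_of_nonneg (sub_nonneg.2 hy), one_mul] at this; exact (abs_le.1 this).1

lemma abs_eR_sub_le {c : ℝ} (hc : ∀ m ≤ p.N, |p.mu m| ≤ c) (y y' : ℝ) :
    |p.eR y' - p.eR y| ≤ c * |y' - y| := by
  have := (dyadic_disjoint p.N (show (0 : ℝ) < 1 / 2 by norm_num)).abs_edgeSum_sub_le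
    (fun j hj => p.re_end_sub (Nat.lt_succ_iff.1 hj)) (y := y) (y' := y')
    ((abs_nonneg _).trans (hc 0 (Nat.zero_le _))) fun j hj h1 _ => hc j (by omega)
  convert this using 2
  unfold eR rightSum; ring

lemma le_eR_sub {y y' : ℝ} (hy : y ≤ y') : -(p.κ * p.x) * (y' - y) ≤ p.eR y' - p.eR y := by
  have := (dyadic_disjoint p.N (show (0 : ℝ) < 1 / 2 by norm_num)).le_edgeSum_sub
    (fun j hj => p.re_end_sub (Nat.lt_succ_iff.1 hj))
    (mul_nonneg (zero_le_one.trans p.κ_ge) p.x_pos.le) hy fun j hj => p.neg_le_mu j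
  convert this using 1
  unfold eR rightSum; ring

lemma Rx_half : p.Rx (1 / 2) = p.rqx 0 := by unfold Rx; ring

lemma eR_half : p.eR (1 / 2) = 0 := sub_self _

lemma rqx_eq' (j : ℕ) : p.rqx j = 1 + p.M - (1 + p.a) / 2 * (p.a ^ p.g / p.a ^ j / (1 - p.a)) := by
  rw [← p.Y_eq]; unfold rqx Y; have := p.one_sub_pos.ne'; field_simp

lemma rqx_zero : p.rqx 0 = 1 - p.a ^ p.g / 2 := by
  rw [p.rqx_eq', M, ← p.a_pow_g]; have := p.one_sub_pos.ne'; field_simp; ring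

lemma Rx_one : p.Rx 1 = p.ptx p.k := by
  have h := p.rightSum_last p.rqx (p.ptx p.k) (θ := 1) (by simp); unfold Rx
  have e : 1 - p.h + 1 * p.h = 1 := by ring
  rw [e] at h; linarith

lemma eR_one : p.eR 1 = 0 := by
  have h := p.rightSum_last p.re_ 0 (θ := 1) (by simp); unfold eR
  have e : 1 - p.h + 1 * p.h = 1 := by ring
  rw [e, p.re_zero] at h; linarith

lemma Rx_le {y : ℝ} (hy : 1 / 2 ≤ y) : p.Rx y ≤ 1 - p.a ^ p.g / 2 := by
  rw [← p.rqx_zero, ← p.Rx_half]; exact p.Rx_antitone hy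

lemma ptx_le_Rx {y : ℝ} (hy : y ≤ 1) : p.ptx p.k ≤ p.Rx y := by
  rw [← p.Rx_one]; exact p.Rx_antitone hy

/-- Twice the largest deviation of the left side. -/
def bump : ℝ := (p.a ^ (p.k + 1) - p.x) / (1 - p.a)

lemma ptx_k : p.ptx p.k = 1 - p.bump := by rw [p.ptx_eq, bump, M]; ring

/-! ### The left side -/

lemma le_zero : p.le_ 0 = 0 := by rw [p.le_eq]; simp; right; ring

lemma exists_left {y : ℝ} (hy : y ∈ Icc (1 / 2 : ℝ) 1) : ∃ m ≤ p.N, ∃ θ ∈ Icc (0 : ℝ) 1,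
    y = leftNode m + θ * (leftNode (leftEndIdx p.N m) - leftNode m) ∧
    p.Lx y = p.lmx m + θ * (p.lmx (leftEndIdx p.N m) - p.lmx m) ∧
    p.eL y = p.le_ m + θ * (p.le_ (leftEndIdx p.N m) - p.le_ m) := by
  obtain ⟨m, hm, θ, hθ, rfl⟩ := exists_left_edge p.N hy; refine ⟨m, hm, θ, hθ, rfl, ?_⟩
  rcases hm.lt_or_eq with h | rfl
  · have e : leftEndIdx p.N m = m + 2 := if_pos h; rw [e]; unfold Lx eL
    rw [p.leftSum_edge _ h hθ, p.leftSum_edge _ h hθ, p.le_zero, p.lmx_zero]; constructor <;> ring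
  · have e : leftEndIdx p.N p.N = p.N + 1 := by simp [leftEndIdx]
    rw [e]; unfold Lx eL; rw [p.leftSum_last _ hθ, p.leftSum_last _ hθ, p.le_zero, p.lmx_zero]
    constructor <;> ring

lemma abs_le_le (m : ℕ) : |p.le_ m| ≤ p.M := by
  have h1 := p.a_pow_sub_le m; have h2 := p.half_pow_le m; have h3 := p.x_pos
  have h4 : (1 / 2 : ℝ) ^ m ≤ 1 := pow_le_one₀ (by norm_num) (by norm_num)
  have h5 : (0 : ℝ) < (1 / 2) ^ m := by positivity
  have h6 : |p.x + 3 * (-p.a) ^ m - (3 + p.x) * (-1 / 2) ^ m| ≤ 5 * p.x := by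
    rw [show (-p.a) ^ m = (-1) ^ m * p.a ^ m by rw [← mul_pow]; simp, neg_half_pow]
    rcases neg_one_pow_eq_or ℝ m with h | h <;> rw [h, abs_le] <;> constructor <;> nlinarith
  have h7 : p.a ^ 2 / (3 * (1 - p.a ^ 2)) ≤ 1 / 5 := by
    have h8 : p.a ^ 2 ≤ 121 / 400 := by nlinarith [p.le_a, p.a_pos]
    rw [div_le_div_iff₀ (by linarith) (by norm_num)]; linarith
  have h8 : 0 ≤ p.a ^ 2 / (3 * (1 - p.a ^ 2)) := by
    have h8 : p.a ^ 2 ≤ 121 / 400 := by nlinarith [p.le_a, p.a_pos]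
    exact div_nonneg (sq_nonneg _) (by linarith)
  have h5 : p.x ≤ p.M := by unfold M; rw [le_div_iff₀ p.one_sub_pos]; nlinarith [p.x_pos, p.a_pos]
  rw [p.le_eq, abs_mul, abs_of_nonneg h8]
  calc _ ≤ 1 / 5 * (5 * p.x) := mul_le_mul h7 h6 (abs_nonneg _) (by norm_num)
    _ ≤ _ := by linarith

lemma eL_mem {y : ℝ} (hy : y ∈ Icc (1 / 2 : ℝ) 1) : p.eL y ∈ Icc (-p.M) p.M := by
  obtain ⟨j, hj, θ, hθ, -, -, h⟩ := p.exists_left hy; rw [h]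
  have h0 := fun m => abs_le.1 (p.abs_le_le m)
  exact ⟨le_lerp (h0 _).1 (h0 _).1 hθ, lerp_le (h0 _).2 (h0 _).2 hθ⟩

lemma abs_neg_one_pow_mul (m : ℕ) (r : ℝ) : |(-1) ^ m * r| = |r| := by rw [abs_mul]; simp

lemma abs_Lx_sub_le {c y y' : ℝ} (hc : 0 ≤ c)
    (h : ∀ m ≤ p.N, min (leftNode m) (leftNode (leftEndIdx p.N m)) < max y y' →
      min y y' < max (leftNode m) (leftNode (leftEndIdx p.N m)) → p.sig m ≤ c) :
    |p.Lx y' - p.Lx y| ≤ c * |y' - y| := by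
  have := (left_disjoint p.N).abs_edgeSum_sub_le
    (fun j hj => p.lmx_end_sub (Nat.lt_succ_iff.1 hj)) (y := y) (y' := y') hc fun j hj h1 h2 => by
      rw [abs_neg_one_pow_mul, abs_of_nonneg (p.sig_nonneg j)]; exact h j (by omega) h1 h2
  convert this using 2
  unfold Lx leftSum; ring

lemma abs_eL_sub_le {c : ℝ} (hc : ∀ m ≤ p.N, |p.mu m| ≤ c) (y y' : ℝ) :
    |p.eL y' - p.eL y| ≤ c * |y' - y| := by
  have := (left_disjoint p.N).abs_edgeSum_sub_le
    (fun j hj => p.le_end_sub (Nat.lt_succ_iff.1 hj)) (y := y) (y' := y')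
    ((abs_nonneg _).trans (hc 0 (Nat.zero_le _))) fun j hj h1 _ => hc j (by omega)
  convert this using 2
  unfold eL leftSum; ring

lemma le_eL_sub {y y' : ℝ} (hy : y ≤ y') : -(p.κ * p.x) * (y' - y) ≤ p.eL y' - p.eL y := by
  have := (left_disjoint p.N).le_edgeSum_sub (fun j hj => p.le_end_sub (Nat.lt_succ_iff.1 hj))
    (mul_nonneg (zero_le_one.trans p.κ_ge) p.x_pos.le) hy fun j hj => p.neg_le_mu j
  convert this using 1
  unfold eL leftSum; ring

lemma lmx_antitone {m n : ℕ} (h : m ≤ n) : p.lmx n ≤ p.lmx m := by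
  unfold lmx; refine div_le_div_of_nonneg_right ?_ (by linarith [p.one_sub_pos])
  have := div_le_div_of_nonneg_left p.x_pos.le (p.apos n) (p.amono h); linarith

lemma lmx_one : p.lmx 1 = -(p.a ^ p.g / 2) := by
  unfold lmx; rw [← p.a_pow_g]; have := p.one_sub_pos.ne'; have := p.a_ne; field_simp; ring

lemma lmx_last : p.lmx (p.N + 1) = -(p.bump / 2) := by
  unfold lmx bump; rw [p.x_div_pow (n := p.N + 1) (m := p.k + 1) (by unfold g; omega)]
  have := p.one_sub_pos.ne'; field_simp; ring

lemma leftNode_zero : leftNode 0 = 1 := by norm_num [leftNode]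
lemma leftNode_one : leftNode 1 = 1 / 2 := by norm_num [leftNode]

lemma Lx_one : p.Lx 1 = 0 := sub_self _
lemma eL_one : p.eL 1 = 0 := sub_self _

lemma leftSum_node (b : ℕ → ℝ) {m : ℕ} (hm : m ≤ p.N + 1) :
    p.leftSum b (leftNode m) - p.leftSum b 1 = b m - b 0 := by
  have := edgeSum_left p.N b hm; rw [leftNode_zero] at this; exact this

lemma Lx_half : p.Lx (1 / 2) = -(p.a ^ p.g / 2) := by
  have := p.leftSum_node p.lmx (m := 1) (by omega); rw [leftNode_one, p.lmx_zero, p.lmx_one] at this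
  unfold Lx; linarith

lemma le_one : p.le_ 1 = 0 := by rw [p.le_eq]; unfold x; ring

lemma eL_half : p.eL (1 / 2) = 0 := by
  have := p.leftSum_node p.le_ (m := 1) (by omega); rw [leftNode_one, p.le_zero, p.le_one] at this
  unfold eL; linarith

lemma Lx_le {y : ℝ} (hy : y ∈ Icc (1 / 2 : ℝ) 1) : p.Lx y ≤ -(p.a ^ p.g * (1 - y)) := by
  obtain ⟨m, hm, θ, hθ, h, h', -⟩ := p.exists_left hy; have h0 := p.apos p.g
  have key : ∀ m, p.lmx m + p.a ^ p.g * (1 - leftNode m) ≤ 0 := by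
    intro m; rcases m with _ | m
    · rw [p.lmx_zero, leftNode_zero]; simp
    · have h1 := p.lmx_antitone (show 1 ≤ m + 1 by omega); rw [p.lmx_one] at h1
      have h2 := (leftNode_mem (m + 1)).1; nlinarith
  have := lerp_le (key m) (key (leftEndIdx p.N m)) hθ
  have e : p.a ^ p.g * (1 - y) = p.a ^ p.g * (1 - (leftNode m +
      θ * (leftNode (leftEndIdx p.N m) - leftNode m))) := by rw [← h]
  rw [h', e]; linarith

lemma le_Lx {y : ℝ} (hy : y ∈ Icc (1 / 2 : ℝ) 1) : -(p.bump / 2) ≤ p.Lx y := by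
  obtain ⟨m, hm, θ, hθ, -, h', -⟩ := p.exists_left hy; rw [h', ← p.lmx_last]
  exact le_lerp (p.lmx_antitone (by omega))
    (p.lmx_antitone (by unfold leftEndIdx; split_ifs <;> omega)) hθ

/-! ### The dents of the top -/

/-- The slopes of the dents. -/
def dsl (j : ℕ) : ℝ := 2 * (p.a * p.x / (p.a ^ (j / 2 + 1)) ^ 2 / (1 - p.a))

lemma dep_pos (i : ℕ) : 0 < p.dep i := div_pos (div_pos (p.apos _) (p.apos _)) p.one_sub_pos

lemma dsl_nonneg (j : ℕ) : 0 ≤ p.dsl j := by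
  have := p.a_pos; have := p.x_pos; have := p.one_sub_pos; have := p.apos (j / 2 + 1)
  unfold dsl; positivity

lemma denty_sub (j : ℕ) :
    p.denty (j + 1) - p.denty j = (-1) ^ (j + 1) * p.dsl j * (p.dentx (j + 1) - p.dentx j) := by
  have h1 := (p.apos (j / 2 + 1)).ne'; have h2 := p.one_sub_pos.ne'
  have e0 : p.dep (j / 2 + 1) = p.dsl j * (p.a ^ (j / 2 + 1) / 2) := by
    unfold dep dsl; rw [pow_succ p.a (p.g + 1), p.a_pow]; field_simp
  unfold dentx denty; rcases Nat.mod_two_eq_zero_or_one j with h | h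
  · have h' : (j + 1) % 2 = 1 := by omega
    have e : (j + 1) / 2 = j / 2 := by omega
    have e' : (-1 : ℝ) ^ (j + 1) = -1 := Odd.neg_one_pow (Nat.odd_iff.2 h')
    rw [if_pos h, if_pos h, if_neg (by omega), if_neg (by omega), e, p.qx_succ, e', e0]; ring
  · have h' : (j + 1) % 2 = 0 := by omega
    have e : (j + 1) / 2 = j / 2 + 1 := by omega
    have e' : (-1 : ℝ) ^ (j + 1) = 1 := Even.neg_one_pow (Nat.even_iff.2 h')
    simp only [if_neg (show ¬ j % 2 = 0 by omega), if_pos h']; rw [e, p.qx_succ, p.ptx_succ, e', e0]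
    ring

lemma dsl_le_two {j : ℕ} (hj : j < 2 * p.k) : p.dsl j ≤ 3 / 2 := by
  refine le_trans ?_ p.κ_le; have e : p.κ = 2 * (p.a ^ 2 / (1 - p.a)) := by unfold κ; ring
  rw [dsl, e]
  refine mul_le_mul_of_nonneg_left (div_le_div_of_nonneg_right ?_ p.one_sub_pos.le) (by norm_num)
  rw [← pow_mul, div_le_iff₀ (p.apos _), ← p.a_pow, ← pow_succ', ← pow_add]
  exact p.amono (by have := p.hkN; unfold g; omega)

lemma abs_tau_sub_le {c y y' : ℝ} (hc : 0 ≤ c)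
    (h : ∀ j < 2 * p.k, p.dentx j < max y y' → min y y' < p.dentx (j + 1) → p.dsl j ≤ c) :
    |p.tau y' - p.tau y| ≤ c * |y' - y| := by
  have := (p.dent_disjoint (2 * p.k)).abs_edgeSum_sub_le
    (fun j _ => p.denty_sub j) (y := y) (y' := y') hc fun j hj h1 h2 => by
      rw [abs_neg_one_pow_mul, abs_of_nonneg (p.dsl_nonneg j)]
      rw [min_eq_left (p.dentx_lt j).le] at h1; rw [max_eq_right (p.dentx_lt j).le] at h2
      exact h j (by omega) h1 h2
  convert this using 2
  unfold tau tauSum; ring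

lemma dentx_mono {i j : ℕ} (h : i ≤ j) : p.dentx i ≤ p.dentx j :=
  monotone_nat_of_le_succ (fun j => (p.dentx_lt j).le) h

lemma dentx_zero : p.dentx 0 = 0 := by simp [dentx, p.ptx_zero]
lemma dentx_last : p.dentx (2 * p.k) = p.ptx p.k := by simp [dentx]

lemma tau_zero : p.tau 0 = 0 := sub_self _

lemma tau_last : p.tau (p.ptx p.k) = 0 := by
  have hk := p.hk; have h := p.tau_edge (j := 2 * p.k - 1) (by omega) (θ := 1) (by simp)
  rw [one_mul, one_mul, add_sub_cancel, add_sub_cancel, Nat.sub_add_cancel (by omega), p.dentx_last] at h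
  rw [h]; simp [denty]

lemma tau_of_nonpos {y : ℝ} (hy : y ≤ 0) : p.tau y = 0 := by
  have := p.abs_tau_sub_le le_rfl (y := 0) (y' := y) fun j hj h1 _ => by
    rw [max_eq_left hy] at h1; have := p.dentx_mono (Nat.zero_le j)
    rw [p.dentx_zero] at this; linarith
  rw [zero_mul, p.tau_zero, sub_zero] at this; exact abs_nonpos_iff.1 this

lemma tau_of_ge {y : ℝ} (hy : p.ptx p.k ≤ y) : p.tau y = 0 := by
  have := p.abs_tau_sub_le le_rfl (y := p.ptx p.k) (y' := y) fun j hj _ h2 => by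
    rw [min_eq_left hy, ← p.dentx_last] at h2; have := p.dentx_mono (show j + 1 ≤ 2 * p.k by omega)
    linarith
  rw [zero_mul, p.tau_last, sub_zero] at this; exact abs_nonpos_iff.1 this

/-- The depth of the dents. -/
def depth : ℝ := p.a ^ (p.N + 3) / (1 - p.a)

lemma dep_le {i : ℕ} (hi : i ≤ p.k) : p.dep i ≤ p.depth := by
  unfold dep depth; refine div_le_div_of_nonneg_right ?_ p.one_sub_pos.le
  rw [div_le_iff₀ (p.apos i), ← pow_add]; exact p.amono (by unfold g; omega)

lemma depth_pos : 0 < p.depth := div_pos (p.apos _) p.one_sub_pos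

lemma tau_mem (y : ℝ) : p.tau y ∈ Icc (-p.depth) 0 := by
  have h0 := p.depth_pos; rcases le_total y 0 with h | h
  · rw [p.tau_of_nonpos h]; exact ⟨by linarith, le_rfl⟩
  rcases le_total (p.ptx p.k) y with h' | h'
  · rw [p.tau_of_ge h']; exact ⟨by linarith, le_rfl⟩
  obtain ⟨j, hj, θ, hθ, rfl⟩ := exists_chain_edge (u := p.dentx) (n := 2 * p.k) (y := y)
    (by rwa [p.dentx_zero]) (by rwa [p.dentx_last]) (by have := p.hk; omega)
  rw [p.tau_edge hj hθ]
  have key : ∀ j ≤ 2 * p.k, p.denty j ∈ Icc (-p.depth) 0 := by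
    intro j hj; unfold denty; split_ifs with h
    · exact ⟨by linarith, le_rfl⟩
    · exact ⟨by linarith [p.dep_le (i := j / 2 + 1) (by omega)], by linarith [p.dep_pos (j / 2 + 1)]⟩
  have h1 := key j (by omega); have h2 := key (j + 1) (by omega)
  exact ⟨le_lerp h1.1 h2.1 hθ, lerp_le h1.2 h2.2 hθ⟩

end Par

lemma le_min_sub_min {a a' b b' t : ℝ} (ha : t ≤ a' - a) (hb : t ≤ b' - b) :
    t ≤ min a' b' - min a b := by
  have h : min a b + t ≤ min a' b' :=
    le_min (by linarith [min_le_left a b]) (by linarith [min_le_right a b])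
  linarith

lemma le_max_sub_max {a a' b b' t : ℝ} (ha : t ≤ a' - a) (hb : t ≤ b' - b) :
    t ≤ max a' b' - max a b := by
  have h : max a b ≤ max a' b' - t :=
    max_le (by linarith [le_max_left a' b']) (by linarith [le_max_right a' b'])
  linarith

/-- Truncation of `e` at `± m`. -/
def truncate (e m : ℝ) : ℝ := max (-m) (min m e)

lemma truncate_of_abs_le {e m : ℝ} (h : |e| ≤ m) : truncate e m = e := by
  have := abs_le.1 h; rw [truncate, min_eq_right this.2, max_eq_right this.1]

lemma truncate_zero (e : ℝ) : truncate e 0 = 0 := by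
  rcases le_total 0 e with h | h
  · simp [truncate, h]
  · simp [truncate, h]

lemma zero_truncate {m : ℝ} (hm : 0 ≤ m) : truncate 0 m = 0 := truncate_of_abs_le (by simpa)

namespace Par

variable (p : Par)

def q (y : ℝ) : ℝ := 2 * p.w / p.h * max 0 (y - (1 - p.h / 2))
def rL (y : ℝ) : ℝ := p.Lx y + p.a ^ p.g * (1 - y)
def rR (y : ℝ) : ℝ := p.Rx y - 1 + p.a ^ p.g * (1 - y) + (1 - p.phiw / p.w - p.lam) * p.q y

/-- The factors of the piecewise affine homeomorphism. -/
def Cf (z : ℂ) : ℝ := z.im - max 0 (p.h / 2 * (1 - (1 - z.re) / p.w) - (1 - z.im) / 2)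
def Hf (z : ℂ) : ℝ :=
  min (z.re + p.phi z.re) (z.re + p.M * (2 * z.im - 1)) - p.a ^ p.g * (1 - z.im) +
    min 0 (p.rL z.im + p.lam * z.re) + min 0 (p.rR z.im + p.lam * (1 - z.re))
def bottom (z : ℂ) : ℝ := max 0 (1 - 2 * |z.re - p.p0| - (2 * z.im - 1))
def Vf (z : ℂ) : ℝ := p.A z.im + truncate (p.eL z.im) (p.M * max 0 (1 - 4 * z.re)) +
    truncate (p.eR z.im) (p.M * max 0 (4 * z.re - 1)) +
    min 0 (p.tau z.re + p.lam * (1 - z.im)) + p.e0 * p.bottom z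

/-- The map from the rectangle to the model of the surface of genus `g`. -/
def Fmap (z : ℂ) : ℂ := vShear p.Vf (hShear p.Hf (vShear p.Cf z))

/-! ### The homeomorphism -/

lemma bump_le_lam : p.bump ≤ p.lam := p.bump_le

lemma slack_nonneg : 0 ≤ 1 - p.phiw / p.w - p.lam := by linarith [p.phiw_div_w_add_lam]

lemma slack_le : 1 - p.phiw / p.w - p.lam ≤ 1 := by
  linarith [p.lam_pos, div_nonneg p.phiw_nonneg p.w_pos.le]

lemma Cf_slope (x y y' : ℝ) (h : y ≤ y') : 1 / 2 * (y' - y) ≤ p.Cf ⟨x, y'⟩ - p.Cf ⟨x, y⟩ := by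
  have := le_max_sub_max (a' := 0) (a := 0) (b := p.h / 2 * (1 - (1 - x) / p.w) - (1 - y') / 2)
    (b' := p.h / 2 * (1 - (1 - x) / p.w) - (1 - y) / 2) (t := -(1 / 2 * (y' - y)))
    (by linarith) (by linarith)
  simp only [Cf]; linarith

lemma Hf_slope (x x' y : ℝ) (h : x ≤ x') : 1 / 10 * (x' - x) ≤ p.Hf ⟨x', y⟩ - p.Hf ⟨x, y⟩ := by
  have h0 : 0 ≤ x' - x := sub_nonneg.2 h; have hl := p.lam_pos
  have hpw : 0 ≤ p.phiw / p.w := div_nonneg p.phiw_nonneg p.w_pos.le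
  have h1 := le_min_sub_min (a := x + p.phi x) (a' := x' + p.phi x') (b := x + p.M * (2 * y - 1))
    (b' := x' + p.M * (2 * y - 1)) (t := (1 - p.phiw / p.w) * (x' - x))
    (by linarith [p.le_phi_sub h]) (by nlinarith)
  have h2 := le_min_sub_min (a := 0) (a' := 0) (b := p.rL y + p.lam * x) (b' := p.rL y + p.lam * x')
    (t := 0) (by simp) (by nlinarith)
  have h3 := le_min_sub_min (a := 0) (a' := 0) (b := p.rR y + p.lam * (1 - x))
    (b' := p.rR y + p.lam * (1 - x')) (t := -p.lam * (x' - x)) (by nlinarith) (by linarith)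
  have h4 := p.phiw_div_w_add_lam; simp only [Hf]; nlinarith

lemma Vf_slope (x y y' : ℝ) (h : y ≤ y') : 1 / 20 * (y' - y) ≤ p.Vf ⟨x, y'⟩ - p.Vf ⟨x, y⟩ := by
  have h0 : 0 ≤ y' - y := sub_nonneg.2 h; have hl := p.lam_pos
  have hk : 0 ≤ p.κ * p.x := mul_nonneg (zero_le_one.trans p.κ_ge) p.x_pos.le
  have hn : -(p.κ * p.x) * (y' - y) ≤ 0 := by nlinarith
  have ht : ∀ m e e', -(p.κ * p.x) * (y' - y) ≤ e' - e →
      -(p.κ * p.x) * (y' - y) ≤ truncate e' m - truncate e m := fun m e e' he =>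
    le_max_sub_max (by simpa using hn) (le_min_sub_min (by simpa using hn) he)
  have h1 := ht (p.M * max 0 (1 - 4 * x)) _ _ (p.le_eL_sub h)
  have h2 := ht (p.M * max 0 (4 * x - 1)) _ _ (p.le_eR_sub h)
  have h3 := le_min_sub_min (a := 0) (a' := 0) (b := p.tau x + p.lam * (1 - y))
    (b' := p.tau x + p.lam * (1 - y')) (t := -p.lam * (y' - y)) (by nlinarith) (by linarith)
  have h4 := le_max_sub_max (a := 0) (a' := 0) (b := 1 - 2 * |x - p.p0| - (2 * y - 1))
    (b' := 1 - 2 * |x - p.p0| - (2 * y' - 1)) (t := -2 * (y' - y)) (by linarith) (by linarith)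
  have h5 := mul_le_mul_of_nonneg_left h4 p.e0_pos.le
  have h6 : p.A y' - p.A y = p.κ * (y' - y) := by unfold A; ring
  have h7 : p.e0 ≤ 1 / 8 := by linarith [p.e0_le_x, p.x_le]
  have h8 := p.lam_le
  have h9 : (4 / 5 : ℝ) ≤ p.κ - 2 * (p.κ * p.x) := by nlinarith [p.κ_ge, p.x_le, p.x_pos]
  simp only [Vf, bottom]; nlinarith

end Par

namespace LipOn

variable {S : Set ℂ} {c : ℝ} {f f' : ℂ → ℝ}

lemma const_mul_le (h : LipOn S c f) {r c' : ℝ} (hr : 0 ≤ r) (hc : r * c ≤ c') :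
    LipOn S c' (fun z => r * f z) := by
  have := h.const_mul r; rw [abs_of_nonneg hr] at this; exact this.mono hc

lemma truncate (h : LipOn S c f) (h' : LipOn S c f') : LipOn S c (fun z => truncate (f z) (f' z)) :=
  h'.neg.max (h'.min h)

lemma const' (r : ℝ) (hc : 0 ≤ c) : LipOn S c (fun _ => r) := (const r).mono hc

lemma real_comp {φ : ℝ → ℝ} (hφ : ∀ y y', |φ y' - φ y| ≤ c * |y' - y|) (hc : 0 ≤ c) {f : ℂ → ℝ}
    (hf : LipOn S 1 f) : LipOn S c (fun z => φ (f z)) := by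
  have := hf.comp_real hc (φ := φ) fun z _ w _ => hφ _ _
  rwa [mul_one] at this

end LipOn

namespace Par

variable (p : Par) {S : Set ℂ} {c : ℝ}

lemma Hf_sub_lip (hφ : ∀ n ≤ p.g + 1, (2 * p.a) ^ n - 1 ≤ c) (hw : p.M / p.w ≤ c)
    (hM : 2 * p.M ≤ c) (hg : p.a ^ p.g ≤ c)
    (hL : LipOn S c fun z => min 0 (p.rL z.im + p.lam * z.re))
    (hR : LipOn S c fun z => min 0 (p.rR z.im + p.lam * (1 - z.re))) :
    LipOn S (4 * c) fun z => p.Hf z - z.re := by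
  have hc : 0 ≤ c := (p.apos p.g).le.trans hg
  have h1 : LipOn S c fun z => p.phi z.re := LipOn.re.real_comp (p.abs_phi_sub_le hφ hw) hc
  have h2 : LipOn S c fun z : ℂ => p.M * (2 * z.im - 1) :=
    ((LipOn.im.const_mul_le (r := 2) (c' := 2) (by norm_num) (by norm_num)).sub
      (LipOn.const 1)).const_mul_le p.M_pos.le (by linarith)
  have h3 : LipOn S c fun z : ℂ => p.a ^ p.g * (1 - z.im) :=
    ((LipOn.const 1).sub LipOn.im).const_mul_le (p.apos p.g).le (by linarith)
  refine ((((h1.min h2).sub h3).add hL).add hR).congr (fun z _ => ?_) |>.mono (by linarith)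
  unfold Hf; rw [min_add_add_left]; ring

lemma bottom_lip : LipOn S 4 p.bottom := ((LipOn.const 0).mono (by norm_num)).max <|
    (((LipOn.const 1).sub ((LipOn.re.sub (LipOn.const p.p0)).abs.const_mul_le (r := 2) (c' := 2)
      (by norm_num) (by norm_num))).sub
        ((LipOn.im.const_mul_le (r := 2) (c' := 2) (by norm_num) (by norm_num)).sub
          (LipOn.const 1))).mono (by norm_num)

lemma Vf_sub_lip (hκ : p.κ - 1 ≤ c) (hmu : ∀ m ≤ p.N, |p.mu m| ≤ c) (hM : 4 * p.M ≤ c)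
    (he : 4 * p.e0 ≤ c) (hτ : LipOn S c fun z => min 0 (p.tau z.re + p.lam * (1 - z.im))) :
    LipOn S (5 * c) fun z => p.Vf z - z.im := by
  have hc : 0 ≤ c := by linarith [p.M_pos]
  have h0 : LipOn S c fun z : ℂ => p.A z.im - z.im := by
    have := (LipOn.im.const_mul_le (S := S) (r := p.κ - 1) (c' := c) (by linarith [p.κ_ge])
      (by linarith)).add (LipOn.const (p.a - p.κ / 2))
    refine this.congr (fun z _ => ?_) |>.mono (by linarith); unfold A; ring
  have h1 : LipOn S c fun z => p.eL z.im := LipOn.im.real_comp (p.abs_eL_sub_le hmu) hc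
  have h2 : LipOn S c fun z => p.eR z.im := LipOn.im.real_comp (p.abs_eR_sub_le hmu) hc
  have h3 : LipOn S c fun z : ℂ => p.M * max 0 (1 - 4 * z.re) :=
    ((LipOn.const' 0 (by norm_num)).max ((LipOn.const 1).sub
      (LipOn.re.const_mul_le (r := 4) (c' := 4) (by norm_num) (by norm_num)))).const_mul_le p.M_pos.le
        (by linarith)
  have h4 : LipOn S c fun z : ℂ => p.M * max 0 (4 * z.re - 1) := ((LipOn.const' 0 (by norm_num)).max
      ((LipOn.re.const_mul_le (r := 4) (c' := 4) (by norm_num) (by norm_num)).sub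
        (LipOn.const 1))).const_mul_le p.M_pos.le (by linarith)
  have h5 : LipOn S c fun z => p.e0 * p.bottom z := p.bottom_lip.const_mul_le p.e0_pos.le (by linarith)
  refine ((((h0.add (h1.truncate h3)).add (h2.truncate h4)).add hτ).add h5).congr (fun z _ => ?_)
    |>.mono (by linarith)
  unfold Vf; ring

lemma Cf_lip : LipOn S 2 p.Cf := by
  have h1 : LipOn S 1 fun z : ℂ => p.h / 2 * (1 - (1 - z.re) / p.w) - (1 - z.im) / 2 := by
    have h2 : p.h / 2 * (1 / p.w) ≤ 1 / 2 := by
      rw [mul_one_div, div_le_iff₀ p.w_pos]; linarith [p.h_le_w]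
    have h3 := (LipOn.re.const_mul_le (S := S) (r := p.h / 2 * (1 / p.w)) (c' := 1 / 2)
      (by have := p.h_pos; have := p.w_pos; positivity) (by linarith)).add
      (LipOn.im.const_mul_le (r := 1 / 2) (c' := 1 / 2) (by norm_num) (by norm_num))
    refine (h3.add (LipOn.const (p.h / 2 * (1 - 1 / p.w) - 1 / 2))).congr (fun z _ => ?_)
      |>.mono (by norm_num)
    ring
  exact (LipOn.im.sub ((LipOn.const' 0 zero_le_one).max h1)).mono (by norm_num)

lemma q_lip : ∀ y y', |p.q y' - p.q y| ≤ 4 * |y' - y| := by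
  intro y y'; have h1 : 2 * p.w / p.h ≤ 4 := by rw [div_le_iff₀ p.h_pos]; linarith [p.w_le_h]
  have h0 : 0 ≤ 2 * p.w / p.h := div_nonneg (by linarith [p.w_pos]) p.h_pos.le; unfold q
  rw [← mul_sub, abs_mul, abs_of_nonneg h0]; refine mul_le_mul h1 ?_ (abs_nonneg _) (by norm_num)
  refine (abs_max_sub_max_le_max _ _ _ _).trans (max_le (by simp) (le_of_eq ?_)); congr 1; ring

lemma rL_lip {c : ℝ} (hc : 0 ≤ c) (hσ : LipOn S c fun z => p.Lx z.im) (hg : p.a ^ p.g ≤ c) (hl : p.lam ≤ c) :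
    LipOn S (3 * c) fun z => min 0 (p.rL z.im + p.lam * z.re) := by
  have h1 : LipOn S c fun z : ℂ => p.a ^ p.g * (1 - z.im) :=
    ((LipOn.const 1).sub LipOn.im).const_mul_le (p.apos p.g).le (by linarith)
  have h2 : LipOn S c fun z : ℂ => p.lam * z.re := LipOn.re.const_mul_le p.lam_pos.le (by linarith)
  exact (LipOn.const' 0 (by linarith)).min (((hσ.add h1).add h2).mono (by linarith))

lemma Lx_lip : LipOn S 1 fun z => p.Lx z.im :=
  LipOn.im.real_comp (fun _ _ => p.abs_Lx_sub_le zero_le_one fun m _ _ _ => p.sig_le_one m) zero_le_one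

lemma Rx_lip : LipOn S 1 fun z => p.Rx z.im :=
  LipOn.im.real_comp (fun _ _ => p.abs_Rx_sub_le zero_le_one fun m _ _ => p.sig_le_one m) zero_le_one

lemma rR_lip {c cq : ℝ} (hc : 0 ≤ c) (hcq : 0 ≤ cq) (hσ : LipOn S c fun z => p.Rx z.im)
    (hq : LipOn S cq fun z => p.q z.im) (hg : p.a ^ p.g ≤ c) (hl : p.lam ≤ c) :
    LipOn S (3 * c + cq) fun z => min 0 (p.rR z.im + p.lam * (1 - z.re)) := by
  have h1 : LipOn S c fun z : ℂ => p.a ^ p.g * (1 - z.im) :=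
    ((LipOn.const 1).sub LipOn.im).const_mul_le (p.apos p.g).le (by linarith)
  have h2 : LipOn S c fun z : ℂ => p.lam * (1 - z.re) :=
    ((LipOn.const 1).sub LipOn.re).const_mul_le p.lam_pos.le (by linarith)
  have h3 := hq.const_mul_le p.slack_nonneg (c' := cq) (by nlinarith [p.slack_le])
  exact (LipOn.const' 0 (by linarith)).min
    (((((hσ.sub (LipOn.const 1)).add h1).add h3).add h2).mono (by linarith))

lemma a_pow_g_le' : p.a ^ p.g ≤ 1 := p.ale _

lemma Hf_lip : LipOn S 29 p.Hf := by
  have h : LipOn S (4 * 7) fun z => p.Hf z - z.re := by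
    refine p.Hf_sub_lip (fun n hn => by linarith [p.two_a_pow_le hn]) (by linarith [p.M_div_w])
      (by linarith [p.M_le_x, p.x_le]) (by linarith [p.a_pow_g_le']) ?_ ?_
    · exact (p.rL_lip zero_le_one p.Lx_lip p.a_pow_g_le' (by linarith [p.lam_le])).mono (by norm_num)
    · exact (p.rR_lip zero_le_one (by norm_num : (0 : ℝ) ≤ 4) p.Rx_lip
        (LipOn.im.real_comp p.q_lip (by norm_num)) p.a_pow_g_le'
        (by linarith [p.lam_le])).mono (by norm_num)
  exact (h.add LipOn.re).congr (fun z _ => by ring) |>.mono (by norm_num)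

lemma tau_lip : LipOn S (3 / 2) fun z => p.tau z.re :=
  LipOn.re.real_comp (fun _ _ => p.abs_tau_sub_le (by norm_num) fun _ hj _ _ => p.dsl_le_two hj)
    (by norm_num)

lemma Vf_lip : LipOn S 11 p.Vf := by
  have h : LipOn S (5 * 2) fun z => p.Vf z - z.im := by
    refine p.Vf_sub_lip (by linarith [p.κ_le]) (fun m hm => by linarith [p.abs_mu_le hm])
      (by linarith [p.M_le_x, p.x_le]) (by linarith [p.e0_le_x, p.x_le]) ?_
    exact (LipOn.const' 0 (by norm_num)).min ((p.tau_lip.add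
      (((LipOn.const 1).sub LipOn.im).const_mul_le p.lam_pos.le (c' := 1 / 2)
        (by linarith [p.lam_le]))).mono (by norm_num))
  exact (h.add LipOn.im).congr (fun z _ => by ring) |>.mono (by norm_num)

lemma exists_homeo : ∃ F : ℂ ≃ₜ ℂ, ⇑F = p.Fmap := by
  obtain ⟨e1, h1⟩ := exists_homeo_vShear p.Cf_lip (by norm_num) (by norm_num) p.Cf_slope
  obtain ⟨e2, h2⟩ := exists_homeo_hShear p.Hf_lip (by norm_num) (by norm_num) p.Hf_slope
  obtain ⟨e3, h3⟩ := exists_homeo_vShear p.Vf_lip (by norm_num) (by norm_num) p.Vf_slope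
  exact ⟨(e1.trans e2).trans e3, by funext z; simp [h1, h2, h3, Fmap]⟩

/-- The piecewise affine homeomorphism. -/
def F : ℂ ≃ₜ ℂ := p.exists_homeo.choose

lemma F_apply (z : ℂ) : p.F z = p.Fmap z := congrFun p.exists_homeo.choose_spec z

lemma dist_le_abs_add_abs (z w : ℂ) : dist z w ≤ |z.re - w.re| + |z.im - w.im| := by
  rw [dist_eq_norm]; simpa using norm_le_abs_re_add_abs_im (z - w)

lemma dist_vShear_le {f : ℂ → ℝ} {C : ℝ} (hf : LipOn univ C f) (z w : ℂ) :
    dist (vShear f z) (vShear f w) ≤ (1 + C) * dist z w := by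
  have h1 := hf z trivial w trivial; have h2 := LipOn.re (S := univ) z trivial w trivial
  have := dist_le_abs_add_abs (vShear f z) (vShear f w); simp only [vShear] at this ⊢; linarith

lemma dist_hShear_le {f : ℂ → ℝ} {C : ℝ} (hf : LipOn univ C f) (z w : ℂ) :
    dist (hShear f z) (hShear f w) ≤ (1 + C) * dist z w := by
  have h1 := hf z trivial w trivial; have h2 := LipOn.im (S := univ) z trivial w trivial
  have := dist_le_abs_add_abs (hShear f z) (hShear f w); simp only [hShear] at this ⊢; linarith

lemma dist_F_le (z w : ℂ) : dist (p.F z) (p.F w) ≤ 1080 * dist z w := by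
  rw [p.F_apply, p.F_apply, Fmap, Fmap]; have h1 := dist_vShear_le p.Cf_lip z w
  have h2 := dist_hShear_le p.Hf_lip (vShear p.Cf z) (vShear p.Cf w)
  have h3 := dist_vShear_le p.Vf_lip (hShear p.Hf (vShear p.Cf z)) (hShear p.Hf (vShear p.Cf w))
  linarith

lemma isPL_edgeSum {f : ℂ → ℝ} (hf : IsPL f) (n : ℕ) (s t bs bt : ℕ → ℝ) :
    IsPL fun z => edgeSum n s t bs bt (f z) := IsPL.clampSum hf _ _ _ _

lemma isPL_F : IsPL (fun z => p.F z) := by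
  have hL : IsPL fun z : ℂ => p.Lx z.im := (isPL_edgeSum IsPL.im _ _ _ _ _).sub (IsPL.const _)
  have heL : IsPL fun z : ℂ => p.eL z.im := (isPL_edgeSum IsPL.im _ _ _ _ _).sub (IsPL.const _)
  have hR : IsPL fun z : ℂ => p.Rx z.im :=
    (IsPL.const _).add ((isPL_edgeSum IsPL.im _ _ _ _ _).sub (IsPL.const _))
  have heR : IsPL fun z : ℂ => p.eR z.im := (isPL_edgeSum IsPL.im _ _ _ _ _).sub (IsPL.const _)
  have hφ : IsPL fun z : ℂ => p.phi z.re := (isPL_edgeSum IsPL.re _ _ _ _ _).sub (IsPL.const _)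
  have hτ : IsPL fun z : ℂ => p.tau z.re := (isPL_edgeSum IsPL.re _ _ _ _ _).sub (IsPL.const _)
  have hone : ∀ {f : ℂ → ℝ}, IsPL f → IsPL fun z => 1 - f z := fun hf => (IsPL.const 1).sub hf
  have hq : IsPL fun z : ℂ => p.q z.im :=
    ((IsPL.const 0).max (IsPL.im.sub (IsPL.const _))).const_mul _
  have h1 : IsPL fun z : ℂ => 2 * z.im - 1 := (IsPL.im.const_mul 2).sub (IsPL.const 1)
  have hC : IsPL p.Cf := by
    have e : p.Cf = fun z : ℂ => z.im - max 0 (p.h / 2 * (1 - 1 / p.w * (1 - z.re)) -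
        1 / 2 * (1 - z.im)) := by
      funext z; unfold Cf; congr 2; ring
    rw [e]
    exact IsPL.im.sub ((IsPL.const 0).max (((hone ((hone IsPL.re).const_mul _)).const_mul _).sub
      ((hone IsPL.im).const_mul _)))
  have hH : IsPL p.Hf :=
    ((((IsPL.re.add hφ).min (IsPL.re.add (h1.const_mul _))).sub ((hone IsPL.im).const_mul _)).add
      ((IsPL.const 0).min ((hL.add ((hone IsPL.im).const_mul _)).add (IsPL.re.const_mul _)))).add
      ((IsPL.const 0).min ((((hR.sub (IsPL.const 1)).add ((hone IsPL.im).const_mul _)).add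
        (hq.const_mul _)).add ((hone IsPL.re).const_mul _)))
  have htr : ∀ {e m : ℂ → ℝ}, IsPL e → IsPL m → IsPL fun z => truncate (e z) (m z) :=
    fun he hm => hm.neg.max (hm.min he)
  have habs : ∀ {e : ℂ → ℝ}, IsPL e → IsPL fun z => |e z| := fun he => by
    simpa only [abs_eq_max_neg] using he.max he.neg
  have hV : IsPL p.Vf :=
    (((((IsPL.const p.a).add (h1.const_mul (p.κ / 2))).add (htr heL (((IsPL.const 0).max
      (hone (IsPL.re.const_mul 4))).const_mul _))).add (htr heR (((IsPL.const 0).max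
      ((IsPL.re.const_mul 4).sub (IsPL.const 1))).const_mul _))).add
      ((IsPL.const 0).min (hτ.add ((hone IsPL.im).const_mul _)))).add
      (((IsPL.const 0).max ((hone ((habs (IsPL.re.sub (IsPL.const _))).const_mul 2)).sub h1)).const_mul _)
  have e : (fun z => p.F z) = fun z => p.Fmap z := funext p.F_apply
  rw [e]; have hv : ∀ {f : ℂ → ℝ}, IsPL f → IsPL (vShear f) := fun hf => IsPL.re.mk hf
  have hh : ∀ {f : ℂ → ℝ}, IsPL f → IsPL (hShear f) := fun hf => hf.mk IsPL.im
  exact (hv hV).comp ((hh hH).comp (hv hC))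

end Par

namespace Par

variable (p : Par)

/-- The vertices of the model. -/
def vP0 : ℂ := ⟨p.p0, p.a + p.e0⟩
def vP (i : ℕ) : ℂ := ⟨p.ptx i, p.Y⟩
def vL (m : ℕ) : ℂ := ⟨p.lmx m, p.lmy m⟩
def vQ (i : ℕ) : ℂ := if i = 0 then p.vL 1 else ⟨p.qx i, p.Y - p.dep i⟩

/-- The images of the edges. -/
def tlo : Slot → ℂ
  | .bot b => if b then p.vP0 else p.vQ 0
  | .top b m => if b then p.vQ (m + 1) else p.vP m
  | .right m => p.vQ (p.g - m)
  | .left m => p.vL m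
def thi : Slot → ℂ
  | .bot b => if b then p.vQ p.g else p.vP0
  | .top b m => if b then p.vP (m + 1) else p.vQ (m + 1)
  | .right m => p.vQ (p.g - m - 1)
  | .left m => p.vL (m + 2)

lemma g_div : p.g / 2 = p.k := by have := p.hNk; have := p.hkN; unfold g; omega
lemma g_sub_div : (p.g - 1) / 2 = p.N := by have := p.hNk; have := p.hkN; unfold g; omega

/-- Heights along the sides. -/
def Ry (y : ℝ) : ℝ := p.A y + p.eR y
def Ly (y : ℝ) : ℝ := p.A y + p.eL y

lemma A_lerp (u v θ : ℝ) : p.A (u + θ * (v - u)) = p.A u + θ * (p.A v - p.A u) := by unfold A; ring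

lemma Rx_edge {j : ℕ} (hj : j < p.N) {θ : ℝ} (hθ : θ ∈ Icc 0 1) :
    p.Rx (1 - (1 / 2) ^ (j + 1) + θ * (1 / 2) ^ (j + 2)) = p.rqx j + θ * (p.rqx (j + 1) - p.rqx j) := by
  unfold Rx; rw [p.rightSum_edge _ _ hj hθ]; ring

lemma half_succ (j : ℕ) : (1 / 2 : ℝ) ^ (j + 1) = 1 / 2 * (1 / 2) ^ j := by rw [pow_succ]; ring

lemma Ry_edge {j : ℕ} (hj : j < p.N) {θ : ℝ} (hθ : θ ∈ Icc 0 1) :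
    p.Ry (1 - (1 / 2) ^ (j + 1) + θ * (1 / 2) ^ (j + 2)) = p.rqy j + θ * (p.rqy (j + 1) - p.rqy j) := by
  unfold Ry eR; rw [p.rightSum_edge _ _ hj hθ, p.re_zero, re_, re_]; unfold A; ring

lemma Rx_last {θ : ℝ} (hθ : θ ∈ Icc 0 1) :
    p.Rx (1 - p.h + θ * p.h) = p.rqx p.N + θ * (p.ptx p.k - p.rqx p.N) := by
  unfold Rx; rw [p.rightSum_last _ _ hθ]; ring

lemma Ry_last {θ : ℝ} (hθ : θ ∈ Icc 0 1) :
    p.Ry (1 - p.h + θ * p.h) = p.rqy p.N + θ * (p.Y - p.rqy p.N) := by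
  unfold Ry eR; rw [p.rightSum_last _ _ hθ, p.re_zero, re_, ← p.A_one]; unfold h; unfold A; ring

lemma Lx_edge {m : ℕ} (hm : m < p.N) {θ : ℝ} (hθ : θ ∈ Icc 0 1) :
    p.Lx (leftNode m + θ * (leftNode (m + 2) - leftNode m)) =
      p.lmx m + θ * (p.lmx (m + 2) - p.lmx m) := by
  unfold Lx; rw [p.leftSum_edge _ hm hθ, p.lmx_zero]; ring

lemma Ly_edge {m : ℕ} (hm : m < p.N) {θ : ℝ} (hθ : θ ∈ Icc 0 1) :
    p.Ly (leftNode m + θ * (leftNode (m + 2) - leftNode m)) =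
      p.lmy m + θ * (p.lmy (m + 2) - p.lmy m) := by
  unfold Ly eL; rw [p.leftSum_edge _ hm hθ, p.le_zero, p.A_lerp, le_, le_]; ring

lemma Lx_last {θ : ℝ} (hθ : θ ∈ Icc 0 1) :
    p.Lx (leftNode p.N + θ * (leftNode (p.N + 1) - leftNode p.N)) =
      p.lmx p.N + θ * (p.lmx (p.N + 1) - p.lmx p.N) := by
  unfold Lx; rw [p.leftSum_last _ hθ, p.lmx_zero]; ring

lemma Ly_last {θ : ℝ} (hθ : θ ∈ Icc 0 1) :
    p.Ly (leftNode p.N + θ * (leftNode (p.N + 1) - leftNode p.N)) =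
      p.lmy p.N + θ * (p.lmy (p.N + 1) - p.lmy p.N) := by
  unfold Ly eL; rw [p.leftSum_last _ hθ, p.le_zero, p.A_lerp, le_, le_]; ring

lemma vQ_right {j : ℕ} (hj : j < p.g) : p.vQ (p.g - j) = ⟨p.rqx j, p.rqy j⟩ := by
  unfold vQ; rw [if_neg (by omega), p.rqx_eq hj.le]; congr 1; unfold dep rqy Y
  have e : p.a ^ (p.g + 2) / p.a ^ (p.g - j) = p.a ^ (j + 2) := by
    rw [div_eq_iff (p.apos _).ne', ← pow_add]; congr 1; omega
  rw [e]; ring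

/-! ### The shear in the horizontal direction -/

lemma q_nonneg (y : ℝ) : 0 ≤ p.q y :=
  mul_nonneg (div_nonneg (by linarith [p.w_pos]) p.h_pos.le) (le_max_left _ _)

lemma q_of_le {y : ℝ} (hy : y ≤ 1 - p.h / 2) : p.q y = 0 := by
  unfold q; rw [max_eq_left (by linarith), mul_zero]

lemma q_of_ge {y : ℝ} (hy : 1 - p.h / 2 ≤ y) : p.q y = 2 * p.w / p.h * (y - (1 - p.h / 2)) := by
  unfold q; rw [max_eq_right (by linarith)]

lemma q_le {y : ℝ} (hy : y ≤ 1) : p.q y ≤ p.w := by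
  have hw := p.w_pos; have hh := p.h_pos; rcases le_total y (1 - p.h / 2) with h | h
  · rw [p.q_of_le h]; exact hw.le
  · rw [p.q_of_ge h, div_mul_eq_mul_div, div_le_iff₀ hh]; nlinarith

lemma rL_nonpos {y : ℝ} (hy : y ∈ Icc (1 / 2 : ℝ) 1) : p.rL y ≤ 0 := by
  unfold rL; linarith [p.Lx_le hy]

lemma le_rL {y : ℝ} (hy : y ∈ Icc (1 / 2 : ℝ) 1) : -(p.bump / 2) ≤ p.rL y := by
  unfold rL; have := p.le_Lx hy; nlinarith [p.apos p.g, hy.2]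

lemma le_rR {y : ℝ} (hy : y ∈ Icc (1 / 2 : ℝ) 1) : -p.bump ≤ p.rR y := by
  unfold rR; have h1 := p.ptx_le_Rx hy.2; rw [p.ptx_k] at h1
  have := mul_nonneg p.slack_nonneg (p.q_nonneg y); nlinarith [p.apos p.g, hy.2]

lemma rR_one : p.rR 1 = -(p.lam * p.w) := by
  have hh := p.h_pos.ne'; have hw := p.w_pos.ne'
  have e : p.q 1 = p.w := by rw [p.q_of_ge (by linarith [p.h_pos])]; field_simp; ring
  unfold rR; rw [e, p.Rx_one, phiw]; field_simp; ring

lemma rR_add_nonpos {y : ℝ} (hy : y ∈ Icc (1 / 2 : ℝ) 1) : p.rR y + p.lam * p.q y ≤ 0 := by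
  have hh := p.h_pos
  have h0 : ∀ y ∈ Icc (1 / 2 : ℝ) 1, p.Rx y - 1 + p.a ^ p.g * (1 - y) ≤ 0 := fun y hy => by
    have := p.Rx_le hy.1; nlinarith [p.apos p.g, hy.1]
  rcases le_total y (1 - p.h / 2) with h | h
  · unfold rR; rw [p.q_of_le h]; linarith [h0 y hy]
  · -- affine on the last edge
    have hR : ∀ y ∈ Icc (1 - p.h) 1, p.Rx y = p.rqx p.N + (y - (1 - p.h)) / p.h * (p.ptx p.k - p.rqx p.N) := by
      intro y hy
      have hθ : (y - (1 - p.h)) / p.h ∈ Icc (0 : ℝ) 1 :=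
        ⟨div_nonneg (by linarith [hy.1]) hh.le, by rw [div_le_one hh]; linarith [hy.2]⟩
      rw [← p.Rx_last hθ]; congr 1; field_simp; ring
    have h1 := h0 (1 - p.h / 2) ⟨by linarith [p.h_le], by linarith⟩; have h2 := p.rR_one
    unfold rR at h2 ⊢; have eq1 : p.q 1 = p.w := by rw [p.q_of_ge (by linarith)]; field_simp; ring
    rw [hR _ ⟨by linarith, by linarith⟩] at h1; rw [hR 1 ⟨by linarith, le_rfl⟩, eq1] at h2
    rw [hR y ⟨by linarith, hy.2⟩, p.q_of_ge h]; set t := 2 / p.h * (y - (1 - p.h / 2)) with ht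
    have t1 : t ≤ 1 := by rw [ht, div_mul_eq_mul_div, div_le_one hh]; linarith [hy.2]
    have ey : y = 1 - p.h / 2 + t * (p.h / 2) := by rw [ht]; field_simp; ring
    have e1 : (1 - p.h / 2 - (1 - p.h)) / p.h = 1 / 2 := by field_simp; ring
    have e2 : (1 - (1 - p.h)) / p.h = 1 := by field_simp; ring
    have e3 : (y - (1 - p.h)) / p.h = 1 / 2 + t / 2 := by rw [ey]; field_simp; ring
    have e4 : 2 * p.w / p.h * (y - (1 - p.h / 2)) = t * p.w := by rw [ht]; ring
    rw [e1] at h1; rw [e2] at h2; rw [e3, e4]; rw [ey]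
    have h3 : p.a ^ p.g * (1 - (1 - p.h / 2)) = p.a ^ p.g * p.h / 2 := by ring
    have h4 := mul_le_mul_of_nonneg_left h1 (sub_nonneg.2 t1)
    have h5 : t * (p.rqx p.N + 1 * (p.ptx p.k - p.rqx p.N) - 1 + p.a ^ p.g * (1 - 1) +
      (1 - p.phiw / p.w - p.lam) * p.w) = t * -(p.lam * p.w) := by rw [h2]
    linarith

lemma H_left {y : ℝ} (hy : y ∈ Icc (1 / 2 : ℝ) 1) : p.Hf ⟨0, y⟩ = p.Lx y := by
  have h1 := p.rL_nonpos hy; have h2 := p.le_rR hy; have h3 := p.bump_le_lam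
  have h4 : 0 ≤ p.M * (2 * y - 1) := mul_nonneg p.M_pos.le (by linarith [hy.1]); simp only [Hf]
  rw [p.phi_zero, min_eq_left (by linarith), mul_zero, min_eq_right (by linarith),
    min_eq_left (by linarith)]
  unfold rL; ring

lemma H_right {y : ℝ} (hy : y ∈ Icc (1 / 2 : ℝ) 1) : p.Hf ⟨1 - p.q y, y⟩ = p.Rx y := by
  have hw := p.w_pos; have hh := p.h_pos; have hq := p.q_le hy.2; have hq0 := p.q_nonneg y
  have h1 := p.le_rL hy; have h3 := p.bump_le_lam; have h5 := p.rR_add_nonpos hy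
  have e : p.phi (1 - p.q y) = p.q y / p.w * p.phiw := by
    rw [← p.phi_last ⟨div_nonneg hq0 hw.le, by rwa [div_le_one hw]⟩, div_mul_cancel₀ _ hw.ne']
  have h4 : p.q y / p.w * p.phiw ≤ p.M * (2 * y - 1) := by
    have h6 : p.q y / p.w ≤ 2 * y - 1 := by
      rcases le_total y (1 - p.h / 2) with h | h
      · rw [p.q_of_le h, zero_div]; linarith [hy.1]
      · rw [p.q_of_ge h]
        have : 2 * p.w / p.h * (y - (1 - p.h / 2)) / p.w = 2 / p.h * (y - (1 - p.h / 2)) := by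
          field_simp
        rw [this, div_mul_eq_mul_div, div_le_iff₀ hh]; nlinarith [hy.2, p.h_le]
    have := mul_le_mul h6 p.phiw_le p.phiw_nonneg (by linarith [hy.1]); linarith
  have h7 : p.bump / 2 ≤ p.lam * (1 - p.q y) := by
    have : (1 : ℝ) / 2 ≤ 1 - p.q y := by linarith [p.w_le]
    nlinarith [p.lam_pos]
  simp only [Hf]
  rw [e, min_eq_left (by linarith), min_eq_left (by linarith), min_eq_right (by linarith)]
  unfold rR; ring

lemma H_bot {x : ℝ} (hx : x ∈ Icc 0 1) : p.Hf ⟨x, 1 / 2⟩ = x - p.a ^ p.g / 2 := by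
  have e1 : p.rL (1 / 2) = 0 := by unfold rL; rw [p.Lx_half]; ring
  have e2 : p.rR (1 / 2) = 0 := by
    unfold rR; rw [p.Rx_half, p.rqx_zero, p.q_of_le (by linarith [p.h_le])]; ring
  have h0 := (p.phi_mem hx).1; have h1 := mul_nonneg p.lam_pos.le hx.1
  have h2 := mul_nonneg p.lam_pos.le (sub_nonneg.2 hx.2); simp only [Hf]
  rw [e1, e2, min_eq_right (by linarith), min_eq_left (by linarith), min_eq_left (by linarith)]
  ring

lemma H_top {x : ℝ} (hx : x ∈ Icc (0 : ℝ) (1 - p.w)) : p.Hf ⟨x, 1⟩ = x + p.phi x := by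
  have e1 : p.rL 1 = 0 := by unfold rL; rw [p.Lx_one]; ring
  have h0 := (p.phi_mem (t := x) ⟨hx.1, by linarith [hx.2, p.w_pos]⟩).2
  have h1 := mul_nonneg p.lam_pos.le hx.1; have h2 := mul_nonneg p.lam_pos.le (sub_nonneg.2 hx.2)
  simp only [Hf]
  rw [e1, p.rR_one, min_eq_left (by linarith), min_eq_left (by linarith), min_eq_left (by linarith)]
  ring

/-! ### The shear in the vertical direction -/

lemma V_left {X y : ℝ} (hy : y ∈ Icc (1 / 2 : ℝ) 1) (hX : X ≤ -(p.a ^ p.g * (1 - y))) :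
    p.Vf ⟨X, y⟩ = p.Ly y := by
  have h0 := p.apos p.g; have hX0 : X ≤ 0 := by nlinarith [hy.2]
  have h1 := p.a_pow_g_le'
  have hb : p.bottom ⟨X, y⟩ = 0 := by
    have h2 : (p.a ^ p.g - 1) * (2 * y - 1) ≤ 0 :=
      mul_nonpos_of_nonpos_of_nonneg (by linarith) (by linarith [hy.1])
    have := neg_le_abs (X - p.p0); refine max_eq_left ?_; unfold p0 at this ⊢; linarith
  have hm : p.M ≤ p.M * max 0 (1 - 4 * X) :=
    le_mul_of_one_le_right p.M_pos.le (le_max_of_le_right (by linarith))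
  simp only [Vf]
  rw [hb, truncate_of_abs_le ((abs_le.2 (p.eL_mem hy)).trans hm), max_eq_left (by linarith : 4 * X - 1 ≤ 0),
    mul_zero, truncate_zero, p.tau_of_nonpos hX0, min_eq_left]
  · unfold Ly; ring
  · have := mul_nonneg p.lam_pos.le (sub_nonneg.2 hy.2); linarith

lemma half_le_ptx : 1 / 2 ≤ p.ptx p.k := by
  have h1 := p.ptx_mono p.hk; have h2 := p.ptx_succ 0; rw [p.ptx_zero] at h2; norm_num at h2
  linarith [p.half_lt]

lemma V_right {X y : ℝ} (hy : y ∈ Icc (1 / 2 : ℝ) 1) (hX : p.Rx y ≤ X) : p.Vf ⟨X, y⟩ = p.Ry y := by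
  have hXk := (p.ptx_le_Rx hy.2).trans hX; have h2 := p.half_le_ptx
  have hb : p.bottom ⟨X, y⟩ = 0 := by
    have h3 := p.le_Rx_sub hy.1; rw [p.Rx_half, p.rqx_zero] at h3; have := le_abs_self (X - p.p0)
    refine max_eq_left ?_; unfold p0 at this ⊢; linarith
  have hm : p.M ≤ p.M * max 0 (4 * X - 1) :=
    le_mul_of_one_le_right p.M_pos.le (le_max_of_le_right (by linarith))
  have he : |p.eR y| ≤ p.M := by
    have := p.eR_mem hy; exact abs_le.2 ⟨this.1, this.2.trans p.M_pos.le⟩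
  simp only [Vf]
  rw [hb, truncate_of_abs_le (he.trans hm), max_eq_left (by linarith : 1 - 4 * X ≤ 0),
    mul_zero, truncate_zero, p.tau_of_ge hXk, min_eq_left]
  · unfold Ry; ring
  · have := mul_nonneg p.lam_pos.le (sub_nonneg.2 hy.2); linarith

lemma V_bot (X : ℝ) : p.Vf ⟨X, 1 / 2⟩ = p.a + p.e0 * max 0 (1 - 2 * |X - p.p0|) := by
  have h := (p.tau_mem X).1; have h1 : p.depth ≤ p.lam / 2 := p.depth_le
  have hb : p.bottom ⟨X, 1 / 2⟩ = max 0 (1 - 2 * |X - p.p0|) := by simp [bottom]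
  simp only [Vf]
  rw [hb, p.eL_half, p.eR_half, zero_truncate (mul_nonneg p.M_pos.le (le_max_left _ _)),
    zero_truncate (mul_nonneg p.M_pos.le (le_max_left _ _)), p.A_half, min_eq_left (by linarith)]
  ring

lemma V_top (X : ℝ) : p.Vf ⟨X, 1⟩ = p.Y + p.tau X := by
  have h := (p.tau_mem X).2
  have hb : p.bottom ⟨X, 1⟩ = 0 := max_eq_left (by simp only; linarith [abs_nonneg (X - p.p0)])
  simp only [Vf]
  rw [hb, p.eL_one, p.eR_one, zero_truncate (mul_nonneg p.M_pos.le (le_max_left _ _)),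
    zero_truncate (mul_nonneg p.M_pos.le (le_max_left _ _)), p.A_one, min_eq_right (by linarith)]
  ring

/-! ### The shear at the corner -/

lemma C_of_le {x y : ℝ} (h : p.h / 2 * (1 - (1 - x) / p.w) ≤ (1 - y) / 2) : p.Cf ⟨x, y⟩ = y := by
  simp only [Cf]; rw [max_eq_left (by linarith)]; ring

lemma C_of_left {x y : ℝ} (hx : x ≤ 1 - p.w) (hy : y ≤ 1) : p.Cf ⟨x, y⟩ = y := by
  refine p.C_of_le ?_; have h1 : 1 ≤ (1 - x) / p.w := by rw [le_div_iff₀ p.w_pos]; linarith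
  nlinarith [p.h_pos]

lemma C_of_low {x y : ℝ} (hx : x ≤ 1) (hy : y ≤ 1 - p.h) : p.Cf ⟨x, y⟩ = y := by
  refine p.C_of_le ?_; have h1 : 0 ≤ (1 - x) / p.w := div_nonneg (by linarith) p.w_pos.le
  nlinarith [p.h_pos]

lemma C_top {x : ℝ} (hx : 1 - p.w ≤ x) : p.Cf ⟨x, 1⟩ = 1 - p.h / 2 * (1 - (1 - x) / p.w) := by
  simp only [Cf]; rw [max_eq_right]
  · ring
  · have h1 : (1 - x) / p.w ≤ 1 := by rw [div_le_iff₀ p.w_pos]; linarith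
    nlinarith [p.h_pos]

lemma F_of {x y y1 X : ℝ} (hC : p.Cf ⟨x, y⟩ = y1) (hH : p.Hf ⟨x, y1⟩ = X) :
    p.F ⟨x, y⟩ = ⟨X, p.Vf ⟨X, y1⟩⟩ := by
  rw [p.F_apply]; simp only [Fmap, vShear, hShear, hC, hH]

lemma F_left {y : ℝ} (hy : y ∈ Icc (1 / 2 : ℝ) 1) : p.F ⟨0, y⟩ = ⟨p.Lx y, p.Ly y⟩ := by
  rw [p.F_of (p.C_of_left (by linarith [p.w_le]) hy.2) (p.H_left hy), p.V_left hy (p.Lx_le hy)]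

lemma F_bot {x : ℝ} (hx : x ∈ Icc 0 1) :
    p.F ⟨x, 1 / 2⟩ = ⟨x - p.a ^ p.g / 2, p.a + p.e0 * (1 - 2 * |x - 1 / 2|)⟩ := by
  rw [p.F_of (p.C_of_low hx.2 (by linarith [p.h_le])) (p.H_bot hx), p.V_bot]
  have e : x - p.a ^ p.g / 2 - p.p0 = x - 1 / 2 := by unfold p0; ring
  have : |x - 1 / 2| ≤ 1 / 2 := abs_le.2 ⟨by linarith [hx.1], by linarith [hx.2]⟩
  rw [e, max_eq_right (by linarith)]

lemma F_top {x : ℝ} (hx : x ∈ Icc (0 : ℝ) (1 - p.w)) :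
    p.F ⟨x, 1⟩ = ⟨x + p.phi x, p.Y + p.tau (x + p.phi x)⟩ := by
  rw [p.F_of (p.C_of_left hx.2 le_rfl) (p.H_top hx), p.V_top]

lemma F_right {y : ℝ} (hy : y ∈ Icc (1 / 2 : ℝ) (1 - p.h)) : p.F ⟨1, y⟩ = ⟨p.Rx y, p.Ry y⟩ := by
  have hy' : y ∈ Icc (1 / 2 : ℝ) 1 := ⟨hy.1, by linarith [hy.2, p.h_pos]⟩; have h := p.H_right hy'
  rw [p.q_of_le (by linarith [hy.2, p.h_pos]), sub_zero] at h
  rw [p.F_of (p.C_of_low le_rfl hy.2) h, p.V_right hy' le_rfl]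

/-- The leftover part of the right side. -/
lemma exists_right_slit {y : ℝ} (hy : y ∈ Icc (1 - p.h) 1) :
    ∃ v : ℂ, ((v.re = 1 ∧ v.im ∈ Icc (1 - p.h) 1) ∨ (v.im = 1 ∧ v.re ∈ Icc (1 - p.w) 1)) ∧
      p.F v = ⟨p.Rx y, p.Ry y⟩ := by
  have hh := p.h_pos; have hw := p.w_pos
  have hy' : y ∈ Icc (1 / 2 : ℝ) 1 := ⟨by linarith [hy.1, p.h_le], hy.2⟩; have hH := p.H_right hy'
  rcases le_total y (1 - p.h / 2) with h | h
  · refine ⟨⟨1, 2 * y - 1 + p.h⟩, Or.inl ⟨rfl, by simp only; linarith [hy.1], by simp only; linarith⟩, ?_⟩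
    rw [p.q_of_le h, sub_zero] at hH
    have hC : p.Cf ⟨1, 2 * y - 1 + p.h⟩ = y := by
      simp only [Cf]; rw [sub_self, zero_div, max_eq_right (by linarith [hy.1])]; ring
    rw [p.F_of hC hH, p.V_right hy' le_rfl]
  · have hq := p.q_le hy.2
    refine ⟨⟨1 - p.q y, 1⟩, Or.inr ⟨rfl, by simp only; linarith,
      by simp only; linarith [p.q_nonneg y]⟩, ?_⟩
    have hC : p.Cf ⟨1 - p.q y, 1⟩ = y := by
      rw [p.C_top (by linarith), p.q_of_ge h]; field_simp; ring
    rw [p.F_of hC hH, p.V_right hy' le_rfl]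

/-! ### The edges -/

lemma F_slot {s : Slot} (hs : s.Kept p.g) {t : ℝ} (ht : t ∈ Icc 0 1) :
    p.F (s.at' t) = lineMap (p.tlo s) (p.thi s) t := by
  have hlin : ∀ u v : ℂ, (lineMap u v t : ℂ) =
      ⟨u.re + t * (v.re - u.re), u.im + t * (v.im - u.im)⟩ := fun u v => by
    apply Complex.ext <;> simp [lineMap_apply] <;> ring
  rw [hlin]
  have hat : s.at' t = ⟨s.lo.re + t * (s.hi.re - s.lo.re), s.lo.im + t * (s.hi.im - s.lo.im)⟩ :=
    Complex.ext (s.at'_re t) (s.at'_im t)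
  rw [hat]; have hmin := ht.1; have hmax := ht.2
  have hp2 : ∀ n : ℕ, (0 : ℝ) < (1 / 2) ^ n := fun n => by positivity
  cases s with
  | bot b =>
    have hl1 : p.lmy 1 = p.a := by
      unfold lmy; rw [p.one_sub_sq]; field_simp; ring
    cases b
    · have e : (⟨0 + t * (1 / 2 - 0), 1 / 2 + t * (1 / 2 - 1 / 2)⟩ : ℂ) = ⟨t / 2, 1 / 2⟩ := by
        congr 1 <;> ring
      simp only [Slot.lo, Slot.hi, tlo, thi, vP0, vQ, vL, if_true, Bool.false_eq_true, if_false]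
      rw [e, p.F_bot ⟨by linarith, by linarith⟩, abs_of_nonpos (by linarith), p.lmx_one, hl1]
      unfold p0; congr 1 <;> ring
    · have e : (⟨1 / 2 + t * (1 - 1 / 2), 1 / 2 + t * (1 / 2 - 1 / 2)⟩ : ℂ) =
          ⟨(1 + t) / 2, 1 / 2⟩ := by congr 1 <;> ring
      have hv := p.vQ_right (j := 0) (by unfold g; omega); rw [Nat.sub_zero] at hv
      simp only [Slot.lo, Slot.hi, tlo, thi, if_true, hv, vP0]
      have hr : p.rqy 0 = p.a := by
        unfold rqy; have := p.one_sub_pos.ne'; field_simp; ring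
      rw [e, p.F_bot ⟨by linarith, by linarith⟩, abs_of_nonneg (by linarith), p.rqx_zero, hr]
      unfold p0; congr 1 <;> ring
  | top b m =>
    have hm : m < p.k := by have : m < p.g / 2 := hs; rwa [p.g_div] at this
    have key : ∀ θ ∈ Icc (0 : ℝ) 1, p.F ⟨1 - (1 / 2) ^ m + θ * (1 / 2) ^ (m + 1), 1⟩ =
        ⟨p.ptx m + θ * p.a ^ (m + 1), p.Y + p.tau (p.ptx m + θ * p.a ^ (m + 1))⟩ := by
      intro θ hθ; have h1 : (1 / 2 : ℝ) ^ m ≤ 1 := pow_le_one₀ (by norm_num) (by norm_num)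
      have h2 : p.w ≤ (1 / 2) ^ (m + 1) := pow_le_pow_of_le_one (by norm_num) (by norm_num) hm
      have h3 := half_succ m; have h4 := hp2 m
      rw [p.F_top ⟨by nlinarith [hθ.1], by nlinarith [hθ.2]⟩, p.phi_edge hm hθ]
    have hd0 : p.dentx (2 * m) = p.ptx m := by unfold dentx; rw [if_pos (by omega)]; congr 1; omega
    have hd1 : p.dentx (2 * m + 1) = p.qx (m + 1) := by
      unfold dentx; rw [if_neg (by omega)]; congr 1; omega
    have hd2 : p.dentx (2 * m + 1 + 1) = p.ptx (m + 1) := by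
      unfold dentx; rw [if_pos (by omega)]; congr 1; omega
    have he0 : p.denty (2 * m) = 0 := by unfold denty; rw [if_pos (by omega)]
    have he1 : p.denty (2 * m + 1) = -p.dep (m + 1) := by
      unfold denty; rw [if_neg (by omega)]; congr 2; omega
    have he2 : p.denty (2 * m + 1 + 1) = 0 := by unfold denty; rw [if_pos (by omega)]
    have hq := p.qx_succ m; have hpt := p.ptx_succ m; cases b
    · have e : (⟨1 - 1 * (1 / 2) ^ m + t * (1 - 3 / 4 * (1 / 2) ^ m - (1 - 1 * (1 / 2) ^ m)),
          1 + t * (1 - 1)⟩ : ℂ) = ⟨1 - (1 / 2) ^ m + t / 2 * (1 / 2) ^ (m + 1), 1⟩ := by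
        rw [half_succ]; congr 1 <;> ring
      simp only [Slot.lo, Slot.hi, tlo, thi, vP, vQ, if_neg (Nat.succ_ne_zero m), Bool.false_eq_true,
        if_false]
      have ht' := p.tau_edge (j := 2 * m) (by omega) ht; rw [hd0, hd1, he0, he1] at ht'
      have e' : p.ptx m + t / 2 * p.a ^ (m + 1) = p.ptx m + t * (p.qx (m + 1) - p.ptx m) := by
        rw [hq]; ring
      rw [e, key _ ⟨by linarith, by linarith⟩, e', ht']; congr 1; ring
    · have e : (⟨1 - 3 / 4 * (1 / 2) ^ m + t * (1 - 1 / 2 * (1 / 2) ^ m - (1 - 3 / 4 * (1 / 2) ^ m)),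
          1 + t * (1 - 1)⟩ : ℂ) = ⟨1 - (1 / 2) ^ m + (1 + t) / 2 * (1 / 2) ^ (m + 1), 1⟩ := by
        rw [half_succ]; congr 1 <;> ring
      simp only [Slot.lo, Slot.hi, tlo, thi, vP, vQ, if_neg (Nat.succ_ne_zero m), if_true]
      have ht' := p.tau_edge (j := 2 * m + 1) (by omega) ht; rw [hd1, hd2, he1, he2] at ht'
      have e' : p.ptx m + (1 + t) / 2 * p.a ^ (m + 1) =
          p.qx (m + 1) + t * (p.ptx (m + 1) - p.qx (m + 1)) := by
        rw [hpt, hq]; ring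
      rw [e, key _ ⟨by linarith, by linarith⟩, e', ht']; congr 1; ring
  | right m =>
    have hm : m < p.N := by have : m < (p.g - 1) / 2 := hs; rwa [p.g_sub_div] at this
    have e : (⟨1 + t * (1 - 1), 1 - (1 / 2) ^ (m + 1) +
        t * (1 - (1 / 2) ^ (m + 2) - (1 - (1 / 2) ^ (m + 1)))⟩ : ℂ) =
        ⟨1, 1 - (1 / 2) ^ (m + 1) + t * (1 / 2) ^ (m + 2)⟩ := by
      rw [half_succ (m + 1)]; congr 1 <;> ring
    have hv := p.vQ_right (j := m) (by unfold g; omega)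
    have hv' := p.vQ_right (j := m + 1) (by unfold g; omega); rw [← Nat.sub_sub] at hv'
    simp only [Slot.lo, Slot.hi, tlo, thi, hv, hv']
    have h1 : (1 / 2 : ℝ) ^ (m + 1) ≤ 1 / 2 := by
      rw [half_succ]; have : (1 / 2 : ℝ) ^ m ≤ 1 := pow_le_one₀ (by norm_num) (by norm_num)
      linarith
    have h2 : p.h ≤ (1 / 2) ^ (m + 2) := pow_le_pow_of_le_one (by norm_num) (by norm_num) (by omega)
    have h3 := half_succ (m + 1); have h4 := hp2 (m + 2)
    rw [e, p.F_right ⟨by nlinarith, by nlinarith⟩, p.Rx_edge hm ht, p.Ry_edge hm ht]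
  | left m =>
    have hm : m < p.N := by have : m < (p.g - 1) / 2 := hs; rwa [p.g_sub_div] at this
    have h1 := leftNode_mem m; have h2 := leftNode_mem (m + 2)
    simp only [Slot.lo, Slot.hi, tlo, thi, vL]
    rw [sub_self, mul_zero, add_zero, p.F_left ⟨le_lerp h1.1 h2.1 ht, lerp_le h1.2 h2.2 ht⟩,
      p.Lx_edge hm ht, p.Ly_edge hm ht]

end Par

/-! ### Connectedness of subsets of the plane -/

lemma isPreconnected_punctured_ball (v : ℂ) {r : ℝ} (hr : 0 < r) :
    IsPreconnected (ball v r \ {v}) := by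
  have e : ball v r \ {v} = (fun z => v + Complex.exp z) '' {z | z.re < Real.log r} := by
    ext w; constructor
    · rintro ⟨h1, h2⟩; have hw : w - v ≠ 0 := sub_ne_zero.2 h2
      refine ⟨Complex.log (w - v), ?_, by simp [Complex.exp_log hw]⟩
      rw [mem_ofPred_eq, Complex.log_re]
      exact Real.log_lt_log (norm_pos_iff.2 hw) (by rwa [← dist_eq_norm])
    · rintro ⟨z, hz, rfl⟩; refine ⟨?_, by simp [Complex.exp_ne_zero]⟩
      rw [mem_ball, dist_eq_norm, add_sub_cancel_left, Complex.norm_exp,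
        ← Real.lt_log_iff_exp_lt hr]
      exact hz
  rw [e]; exact (convex_halfSpace_re_lt _).isPreconnected.image _ (by fun_prop)

lemma IsPreconnected.diff_singleton_of_isOpen {S : Set ℂ} (h : IsPreconnected S) (hS : IsOpen S)
    (v : ℂ) : IsPreconnected (S \ {v}) := by
  by_cases hv : v ∈ S
  swap
  · rwa [sdiff_singleton_eq_self hv]
  obtain ⟨r, hr, hb⟩ := isOpen_iff.1 hS v hv; have hD := isPreconnected_punctured_ball v hr
  have key : ∀ A B : Set ℂ, IsOpen A → IsOpen B → S \ {v} ⊆ A ∪ B → (S \ {v} ∩ B).Nonempty →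
      ball v r \ {v} ⊆ A → (S \ {v} ∩ (A ∩ B)).Nonempty := by
    rintro A B hA hB hAB ⟨x, hx, hxB⟩ hDA
    obtain ⟨y, hy, hyA, hyB⟩ := h (A ∪ ball v r) B (hA.union isOpen_ball) hB (fun z hz => by
        by_cases e : z = v
        · exact Or.inl (Or.inr (e ▸ mem_ball_self hr))
        · rcases hAB ⟨hz, e⟩ with h | h
          · exact Or.inl (Or.inl h)
          · exact Or.inr h) ⟨v, hv, Or.inr (mem_ball_self hr)⟩ ⟨x, hx.1, hxB⟩
    by_cases e : y = v
    · subst e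
      have : ∀ᶠ z in 𝓝[≠] y, z ∈ B ∩ ball y r :=
        mem_nhdsWithin_of_mem_nhds ((hB.inter isOpen_ball).mem_nhds ⟨hyB, mem_ball_self hr⟩)
      obtain ⟨z, ⟨hz1, hz2⟩, hz3⟩ := (this.and self_mem_nhdsWithin).exists
      exact ⟨z, ⟨hb hz2, hz3⟩, hDA ⟨hz2, hz3⟩, hz1⟩
    · refine ⟨y, ⟨hy, e⟩, ?_, hyB⟩; rcases hyA with h | h
      · exact h
      · exact hDA ⟨h, e⟩
  rintro A B hA hB hAB h1 h2; by_contra hne; rw [not_nonempty_iff_eq_empty] at hne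
  have hsub := sdiff_subset_sdiff_left (t := {v}) hb
  rcases (isPreconnected_iff_subset_of_disjoint.1 hD) A B hA hB (hsub.trans hAB)
    (subset_eq_empty (inter_subset_inter_left _ hsub) hne) with h | h
  · exact (key A B hA hB hAB h2 h).ne_empty hne
  · rw [union_comm] at hAB; rw [inter_comm A] at hne; exact (key B A hB hA hAB h1 h).ne_empty hne

lemma IsPreconnected.diff_finite {S : Set ℂ} (h : IsPreconnected S) (hS : IsOpen S)
    {V : Set ℂ} (hV : V.Finite) : IsPreconnected (S \ V) := by
  induction V, hV using Set.Finite.induction_on with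
  | empty => simpa using h
  | @insert v V _ hV ih =>
    rw [insert_eq, union_comm, ← sdiff_sdiff]
    exact ih.diff_singleton_of_isOpen (hS.sdiff hV.isClosed) v

lemma isPreconnected_compl_rect : IsPreconnected rectᶜ := by
  have e : rectᶜ = {z : ℂ | z.re < 0} ∪ {z | 1 < z.im} ∪ {z | 1 < z.re} ∪ {z | z.im < 1 / 2} := by
    ext z; simp only [rect, mem_compl_iff, mem_ofPred_eq, mem_Icc, mem_union]; constructor
    · intro h; by_contra! h'; exact h ⟨⟨h'.1.1.1, h'.1.2⟩, h'.2, h'.1.1.2⟩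
    · rintro (((h | h) | h) | h) ⟨⟨_, _⟩, _, _⟩ <;> linarith
  rw [e]
  refine IsPreconnected.union ⟨2, 0⟩ ?_ ?_ (IsPreconnected.union ⟨2, 2⟩ ?_ ?_
    (IsPreconnected.union ⟨-1, 2⟩ ?_ ?_ (convex_halfSpace_re_lt _).isPreconnected
    (convex_halfSpace_im_gt _).isPreconnected) (convex_halfSpace_re_gt _).isPreconnected)
    (convex_halfSpace_im_lt _).isPreconnected <;> norm_num

lemma isPreconnected_openRect : IsPreconnected openRect :=
  (((convex_Ioo _ _).linear_preimage reLm).inter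
    ((convex_Ioo _ _).linear_preimage imLm)).isPreconnected

/-! ### Triangles -/

/-- Twice the signed area of a triangle. -/
def cr (u v z : ℂ) : ℝ := (v.re - u.re) * (z.im - u.im) - (v.im - u.im) * (z.re - u.re)

lemma cr_swap (u v z : ℂ) : cr v u z = -cr u v z := by unfold cr; ring

lemma cr_rotate (u v w : ℂ) : cr v w u = cr u v w := by unfold cr; ring

lemma cr_add (u v w z : ℂ) : cr u v z + cr v w z + cr w u z = cr u v w := by unfold cr; ring

lemma continuous_cr (u v : ℂ) : Continuous (cr u v) := by
  have := Complex.continuous_re; have := Complex.continuous_im; unfold cr; fun_prop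

lemma cr_of_mem_openSegment {u v z : ℂ} (h : z ∈ openSegment ℝ u v) (w : ℂ) :
    cr u v z = 0 ∧ ∃ t ∈ Ioo (0 : ℝ) 1, cr v w z = (1 - t) * cr u v w ∧ cr w u z = t * cr u v w := by
  rw [openSegment_eq_image'] at h; obtain ⟨t, ht, rfl⟩ := h
  refine ⟨?_, t, ht, ?_, ?_⟩ <;> simp [cr] <;> ring

lemma mem_convexHull_iff_cr {u v w : ℂ} (h : 0 < cr u v w) {z : ℂ} :
    z ∈ convexHull ℝ {u, v, w} ↔ 0 ≤ cr u v z ∧ 0 ≤ cr v w z ∧ 0 ≤ cr w u z := by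
  constructor
  · intro hz
    have hconv : ∀ a b : ℂ, Convex ℝ {z | 0 ≤ cr a b z} := by
      intro a b x hx y hy s t hs ht hst
      simp only [mem_ofPred_eq, cr, Complex.add_re, Complex.add_im, Complex.real_smul, Complex.mul_re,
        Complex.mul_im, Complex.ofReal_re, Complex.ofReal_im] at hx hy ⊢
      obtain rfl : s = 1 - t := by linarith
      nlinarith [mul_nonneg hs hx, mul_nonneg ht hy]
    have h0 : ∀ a b : ℂ, cr a b a = 0 ∧ cr a b b = 0 := fun a b => ⟨by unfold cr; ring, by unfold cr; ring⟩
    have h1 : 0 ≤ cr v w u := by rw [cr_rotate]; exact h.le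
    have h2 : 0 ≤ cr w u v := by rw [cr_rotate, cr_rotate]; exact h.le
    have := convexHull_min (s := {u, v, w})
      (t := {z | 0 ≤ cr u v z} ∩ ({z | 0 ≤ cr v w z} ∩ {z | 0 ≤ cr w u z}))
      (by
        rintro x (rfl | rfl | rfl)
        · exact ⟨(h0 _ _).1.ge, h1, (h0 _ _).2.ge⟩
        · exact ⟨(h0 _ _).2.ge, (h0 _ _).1.ge, h2⟩
        · exact ⟨h.le, (h0 _ _).2.ge, (h0 _ _).1.ge⟩)
      ((hconv _ _).inter ((hconv _ _).inter (hconv _ _))) hz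
    exact this
  · rintro ⟨h1, h2, h3⟩
    have e : z = ∑ i : Fin 3, (![cr v w z / cr u v w, cr w u z / cr u v w, cr u v z / cr u v w] i) •
        (![u, v, w] i) := by
      have hne := h.ne'
      apply Complex.ext <;>
        simp only [Fin.sum_univ_three, Matrix.cons_val_zero, Matrix.cons_val_one, Matrix.cons_val,
          Complex.add_re, Complex.add_im, Complex.real_smul, Complex.mul_re, Complex.mul_im,
          Complex.ofReal_re, Complex.ofReal_im] <;> field_simp <;> simp only [cr] <;> ring
    rw [e]
    refine (convex_convexHull ℝ _).sum_mem (fun i _ => ?_) ?_ (fun i _ => subset_convexHull _ _ ?_)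
    · fin_cases i <;> simp <;> positivity
    · simp only [Fin.sum_univ_three, Matrix.cons_val_zero, Matrix.cons_val_one, Matrix.cons_val]
      rw [← add_div, ← add_div, div_eq_one_iff_eq h.ne', ← cr_add u v w z]; ring
    · fin_cases i <;> simp

open Classical in
/-- Twice the density of a triangle: `2` inside, `1` on the edges, `0` outside. -/
def wt (u v w z : ℂ) : ℤ := if 0 ≤ cr u v z ∧ 0 ≤ cr v w z ∧ 0 ≤ cr w u z then
    if 0 < cr u v z ∧ 0 < cr v w z ∧ 0 < cr w u z then 2 else 1
  else 0

lemma wt_rotate (u v w z : ℂ) : wt v w u z = wt u v w z := by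
  simp only [wt, and_comm, and_left_comm]

lemma wt_nonneg (u v w z : ℂ) : 0 ≤ wt u v w z := by unfold wt; split_ifs <;> norm_num

lemma wt_pos {u v w : ℂ} (h : 0 < cr u v w) {z : ℂ} (hz : z ∈ convexHull ℝ {u, v, w}) :
    1 ≤ wt u v w z := by
  rw [mem_convexHull_iff_cr h] at hz; unfold wt; rw [if_pos hz]; split_ifs <;> norm_num

lemma wt_of_notMem {u v w : ℂ} (h : 0 < cr u v w) {z : ℂ} (hz : z ∉ convexHull ℝ {u, v, w}) :
    wt u v w z = 0 := by
  rw [mem_convexHull_iff_cr h] at hz; exact if_neg hz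

open Classical in
/-- The side of the line through `u` and `v` on which `z'` lies, if `z` is between `u` and `v`. -/
def sideOf (z z' u v : ℂ) : ℤ :=
  if z ∈ openSegment ℝ u v then (SignType.sign (cr u v z') : ℤ) else 0

lemma sideOf_swap (z z' u v : ℂ) : sideOf z z' v u = -sideOf z z' u v := by
  unfold sideOf; rw [openSegment_symm, cr_swap, Left.sign_neg]; split_ifs <;> simp

lemma wt_eventually {u v w : ℂ} (h : 0 < cr u v w) {z : ℂ} (hu : z ≠ u) (hv : z ≠ v) (hw : z ≠ w) :
    ∀ᶠ z' in 𝓝 z, wt u v w z' = wt u v w z + (sideOf z z' u v + sideOf z z' v w + sideOf z z' w u) := by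
  have hpos : ∀ a b : ℂ, 0 < cr a b z → ∀ᶠ z' in 𝓝 z, 0 < cr a b z' := fun a b h =>
    (continuous_cr a b).continuousAt.eventually (lt_mem_nhds h)
  have hseg : ∀ a b z', cr a b z ≠ 0 → sideOf z z' a b = 0 := fun a b z' h =>
    if_neg fun hz => h (cr_of_mem_openSegment hz 0).1
  have hout : ∀ a b c : ℂ, 0 < cr a b c → cr a b z < 0 → ∀ᶠ z' in 𝓝 z,
      wt a b c z' = wt a b c z + (sideOf z z' a b + sideOf z z' b c + sideOf z z' c a) := by
    intro a b c h hlt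
    have hn : ∀ z', cr a b z' < 0 → wt a b c z' = 0 := fun z' h => if_neg fun h' => absurd h'.1 (not_le.2 h)
    have h1 : z ∉ openSegment ℝ b c := fun hz => by
      obtain ⟨-, t, ht, -, e⟩ := cr_of_mem_openSegment hz a
      rw [show cr b c a = cr a b c from cr_rotate a b c] at e; nlinarith [ht.1]
    have h2 : z ∉ openSegment ℝ c a := fun hz => by
      obtain ⟨-, t, ht, e, -⟩ := cr_of_mem_openSegment hz b
      rw [show cr c a b = cr a b c by unfold cr; ring] at e; nlinarith [ht.2]
    filter_upwards [(continuous_cr a b).continuousAt.eventually (gt_mem_nhds hlt)] with z' hz'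
    rw [hn z' hz', hn z hlt, hseg a b z' hlt.ne, sideOf, sideOf, if_neg h1, if_neg h2]; simp
  have hid : ∀ a b c : ℂ,
      cr c a z * (b.re - a.re) - (z.re - a.re) * cr a b c = (a.re - c.re) * cr a b z ∧
      cr c a z * (b.im - a.im) - (z.im - a.im) * cr a b c = (a.im - c.im) * cr a b z := fun a b c => by
    constructor <;> unfold cr <;> ring
  have hedge : ∀ a b c : ℂ, 0 < cr a b c → cr a b z = 0 → 0 < cr b c z → 0 < cr c a z → ∀ᶠ z' in 𝓝 z,
      wt a b c z' = wt a b c z + (sideOf z z' a b + sideOf z z' b c + sideOf z z' c a) := by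
    intro a b c h h0 h1 h2
    have hm : z ∈ openSegment ℝ a b := by
      rw [openSegment_eq_image']; have hadd := cr_add a b c z
      refine ⟨cr c a z / cr a b c, ⟨by positivity, by rw [div_lt_one h]; linarith⟩, ?_⟩
      have hne := h.ne'
      have := hid a b c; rw [h0] at this
      apply Complex.ext <;> simp <;> field_simp <;> linarith [this.1, this.2]
    filter_upwards [hpos b c h1, hpos c a h2] with z' h1' h2'
    have e1 : wt a b c z = 1 := by
      rw [wt, if_pos ⟨h0.ge, h1.le, h2.le⟩, if_neg (fun h => h.1.ne' h0)]
    rw [hseg b c z' h1.ne', hseg c a z' h2.ne', sideOf, if_pos hm, e1, wt]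
    rcases lt_trichotomy (cr a b z') 0 with h3 | h3 | h3
    · rw [if_neg (fun h => absurd h.1 (not_le.2 h3)), sign_neg h3]; simp
    · rw [if_pos ⟨h3.ge, h1'.le, h2'.le⟩, if_neg (fun h => h.1.ne' h3), h3, sign_zero]; simp
    · rw [if_pos ⟨h3.le, h1'.le, h2'.le⟩, if_pos ⟨h3, h1', h2'⟩, sign_pos h3]; simp
  have rot : ∀ a b c : ℂ, (∀ᶠ z' in 𝓝 z,
      wt a b c z' = wt a b c z + (sideOf z z' a b + sideOf z z' b c + sideOf z z' c a)) → ∀ᶠ z' in 𝓝 z,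
      wt c a b z' = wt c a b z + (sideOf z z' c a + sideOf z z' a b + sideOf z z' b c) := by
    intro a b c h
    filter_upwards [h] with z' h
    rw [← wt_rotate c a b, ← wt_rotate c a b, h]; ring
  have hvert : ∀ a b c : ℂ, 0 < cr a b c → cr a b z = 0 → cr c a z = 0 → z = a := by
    intro a b c h h1 h2
    have e := hid a b c; rw [h1, h2] at e
    refine Complex.ext ?_ ?_ <;> refine sub_eq_zero.1 ((mul_eq_zero.1 ?_).resolve_right h.ne')
    · linarith [e.1]
    · linarith [e.2]
  have hr1 : 0 < cr v w u := by rwa [cr_rotate]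
  have hr2 : 0 < cr w u v := by rwa [cr_rotate, cr_rotate]
  by_cases k1 : cr u v z < 0
  · exact hout u v w h k1
  by_cases k2 : cr v w z < 0
  · exact rot _ _ _ (hout v w u hr1 k2)
  by_cases k3 : cr w u z < 0
  · exact rot _ _ _ (rot _ _ _ (hout w u v hr2 k3))
  rcases (not_lt.1 k1).eq_or_lt' with h1 | h1 <;> rcases (not_lt.1 k2).eq_or_lt' with h2 | h2 <;>
    rcases (not_lt.1 k3).eq_or_lt' with h3 | h3
  · exact absurd (hvert u v w h h1 h3) hu
  · exact absurd (hvert v w u hr1 h2 h1) hv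
  · exact absurd (hvert u v w h h1 h3) hu
  · exact hedge u v w h h1 h2 h3
  · exact absurd (hvert w u v hr2 h3 h2) hw
  · exact rot _ _ _ (hedge v w u hr1 h2 h3 h1)
  · exact rot _ _ _ (rot _ _ _ (hedge w u v hr2 h3 h1 h2))
  · filter_upwards [hpos u v h1, hpos v w h2, hpos w u h3] with z' h1' h2' h3'
    have e : ∀ x, 0 < cr u v x → 0 < cr v w x → 0 < cr w u x → wt u v w x = 2 := fun x k1 k2 k3 => by
      rw [wt, if_pos ⟨k1.le, k2.le, k3.le⟩, if_pos ⟨k1, k2, k3⟩]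
    rw [hseg u v z' h1.ne', hseg v w z' h2.ne', hseg w u z' h3.ne', e z h1 h2 h3, e z' h1' h2' h3']; simp

lemma interior_rect : interior rect = openRect := by
  have e : rect = Icc 0 1 ×ℂ Icc (1 / 2) 1 := rfl
  rw [e, Complex.interior_reProdIm, interior_Icc, interior_Icc]; rfl

/-- Positively oriented triangles whose total boundary lies on the boundary of the image of the
rectangle. -/
structure IsTiling {ι : Type*} (F : ℂ ≃ₜ ℂ) (T : Finset ι) (a b c : ι → ℂ) : Prop where
  pos : ∀ t ∈ T, 0 < cr (a t) (b t) (c t)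
  chain : ∀ φ : ℂ → ℂ → ℤ, (∀ u v, φ v u = -φ u v) →
    (∀ u v, segment ℝ u v ⊆ F '' (rect \ openRect) → φ u v = 0) →
    ∑ t ∈ T, (φ (a t) (b t) + φ (b t) (c t) + φ (c t) (a t)) = 0
  extremal : ∃ t₀ ∈ T, (a t₀).re < (b t₀).re ∧ (c t₀).re < (b t₀).re ∧
    ∀ t ∈ T, t ≠ t₀ → (a t).re < (b t₀).re ∧ (b t).re < (b t₀).re ∧ (c t).re < (b t₀).re

namespace IsTiling

variable {ι : Type*} {F : ℂ ≃ₜ ℂ} {T : Finset ι} {a b c : ι → ℂ} (H : IsTiling F T a b c)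

lemma isCompact_tile (a b c : ι → ℂ) (t : ι) : IsCompact (convexHull ℝ {a t, b t, c t}) :=
  (toFinite _).isCompact_convexHull _

/-- The vertices. -/
def vertices (T : Finset ι) (a b c : ι → ℂ) : Set ℂ := {z | ∃ t ∈ T, z = a t ∨ z = b t ∨ z = c t}

lemma finite_vertices : (vertices T a b c).Finite := by
  refine ((T.finite_toSet.image a).union ((T.finite_toSet.image b).union
    (T.finite_toSet.image c))).subset ?_
  rintro z ⟨t, ht, rfl | rfl | rfl⟩
  · exact Or.inl ⟨t, ht, rfl⟩
  · exact Or.inr (Or.inl ⟨t, ht, rfl⟩)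
  · exact Or.inr (Or.inr ⟨t, ht, rfl⟩)

/-- Twice the number of triangles over a point. -/
def cnt (T : Finset ι) (a b c : ι → ℂ) (z : ℂ) : ℤ := ∑ t ∈ T, wt (a t) (b t) (c t) z

lemma cnt_eventually (h : ∀ t ∈ T, 0 < cr (a t) (b t) (c t)) {z : ℂ} (hz : z ∉ vertices T a b c) :
    ∀ᶠ z' in 𝓝 z, cnt T a b c z' = cnt T a b c z + ∑ t ∈ T,
      (sideOf z z' (a t) (b t) + sideOf z z' (b t) (c t) + sideOf z z' (c t) (a t)) := by
  have : ∀ᶠ z' in 𝓝 z, ∀ t ∈ T, wt (a t) (b t) (c t) z' = wt (a t) (b t) (c t) z +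
      (sideOf z z' (a t) (b t) + sideOf z z' (b t) (c t) + sideOf z z' (c t) (a t)) := by
    rw [eventually_all_finset]
    exact fun t ht => wt_eventually (h t ht) (fun e => hz ⟨t, ht, Or.inl e⟩)
      (fun e => hz ⟨t, ht, Or.inr (Or.inl e)⟩) (fun e => hz ⟨t, ht, Or.inr (Or.inr e)⟩)
  filter_upwards [this] with z' hz'
  rw [cnt, cnt, ← Finset.sum_add_distrib]; exact sum_congr rfl hz'

lemma exists_mem_of_cnt_ne_zero (h : ∀ t ∈ T, 0 < cr (a t) (b t) (c t)) {z : ℂ}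
    (hz : cnt T a b c z ≠ 0) : ∃ t ∈ T, z ∈ convexHull ℝ {a t, b t, c t} := by
  by_contra! hcon; exact hz (Finset.sum_eq_zero fun t ht => wt_of_notMem (h t ht) (hcon t ht))

include H

lemma cnt_constant {S : Set ℂ} (hS : IsPreconnected S) (hV : Disjoint S (vertices T a b c))
    (hB : Disjoint S (F '' (rect \ openRect))) {z w : ℂ} (hz : z ∈ S) (hw : w ∈ S) :
    cnt T a b c z = cnt T a b c w := by
  refine hS.constant (fun x hx => ContinuousAt.continuousWithinAt ?_) hz hw
  refine ContinuousAt.congr (continuousAt_const (y := cnt T a b c x)) ?_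
  filter_upwards [cnt_eventually H.pos (hV.notMem_of_mem_left hx)] with z' hz'
  rw [hz', H.chain (sideOf x z') (fun u v => sideOf_swap _ _ _ _) (fun u v h => if_neg fun hm =>
    hB.notMem_of_mem_left hx (h (openSegment_subset_segment _ _ _ hm))), add_zero]

omit H in
lemma isBounded_image : Bornology.IsBounded (F '' rect) :=
  ((isCompact_of_isClosed_isBounded isClosed_rect
    ((isBounded_Icc (0 : ℝ) 1).reProdIm (isBounded_Icc (1 / 2 : ℝ) 1))).image
      F.continuous).isBounded

lemma cnt_eq_zero {z : ℂ} (hz : z ∉ F '' rect) (hzV : z ∉ vertices T a b c) :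
    cnt T a b c z = 0 := by
  have hbd : Bornology.IsBounded (F '' rect ∪ vertices T a b c ∪
      ⋃ t ∈ T, convexHull ℝ {a t, b t, c t}) :=
    (isBounded_image.union finite_vertices.isBounded).union ((Bornology.isBounded_biUnion T.finite_toSet).2
      fun t _ => (isCompact_tile a b c t).isBounded)
  obtain ⟨w, hw⟩ : ∃ w, w ∉ F '' rect ∪ vertices T a b c ∪
      ⋃ t ∈ T, convexHull ℝ {a t, b t, c t} := by
    by_contra! h; exact NormedSpace.unbounded_univ ℝ ℂ (hbd.subset fun x _ => h x)
  simp only [mem_union, not_or, mem_iUnion, not_exists] at hw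
  have e : (F '' rect)ᶜ = F '' rectᶜ := (image_compl_eq F.bijective).symm
  have hpre : IsPreconnected ((F '' rect)ᶜ \ vertices T a b c) := by
    refine IsPreconnected.diff_finite ?_ (F.isClosed_image.2 isClosed_rect).isOpen_compl finite_vertices
    rw [e]; exact isPreconnected_compl_rect.image _ F.continuous.continuousOn
  rw [H.cnt_constant hpre disjoint_sdiff_left ?_ ⟨hz, hzV⟩ ⟨hw.1.1, hw.1.2⟩]
  · by_contra h; obtain ⟨t, ht, hm⟩ := exists_mem_of_cnt_ne_zero H.pos h; exact hw.2 t ht hm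
  · exact (disjoint_compl_left.mono_right (image_mono sdiff_subset)).mono_left sdiff_subset

lemma cnt_pos {t : ι} (ht : t ∈ T) {z : ℂ} (hz : z ∈ convexHull ℝ {a t, b t, c t}) :
    cnt T a b c z ≠ 0 :=
  (zero_lt_one.trans_le ((wt_pos (H.pos t ht) hz).trans
    (Finset.single_le_sum (f := fun t => wt (a t) (b t) (c t) z) (fun _ _ => wt_nonneg _ _ _ _) ht))).ne'

lemma tile_subset {t : ι} (ht : t ∈ T) : convexHull ℝ {a t, b t, c t} ⊆ F '' rect := by
  intro z hz; by_contra hcon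
  obtain ⟨y, hy, hyz⟩ : ∃ y ∈ convexHull ℝ {a t, b t, c t}, y ≠ z := by
    by_contra! h; have h1 := h (a t) (subset_convexHull _ _ (by simp))
    have h2 := h (b t) (subset_convexHull _ _ (by simp)); have := H.pos t ht; rw [h1, h2] at this
    simp [cr] at this
  have hlim : Tendsto (fun s : ℝ => (lineMap z y s : ℂ)) (𝓝[>] 0) (𝓝 z) := by
    have := ((AffineMap.lineMap_continuous (p := z) (q := y) (R := ℝ)).tendsto 0)
    rw [lineMap_apply_zero] at this; exact this.mono_left nhdsWithin_le_nhds
  have h1 := hlim.eventually ((F.isClosed_image.2 isClosed_rect).isOpen_compl.mem_nhds hcon)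
  have h2 := hlim.eventually (((finite_vertices (T := T) (a := a) (b := b) (c := c)).subset
    (sdiff_subset (t := {z}))).isClosed.isOpen_compl.mem_nhds (fun h => h.2 rfl))
  obtain ⟨s, ⟨h1, h2⟩, hs⟩ := ((h1.and h2).and (Ioo_mem_nhdsGT (zero_lt_one' ℝ))).exists
  have hne : (lineMap z y s : ℂ) ≠ z := by
    rw [Ne, AffineMap.lineMap_eq_left_iff]; exact not_or.2 ⟨hyz.symm, hs.1.ne'⟩
  exact H.cnt_pos ht ((convex_convexHull ℝ _).lineMap_mem hz hy (Ioo_subset_Icc_self hs))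
    (H.cnt_eq_zero h1 fun h => h2 ⟨h, hne⟩)

omit H in
lemma interior_image : interior (F '' rect) = F '' openRect := by
  rw [← F.image_interior, interior_rect]

lemma cnt_eq_two {z : ℂ} (hz : z ∈ F '' openRect) (hzV : z ∉ vertices T a b c) :
    cnt T a b c z = 2 := by
  obtain ⟨t, ht, ha, hc, hother⟩ := H.extremal; have hΔ := H.pos t ht
  have hp : ∀ u v : ℂ, cr u v v = 0 ∧ cr u v u = 0 := fun u v => ⟨by unfold cr; ring, by unfold cr; ring⟩
  let γ : ℝ → ℂ := fun s => lineMap (b t) ((1 / 2 : ℝ) • (a t + c t)) s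
  have hγre : ∀ s, (γ s).re = (b t).re + s * (((a t).re + (c t).re) / 2 - (b t).re) := by
    intro s; simp [γ, lineMap_apply]; ring
  have hγim : ∀ s, (γ s).im = (b t).im + s * (((a t).im + (c t).im) / 2 - (b t).im) := by
    intro s; simp [γ, lineMap_apply]; ring
  have hlim : Tendsto (fun s => (γ s).re) (𝓝[>] 0) (𝓝 (b t).re) := by
    simp only [hγre]
    have : Continuous fun s : ℝ => (b t).re + s * (((a t).re + (c t).re) / 2 - (b t).re) := by fun_prop
    have := this.tendsto 0; rw [zero_mul, add_zero] at this; exact this.mono_left nhdsWithin_le_nhds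
  have hev : ∀ᶠ s in 𝓝[>] (0 : ℝ), ∀ u ∈ T, u ≠ t →
      (a u).re < (γ s).re ∧ (b u).re < (γ s).re ∧ (c u).re < (γ s).re := by
    rw [eventually_all_finset]; intro u hu
    by_cases e : u = t
    · exact Eventually.of_forall fun s h => absurd e h
    · obtain ⟨k1, k2, k3⟩ := hother u hu e
      filter_upwards [hlim.eventually (lt_mem_nhds k1), hlim.eventually (lt_mem_nhds k2),
        hlim.eventually (lt_mem_nhds k3)] with s s1 s2 s3 _ using ⟨s1, s2, s3⟩
  obtain ⟨s, ⟨⟨hs, hsa⟩, hsc⟩, hs01⟩ := (((hev.and (hlim.eventually (lt_mem_nhds ha))).and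
    (hlim.eventually (lt_mem_nhds hc))).and (Ioo_mem_nhdsGT (zero_lt_one' ℝ))).exists
  have c1 : 0 < cr (a t) (b t) (γ s) := by
    have : cr (a t) (b t) (γ s) = s / 2 * cr (a t) (b t) (c t) := by
      simp only [cr, hγre, hγim]; ring
    rw [this]; exact mul_pos (half_pos hs01.1) hΔ
  have c2 : 0 < cr (b t) (c t) (γ s) := by
    have : cr (b t) (c t) (γ s) = s / 2 * cr (a t) (b t) (c t) := by
      simp only [cr, hγre, hγim]; ring
    rw [this]; exact mul_pos (half_pos hs01.1) hΔ
  have c3 : 0 < cr (c t) (a t) (γ s) := by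
    have : cr (c t) (a t) (γ s) = (1 - s) * cr (a t) (b t) (c t) := by
      simp only [cr, hγre, hγim]; ring
    rw [this]; exact mul_pos (by linarith [hs01.2]) hΔ
  have hO : γ s ∈ F '' openRect := by
    rw [← interior_image, mem_interior_iff_mem_nhds]
    filter_upwards [(continuous_cr _ _).continuousAt.eventually (lt_mem_nhds c1),
      (continuous_cr _ _).continuousAt.eventually (lt_mem_nhds c2),
      (continuous_cr _ _).continuousAt.eventually (lt_mem_nhds c3)] with w w1 w2 w3
    exact H.tile_subset ht ((mem_convexHull_iff_cr hΔ).2 ⟨w1.le, w2.le, w3.le⟩)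
  have hV : γ s ∉ vertices T a b c := by
    rintro ⟨u, hu, h⟩
    by_cases e : u = t
    · subst e; rcases h with h | h | h <;> rw [h] at c1 c2 c3
      · exact c1.ne' (hp _ _).2
      · exact c1.ne' (hp _ _).1
      · exact c2.ne' (hp _ _).1
    · obtain ⟨k1, k2, k3⟩ := hs u hu e; rcases h with h | h | h <;> rw [h] at k1 k2 k3
      · exact lt_irrefl _ k1
      · exact lt_irrefl _ k2
      · exact lt_irrefl _ k3
  have hpre : IsPreconnected (F '' openRect \ vertices T a b c) :=
    (isPreconnected_openRect.image _ F.continuous.continuousOn).diff_finite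
      (F.isOpenMap _ isOpen_openRect) finite_vertices
  rw [H.cnt_constant hpre disjoint_sdiff_left ?_ ⟨hz, hzV⟩ ⟨hO, hV⟩]
  · rw [cnt, sum_eq_single t]
    · rw [wt, if_pos ⟨c1.le, c2.le, c3.le⟩, if_pos ⟨c1, c2, c3⟩]
    · intro u hu e; refine wt_of_notMem (H.pos u hu) fun hm => ?_
      have : convexHull ℝ {a u, b u, c u} ⊆ {z : ℂ | z.re < (γ s).re} := by
        refine convexHull_min ?_ (convex_halfSpace_re_lt _); obtain ⟨k1, k2, k3⟩ := hs u hu e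
        rintro z (rfl | rfl | rfl) <;> assumption
      exact lt_irrefl (γ s).re (this hm)
    · exact fun h => absurd ht h
  · refine Disjoint.mono_left sdiff_subset ?_; rw [disjoint_image_iff F.injective]
    exact disjoint_sdiff_right

lemma subset_iUnion {z : ℂ} (hz : z ∈ F '' rect) : ∃ t ∈ T, z ∈ convexHull ℝ {a t, b t, c t} := by
  obtain ⟨v, hv, rfl⟩ := hz; by_contra! hcon
  have hcl : IsClosed (⋃ t ∈ T, convexHull ℝ {a t, b t, c t}) :=
    T.finite_toSet.isClosed_biUnion fun t _ => (isCompact_tile a b c t).isClosed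
  have hn : ∀ᶠ w in 𝓝 v, F w ∉ ⋃ t ∈ T, convexHull ℝ {a t, b t, c t} :=
    F.continuous.continuousAt.eventually (hcl.isOpen_compl.mem_nhds (by simpa using hcon))
  obtain ⟨s, h1, h2⟩ := ((eventually_lineMap_center v hn).and
    (Ioc_mem_nhdsGT (zero_lt_one' ℝ))).exists
  simp only [mem_iUnion, not_exists] at h1
  have hV : F (lineMap v center s) ∉ vertices T a b c := by
    rintro ⟨t, ht, h⟩; refine h1 t ht (subset_convexHull _ _ ?_); simpa using h
  have := H.cnt_eq_two ⟨_, lineMap_center_mem hv h2, rfl⟩ hV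
  obtain ⟨t, ht, hm⟩ := exists_mem_of_cnt_ne_zero H.pos (z := F (lineMap v center s))
    (by rw [this]; norm_num)
  exact h1 t ht hm

lemma le_cnt {z : ℂ} {s : Finset ι} (hs : s ⊆ T) (h : ∀ t ∈ s, z ∈ convexHull ℝ {a t, b t, c t}) :
    (s.card : ℤ) ≤ cnt T a b c z := by
  calc (s.card : ℤ) = ∑ t ∈ s, 1 := by simp
    _ ≤ ∑ t ∈ s, wt (a t) (b t) (c t) z := sum_le_sum fun t ht => wt_pos (H.pos t (hs ht)) (h t ht)
    _ ≤ _ := sum_le_sum_of_subset_of_nonneg hs fun _ _ _ => wt_nonneg _ _ _ _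

lemma mem_image_openRect {z : ℂ} (hzV : z ∉ vertices T a b c)
    (h2 : 2 ≤ cnt T a b c z) : z ∈ F '' openRect := by
  by_contra hcon; have h := cnt_eventually H.pos hzV
  have hVo := (finite_vertices (T := T) (a := a) (b := b) (c := c)).isClosed.isOpen_compl
  have hcl := (F.isClosed_image.2 isClosed_rect).isOpen_compl
  have hrefl : Continuous fun w : ℂ => 2 * z - w := by fun_prop
  have hr0 : 2 * z - z = z := by ring
  have hrefl' : Tendsto (fun w : ℂ => 2 * z - w) (𝓝 z) (𝓝 z) := by
    have := hrefl.tendsto z; rwa [hr0] at this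
  have hsym : ∀ᶠ w in 𝓝 z, cnt T a b c w + cnt T a b c (2 * z - w) = 2 * cnt T a b c z := by
    filter_upwards [h, hrefl'.eventually h] with w h1 h1'
    have e : ∀ u v, sideOf z (2 * z - w) u v = -sideOf z w u v := by
      intro u v; unfold sideOf; split_ifs with hm
      · have h0 := (cr_of_mem_openSegment hm 0).1
        have : cr u v (2 * z - w) = -cr u v w := by
          have : cr u v (2 * z - w) = 2 * cr u v z - cr u v w := by simp [cr]; ring
          rw [this, h0]; ring
        rw [this, Left.sign_neg]; simp
      · simp
    rw [h1, h1']; simp only [e, ← neg_add, Finset.sum_neg_distrib]; ring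
  have hgood : ∀ᶠ w in 𝓝 z, (cnt T a b c w + cnt T a b c (2 * z - w) = 2 * cnt T a b c z) ∧
      w ∉ vertices T a b c ∧ 2 * z - w ∉ vertices T a b c :=
    hsym.and (Eventually.and (hVo.mem_nhds hzV) (hrefl'.eventually (hVo.mem_nhds hzV)))
  rw [← interior_image, ← mem_compl_iff, ← closure_compl, mem_closure_iff_frequently] at hcon
  obtain ⟨w, hw, hwg⟩ := (hcon.and_eventually (eventually_eventually_nhds.2 hgood)).exists
  have hopen : ∀ᶠ w' in 𝓝 w, 2 ≤ cnt T a b c (2 * z - w') ∧ 2 * z - w' ∈ F '' rect := by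
    filter_upwards [hwg, hcl.mem_nhds hw] with w' h1 h3
    have h4 := h1.1; rw [H.cnt_eq_zero h3 h1.2.1, zero_add] at h4; refine ⟨by omega, ?_⟩
    obtain ⟨t, ht, hm⟩ := exists_mem_of_cnt_ne_zero H.pos (z := 2 * z - w') (by omega)
    exact H.tile_subset ht hm
  have hint : 2 * z - w ∈ F '' openRect := by
    rw [← interior_image, mem_interior_iff_mem_nhds]
    have ht : Tendsto (fun x : ℂ => 2 * z - x) (𝓝 (2 * z - w)) (𝓝 w) := by
      have := hrefl.tendsto (2 * z - w); rwa [show 2 * z - (2 * z - w) = w by ring] at this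
    filter_upwards [ht.eventually hopen] with x hx
    have := hx.2; rwa [show 2 * z - (2 * z - x) = x by ring] at this
  have h5 := H.cnt_eq_two hint hwg.self_of_nhds.2.2; have h6 := hwg.self_of_nhds.1
  rw [H.cnt_eq_zero hw hwg.self_of_nhds.2.1] at h6; omega

/-- A point that is not a vertex and that belongs to two triangles is on a common edge. -/
lemma eq_of_mem {z : ℂ} (hzV : z ∉ vertices T a b c) {t t' : ι} (ht : t ∈ T) (ht' : t' ∈ T)
    (hne : t ≠ t') (hz : z ∈ convexHull ℝ {a t, b t, c t}) (hz' : z ∈ convexHull ℝ {a t', b t', c t'}) :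
    z ∈ F '' openRect ∧ (z ∈ segment ℝ (a t) (b t) ∨ z ∈ segment ℝ (b t) (c t) ∨
      z ∈ segment ℝ (c t) (a t)) ∧
    ∀ u ∈ T, z ∈ convexHull ℝ {a u, b u, c u} → u ≠ t → u = t' := by
  classical
  have h2 := H.le_cnt (z := z) (s := {t, t'}) (by intro u; simp; rintro (rfl | rfl) <;> assumption)
    (by intro u; simp; rintro (rfl | rfl) <;> assumption)
  rw [Finset.card_pair hne] at h2; have hO := H.mem_image_openRect hzV (by exact_mod_cast h2)
  have hc := H.cnt_eq_two hO hzV; refine ⟨hO, ?_, fun u hu hzu hut => ?_⟩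
  · have h1 : wt (a t) (b t) (c t) z ≠ 2 := by
      intro h
      have h3 : wt (a t) (b t) (c t) z + wt (a t') (b t') (c t') z ≤ cnt T a b c z := by
        rw [← sum_pair (f := fun u => wt (a u) (b u) (c u) z) hne]
        exact sum_le_sum_of_subset_of_nonneg (by intro u; simp; rintro (rfl | rfl) <;> assumption)
          fun _ _ _ => wt_nonneg _ _ _ _
      have := wt_pos (H.pos t' ht') hz'; omega
    have hm := (mem_convexHull_iff_cr (H.pos t ht)).1 hz
    have hseg : ∀ u v w : ℂ, 0 < cr u v w → cr u v z = 0 → 0 ≤ cr v w z → 0 ≤ cr w u z →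
        z ∈ segment ℝ u v := by
      intro u v w h h0 h1 h2
      have : z ∈ convexHull ℝ {u, v, w} := (mem_convexHull_iff_cr h).2 ⟨h0.ge, h1, h2⟩
      rw [segment_eq_image']; have hadd := cr_add u v w z
      refine ⟨cr w u z / cr u v w, ⟨by positivity, by rw [div_le_one h]; linarith⟩, ?_⟩
      have hne := h.ne'
      have e1 : cr w u z * (v.re - u.re) = (z.re - u.re) * cr u v w := by
        have : cr w u z * (v.re - u.re) - (z.re - u.re) * cr u v w = (u.re - w.re) * cr u v z := by
          unfold cr; ring
        rw [h0] at this; linarith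
      have e2 : cr w u z * (v.im - u.im) = (z.im - u.im) * cr u v w := by
        have : cr w u z * (v.im - u.im) - (z.im - u.im) * cr u v w = (u.im - w.im) * cr u v z := by
          unfold cr; ring
        rw [h0] at this; linarith
      apply Complex.ext <;> simp <;> field_simp <;> linarith
    have hp := H.pos t ht; rcases hm.1.eq_or_lt' with k1 | k1
    · exact Or.inl (hseg _ _ _ hp k1 hm.2.1 hm.2.2)
    rcases hm.2.1.eq_or_lt' with k2 | k2
    · exact Or.inr (Or.inl (hseg _ _ _ (by rwa [cr_rotate]) k2 hm.2.2 hm.1))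
    rcases hm.2.2.eq_or_lt' with k3 | k3
    · exact Or.inr (Or.inr (hseg _ _ _ (by rwa [cr_rotate, cr_rotate]) k3 hm.1 hm.2.1))
    · exact absurd (by rw [wt, if_pos hm, if_pos ⟨k1, k2, k3⟩]) h1
  · by_contra hut'
    have h3 := H.le_cnt (z := z) (s := {t, t', u})
      (by intro u; simp; rintro (rfl | rfl | rfl) <;> assumption)
      (by intro u; simp; rintro (rfl | rfl | rfl) <;> assumption)
    rw [Finset.card_eq_three.2 ⟨t, t', u, hne, Ne.symm hut, Ne.symm hut', rfl⟩, hc] at h3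
    norm_num at h3

end IsTiling

lemma exists_of_mem_segment {u v z : ℂ} (h : z ∈ segment ℝ u v) : ∃ θ ∈ Icc (0 : ℝ) 1,
    z = ⟨u.re + θ * (v.re - u.re), u.im + θ * (v.im - u.im)⟩ := by
  rw [segment_eq_image'] at h; obtain ⟨θ, hθ, rfl⟩ := h
  exact ⟨θ, hθ, by apply Complex.ext <;> simp⟩

lemma exists_left_edge_from (n : ℕ) {m : ℕ} (hm : m ≤ n) {y : ℝ}
    (hy : y ∈ uIcc (leftNode m) (leftNode (m + 1))) :
    ∃ j ≤ n, m ≤ j ∧ ∃ θ ∈ Icc (0 : ℝ) 1,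
      y = leftNode j + θ * (leftNode (leftEndIdx n j) - leftNode j) := by
  have key : ∀ i m, m + i = n → y ∈ uIcc (leftNode m) (leftNode (m + 1)) → ∃ j ≤ n, m ≤ j ∧
      y ∈ uIcc (leftNode j) (leftNode (leftEndIdx n j)) := by
    intro i
    induction i with
    | zero =>
      intro m hm h; obtain rfl : m = n := by omega
      exact ⟨m, le_rfl, le_rfl, by simpa [leftEndIdx] using h⟩
    | succ i ih =>
      intro m hm h; rcases uIcc_subset_uIcc_union_uIcc (b := leftNode (m + 2)) h with h | h
      · exact ⟨m, by omega, le_rfl, by rwa [leftEndIdx, if_pos (by omega)]⟩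
      · rw [uIcc_comm] at h; obtain ⟨j, hj, hmj, h⟩ := ih (m + 1) (by omega) h
        exact ⟨j, hj, by omega, h⟩
  obtain ⟨j, hj, hmj, h⟩ := key (n - m) m (by omega) hy
  rw [← segment_eq_uIcc, segment_eq_image'] at h; obtain ⟨θ, hθ, h⟩ := h
  exact ⟨j, hj, hmj, θ, hθ, h.symm⟩

namespace ArnouxYoccoz

lemma two_thirds_mem_removed : (⟨0, 2 / 3⟩ : ℂ) ∈ removed := by
  have hlim : Tendsto (fun n => (⟨0, leftNode n⟩ : ℂ)) atTop (𝓝 ⟨0, 2 / 3⟩) := by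
    rw [tendsto_iff_dist_tendsto_zero]; simp only [Near.dist_im, abs_leftNode_sub]
    have := (tendsto_pow_atTop_nhds_zero_of_lt_one (r := (1 / 2 : ℝ)) (by norm_num)
      (by norm_num)).const_mul (1 / 3)
    rwa [mul_zero] at this
  exact isClosed_removed.mem_of_tendsto hlim
    (Eventually.of_forall fun n => subset_closure (Slot.lo_mem_endpoints (.left n)))

lemma one_one_mem_removed : (⟨1, 1⟩ : ℂ) ∈ removed := by
  have hlim : Tendsto (fun n : ℕ => (⟨1 - (1 / 2) ^ n, 1⟩ : ℂ)) atTop (𝓝 ⟨1, 1⟩) := by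
    rw [tendsto_iff_dist_tendsto_zero]
    have : ∀ n : ℕ, |1 - (1 / 2 : ℝ) ^ n - 1| = (1 / 2) ^ n := fun n => by
      rw [abs_sub_comm, sub_sub_cancel, abs_of_pos (by positivity)]
    simp only [Near.dist_re, this]
    exact tendsto_pow_atTop_nhds_zero_of_lt_one (by norm_num) (by norm_num)
  refine isClosed_removed.mem_of_tendsto hlim (Eventually.of_forall fun n => subset_closure ?_)
  simpa [Slot.lo] using Slot.lo_mem_endpoints (.top false n)

/-- The points of the rectangle that do not represent points of `U g`. -/
def Lost (g : ℕ) : Set ℂ := {v | Dropped g v} ∪ removed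

lemma dropped_of_eq {g : ℕ} {s : Slot} {t : ℝ} {v : ℂ} (hs : ¬ s.Kept g) (ht : t ∈ Icc (0 : ℝ) 1)
    (hre : v.re = s.lo.re + t * (s.hi.re - s.lo.re)) (him : v.im = s.lo.im + t * (s.hi.im - s.lo.im)) :
    v ∈ Lost g :=
  Or.inl ⟨s, t, ht, Complex.ext (by rw [hre, s.at'_re]) (by rw [him, s.at'_im]), hs⟩

lemma lost_left {g : ℕ} {y : ℝ}
    (hy : y ∈ uIcc (leftNode ((g - 1) / 2)) (leftNode ((g - 1) / 2 + 1))) : (⟨0, y⟩ : ℂ) ∈ Lost g := by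
  by_cases h : y = 2 / 3
  · rw [h]; exact Or.inr two_thirds_mem_removed
  obtain ⟨n, hn⟩ := exists_pow_lt_of_lt_one (abs_pos.2 (sub_ne_zero.2 h)) (show (1 / 2 : ℝ) < 1 by norm_num)
  set m := (g - 1) / 2
  obtain ⟨j, hj, hmj, θ, hθ, e⟩ := exists_left_edge_from (max m n) (le_max_left m n) hy
  by_cases hjn : j < max m n
  · rw [leftEndIdx, if_pos hjn] at e
    exact dropped_of_eq (s := .left j) (by simpa [Slot.Kept] using hmj) hθ (by simp [Slot.lo, Slot.hi])
      (by simp [Slot.lo, Slot.hi, e])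
  · exfalso; rw [leftEndIdx, if_neg hjn] at e; have h1 := abs_leftNode_sub j
    have h2 := abs_leftNode_sub (j + 1)
    have h3 : (1 / 2 : ℝ) ^ j ≤ (1 / 2) ^ n := Near.half_pow_le (by have := le_max_right m n; omega)
    have h4 : |y - 2 / 3| ≤ (1 - θ) * |leftNode j - 2 / 3| + θ * |leftNode (j + 1) - 2 / 3| := by
      have : y - 2 / 3 = (1 - θ) * (leftNode j - 2 / 3) + θ * (leftNode (j + 1) - 2 / 3) := by
        rw [e]; ring
      rw [this]; refine (abs_add_le _ _).trans (le_of_eq ?_)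
      rw [abs_mul, abs_mul, abs_of_nonneg hθ.1, abs_of_nonneg (sub_nonneg.2 hθ.2)]
    have h5 := Near.half_pow_pos j; rw [h1, h2, pow_succ] at h4; nlinarith [hθ.1, hθ.2]

lemma exists_dyadic {n : ℕ} {x : ℝ} (h0 : 0 < x) (h1 : x ≤ (1 / 2) ^ n) :
    ∃ m, n ≤ m ∧ (1 / 2) ^ (m + 1) < x ∧ x ≤ (1 / 2) ^ m := by
  obtain ⟨m, h2, h3⟩ := exists_nat_pow_near_of_lt_one h0
    (h1.trans (pow_le_one₀ (by norm_num) (by norm_num))) (show (0 : ℝ) < 1 / 2 by norm_num) (by norm_num)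
  refine ⟨m, ?_, h2, h3⟩; by_contra! hlt
  exact absurd (h1.trans (Near.half_pow_le hlt)) (not_le.2 h2)

lemma lost_right {g : ℕ} {y : ℝ} (hy : y ∈ Icc (1 - (1 / 2) ^ ((g - 1) / 2 + 1)) 1) :
    (⟨1, y⟩ : ℂ) ∈ Lost g := by
  rcases hy.2.eq_or_lt with h | h
  · rw [h]; exact Or.inr one_one_mem_removed
  obtain ⟨m, hm, h1, h2⟩ := exists_dyadic (sub_pos.2 h) (show 1 - y ≤ _ by linarith [hy.1])
  obtain ⟨m, rfl⟩ : ∃ l, m = l + 1 := ⟨m - 1, by omega⟩; have hp := Near.half_pow_pos m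
  rw [pow_succ, pow_succ] at h1; rw [pow_succ] at h2
  refine dropped_of_eq (s := .right m) (t := (y - (1 - (1 / 2) ^ (m + 1))) / (1 / 4 * (1 / 2) ^ m))
    (by simp only [Slot.Kept]; omega) ⟨?_, ?_⟩ (by simp [Slot.lo, Slot.hi]) ?_
  · refine div_nonneg ?_ (by positivity); rw [pow_succ]; linarith
  · rw [div_le_one (by positivity), pow_succ]; linarith
  · simp only [Slot.lo, Slot.hi]
    rw [show 1 - (1 / 2 : ℝ) ^ (m + 2) - (1 - (1 / 2) ^ (m + 1)) = 1 / 4 * (1 / 2) ^ m by ring,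
      div_mul_cancel₀ _ (by positivity)]
    ring

lemma lost_top {g : ℕ} {x : ℝ} (hx : x ∈ Icc (1 - (1 / 2) ^ (g / 2)) 1) : (⟨x, 1⟩ : ℂ) ∈ Lost g := by
  rcases hx.2.eq_or_lt with h | h
  · rw [h]; exact Or.inr one_one_mem_removed
  obtain ⟨m, hm, h1, h2⟩ := exists_dyadic (sub_pos.2 h) (show 1 - x ≤ _ by linarith [hx.1])
  have hp := Near.half_pow_pos m; rw [pow_succ] at h1
  have key : ∀ b : Bool, (if b then 1 / 2 else 3 / 4) * (1 / 2) ^ m ≤ 1 - x →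
      1 - x ≤ (if b then 3 / 4 else 1) * (1 / 2) ^ m → (⟨x, 1⟩ : ℂ) ∈ Lost g := by
    intro b k1 k2
    refine dropped_of_eq (s := .top b m)
      (t := (x - (1 - (if b then 3 / 4 else 1) * (1 / 2) ^ m)) / (1 / 4 * (1 / 2) ^ m))
      (by simp only [Slot.Kept]; omega) ⟨?_, ?_⟩ ?_ (by simp [Slot.lo, Slot.hi])
    · exact div_nonneg (by linarith) (by positivity)
    · rw [div_le_one (by positivity)]; cases b <;> simp at k1 k2 ⊢ <;> linarith
    · have e : (Slot.top b m).hi.re - (Slot.top b m).lo.re = 1 / 4 * (1 / 2) ^ m := by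
        cases b <;> simp [Slot.hi, Slot.lo] <;> ring
      rw [e, div_mul_cancel₀ _ (by positivity)]; simp only [Slot.lo]; ring
  rcases le_total (1 - x) (3 / 4 * (1 / 2) ^ m) with h3 | h3
  · exact key true (by simp at h1 ⊢; linarith) (by simpa using h3)
  · exact key false (by simpa using h3) (by simpa using h2)

lemma notMem_openRect_of_lost {g : ℕ} {v : ℂ} (h : v ∈ Lost g) : v ∉ openRect := fun ho =>
  h.elim (fun h => not_dropped_of_mem_openRect ho h) (openRect_subset_good ho).2

lemma mem_rect_of_lost {g : ℕ} {v : ℂ} (h : v ∈ Lost g) : v ∈ rect := by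
  rcases h with ⟨s, t, ht, rfl, -⟩ | h
  · exact s.at'_mem_rect ht
  · exact removed_subset_rect h

end ArnouxYoccoz

namespace Par

variable (p : Par)

/-! ### The leftover segments of the sides -/

lemma left_slit : segment ℝ (p.vL p.N) (p.vL (p.N + 1)) ⊆ p.F '' Lost p.g := by
  intro z hz; obtain ⟨θ, hθ, rfl⟩ := exists_of_mem_segment hz
  refine ⟨⟨0, leftNode p.N + θ * (leftNode (p.N + 1) - leftNode p.N)⟩, lost_left ?_, ?_⟩
  · rw [p.g_sub_div, ← segment_eq_uIcc, segment_eq_image']; exact ⟨θ, hθ, rfl⟩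
  · rw [p.F_left, p.Lx_last hθ, p.Ly_last hθ]
    · rfl
    have h1 := leftNode_mem p.N; have h2 := leftNode_mem (p.N + 1); exact ⟨le_lerp h1.1 h2.1 hθ, lerp_le h1.2 h2.2 hθ⟩

lemma right_slit : segment ℝ (p.vQ (p.k + 1)) (p.vP p.k) ⊆ p.F '' Lost p.g := by
  intro z hz; obtain ⟨θ, hθ, rfl⟩ := exists_of_mem_segment hz; have hh := p.h_pos
  obtain ⟨v, hv, hF⟩ := p.exists_right_slit (y := 1 - p.h + θ * p.h)
    ⟨by nlinarith [hθ.1], by nlinarith [hθ.2]⟩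
  refine ⟨v, ?_, ?_⟩
  · obtain ⟨x, y⟩ := v; rcases hv with ⟨h1, h2⟩ | ⟨h1, h2⟩ <;> simp only at h1 h2 <;> subst h1
    · exact lost_right (by rw [p.g_sub_div]; exact h2)
    · exact lost_top (by rw [p.g_div]; exact h2)
  · rw [hF, p.Rx_last hθ, p.Ry_last hθ, show p.k + 1 = p.g - p.N by unfold g; omega,
      p.vQ_right (by unfold g; omega)]
    rfl

lemma slot_subset {s : Slot} (hs : s.Kept p.g) :
    segment ℝ (p.tlo s) (p.thi s) ⊆ p.F '' (rect \ openRect) := by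
  rw [segment_eq_image_lineMap]; rintro _ ⟨t, ht, rfl⟩
  exact ⟨s.at' t, ⟨s.at'_mem_rect ht, s.at'_notMem_openRect t⟩, p.F_slot hs ht⟩

lemma slit_subset {u v : ℂ} (h : segment ℝ u v ⊆ p.F '' Lost p.g) :
    segment ℝ u v ⊆ p.F '' (rect \ openRect) :=
  h.trans (image_mono fun _ h => ⟨mem_rect_of_lost h, notMem_openRect_of_lost h⟩)

end Par

namespace Par

variable (p : Par)

lemma vQ_pos {i : ℕ} (hi : 1 ≤ i) : p.vQ i = ⟨p.qx i, p.Y - p.dep i⟩ := if_neg (by omega)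
lemma vQ_zero : p.vQ 0 = p.vL 1 := rfl

lemma lmy_one : p.lmy 1 = p.a := by
  unfold lmy; rw [p.one_sub_sq]; have := p.one_sub_pos.ne'; have := p.one_add_pos.ne'
  field_simp; ring

lemma lmy_two : p.lmy 2 = p.Y - p.a ^ 2 := by
  unfold lmy Y; rw [p.one_sub_sq]; have := p.one_sub_pos.ne'; have := p.one_add_pos.ne'
  field_simp; ring

lemma qx_one : p.qx 1 = p.a / 2 := by rw [p.qx_succ, p.ptx_zero]; ring

lemma dep_eq_div {i : ℕ} : p.dep (i + 1) = p.x / (p.a ^ i * (1 - p.a)) := by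
  unfold dep; rw [← p.a_pow]; have := p.a_ne; have := (p.apos i).ne'; have := p.one_sub_pos.ne'
  field_simp; ring

lemma dep_eq_mul (i : ℕ) : p.dep i = p.a * p.dep (i + 1) := by
  unfold dep; rw [pow_succ _ i]; have := p.a_ne; have := (p.apos i).ne'; have := p.one_sub_pos.ne'
  field_simp

lemma dep_one : p.dep 1 = p.M := by rw [p.dep_eq_div]; simp [M]

lemma Y_sub : p.Y - p.a - p.e0 = p.a := by
  unfold Y e0 x; have := p.one_sub_pos.ne'; field_simp; ring

lemma lmx_succ (m : ℕ) : p.lmx (m + 1) = p.lmx m - p.x / p.a ^ (m + 1) / 2 := by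
  unfold lmx; rw [pow_succ]; have := p.a_ne; have := (p.apos m).ne'; have := p.one_sub_pos.ne'
  field_simp; ring

lemma lmx_neg (m : ℕ) : p.lmx (m + 1) < p.lmx m := by
  rw [p.lmx_succ]; have := div_pos p.x_pos (p.apos (m + 1)); linarith

lemma lmx_nonpos (m : ℕ) : p.lmx m ≤ 0 := by
  induction m with
  | zero => exact p.lmx_zero.le
  | succ m ih => exact (p.lmx_neg m).le.trans ih

lemma qx_lt_ptx {i : ℕ} : p.qx (i + 1) < p.ptx (i + 1) := by
  rw [p.qx_succ, p.ptx_succ]; linarith [p.apos (i + 1)]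

lemma ptx_lt_qx (i : ℕ) : p.ptx i < p.qx (i + 1) := by rw [p.qx_succ]; linarith [p.apos (i + 1)]

lemma x_lt_num : p.x < p.a ^ 2 * (1 - p.a) := by
  unfold x; nlinarith [p.half_lt, p.le_a, mul_pos p.a_pos p.one_sub_pos]

lemma M_lt : p.M < p.a ^ 2 := by unfold M; rw [div_lt_iff₀ p.one_sub_pos]; exact p.x_lt_num

/-! ### Orientation of the triangles -/

lemma cr_fan (i : ℕ) : 0 < cr p.vP0 (p.vQ (i + 1)) (p.vQ i) := by
  have ha := p.half_lt; have ha' := p.le_a; have hY := p.Y_sub; have hD := p.one_sub_pos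
  have hx := p.x_pos; have hp1 := p.p0_le; have hp2 := p.p0_ge; rcases i with _ | i
  · rw [p.vQ_zero, p.vQ_pos le_rfl, vL, vP0, p.lmy_one, p.qx_one, p.dep_one]
    have h1 := p.lmx_succ 0; rw [p.lmx_zero] at h1
    have h2 : p.x / p.a ^ (0 + 1) = p.a ^ p.g := by
      rw [zero_add, pow_one, div_eq_iff p.a_ne, mul_comm, p.a_pow_g]
    rw [h2] at h1; have h3 : p.lmx (0 + 1) - p.p0 = -(1 / 2) := by rw [h1]; unfold p0; ring
    have h4 := p.M_lt; have h5 := p.e0_pos; simp only [cr]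
    rw [show p.lmx 1 = p.lmx (0 + 1) from rfl, h3]
    have e : p.Y - p.M - (p.a + p.e0) = p.a - p.M := by linarith
    rw [e]; nlinarith [mul_pos h5 (show 0 < p.p0 - p.a / 2 by linarith)]
  · rw [p.vQ_pos (by omega), p.vQ_pos (by omega), vP0]; set u := p.a ^ (i + 1) with hu
    have hu0 : 0 < u := p.apos _
    have e2 : p.dep (i + 1 + 1) = p.x / (u * (1 - p.a)) := p.dep_eq_div
    have e1 : p.dep (i + 1) = p.a * (p.x / (u * (1 - p.a))) := by rw [p.dep_eq_mul, e2]
    have e3 : p.qx (i + 1) = (2 * p.a - u * (1 + p.a)) / (2 * (1 - p.a)) := by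
      unfold qx; rw [pow_succ _ (i + 1), ← hu]; ring
    have e4 : p.qx (i + 1 + 1) = (2 * p.a - p.a * u * (1 + p.a)) / (2 * (1 - p.a)) := by
      unfold qx; rw [pow_succ _ (i + 1 + 1), pow_succ _ (i + 1), ← hu]; ring
    simp only [cr]; have e5 : p.Y = p.a + p.e0 + p.a := by linarith
    rw [e1, e2, e3, e4, e5]
    have key : 0 < p.a * (1 + p.a) / 2 * u ^ 2 - (1 + p.a) ^ 2 / (2 * (1 - p.a)) * p.x * u +
        (p.a - (1 - p.a) * p.p0) / (1 - p.a) * p.x := by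
      have hA : 3 / 8 ≤ p.a * (1 + p.a) / 2 := by nlinarith
      have hB : (1 + p.a) ^ 2 / (2 * (1 - p.a)) ≤ 2.67 := by
        rw [div_le_iff₀ (by linarith)]; nlinarith
      have hC : 1 / 2 ≤ (p.a - (1 - p.a) * p.p0) / (1 - p.a) := by rw [le_div_iff₀ hD]; nlinarith
      have h1 : (1 + p.a) ^ 2 / (2 * (1 - p.a)) * p.x * u ≤ 2.67 * (p.x * u) := by
        rw [mul_assoc]; exact mul_le_mul_of_nonneg_right hB (by positivity)
      have h2 := mul_le_mul_of_nonneg_right hA (sq_nonneg u)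
      have h3 := mul_le_mul_of_nonneg_right hC hx.le; have h4 := p.x_le
      nlinarith [sq_nonneg (u - 3.56 * p.x), mul_pos hx hu0, mul_le_mul_of_nonneg_left h4 hx.le]
    have e : ∀ D : ℝ, D = 1 - p.a → D ≠ 0 → ((2 * p.a - p.a * u * (1 + p.a)) / (2 * D) - p.p0) *
          (p.a + p.e0 + p.a - p.a * (p.x / (u * D)) - (p.a + p.e0)) -
        (p.a + p.e0 + p.a - p.x / (u * D) - (p.a + p.e0)) *
          ((2 * p.a - u * (1 + p.a)) / (2 * D) - p.p0) =
        (p.a * (1 + p.a) / 2 * u ^ 2 - (1 + p.a) ^ 2 / (2 * D) * p.x * u +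
          (p.a - D * p.p0) / D * p.x) / u := by
      intro D hD1 hD2; have ha1 : p.a = 1 - D := by linarith
      rw [ha1]; field_simp; ring
    rw [e _ rfl hD.ne']; exact div_pos key hu0

lemma cr_top (i : ℕ) : 0 < cr (p.vP (i + 1)) (p.vQ (i + 1)) (p.vQ (i + 2)) := by
  rw [p.vQ_pos (by omega), p.vQ_pos (by omega), vP]; simp only [cr]; have h1 := p.dep_pos (i + 1)
  have h2 := p.dep_pos (i + 2); have h3 := p.qx_lt_ptx (i := i); have h4 := p.ptx_lt_qx (i + 1)
  nlinarith [mul_pos h2 (sub_pos.2 h3), mul_pos h1 (sub_pos.2 h4)]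

lemma cr_mid : 0 < cr (p.vL 2) (p.vQ 0) (p.vQ 1) := by
  rw [p.vQ_zero, p.vQ_pos le_rfl, vL, vL, p.lmy_one, p.lmy_two, p.dep_one, p.qx_one]; simp only [cr]
  have h1 := p.lmx_neg 1; have h2 := p.lmx_nonpos 2; have h3 := p.M_lt
  have h4 : p.a + p.a ^ 2 < p.Y := by unfold Y; rw [lt_div_iff₀ p.one_sub_pos]; nlinarith [p.apos 3]
  have e : p.Y - p.M - (p.Y - p.a ^ 2) = p.a ^ 2 - p.M := by ring
  rw [e]
  nlinarith [mul_pos (sub_pos.2 h1) (sub_pos.2 h3),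
    mul_pos (sub_pos.2 h4) (show 0 < p.a / 2 - p.lmx 2 by linarith [p.a_pos])]

lemma cr_corner : 0 < cr (p.vQ 1) (p.vL 0) (p.vL 2) := by
  rw [p.vQ_pos le_rfl, vL, vL, p.lmx_zero, p.lmy_zero, p.lmy_two, p.dep_one, p.qx_one]
  simp only [cr]; have h2 := p.lmx_nonpos 2; have h3 := p.M_lt; have h4 := p.M_pos
  nlinarith [mul_pos p.a_pos (sub_pos.2 h3), mul_pos h4 p.a_pos, mul_nonneg h4.le (neg_nonneg.2 h2)]

lemma cr_chain (m : ℕ) : cr (p.vL (m + 1)) (p.vL (m + 2)) (p.vL m) =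
    -(-p.a) ^ m * (p.x / p.a ^ (m + 2) * p.a ^ 2 / (1 - p.a) * (1 + p.a ^ 2) / 4) * 2 := by
  simp only [cr, vL]; rw [p.lmx_succ (m + 1), p.lmx_succ m]; unfold lmy
  rw [p.one_sub_sq, pow_succ _ (m + 1), pow_succ _ m, pow_succ _ (m + 1), pow_succ _ m]
  have := p.a_ne; have := (p.apos m).ne'; have := p.one_sub_pos.ne'; have := p.one_add_pos.ne'
  field_simp; ring

/-! ### The triangles of the model -/

/-- The number of the first vertex. -/
def tP (kk : ℕ) : ℂ := if kk ≤ p.g then p.vP0 else if kk = p.g + 1 then p.vL 2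
  else if kk ≤ p.g + p.k + 1 then p.vP (kk - p.g - 1)
  else if kk = 2 * p.g then p.vQ 1 else p.vL (2 * p.g - kk + 1)

def tU (kk : ℕ) : ℂ :=
  if kk ≤ p.g then p.vQ (kk - 1) else if kk ≤ p.g + p.k + 1 then p.vQ (kk - p.g - 1)
  else p.vL (2 * p.g - kk + 2)

def tV (kk : ℕ) : ℂ :=
  if kk ≤ p.g then p.vQ kk else if kk ≤ p.g + p.k + 1 then p.vQ (kk - p.g) else p.vL (2 * p.g - kk)

/-- The triangles that are reflected. -/
def par (kk : ℕ) : Bool := decide (p.g + p.k + 1 < kk ∧ (2 * p.g - kk) % 2 = 0)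

def tB (kk : ℕ) : ℂ := if kk ≤ p.g ∨ p.par kk then p.tV kk else p.tU kk
def tC (kk : ℕ) : ℂ := if kk ≤ p.g ∨ p.par kk then p.tU kk else p.tV kk

lemma g_eq : p.g = p.k + p.N + 1 := rfl

lemma tile_fan {i : ℕ} (hi : i < p.g) : p.tP (i + 1) = p.vP0 ∧ p.tU (i + 1) = p.vQ i ∧
    p.tV (i + 1) = p.vQ (i + 1) ∧ p.tB (i + 1) = p.vQ (i + 1) ∧ p.tC (i + 1) = p.vQ i := by
  have h : i + 1 ≤ p.g := hi; simp [tP, tU, tV, tB, tC, h]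

lemma tile_mid : p.tP (p.g + 1) = p.vL 2 ∧ p.tU (p.g + 1) = p.vQ 0 ∧ p.tV (p.g + 1) = p.vQ 1 ∧
    p.tB (p.g + 1) = p.vQ 0 ∧ p.tC (p.g + 1) = p.vQ 1 := by
  have h : p.par (p.g + 1) = false := by simp [par]
  simp [tP, tU, tV, tB, tC, h]

lemma tile_top {i : ℕ} (hi : i < p.k) : p.tP (p.g + 2 + i) = p.vP (i + 1) ∧
    p.tU (p.g + 2 + i) = p.vQ (i + 1) ∧ p.tV (p.g + 2 + i) = p.vQ (i + 2) ∧
    p.tB (p.g + 2 + i) = p.vQ (i + 1) ∧ p.tC (p.g + 2 + i) = p.vQ (i + 2) := by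
  have h : p.par (p.g + 2 + i) = false := by simp [par]; omega
  have h1 : ¬ p.g + 2 + i ≤ p.g := by omega
  have h2 : p.g + 2 + i ≤ p.g + p.k + 1 := by omega
  have h3 : p.g + 2 + i ≠ p.g + 1 := by omega
  have h5 : p.g + 2 + i - p.g = i + 2 := by omega
  have h6 : i + 2 - 1 = i + 1 := rfl
  simp only [tP, tU, tV, tB, tC, h, h1, h2, h3, h5, h6, if_true, if_false, Bool.false_eq_true, or_self,
    and_self]

lemma tile_chain {m : ℕ} (hm : m < p.N) : p.tP (2 * p.g - m) = (if m = 0 then p.vQ 1 else p.vL (m + 1)) ∧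
    p.tU (2 * p.g - m) = p.vL (m + 2) ∧ p.tV (2 * p.g - m) = p.vL m ∧
    p.tB (2 * p.g - m) = (if Even m then p.vL m else p.vL (m + 2)) ∧
    p.tC (2 * p.g - m) = (if Even m then p.vL (m + 2) else p.vL m) ∧
    p.par (2 * p.g - m) = decide (Even m) := by
  have hg := p.g_eq; have h1 : ¬ 2 * p.g - m ≤ p.g := by omega
  have h2 : ¬ 2 * p.g - m ≤ p.g + p.k + 1 := by omega
  have h3 : 2 * p.g - m ≠ p.g + 1 := by omega
  have h4 : 2 * p.g - (2 * p.g - m) = m := by omega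
  have h5 : (2 * p.g - m = 2 * p.g) = (m = 0) := by ext; omega
  have h : p.par (2 * p.g - m) = decide (Even m) := by
    simp only [par, h4, Nat.even_iff]; congr 1; ext; omega
  simp only [tP, tU, tV, tB, tC, h, h1, h2, h3, h4, h5, if_false, false_or, decide_eq_true_eq, and_self]

/-- The indices of the triangles. -/
lemma index_cases {kk : ℕ} (h : kk ∈ Finset.Ico 1 (2 * p.g + 1)) :
    (∃ i < p.g, kk = i + 1) ∨ kk = p.g + 1 ∨ (∃ i < p.k, kk = p.g + 2 + i) ∨
      ∃ m < p.N, kk = 2 * p.g - m := by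
  rw [Finset.mem_Ico] at h; have hg := p.g_eq
  by_cases h1 : kk ≤ p.g
  · exact Or.inl ⟨kk - 1, by omega, by omega⟩
  by_cases h2 : kk = p.g + 1
  · exact Or.inr (Or.inl h2)
  by_cases h3 : kk ≤ p.g + p.k + 1
  · exact Or.inr (Or.inr (Or.inl ⟨kk - p.g - 2, by omega, by omega⟩))
  · exact Or.inr (Or.inr (Or.inr ⟨2 * p.g - kk, by omega, by omega⟩))

lemma cr_tile {kk : ℕ} (h : kk ∈ Finset.Ico 1 (2 * p.g + 1)) :
    0 < cr (p.tP kk) (p.tB kk) (p.tC kk) := by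
  rcases p.index_cases h with ⟨i, hi, rfl⟩ | rfl | ⟨i, hi, rfl⟩ | ⟨m, hm, rfl⟩
  · obtain ⟨h1, -, -, h4, h5⟩ := p.tile_fan hi; rw [h1, h4, h5]; exact p.cr_fan i
  · obtain ⟨h1, -, -, h4, h5⟩ := p.tile_mid; rw [h1, h4, h5]; exact p.cr_mid
  · obtain ⟨h1, -, -, h4, h5⟩ := p.tile_top hi; rw [h1, h4, h5]; exact p.cr_top i
  · obtain ⟨h1, -, -, h4, h5, -⟩ := p.tile_chain hm; rw [h1, h4, h5]
    have hx := p.x_pos; have hD := p.one_sub_pos; have ha := p.a_pos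
    rcases m.eq_zero_or_pos with rfl | hm0
    · simpa using p.cr_corner
    · rw [if_neg hm0.ne']; split_ifs with he
      · have e : cr (p.vL (m + 1)) (p.vL m) (p.vL (m + 2)) = -cr (p.vL (m + 1)) (p.vL (m + 2)) (p.vL m) := by
          unfold cr; ring
        rw [e, p.cr_chain, he.neg_pow]
        have : 0 < p.a ^ m * (p.x / p.a ^ (m + 2) * p.a ^ 2 / (1 - p.a) * (1 + p.a ^ 2) / 4) * 2 := by
          positivity
        linarith
      · rw [p.cr_chain, (Nat.not_even_iff_odd.1 he).neg_pow]
        have : 0 < p.a ^ m * (p.x / p.a ^ (m + 2) * p.a ^ 2 / (1 - p.a) * (1 + p.a ^ 2) / 4) * 2 := by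
          positivity
        linarith

lemma vQ_re_lt {i : ℕ} (hi : i < p.g) : (p.vQ i).re < (p.vQ p.g).re := by
  have hpos : ∀ i, 0 < p.qx (i + 1) := fun i => by
    have := p.ptx_mono (Nat.zero_le i); rw [p.ptx_zero] at this; exact this.trans_lt (p.ptx_lt_qx i)
  obtain ⟨n, hn⟩ : ∃ n, p.g = n + 1 := ⟨p.g - 1, by omega⟩
  rw [hn, p.vQ_pos (i := n + 1) (by omega)]; rcases i with _ | i
  · exact (p.lmx_nonpos 1).trans_lt (hpos n)
  · rw [p.vQ_pos (by omega)]
    exact (p.qx_lt_ptx.trans_le (p.ptx_mono (by omega))).trans (p.ptx_lt_qx n)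

lemma chain_sum (φ : ℂ → ℂ → ℤ) (hφ : ∀ u v, φ v u = -φ u v)
    (hs : ∀ s : Slot, s.Kept p.g → φ (p.tlo s) (p.thi s) = 0)
    (hl : φ (p.vL p.N) (p.vL (p.N + 1)) = 0) (hr : φ (p.vQ (p.k + 1)) (p.vP p.k) = 0) :
    ∑ t ∈ Finset.Ico 1 (2 * p.g + 1),
      (φ (p.tP t) (p.tB t) + φ (p.tB t) (p.tC t) + φ (p.tC t) (p.tP t)) = 0 := by
  have hg := p.g_eq
  have hkept : ∀ m < p.k, ∀ b, (Slot.top b m).Kept p.g := fun m hm b => by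
    simp only [Slot.Kept, p.g_div]; exact hm
  have hkept' : ∀ m < p.N, (Slot.left m).Kept p.g ∧ (Slot.right m).Kept p.g := fun m hm => by
    simp only [Slot.Kept, p.g_sub_div]; exact ⟨hm, hm⟩
  set f : ℕ → ℤ := fun t => φ (p.tP t) (p.tB t) + φ (p.tB t) (p.tC t) + φ (p.tC t) (p.tP t) with hf
  have s1 : ∀ n ≤ p.g, ∑ i ∈ range n, f (1 + i) =
      φ p.vP0 (p.vQ n) - φ p.vP0 (p.vQ 0) - ∑ i ∈ range n, φ (p.vQ i) (p.vQ (i + 1)) := by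
    intro n hn
    induction n with
    | zero => simp
    | succ n ih =>
      obtain ⟨h1, -, -, h4, h5⟩ := p.tile_fan (i := n) (by omega)
      rw [sum_range_succ, sum_range_succ, ih (by omega), hf, add_comm 1 n]; simp only [h1, h4, h5]
      rw [hφ (p.vQ n) (p.vQ (n + 1)), hφ p.vP0 (p.vQ n)]; ring
  have b0 := hs (.bot false) trivial; have b1 := hs (.bot true) trivial
  simp only [tlo, thi, if_true, Bool.false_eq_true, if_false] at b0 b1
  have s1' : ∑ i ∈ range p.g, f (1 + i) =
      -∑ i ∈ range (p.k + 1), φ (p.vQ i) (p.vQ (i + 1)) := by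
    rw [s1 _ le_rfl, b1, hφ, b0]
    have : ∑ i ∈ range p.g, φ (p.vQ i) (p.vQ (i + 1)) =
        ∑ i ∈ range (p.k + 1), φ (p.vQ i) (p.vQ (i + 1)) := by
      refine (Finset.sum_subset (by intro i; simp; omega) fun i hi hi' => ?_).symm
      rw [Finset.mem_range] at hi hi'; have := hs _ (hkept' (p.g - 1 - i) (by omega)).2
      simp only [tlo, thi] at this
      rw [show p.g - (p.g - 1 - i) = i + 1 by omega, Nat.add_sub_cancel, hφ] at this; omega
    rw [this]; ring
  have s2 : f (1 + p.g) = φ (p.vL 2) (p.vQ 0) + φ (p.vQ 0) (p.vQ 1) + φ (p.vQ 1) (p.vL 2) := by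
    obtain ⟨h1, -, -, h4, h5⟩ := p.tile_mid; simp only [hf, add_comm 1, h1, h4, h5]
  have s3 : ∑ i ∈ range p.k, f (1 + (p.g + 1 + i)) =
      ∑ i ∈ range p.k, φ (p.vQ (i + 1)) (p.vQ (i + 1 + 1)) := by
    refine sum_congr rfl fun i hi => ?_
    rw [Finset.mem_range] at hi; obtain ⟨h1, -, -, h4, h5⟩ := p.tile_top hi
    rw [show 1 + (p.g + 1 + i) = p.g + 2 + i by ring]; simp only [hf, h1, h4, h5]
    have k1 := hs _ (hkept i hi true); simp only [tlo, thi, if_true] at k1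
    have k2 : φ (p.vQ (i + 2)) (p.vP (i + 1)) = 0 := by
      rcases Nat.lt_or_ge (i + 1) p.k with h | h
      · have := hs _ (hkept (i + 1) h false)
        simp only [tlo, thi, Bool.false_eq_true, if_false] at this; rw [hφ, this, neg_zero]
      · rwa [show i + 1 = p.k by omega, show i + 2 = p.k + 1 by omega]
    rw [hφ, k1, k2]; ring
  have s4 : ∀ n ≤ p.N, 1 ≤ n → ∑ m ∈ range n, f (2 * p.g - m) = -φ (p.vQ 1) (p.vL 2) +
      φ (p.vL 1) (p.vL 2) + (if Even n then 1 else -1) * φ (p.vL n) (p.vL (n + 1)) := by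
    intro n hn h1
    induction n, h1 using Nat.le_induction with
    | base =>
      obtain ⟨h1, -, -, h4, h5, -⟩ := p.tile_chain (m := 0) (by omega)
      have k1 := hs _ (hkept' 0 (by omega)).1; simp only [tlo, thi] at k1
      have k2 := hs _ (hkept 0 p.hk false); simp only [tlo, thi, Bool.false_eq_true, if_false] at k2
      have hPL : p.vP 0 = p.vL 0 := by rw [vP, vL, p.ptx_zero, p.lmx_zero, p.lmy_zero]
      rw [hPL] at k2; rw [sum_range_one]; simp only [hf, h1, h4, h5, if_true, Even.zero]
      rw [k1, hφ (p.vL 0) (p.vQ 1), k2, hφ (p.vQ 1) (p.vL 2)]; simp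
    | succ n h1n ih =>
      obtain ⟨h1, -, -, h4, h5, -⟩ := p.tile_chain (m := n) (by omega)
      have k1 := hs _ (hkept' n (by omega)).1; simp only [tlo, thi] at k1
      rw [sum_range_succ, ih (by omega), hf]
      simp only [h1, h4, h5, if_neg (show n ≠ 0 by omega), Nat.even_add_one]; split_ifs
      · rw [k1, hφ (p.vL n), hφ (p.vL (n + 1)) (p.vL (n + 2))]; ring
      · rw [hφ (p.vL n) (p.vL (n + 2)), k1]; ring
  change ∑ t ∈ _, f t = 0
  rw [Finset.sum_Ico_eq_sum_range, show 2 * p.g + 1 - 1 = p.g + (1 + (p.k + p.N)) by omega,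
    sum_range_add, sum_range_add, sum_range_add, sum_range_one]
  have s5 : ∑ x ∈ range p.N, f (1 + (p.g + (1 + (p.k + x)))) =
      ∑ m ∈ range p.N, f (2 * p.g - m) := by
    rw [← Finset.sum_range_reflect]; refine sum_congr rfl fun m hm => ?_
    rw [Finset.mem_range] at hm; congr 1; omega
  have s3' : ∑ i ∈ range p.k, f (1 + (p.g + (1 + i))) =
      ∑ i ∈ range p.k, φ (p.vQ (i + 1)) (p.vQ (i + 1 + 1)) := by
    rw [← s3]; refine sum_congr rfl fun i _ => ?_
    congr 1; omega
  rw [s1', add_zero, s2, s3', s5, s4 _ le_rfl p.hN, hl, Finset.sum_range_succ', hφ (p.vQ 0) (p.vL 2), p.vQ_zero]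
  ring

lemma isTiling : IsTiling p.F (Finset.Ico 1 (2 * p.g + 1)) p.tP p.tB p.tC where
  pos _ ht := p.cr_tile ht
  chain φ hφ h := p.chain_sum φ hφ (fun s hs => h _ _ (p.slot_subset hs))
    (h _ _ (p.slit_subset p.left_slit)) (h _ _ (p.slit_subset p.right_slit))
  extremal := by
    have hg := p.g_eq; have hN := p.hN
    have hx : ∀ {i}, i < p.g → (p.vQ i).re < (p.vQ p.g).re := fun h => p.vQ_re_lt h
    have h0 : 0 < (p.vQ p.g).re := by
      have := p.ptx_mono (Nat.zero_le (p.g - 1)); rw [p.ptx_zero] at this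
      have h2 := p.ptx_lt_qx (p.g - 1); rw [Nat.sub_add_cancel (by omega)] at h2
      rw [p.vQ_pos (by omega)]; exact this.trans_lt h2
    have hL : ∀ m, (p.vL m).re < (p.vQ p.g).re := fun m => (p.lmx_nonpos m).trans_lt h0
    have hP0 : p.vP0.re < (p.vQ p.g).re := by
      have h1 := p.vQ_right (j := 0) (by omega); rw [Nat.sub_zero] at h1; rw [h1]
      simp only [vP0, rqx, p0]; rw [pow_zero, div_one, lt_div_iff₀ (by linarith [p.one_sub_pos])]
      nlinarith [p.half_lt, p.apos p.g, p.a_pow_g, p.x_le]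
    have hP : ∀ i ≤ p.k, (p.vP i).re < (p.vQ p.g).re := fun i hi =>
      (p.ptx_lt_qx i).trans_eq (by rw [p.vQ_pos (i := i + 1) (by omega)]) |>.trans (hx (by omega))
    refine ⟨p.g, by rw [Finset.mem_Ico]; omega, ?_⟩
    obtain ⟨n, hn⟩ : ∃ n, p.g = n + 1 := ⟨p.g - 1, by omega⟩
    obtain ⟨h1, -, -, h4, h5⟩ := p.tile_fan (i := n) (by omega); rw [← hn] at h1 h4; rw [← hn] at h5
    rw [h1, h4, h5]; refine ⟨hP0, hx (by omega), fun t ht hne => ?_⟩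
    rcases p.index_cases ht with ⟨i, hi, rfl⟩ | rfl | ⟨i, hi, rfl⟩ | ⟨m, hm, rfl⟩
    · obtain ⟨h1, -, -, h4, h5⟩ := p.tile_fan hi; rw [h1, h4, h5]; exact ⟨hP0, hx (by omega), hx hi⟩
    · obtain ⟨h1, -, -, h4, h5⟩ := p.tile_mid
      rw [h1, h4, h5]; exact ⟨hL 2, hx (by omega), hx (by omega)⟩
    · obtain ⟨h1, -, -, h4, h5⟩ := p.tile_top hi
      rw [h1, h4, h5]; exact ⟨hP _ hi, hx (by omega), hx (by omega)⟩
    · obtain ⟨h1, -, -, h4, h5, -⟩ := p.tile_chain hm; rw [h1, h4, h5]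
      refine ⟨?_, ?_, ?_⟩ <;> split_ifs <;> first | exact hL _ | exact hx (by omega)

end Par

namespace ArnouxYoccoz

lemma exists_par {g : ℕ} (hg : 3 ≤ g) : ∃ p : Par, p.g = g ∧ p.a = alpha g := by
  obtain ⟨h0, h1⟩ := alpha_spec (g := g) (by omega); have hp := alpha_pow (g := g) (by omega)
  have hsum : ∀ n ≤ g, ∑ i ∈ Finset.Icc 1 n, alpha g ^ i ≤ 1 := fun n hn => by
    rw [← h1]
    exact sum_le_sum_of_subset_of_nonneg (Finset.Icc_subset_Icc le_rfl hn)
      fun _ _ _ => (pow_pos h0 _).le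
  refine ⟨⟨alpha g, g / 2, (g - 1) / 2, ?_, ?_, ?_, by omega, by omega, by omega, fun hk => ?_⟩, ?_, rfl⟩
  · rw [← hp]; congr 1; omega
  · have := pow_pos h0 (g + 1); linarith
  · by_contra! h; have h3 := hsum 3 hg; have h2 := pow_le_pow_left₀ (by norm_num) h.le 2
    have h4 := pow_le_pow_left₀ (by norm_num) h.le 3; simp [sum_Icc_succ_top] at h3
    norm_num at h2 h4; linarith
  · by_contra! h; have h3 := hsum 4 (by omega); have h2 := pow_le_pow_left₀ (by norm_num) h.le 2
    have h4 := pow_le_pow_left₀ (by norm_num) h.le 3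
    have h5 := pow_le_pow_left₀ (by norm_num) h.le 4; simp [sum_Icc_succ_top] at h3
    norm_num at h2 h4 h5; linarith
  · simp only [Par.g]; omega

lemma mir_mir (m m' : Bool) (z : ℂ) : mir m (mir m' z) = mir (xor m m') z := by
  cases m <;> cases m' <;> simp [mir]

/-- `mir m` as a linear map. -/
def mirLM (m : Bool) : ℂ →ₗ[ℝ] ℂ := if m then Complex.conjAe.toLinearMap else LinearMap.id

lemma mirLM_apply (m : Bool) (z : ℂ) : mirLM m z = mir m z := by cases m <;> simp [mirLM, mir]

lemma dist_mir (m : Bool) (z w : ℂ) : dist (mir m z) (mir m w) = dist z w := by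
  cases m <;> simp [mir, dist_conj_conj]

lemma mir_re (m : Bool) (z : ℂ) : (mir m z).re = z.re := by cases m <;> simp [mir]

lemma mir_im (m : Bool) (z : ℂ) : (mir m z).im = if m then -z.im else z.im := by
  cases m <;> simp [mir]

lemma Glue.ne {g : ℕ} (hg : 3 ≤ g) {i j : Bool × ℕ} {a b c d : ℂ} (h : Glue g i a b j c d) : i ≠ j := by
  intro e
  cases h <;> simp only [Prod.mk.injEq, Bool.eq_not_self, false_and, true_and] at e <;> omega

end ArnouxYoccoz

namespace Par

variable (p : Par)

/-- The translation part of the map from a triangle to the model. -/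
def tr (kk : ℕ) : ℂ := if kk ≤ p.g then 0 else p.tV kk - mir (p.par kk) (Q p.g (kk - p.g))

/-- The map from a triangle to the model. -/
def toModel (kk : ℕ) (z : ℂ) : ℂ := mir (p.par kk) z + p.tr kk

lemma three_le : 3 ≤ p.g := by have := p.four_le; omega

variable {p} (hα : p.a = alpha p.g)

include hα

lemma Q_eq {i : ℕ} (hi : i ≤ p.g) : Q p.g i = p.vQ i := by
  unfold Q; rw [← hα]; have hD := p.one_sub_pos.ne'; split_ifs with h
  · rw [h, p.vQ_zero, vL, p.lmy_one]; congr 1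
    rw [p.lmx_succ 0, p.lmx_zero, ← p.a_pow_g, zero_add, pow_one]; have := p.a_ne; field_simp; ring
  · rw [p.vQ_pos (by omega)]; obtain ⟨i, rfl⟩ : ∃ j, i = j + 1 := ⟨i - 1, by omega⟩; congr 1
    have e : p.dep (i + 1) = p.a ^ (p.g - (i + 1) + 2) / (1 - p.a) := by
      unfold dep; congr 1; rw [div_eq_iff (p.apos _).ne', ← pow_add]; congr 1; omega
    rw [e, Y]; unfold qx; ring

lemma P_zero : P p.g 0 = p.vP0 := by
  simp only [P, ← hα, if_true, vP0, p0, e0, x]; have := p.one_sub_pos.ne'; congr 1; field_simp; ring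

lemma P_mid {i : ℕ} (hi : i + 2 < p.g) : P p.g (i + 2) = p.vP (i + 1) := by
  simp only [P, ← hα, if_neg (show i + 2 ≠ 0 by omega), if_neg (show i + 2 ≠ 1 by omega),
    if_neg (show i + 2 ≠ p.g by omega)]
  rfl

lemma lmx_two : p.lmx 2 = -(p.a ^ (p.g - 1) + p.a ^ p.g) / 2 := by
  obtain ⟨n, hn⟩ : ∃ n, p.g = n + 1 := ⟨p.g - 1, by have := p.three_le; omega⟩; have hx := p.a_pow_g
  rw [p.lmx_succ 1, p.lmx_succ 0, p.lmx_zero, ← hx, hn, Nat.add_sub_cancel, pow_succ]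
  have := p.a_ne; field_simp; ring

lemma toModel_low {kk : ℕ} (h1 : 1 ≤ kk) (h2 : kk ≤ p.g) : p.toModel kk (P p.g 0) = p.tP kk ∧
    p.toModel kk (Q p.g kk) = p.tV kk ∧ p.toModel kk (Q p.g (kk - 1)) = p.tU kk := by
  have e : ∀ z, p.toModel kk z = z := fun z => by
    have : p.par kk = false := by simp [par]; omega
    simp [toModel, tr, h2, this, mir]
  obtain ⟨i, rfl⟩ : ∃ i, kk = i + 1 := ⟨kk - 1, by omega⟩
  obtain ⟨t1, t2, t3, -, -⟩ := p.tile_fan (i := i) (by omega)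
  rw [e, e, e, t1, t2, t3, P_zero hα, Q_eq hα h2, Nat.add_sub_cancel, Q_eq hα (by omega)]
  exact ⟨rfl, rfl, rfl⟩

lemma toModel_high {i : ℕ} (h1 : 1 ≤ i) (h2 : i ≤ p.g) :
    p.toModel (p.g + i) (P p.g i) = p.tP (p.g + i) ∧
    p.toModel (p.g + i) (Q p.g i) = p.tV (p.g + i) ∧
    p.toModel (p.g + i) (Q p.g (i - 1)) = p.tU (p.g + i) := by
  have hg := p.g_eq; have hgn : ¬ p.g + i ≤ p.g := by omega
  have e : ∀ z, p.toModel (p.g + i) z = p.tV (p.g + i) + mir (p.par (p.g + i)) (z - Q p.g i) := by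
    intro z; rw [toModel, tr, if_neg hgn, Nat.add_sub_cancel_left, ← mir_sub_mir]; ring
  have eV : p.toModel (p.g + i) (Q p.g i) = p.tV (p.g + i) := by
    rw [e, sub_self, ← mirLM_apply, map_zero, add_zero]
  have hone := p.one_sub_pos.ne'; have ha := p.a_ne
  by_cases hk : i ≤ p.k + 1
  · have e' : ∀ z, p.toModel (p.g + i) z = z := by
      intro z; have hp : p.par (p.g + i) = false := by simp [par]; omega
      have : p.tV (p.g + i) = Q p.g i := by
        rw [tV, if_neg hgn, if_pos (by omega), Nat.add_sub_cancel_left, Q_eq hα h2]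
      rw [e, hp, this]; simp [mir]
    refine ⟨?_, eV, ?_⟩
    · rw [e']; rcases h1.eq_or_lt with rfl | h
      · rw [p.tile_mid.1, vL, lmx_two hα, p.lmy_two]
        simp only [P, ← hα, if_neg one_ne_zero, if_true]; congr 1; unfold Y; field_simp; ring
      · obtain ⟨j, rfl⟩ : ∃ j, i = j + 2 := ⟨i - 2, by omega⟩
        rw [P_mid hα (by have := p.hN; omega), show p.g + (j + 2) = p.g + 2 + j by ring,
          (p.tile_top (by omega)).1]
    · rw [e', Q_eq hα (by omega), tU, if_neg hgn, if_pos (by omega), Nat.add_sub_cancel_left]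
  · obtain ⟨m, hm, rfl⟩ : ∃ m < p.N, i = p.g - m := ⟨p.g - i, by omega, by omega⟩
    obtain ⟨t1, t2, t3, -, -, t6⟩ := p.tile_chain hm
    have e2 : p.g + (p.g - m) = 2 * p.g - m := by omega
    rw [e2] at e eV ⊢; refine ⟨?_, eV, ?_⟩
    · rw [e, t1, t3, t6, Q_eq hα h2, p.vQ_right (by omega), eq_comm, ← sub_eq_iff_eq_add', eq_comm]
      rcases m.eq_zero_or_pos with rfl | hm0
      · have hg3 := p.three_le
        simp only [P, ← hα, if_neg (show p.g ≠ 0 by omega), if_neg (show p.g ≠ 1 by omega),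
          Nat.sub_zero, if_true]
        rw [p.vQ_pos le_rfl, p.dep_one, vL, p.lmx_zero, p.lmy_zero, p.qx_one]
        have h1 : p.a ^ p.g = p.x / p.a := by rw [← p.a_pow_g]; field_simp
        simp only [Nat.even_iff, Nat.zero_mod, decide_true]
        apply Complex.ext <;> simp only [mir_re, mir_im, sub_re, sub_im, if_true, rqx, rqy,
          pow_zero, Y, M, x, div_one]
        · rw [h1]; unfold x; field_simp; ring
        · field_simp; ring
      · rw [if_neg hm0.ne', show p.g - m = (p.g - m - 2) + 2 by omega, P_mid hα (by omega),
          show p.g - m - 2 + 1 = p.g - m - 1 by omega, vP, vL, vL, p.lmx_succ]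
        have hx : p.a ^ (p.g - m - 1 + 1) * p.a ^ m * p.a = p.x := by
          rw [← pow_add, ← p.a_pow_g, mul_comm]; congr 2; omega
        apply Complex.ext
        · simp only [mir_re, sub_re, ptx, rqx]
          have h1 : p.a ^ p.g / p.a ^ m = p.a ^ (p.g - m - 1 + 1) := by
            rw [div_eq_iff (p.apos _).ne', ← pow_add]; congr 1; omega
          rw [h1, ← hx, pow_succ _ m]; have := (p.apos m).ne'; field_simp; ring
        · simp only [mir_im, sub_im, rqy, Y, lmy, p.one_sub_sq]; have := p.one_add_pos.ne'
          rcases Nat.even_or_odd m with he | he <;> rw [pow_succ (-p.a), he.neg_pow] <;>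
            simp [Nat.even_iff, Nat.odd_iff.1, he] <;> field_simp <;> ring
    · rw [e, t2, t3, t6, Q_eq hα h2, Q_eq hα (by omega), p.vQ_right (by omega),
        show p.g - m - 1 = p.g - (m + 1) by omega, p.vQ_right (by omega), vL, vL, eq_comm,
        ← sub_eq_iff_eq_add', eq_comm]
      apply Complex.ext
      · simp only [mir_re, sub_re]
        rw [p.rqx_sub, p.lmx_succ (m + 1), p.lmx_succ m, ← p.a_pow_g, pow_succ _ (m + 1)]
        have := (p.apos (m + 1)).ne'; field_simp; ring
      · simp only [mir_im, sub_im, rqy, lmy, p.one_sub_sq]; have := p.one_add_pos.ne'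
        by_cases he : Even m
        · simp only [he, decide_true, if_true]; rw [pow_add (-p.a), he.neg_pow]; field_simp; ring
        · simp only [he, decide_false, Bool.false_eq_true, if_false]
          rw [pow_add (-p.a), (Nat.not_even_iff_odd.1 he).neg_pow]; field_simp; ring

end Par

namespace Par

variable (p : Par)

/-- The sheet of the limit surface to which a triangle belongs. -/
def sheet (i : Bool × ℕ) : Bool := xor i.1 (p.par i.2)

/-- The position in the model of a point of a triangle. -/
def place (i : Bool × ℕ) (z : ℂ) : ℂ := mir (p.sheet i) z + p.tr i.2

lemma place_mir (m : Bool) (kk : ℕ) (z : ℂ) : p.place (m, kk) (mir m z) = p.toModel kk z := by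
  unfold place toModel sheet; rw [mir_mir]; congr 2; cases m <;> cases p.par kk <;> rfl

lemma sheet_low {m : Bool} {kk : ℕ} (h : kk ≤ p.g + p.k + 1) : p.sheet (m, kk) = m := by
  have : p.par kk = false := by simp [par]; omega
  simp [sheet, this]

lemma sheet_chain {m : Bool} {kk j : ℕ} (hj : j < p.N) (h : kk + j = 2 * p.g) :
    p.sheet (m, kk) = xor m (j % 2 == 0) := by
  obtain rfl : kk = 2 * p.g - j := by omega
  unfold sheet; rw [(p.tile_chain hj).2.2.2.2.2]; congr 1
  simp [Nat.even_iff, Bool.beq_eq_decide_eq]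

/-- Two edges are partners over the pair of edges `s`, `s.ps` of the limit surface. -/
def SlotMatch (s : Slot) (i : Bool × ℕ) (a b : ℂ) (j : Bool × ℕ) (c d : ℂ) : Prop :=
  s.Kept p.g ∧ p.sheet j = s.pf (p.sheet i) ∧
    ((p.place i a = p.tlo s ∧ p.place i b = p.thi s ∧ p.place j c = p.tlo s.ps ∧ p.place j d = p.thi s.ps) ∨
     (p.place i a = p.thi s ∧ p.place i b = p.tlo s ∧ p.place j c = p.thi s.ps ∧ p.place j d = p.tlo s.ps))

/-- The possible positions in the model of a pair of glued edges. -/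
def Match (i : Bool × ℕ) (a b : ℂ) (j : Bool × ℕ) (c d : ℂ) : Prop :=
  (p.sheet i = p.sheet j ∧ p.place i a = p.place j c ∧ p.place i b = p.place j d) ∨
  (∃ s, p.SlotMatch s i a b j c d) ∨
  (segment ℝ (p.place i a) (p.place i b) ⊆ p.F '' Lost p.g ∧
    segment ℝ (p.place j c) (p.place j d) ⊆ p.F '' Lost p.g)

variable {p} (hα : p.a = alpha p.g)

include hα

lemma place_low (m : Bool) {kk : ℕ} (h1 : 1 ≤ kk) (h2 : kk ≤ p.g) :
    p.place (m, kk) (mir m (P p.g 0)) = p.vP0 ∧ p.place (m, kk) (mir m (Q p.g kk)) = p.vQ kk ∧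
    p.place (m, kk) (mir m (Q p.g (kk - 1))) = p.vQ (kk - 1) := by
  obtain ⟨i, rfl⟩ : ∃ i, kk = i + 1 := ⟨kk - 1, by omega⟩
  obtain ⟨t1, t2, t3, -, -⟩ := p.tile_fan (i := i) (by omega)
  obtain ⟨e1, e2, e3⟩ := toModel_low hα h1 h2
  rw [place_mir, place_mir, place_mir, e1, e2, e3, t1, t2, t3]; exact ⟨rfl, rfl, rfl⟩

lemma place_high (m : Bool) {kk i : ℕ} (h1 : 1 ≤ i) (h2 : i ≤ p.k + 1) (hkk : kk = p.g + i) :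
    p.place (m, kk) (mir m (P p.g i)) = (if i = 1 then p.vL 2 else p.vP (i - 1)) ∧
    p.place (m, kk) (mir m (Q p.g i)) = p.vQ i ∧
    p.place (m, kk) (mir m (Q p.g (i - 1))) = p.vQ (i - 1) := by
  subst hkk; obtain ⟨e1, e2, e3⟩ := toModel_high hα h1 (h2.trans (by have := p.g_eq; omega))
  rw [place_mir, place_mir, place_mir, e1, e2, e3]; rcases h1.eq_or_lt with rfl | h
  · obtain ⟨t1, t2, t3, -, -⟩ := p.tile_mid; exact ⟨by rw [t1, if_pos rfl], t3, t2⟩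
  · obtain ⟨i, rfl⟩ : ∃ j, i = j + 2 := ⟨i - 2, by omega⟩
    obtain ⟨t1, t2, t3, -, -⟩ := p.tile_top (i := i) (by omega)
    rw [show p.g + (i + 2) = p.g + 2 + i by ring]
    exact ⟨by rw [t1, if_neg (by omega)]; rfl, t3, t2⟩

lemma place_chain (m : Bool) {kk i j : ℕ} (hj : j < p.N) (hi : i + j = p.g) (hkk : kk = p.g + i) :
    p.place (m, kk) (mir m (P p.g i)) = (if j = 0 then p.vQ 1 else p.vL (j + 1)) ∧
    p.place (m, kk) (mir m (Q p.g i)) = p.vL j ∧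
    p.place (m, kk) (mir m (Q p.g (i - 1))) = p.vL (j + 2) := by
  subst hkk; have := p.g_eq; obtain ⟨e1, e2, e3⟩ := toModel_high (i := i) hα (by omega) (by omega)
  rw [place_mir, place_mir, place_mir, e1, e2, e3, show p.g + i = 2 * p.g - j by omega]
  obtain ⟨t1, t2, t3, -, -, -⟩ := p.tile_chain hj; exact ⟨t1, t3, t2⟩

lemma slotMatch_base (m : Bool) : p.SlotMatch (.bot false) (m, 1) (mir m (P p.g 0)) (mir m (Q p.g 0))
    (!m, p.g) (mir (!m) (Q p.g p.g)) (mir (!m) (P p.g 0)) := by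
  have h3 := p.three_le; obtain ⟨e1, -, e2⟩ := place_low hα m le_rfl (show 1 ≤ p.g by omega)
  obtain ⟨e3, e4, -⟩ := place_low hα (!m) (show 1 ≤ p.g by omega) le_rfl
  refine ⟨trivial, ?_, Or.inr ⟨e1, e2, e4, e3⟩⟩
  rw [p.sheet_low (by omega), p.sheet_low (by omega)]; rfl

lemma slotMatch_right (m : Bool) : p.SlotMatch (.top false 0) (m, 2 * p.g) (mir m (P p.g p.g))
    (mir m (Q p.g p.g)) (m, p.g + 2) (mir m (P p.g 2)) (mir m (Q p.g 1)) := by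
  have hg := p.g_eq; have hN := p.hN; have hk := p.hk
  obtain ⟨e1, e2, -⟩ := place_chain hα m (j := 0) (i := p.g) (show 0 < p.N by omega) (add_zero _) (two_mul p.g)
  obtain ⟨e3, -, e4⟩ := place_high hα m (show 1 ≤ 2 by omega) (by omega) rfl
  refine ⟨?_, ?_, Or.inr ⟨e1, ?_, e3, e4⟩⟩
  · simp only [Slot.Kept, p.g_div]; omega
  · rw [p.sheet_low (by omega), p.sheet_chain (j := 0) (by omega) (add_zero _)]; simp [Slot.pf]
  · rw [e2, vL, p.lmx_zero, p.lmy_zero, tlo, if_neg (by simp), vP, p.ptx_zero]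

lemma slotMatch_step (m : Bool) {i : ℕ} (h : 1 ≤ i) (h' : i < p.k) :
    p.SlotMatch (.top false i) (m, p.g + (i + 1)) (mir m (P p.g (i + 1))) (mir m (Q p.g (i + 1)))
      (!m, p.g + (i + 1) + 1) (mir (!m) (Q p.g (i + 1))) (mir (!m) (P p.g (i + 1 + 1))) := by
  obtain ⟨e1, e2, -⟩ := place_high hα m (show 1 ≤ i + 1 by omega) (by omega) rfl
  obtain ⟨e3, -, e4⟩ := place_high hα (!m) (show 1 ≤ i + 1 + 1 by omega) (by omega) rfl
  rw [if_neg (by omega)] at e1 e3; refine ⟨?_, ?_, Or.inl ⟨e1, e2, e4, e3⟩⟩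
  · simp only [Slot.Kept, p.g_div]; omega
  · rw [p.sheet_low (by omega), p.sheet_low (by omega)]; rfl

lemma slotMatch_outer (m : Bool) {j i : ℕ} (hj : j < p.N) (hi : i + j = p.g) :
    p.SlotMatch (.right j) (m, i) (mir m (Q p.g (i - 1))) (mir m (Q p.g i))
      (m, p.g + i) (mir m (Q p.g (i - 1))) (mir m (Q p.g i)) := by
  have := p.g_eq; obtain ⟨-, e1, e2⟩ := place_low hα m (show 1 ≤ i by omega) (by omega)
  obtain ⟨-, e3, e4⟩ := place_chain hα m hj hi rfl; have hi' : p.g - j = i := by omega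
  refine ⟨?_, ?_, Or.inr ⟨?_, ?_, e4, e3⟩⟩
  · simp only [Slot.Kept, p.g_sub_div]; exact hj
  · rw [p.sheet_chain hj (by omega), p.sheet_low (by omega)]; rfl
  · rw [e2, thi, hi']
  · rw [e1, tlo, hi']

lemma match_of_glue {i j : Bool × ℕ} {a b c d : ℂ} (h : Glue p.g i a b j c d) : p.Match i a b j c d := by
  have hg := p.g_eq; have hN := p.hN; have hk := p.hk
  cases h with
  | fan m i h h' =>
    obtain ⟨e1, e2, -⟩ := place_low hα m h (by omega)
    obtain ⟨e3, -, e4⟩ := place_low hα m (kk := i + 1) (by omega) h'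
    exact Or.inl ⟨by rw [p.sheet_low (by omega), p.sheet_low (by omega)], e1.trans e3.symm, e2.trans e4.symm⟩
  | outer m i h h' =>
    by_cases hik : i ≤ p.k + 1
    · obtain ⟨-, e1, e2⟩ := place_low hα m h h'; obtain ⟨-, e3, e4⟩ := place_high hα m h hik rfl
      exact Or.inl ⟨by rw [p.sheet_low (by omega), p.sheet_low (by omega)], e2.trans e4.symm, e1.trans e3.symm⟩
    · exact Or.inr (Or.inl ⟨_, slotMatch_outer hα m (j := p.g - i) (by omega) (by omega)⟩)
  | base m => exact Or.inr (Or.inl ⟨_, slotMatch_base hα m⟩)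
  | corner m =>
    obtain ⟨e1, e2, -⟩ := place_high hα m le_rfl (by omega) rfl
    obtain ⟨e3, -, e4⟩ := place_chain hα (!m) (j := 0) (i := p.g) (show 0 < p.N by omega) (add_zero _) (two_mul p.g)
    refine Or.inl ⟨?_, e1.trans e4.symm, e2.trans e3.symm⟩
    rw [p.sheet_low (by omega), p.sheet_chain (j := 0) (by omega) (add_zero _)]; simp
  | left m =>
    obtain ⟨e1, -, e2⟩ := place_high hα m le_rfl (by omega) rfl; rcases hN.eq_or_lt with h1 | h1
    · obtain ⟨e3, e4, -⟩ := place_high hα m (i := p.g - 1) (kk := 2 * p.g - 1) (by omega) (by omega) (by omega)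
      refine Or.inr (Or.inr ⟨?_, ?_⟩)
      · rw [e1, e2, if_pos rfl, segment_symm, vQ_zero]; simpa [← h1] using p.left_slit
      · rw [e3, e4, if_neg (by omega), segment_symm, show p.g - 1 - 1 = p.k by omega,
          show p.g - 1 = p.k + 1 by omega]
        exact p.right_slit
    · obtain ⟨e3, e4, -⟩ := place_chain hα m (i := p.g - 1) (kk := 2 * p.g - 1) h1 (by omega) (by omega)
      refine Or.inl ⟨?_, e1.trans e3.symm, e2.trans e4.symm⟩
      rw [p.sheet_low (by omega), p.sheet_chain h1 (by omega)]; simp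
  | right m => exact Or.inr (Or.inl ⟨_, slotMatch_right hα m⟩)
  | step m i h h' =>
    obtain ⟨i, rfl⟩ : ∃ j, i = j + 1 := ⟨i - 1, by omega⟩
    rcases lt_trichotomy i p.k with h1 | h1 | h1
    · exact Or.inr (Or.inl ⟨_, slotMatch_step hα m (by omega) h1⟩)
    · obtain ⟨e1, e2, -⟩ := place_high hα m (i := i + 1) (by omega) (by omega) rfl
      obtain ⟨e3, -, e4⟩ := place_chain hα (!m) (j := p.N - 1) (i := i + 1 + 1) (by omega) (by omega) rfl
      refine Or.inr (Or.inr ⟨?_, ?_⟩)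
      · rw [e1, e2, if_neg (by omega), segment_symm, h1]; exact p.right_slit
      · rw [Nat.add_sub_cancel, show p.N - 1 + 2 = p.N + 1 by omega] at e4
        rw [if_neg (by omega), Nat.sub_add_cancel hN] at e3
        rw [add_assoc p.g, e3, e4, segment_symm]; exact p.left_slit
    · obtain ⟨j, hj⟩ : ∃ j, i + 1 + 1 + j = p.g := ⟨p.g - (i + 2), by omega⟩
      obtain ⟨e1, e2, -⟩ := place_chain hα m (j := j + 1) (i := i + 1) (by omega) (by omega) rfl
      obtain ⟨e3, -, e4⟩ := place_chain hα (!m) (j := j) (i := i + 1 + 1) (by omega) hj rfl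
      rw [if_neg (by omega)] at e1 e3
      refine Or.inl ⟨?_, e1.trans (Eq.symm e4), e2.trans (Eq.symm e3)⟩
      rw [p.sheet_chain (j := j + 1) (by omega) (by omega), p.sheet_chain (j := j) (by omega) (by omega)]
      rcases Nat.mod_two_eq_zero_or_one j with h | h
      · have : (j + 1) % 2 = 1 := by omega
        simp [h, this]
      · have : (j + 1) % 2 = 0 := by omega
        simp [h, this]

/-- Every kept pair of edges of the limit surface comes from a gluing of triangles. -/
lemma exists_slotMatch (f : Bool) {s : Slot} (hs : s.Kept p.g) : ∃ i a b j c d,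
    (Glue p.g i a b j c d ∧ p.sheet i = f ∧ p.SlotMatch s i a b j c d) ∨
    (Glue p.g j c d i a b ∧ p.sheet i = f ∧ p.SlotMatch s.ps j c d i a b) := by
  have hg := p.g_eq; have hN := p.hN; have hk := p.hk
  cases s with
  | bot b =>
    cases b
    · exact ⟨_, _, _, _, _, _, Or.inl ⟨.base f, p.sheet_low (by omega), slotMatch_base hα f⟩⟩
    · exact ⟨_, _, _, _, _, _, Or.inr ⟨.base (!f), by rw [p.sheet_low (by omega), Bool.not_not],
        slotMatch_base hα (!f)⟩⟩
  | top b m =>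
    simp only [Slot.Kept, p.g_div] at hs; rcases m.eq_zero_or_pos with rfl | hm
    · cases b
      · exact ⟨_, _, _, _, _, _, Or.inl ⟨.right (!f), by
          rw [p.sheet_chain (j := 0) (by omega) (add_zero _)]; simp, slotMatch_right hα (!f)⟩⟩
      · exact ⟨_, _, _, _, _, _, Or.inr ⟨.right f, p.sheet_low (by omega), slotMatch_right hα f⟩⟩
    · cases b
      · exact ⟨_, _, _, _, _, _, Or.inl ⟨.step f (m + 1) (by omega) (by omega), p.sheet_low (by omega),
          slotMatch_step hα f hm hs⟩⟩
      · exact ⟨_, _, _, _, _, _, Or.inr ⟨.step (!f) (m + 1) (by omega) (by omega), by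
          rw [p.sheet_low (by omega), Bool.not_not], slotMatch_step hα (!f) hm hs⟩⟩
  | right m =>
    simp only [Slot.Kept, p.g_sub_div] at hs
    exact ⟨_, _, _, _, _, _, Or.inl ⟨.outer f (p.g - m) (by omega) (by omega), p.sheet_low (by omega),
      slotMatch_outer hα f hs (by omega)⟩⟩
  | left m =>
    simp only [Slot.Kept, p.g_sub_div] at hs
    refine ⟨_, _, _, _, _, _, Or.inr ⟨.outer (xor f (m % 2 == 0)) (p.g - m) (by omega) (by omega), ?_,
      slotMatch_outer hα _ hs (by omega)⟩⟩
    rw [p.sheet_chain hs (by omega)]; simp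

/-- Every edge of a tile takes part in a gluing. -/
lemma exists_glue_edge (m : Bool) {kk : ℕ} (hkk : kk ∈ Finset.Ico 1 (2 * p.g + 1)) {u v : ℂ}
    (h : (u, v) ∈ ({(p.tP kk, p.tV kk), (p.tP kk, p.tU kk), (p.tU kk, p.tV kk)} : Set (ℂ × ℂ))) :
    ∃ a b j c d, (Glue p.g (m, kk) a b j c d ∨ Glue p.g j c d (m, kk) a b) ∧
      segment ℝ (p.place (m, kk) a) (p.place (m, kk) b) = segment ℝ u v := by
  have h3 := p.three_le; rw [Finset.mem_Ico] at hkk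
  simp only [mem_insert_iff, mem_singleton_iff, Prod.mk.injEq] at h
  obtain h1 | h1 := Nat.lt_or_ge p.g kk
  · obtain ⟨i, rfl⟩ : ∃ i, kk = p.g + i := ⟨kk - p.g, by omega⟩
    obtain ⟨e1, e2, e3⟩ := toModel_high (i := i) hα (by omega) (by omega)
    rw [← e1, ← e2, ← e3, ← p.place_mir m, ← p.place_mir m, ← p.place_mir m] at h
    rcases h with ⟨rfl, rfl⟩ | ⟨rfl, rfl⟩ | ⟨rfl, rfl⟩
    · by_cases i1 : i = 1
      · subst i1; exact ⟨_, _, _, _, _, Or.inl (.corner m), rfl⟩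
      by_cases i2 : i = p.g
      · rw [i2, ← two_mul]; exact ⟨_, _, _, _, _, Or.inl (.right m), rfl⟩
      by_cases i3 : i = p.g - 1
      · rw [i3, show p.g + (p.g - 1) = 2 * p.g - 1 by omega]; exact ⟨_, _, _, _, _, Or.inr (.left m), rfl⟩
      · exact ⟨_, _, _, _, _, Or.inl (.step m i (by omega) (by omega)), rfl⟩
    · by_cases i1 : i = 1
      · subst i1; exact ⟨_, _, _, _, _, Or.inl (.left m), rfl⟩
      by_cases i2 : i = 2
      · subst i2; exact ⟨_, _, _, _, _, Or.inr (.right m), rfl⟩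
      by_cases i3 : i = p.g
      · have := Glue.corner (g := p.g) (!m); rw [Bool.not_not] at this
        rw [i3, ← two_mul]; exact ⟨_, _, _, _, _, Or.inr this, segment_symm _ _ _⟩
      · obtain ⟨j, rfl⟩ : ∃ j, i = j + 1 := ⟨i - 1, by omega⟩
        have := Glue.step (g := p.g) (!m) j (by omega) (by omega); rw [Bool.not_not] at this
        exact ⟨_, _, _, _, _, Or.inr this, segment_symm _ _ _⟩
    · exact ⟨_, _, _, _, _, Or.inr (.outer m i (by omega) (by omega)), rfl⟩
  · obtain ⟨e1, e2, e3⟩ := toModel_low hα hkk.1 h1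
    rw [← e1, ← e2, ← e3, ← p.place_mir m, ← p.place_mir m, ← p.place_mir m] at h
    rcases h with ⟨rfl, rfl⟩ | ⟨rfl, rfl⟩ | ⟨rfl, rfl⟩
    · by_cases hk : kk = p.g
      · have := Glue.base (g := p.g) (!m); rw [Bool.not_not] at this
        rw [hk]; exact ⟨_, _, _, _, _, Or.inr this, segment_symm _ _ _⟩
      · exact ⟨_, _, _, _, _, Or.inl (.fan m kk hkk.1 (by omega)), rfl⟩
    · by_cases hk : kk = 1
      · subst hk; exact ⟨_, _, _, _, _, Or.inl (.base m), rfl⟩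
      · obtain ⟨j, rfl⟩ : ∃ j, kk = j + 1 := ⟨kk - 1, by omega⟩
        exact ⟨_, _, _, _, _, Or.inr (.fan m j (by omega) (by omega)), rfl⟩
    · exact ⟨_, _, _, _, _, Or.inl (.outer m kk hkk.1 h1), rfl⟩

end Par

namespace ArnouxYoccoz

lemma triangle_low {g kk : ℕ} (m : Bool) (h1 : 1 ≤ kk) (h2 : kk ≤ g) : triangle g (m, kk) =
    convexHull ℝ {mir m (P g 0), mir m (Q g kk), mir m (Q g (kk - 1))} := if_pos ⟨h1, h2⟩

lemma triangle_high {g kk i : ℕ} (m : Bool) (h1 : 1 ≤ i) (h2 : i ≤ g) (h : kk = g + i) : triangle g (m, kk) =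
    convexHull ℝ {mir m (P g i), mir m (Q g (i - 1)), mir m (Q g i)} := by
  subst h; simp only [triangle]; rw [if_neg (by omega), if_pos (by omega), Nat.add_sub_cancel_left]

lemma convex_triangle (g : ℕ) (i : Bool × ℕ) : Convex ℝ (triangle g i) := by
  unfold triangle; split_ifs
  exacts [convex_convexHull _ _, convex_convexHull _ _, convex_empty]

lemma isClosed_triangle (g : ℕ) (i : Bool × ℕ) : IsClosed (triangle g i) := by
  unfold triangle; split_ifs
  exacts [(Set.toFinite _).isClosed_convexHull ℝ, (Set.toFinite _).isClosed_convexHull ℝ, isClosed_empty]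

lemma Glue.endpoints_mem {g : ℕ} (hg : 3 ≤ g) {i j : Bool × ℕ} {a b c d : ℂ} (h : Glue g i a b j c d) :
    a ∈ triangle g i ∧ b ∈ triangle g i ∧ c ∈ triangle g j ∧ d ∈ triangle g j := by
  cases h with
  | fan m i h h' =>
    rw [triangle_low m h (by omega), triangle_low m (by omega) h']
    refine ⟨?_, ?_, ?_, ?_⟩ <;> exact subset_convexHull ℝ _ (by simp)
  | outer m i h h' =>
    rw [triangle_low m h h', triangle_high m h h' rfl]
    refine ⟨?_, ?_, ?_, ?_⟩ <;> exact subset_convexHull ℝ _ (by simp)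
  | base m =>
    rw [triangle_low m le_rfl (by omega), triangle_low (!m) (by omega) le_rfl]
    refine ⟨?_, ?_, ?_, ?_⟩ <;> exact subset_convexHull ℝ _ (by simp)
  | corner m =>
    rw [triangle_high m le_rfl (by omega) rfl, triangle_high (!m) (by omega) le_rfl (two_mul g)]
    refine ⟨?_, ?_, ?_, ?_⟩ <;> exact subset_convexHull ℝ _ (by simp)
  | left m =>
    rw [triangle_high m le_rfl (by omega) rfl,
      triangle_high (i := g - 1) m (by omega) (by omega) (by omega)]
    refine ⟨?_, ?_, ?_, ?_⟩ <;> exact subset_convexHull ℝ _ (by simp)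
  | right m =>
    rw [triangle_high (i := 2) m (by omega) (by omega) rfl, triangle_high m (by omega) le_rfl (two_mul g)]
    refine ⟨?_, ?_, ?_, ?_⟩ <;> exact subset_convexHull ℝ _ (by simp)
  | step m i h h' =>
    rw [triangle_high (i := i) m (by omega) (by omega) rfl,
      triangle_high (i := i + 1) (!m) (by omega) (by omega) (add_assoc g i 1)]
    refine ⟨?_, ?_, ?_, ?_⟩ <;> exact subset_convexHull ℝ _ (by simp)

lemma Glue.pt_eq {g : ℕ} (hg : 3 ≤ g) {i j : Bool × ℕ} {a b c d : ℂ} (h : Glue g i a b j c d) {θ : ℝ}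
    (hθ : θ ∈ Icc (0 : ℝ) 1) : ∃ hu hu', pt (G := surface g hg) i (lineMap a b θ) hu =
      pt (G := surface g hg) j (lineMap c d θ) hu' := by
  obtain ⟨ha, hb, hc, hd⟩ := h.endpoints_mem hg
  refine ⟨(convex_triangle g i).lineMap_mem ha hb hθ, (convex_triangle g j).lineMap_mem hc hd hθ,
    Quot.sound ⟨a, b, c, d, h, ?_, ?_⟩⟩
  · rw [segment_eq_image_lineMap]; exact ⟨θ, hθ, rfl⟩
  · have e := glue_translation hg _ _ _ _ _ _ h
    simp only [lineMap_apply, vsub_eq_sub, vadd_eq_add, e]; ring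

end ArnouxYoccoz

namespace Par

variable (p : Par)

lemma tlo_mem {s : Slot} (hs : s.Kept p.g) : p.tlo s ∈ p.F '' removed :=
  ⟨s.lo, subset_closure s.lo_mem_endpoints, by
    have := p.F_slot hs (t := 0) ⟨le_rfl, zero_le_one⟩
    rwa [s.at'_zero, lineMap_apply_zero] at this⟩

lemma thi_mem {s : Slot} (hs : s.Kept p.g) : p.thi s ∈ p.F '' removed :=
  ⟨s.hi, subset_closure s.hi_mem_endpoints, by
    have := p.F_slot hs (t := 1) ⟨zero_le_one, le_rfl⟩; rwa [s.at'_one, lineMap_apply_one] at this⟩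

lemma vQ_mem {i : ℕ} (hi : i ≤ p.g) : p.vQ i ∈ p.F '' removed := by
  have hg := p.g_eq; rcases i.eq_zero_or_pos with rfl | h0
  · exact p.tlo_mem (s := .bot false) trivial
  by_cases h1 : i ≤ p.k
  · have := p.tlo_mem (s := .top true (i - 1)) (by simp only [Slot.Kept, p.g_div]; omega)
    rwa [tlo, if_pos rfl, Nat.sub_add_cancel h0] at this
  rcases hi.eq_or_lt with rfl | h2
  · exact p.tlo_mem (s := .right 0) (by simp only [Slot.Kept, p.g_sub_div]; exact p.hN)
  · have := p.thi_mem (s := .right (p.g - i - 1)) (by simp only [Slot.Kept, p.g_sub_div]; omega)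
    rwa [thi, show p.g - (p.g - i - 1) - 1 = i by omega] at this

lemma vL_mem {m : ℕ} (hm : m ≤ p.N + 1) : p.vL m ∈ p.F '' removed := by
  have hN := p.hN
  by_cases h1 : m < p.N
  · exact p.tlo_mem (s := .left m) (by simpa only [Slot.Kept, p.g_sub_div] using h1)
  by_cases h2 : m = 1
  · subst h2; exact p.vQ_mem (Nat.zero_le _)
  · have := p.thi_mem (s := .left (m - 2)) (by simp only [Slot.Kept, p.g_sub_div]; omega)
    rwa [thi, show m - 2 + 2 = m by omega] at this

lemma vP_mem {m : ℕ} (hm : m ≤ p.k) : p.vP m ∈ p.F '' removed := by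
  rcases hm.lt_or_eq with h | rfl
  · exact p.tlo_mem (s := .top false m) (by simpa only [Slot.Kept, p.g_div] using h)
  · have hk := p.hk
    have := p.thi_mem (s := .top true (p.k - 1)) (by simp only [Slot.Kept, p.g_div]; omega)
    rwa [thi, if_pos rfl, Nat.sub_add_cancel hk] at this

lemma tP_tU_tV_mem {kk : ℕ} (h : kk ∈ Finset.Ico 1 (2 * p.g + 1)) :
    p.tP kk ∈ p.F '' removed ∧ p.tU kk ∈ p.F '' removed ∧ p.tV kk ∈ p.F '' removed := by
  have hg := p.g_eq; rcases p.index_cases h with ⟨i, hi, rfl⟩ | rfl | ⟨i, hi, rfl⟩ | ⟨m, hm, rfl⟩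
  · obtain ⟨h1, h2, h3, -⟩ := p.tile_fan hi
    rw [h1, h2, h3]; exact ⟨p.thi_mem (s := .bot false) trivial, p.vQ_mem hi.le, p.vQ_mem hi⟩
  · obtain ⟨h1, h2, h3, -⟩ := p.tile_mid
    rw [h1, h2, h3]; exact ⟨p.vL_mem (by have := p.hN; omega), p.vQ_mem (by omega), p.vQ_mem (by omega)⟩
  · obtain ⟨h1, h2, h3, -⟩ := p.tile_top hi
    rw [h1, h2, h3]; exact ⟨p.vP_mem hi, p.vQ_mem (by omega), p.vQ_mem (by omega)⟩
  · obtain ⟨h1, h2, h3, -⟩ := p.tile_chain hm; rw [h1, h2, h3]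
    refine ⟨?_, p.vL_mem (by omega), p.vL_mem (by omega)⟩; split_ifs
    exacts [p.vQ_mem (by omega), p.vL_mem (by omega)]

lemma tB_tC (kk : ℕ) : (p.tB kk = p.tV kk ∧ p.tC kk = p.tU kk) ∨ (p.tB kk = p.tU kk ∧ p.tC kk = p.tV kk) := by
  unfold tB tC; split_ifs <;> simp

/-- The image of a triangle in the model. -/
def tile (kk : ℕ) : Set ℂ := convexHull ℝ {p.tP kk, p.tB kk, p.tC kk}

lemma tile_eq (kk : ℕ) : p.tile kk = convexHull ℝ {p.tP kk, p.tV kk, p.tU kk} := by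
  unfold tile; rcases p.tB_tC kk with ⟨h1, h2⟩ | ⟨h1, h2⟩
  · rw [h1, h2]
  · rw [h1, h2, pair_comm]

lemma tile_subset {kk : ℕ} (h : kk ∈ Finset.Ico 1 (2 * p.g + 1)) : p.tile kk ⊆ p.F '' rect :=
  p.isTiling.tile_subset h

lemma vertices_subset : IsTiling.vertices (Finset.Ico 1 (2 * p.g + 1)) p.tP p.tB p.tC ⊆ p.F '' removed := by
  rintro z ⟨t, ht, hz⟩; obtain ⟨h1, h2, h3⟩ := p.tP_tU_tV_mem ht
  rcases p.tB_tC t with ⟨e1, e2⟩ | ⟨e1, e2⟩ <;> rw [e1, e2] at hz <;> rcases hz with rfl | rfl | rfl <;>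
    assumption

/-- `place i` as an affine map. -/
def placeAff (i : Bool × ℕ) : ℂ →ᵃ[ℝ] ℂ :=
  (mirLM (p.sheet i)).toAffineMap + AffineMap.const ℝ ℂ (p.tr i.2)

lemma placeAff_apply (i : Bool × ℕ) (z : ℂ) : p.placeAff i z = p.place i z := by
  simp [placeAff, place, mirLM_apply]

lemma place_lineMap (i : Bool × ℕ) (a b : ℂ) (θ : ℝ) : p.place i (lineMap a b θ) =
    lineMap (p.place i a) (p.place i b) θ := by
  simp only [← placeAff_apply]; exact AffineMap.apply_lineMap _ _ _ _

lemma dist_place (i : Bool × ℕ) (z w : ℂ) : dist (p.place i z) (p.place i w) = dist z w := by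
  unfold place; rw [dist_add_right, dist_mir]

lemma place_injective (i : Bool × ℕ) : Function.Injective (p.place i) :=
  (Isometry.of_dist_eq (p.dist_place i)).injective

lemma continuous_place (i : Bool × ℕ) : Continuous (p.place i) :=
  (Isometry.of_dist_eq (p.dist_place i)).continuous

/-- The triangle that belongs to a sheet. -/
def piece (f : Bool) (kk : ℕ) : Bool × ℕ := (xor f (p.par kk), kk)

lemma sheet_piece (f : Bool) (kk : ℕ) : p.sheet (p.piece f kk) = f := by simp [sheet, piece]

lemma piece_sheet (i : Bool × ℕ) : p.piece (p.sheet i) i.2 = i := by simp [sheet, piece]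

/-- The inverse of `place`. -/
def unplace (f : Bool) (kk : ℕ) (w : ℂ) : ℂ := mir f (w - p.tr kk)

lemma place_unplace (f : Bool) (kk : ℕ) (w : ℂ) : p.place (p.piece f kk) (p.unplace f kk w) = w := by
  rw [place, sheet_piece, unplace, mir_mir, Bool.xor_self]; simp [mir, piece]

lemma dist_unplace (f : Bool) (kk : ℕ) (z w : ℂ) : dist (p.unplace f kk z) (p.unplace f kk w) = dist z w := by
  unfold unplace; rw [dist_mir, dist_sub_right]

lemma notMem_vertices {v : ℂ} (hv : v ∈ good) :
    p.F v ∉ IsTiling.vertices (Finset.Ico 1 (2 * p.g + 1)) p.tP p.tB p.tC := fun h => by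
  obtain ⟨v', h1, h2⟩ := p.vertices_subset h; rw [p.F.injective h2] at h1; exact hv.2 h1

variable {p}

lemma SlotMatch.symm {s : Slot} {i j : Bool × ℕ} {a b c d : ℂ} (h : p.SlotMatch s i a b j c d) :
    p.SlotMatch s.ps j c d i a b := by
  obtain ⟨h1, h2, h3⟩ := h; refine ⟨(s.kept_ps _).2 h1, by rw [h2, Slot.pf_ps], ?_⟩
  rw [Slot.ps_ps]; tauto

lemma Match.symm {i j : Bool × ℕ} {a b c d : ℂ} (h : p.Match i a b j c d) : p.Match j c d i a b := by
  rcases h with ⟨h1, h2, h3⟩ | ⟨s, h⟩ | ⟨h1, h2⟩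
  exacts [Or.inl ⟨h1.symm, h2.symm, h3.symm⟩, Or.inr (Or.inl ⟨_, h.symm⟩), Or.inr (Or.inr ⟨h2, h1⟩)]

lemma SlotMatch.exists_param {s : Slot} {i j : Bool × ℕ} {a b c d : ℂ} (h : p.SlotMatch s i a b j c d) :
    ∃ σ : ℝ → ℝ, (∀ t, σ (σ t) = t) ∧ ∀ θ ∈ Icc (0 : ℝ) 1, σ θ ∈ Icc (0 : ℝ) 1 ∧
      p.place i (lineMap a b θ) = p.F (s.at' (σ θ)) ∧
      p.place j (lineMap c d θ) = p.F (s.ps.at' (σ θ)) := by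
  obtain ⟨h1, -, ⟨e1, e2, e3, e4⟩ | ⟨e1, e2, e3, e4⟩⟩ := h <;> have h1' := (s.kept_ps _).2 h1
  · refine ⟨id, fun _ => rfl, fun θ hθ => ⟨hθ, ?_, ?_⟩⟩
    · rw [place_lineMap, e1, e2, id, p.F_slot h1 hθ]
    · rw [place_lineMap, e3, e4, id, p.F_slot h1' hθ]
  · refine ⟨fun t => 1 - t, fun t => sub_sub_cancel 1 t, fun θ hθ => ?_⟩
    have hθ' : 1 - θ ∈ Icc (0 : ℝ) 1 := ⟨by linarith [hθ.2], by linarith [hθ.1]⟩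
    refine ⟨hθ', ?_, ?_⟩
    · rw [place_lineMap, e1, e2, p.F_slot h1 hθ', AffineMap.lineMap_apply_one_sub]
    · rw [place_lineMap, e3, e4, p.F_slot h1' hθ', AffineMap.lineMap_apply_one_sub]

lemma Match.point {i j : Bool × ℕ} {a b c d : ℂ} (h : p.Match i a b j c d) {θ : ℝ}
    (hθ : θ ∈ Icc (0 : ℝ) 1) {v v' : ℂ} (hv : p.F v = p.place i (lineMap a b θ))
    (hv' : p.F v' = p.place j (lineMap c d θ)) : (p.sheet i = p.sheet j ∧ v = v') ∨
      (∃ s : Slot, ∃ t ∈ Icc (0 : ℝ) 1, p.sheet j = s.pf (p.sheet i) ∧ v = s.at' t ∧ v' = s.ps.at' t) ∨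
      (v ∈ Lost p.g ∧ v' ∈ Lost p.g) := by
  rcases h with ⟨h1, h2, h3⟩ | ⟨s, h⟩ | ⟨h1, h2⟩
  · refine Or.inl ⟨h1, p.F.injective ?_⟩; rw [hv, hv', place_lineMap, place_lineMap, h2, h3]
  · obtain ⟨σ, -, hσ⟩ := h.exists_param; obtain ⟨ht, e1, e2⟩ := hσ θ hθ
    exact Or.inr (Or.inl ⟨s, σ θ, ht, h.2.1, p.F.injective (hv.trans e1), p.F.injective (hv'.trans e2)⟩)
  · refine Or.inr (Or.inr ⟨?_, ?_⟩)
    · obtain ⟨u, hu, e⟩ := h1 (by rw [segment_eq_image_lineMap]; exact ⟨θ, hθ, rfl⟩)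
      rwa [p.F.injective (hv.trans ((p.place_lineMap _ _ _ _).trans e.symm))]
    · obtain ⟨u, hu, e⟩ := h2 (by rw [segment_eq_image_lineMap]; exact ⟨θ, hθ, rfl⟩)
      rwa [p.F.injective (hv'.trans ((p.place_lineMap _ _ _ _).trans e.symm))]

variable (hα : p.a = alpha p.g)

include hα

lemma mem_triangle_iff {i : Bool × ℕ} {z : ℂ} :
    z ∈ triangle p.g i ↔ i.2 ∈ Finset.Ico 1 (2 * p.g + 1) ∧ p.place i z ∈ p.tile i.2 := by
  obtain ⟨m, kk⟩ := i
  have key : ∀ u v w : ℂ, z ∈ convexHull ℝ {u, v, w} ↔ p.place (m, kk) z ∈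
      convexHull ℝ {p.place (m, kk) u, p.place (m, kk) v, p.place (m, kk) w} := fun u v w => by
    have : ({p.place (m, kk) u, p.place (m, kk) v, p.place (m, kk) w} : Set ℂ) =
        p.placeAff (m, kk) '' {u, v, w} := by simp only [image_insert_eq, image_singleton, placeAff_apply]
    rw [this, ← AffineMap.image_convexHull, ← p.placeAff_apply, Function.Injective.mem_set_image]
    intro z w h; simp only [placeAff_apply] at h; exact p.place_injective _ h
  rw [tile_eq]
  by_cases h : kk ∈ Finset.Ico 1 (2 * p.g + 1)
  · rw [and_iff_right h]; rw [Finset.mem_Ico] at h; obtain h1 | h1 := Nat.lt_or_ge p.g kk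
    · obtain ⟨i, rfl⟩ : ∃ i, kk = p.g + i := ⟨kk - p.g, by omega⟩
      obtain ⟨e1, e2, e3⟩ := toModel_high (i := i) hα (by omega) (by omega)
      rw [triangle_high m (by omega) (by omega) rfl, key, place_mir, place_mir, place_mir, e1, e2, e3,
        pair_comm]
    · obtain ⟨e1, e2, e3⟩ := toModel_low hα h.1 h1
      rw [triangle_low m h.1 h1, key, place_mir, place_mir, place_mir, e1, e2, e3]
  · simp only [h, false_and, iff_false]; rw [Finset.mem_Ico] at h; simp only [triangle]
    rw [if_neg (by omega), if_neg (by omega)]; exact id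

end Par

namespace Par

variable {p : Par}

/-- The surface `X_g`. -/
abbrev surf (p : Par) : TranslationGluing := surface p.g p.three_le

/-- The point `y` lies over the point `w` of the model in the sheet `f`. -/
def Over (y : p.surf.Surface) (f : Bool) (w : ℂ) : Prop :=
  ∃ (i : Bool × ℕ) (z : ℂ) (hz : z ∈ triangle p.g i), y = pt (G := p.surf) i z hz ∧
    p.sheet i = f ∧ p.place i z = w

lemma exists_kk {v : ℂ} (hv : v ∈ rect) : ∃ kk ∈ Finset.Ico 1 (2 * p.g + 1), p.F v ∈ p.tile kk :=
  p.isTiling.subset_iUnion ⟨v, hv, rfl⟩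

variable (hα : p.a = alpha p.g)

include hα

lemma unplace_mem {f : Bool} {kk : ℕ} (h : kk ∈ Finset.Ico 1 (2 * p.g + 1)) {w : ℂ} (hw : w ∈ p.tile kk) :
    p.unplace f kk w ∈ triangle p.g (p.piece f kk) :=
  (mem_triangle_iff hα).2 ⟨h, by rwa [place_unplace]⟩

lemma over_unplace {f : Bool} {kk : ℕ} (h : kk ∈ Finset.Ico 1 (2 * p.g + 1)) {w : ℂ} (hw : w ∈ p.tile kk) :
    Over (pt (G := p.surf) _ _ (unplace_mem hα (f := f) h hw)) f w :=
  ⟨_, _, _, rfl, p.sheet_piece _ _, p.place_unplace _ _ _⟩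

lemma mem_rect_of_triangle {i : Bool × ℕ} {z v : ℂ} (hz : z ∈ triangle p.g i) (hv : p.F v = p.place i z) :
    v ∈ rect := by
  obtain ⟨h1, h2⟩ := (mem_triangle_iff hα).1 hz; obtain ⟨v', h3, h4⟩ := p.tile_subset h1 h2
  rwa [← p.F.injective (h4.trans hv.symm)]

lemma Over.unique {y y' : p.surf.Surface} {f : Bool} {v : ℂ} (hv : v ∈ good) (h : Over y f (p.F v))
    (h' : Over y' f (p.F v)) : y = y' := by
  obtain ⟨i, z, hz, rfl, hs, hp⟩ := h; obtain ⟨i', z', hz', rfl, hs', hp'⟩ := h'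
  have same : ∀ {j j' : Bool × ℕ} {u u' : ℂ} (hu : u ∈ triangle p.g j) (hu' : u' ∈ triangle p.g j'),
      p.sheet j = p.sheet j' → j.2 = j'.2 → p.place j u = p.place j' u' →
      pt (G := p.surf) j u hu = pt (G := p.surf) j' u' hu' := by
    intro j j' u u' hu hu' e1 e2 e3
    obtain rfl : j = j' := by rw [← p.piece_sheet j, ← p.piece_sheet j', e1, e2]
    obtain rfl := p.place_injective j e3; rfl
  by_cases hk : i.2 = i'.2
  · exact same hz hz' (hs.trans hs'.symm) hk (hp.trans hp'.symm)
  obtain ⟨h1, h2⟩ := (mem_triangle_iff hα).1 hz; obtain ⟨h1', h2'⟩ := (mem_triangle_iff hα).1 hz'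
  rw [hp] at h2; rw [hp'] at h2'
  obtain ⟨⟨vo, hvo, evo⟩, hedge, huniq⟩ := p.isTiling.eq_of_mem (p.notMem_vertices hv) h1 h1' hk h2 h2'
  rw [p.F.injective evo] at hvo
  obtain ⟨u, u', huu, hmem⟩ : ∃ u u', (u, u') ∈ ({(p.tP i.2, p.tV i.2), (p.tP i.2, p.tU i.2),
      (p.tU i.2, p.tV i.2)} : Set (ℂ × ℂ)) ∧ p.F v ∈ segment ℝ u u' := by
    have hin : ∀ u u' : ℂ, p.F v ∈ segment ℝ u' u → p.F v ∈ segment ℝ u u' := fun _ _ h => by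
      rwa [segment_symm]
    rcases p.tB_tC i.2 with ⟨e1, e2⟩ | ⟨e1, e2⟩ <;> rw [e1, e2] at hedge <;> rcases hedge with h | h | h
    exacts [⟨_, _, Or.inl rfl, h⟩, ⟨_, _, Or.inr (Or.inr rfl), hin _ _ h⟩, ⟨_, _, Or.inr (Or.inl rfl), hin _ _ h⟩,
      ⟨_, _, Or.inr (Or.inl rfl), h⟩, ⟨_, _, Or.inr (Or.inr rfl), h⟩, ⟨_, _, Or.inl rfl, hin _ _ h⟩]
  obtain ⟨a, b, j, c, d, hgl, hseg⟩ := exists_glue_edge hα i.1 h1 huu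
  rw [← hseg, segment_eq_image_lineMap] at hmem; obtain ⟨θ, hθ, hθv⟩ := hmem
  change lineMap (p.place i a) (p.place i b) θ = p.F v at hθv
  rw [← place_lineMap, ← hp] at hθv; obtain rfl := p.place_injective i hθv
  have hM : p.Match i a b j c d := hgl.elim (match_of_glue hα) fun h => (match_of_glue hα h).symm
  have hne : i ≠ j := hgl.elim (fun h => h.ne p.three_le) fun h => (h.ne p.three_le).symm
  obtain ⟨hu', e⟩ : ∃ hu' : lineMap c d θ ∈ triangle p.g j,
      pt (G := p.surf) i _ hz = pt (G := p.surf) j _ hu' := by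
    rcases hgl with h | h
    · obtain ⟨_, h1, h2⟩ := h.pt_eq p.three_le hθ; exact ⟨h1, h2⟩
    · obtain ⟨h1, _, h2⟩ := h.pt_eq p.three_le hθ; exact ⟨h1, h2.symm⟩
  rw [e]
  rcases hM.point hθ hp.symm (p.F.apply_symm_apply _) with ⟨e1, e2⟩ | ⟨s, t, -, -, e2, -⟩ | ⟨h, -⟩
  · have e3 : p.place j (lineMap c d θ) = p.F v := by rw [e2, p.F.apply_symm_apply]
    obtain ⟨h3, h4⟩ := (mem_triangle_iff hα).1 hu'; rw [e3] at h4
    refine same hu' hz' (e1.symm.trans (hs.trans hs'.symm)) (huniq _ h3 h4 fun h => hne ?_) (e3.trans hp'.symm)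
    rw [← p.piece_sheet i, ← p.piece_sheet j, e1, h]
  · exact absurd hvo (e2 ▸ s.at'_notMem_openRect t)
  · exact absurd hvo (notMem_openRect_of_lost h)

lemma Over.slot {y : p.surf.Surface} {f : Bool} {s : Slot} (hs : s.Kept p.g) {t : ℝ} (ht : t ∈ Icc 0 1)
    (hg : s.at' t ∈ good) (h : Over y f (p.F (s.at' t))) : Over y (s.pf f) (p.F (s.ps.at' t)) := by
  obtain ⟨i, a, b, j, c, d, hgl⟩ := exists_slotMatch hα f hs
  have hM : p.SlotMatch s i a b j c d := by
    rcases hgl with h | h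
    · exact h.2.2
    · simpa using h.2.2.symm
  have hf : p.sheet i = f := by rcases hgl with h | h <;> exact h.2.1
  obtain ⟨σ, hσσ, hσ⟩ := hM.exists_param; obtain ⟨hθ, -, -⟩ := hσ t ht
  obtain ⟨-, e1, e2⟩ := hσ (σ t) hθ; rw [hσσ] at e1 e2
  obtain ⟨hu, hu', e⟩ : ∃ hu hu', pt (G := p.surf) i (lineMap a b (σ t)) hu =
      pt (G := p.surf) j (lineMap c d (σ t)) hu' := by
    rcases hgl with h | h
    · exact h.1.pt_eq p.three_le hθ
    · obtain ⟨h1, h2, h3⟩ := h.1.pt_eq p.three_le hθ; exact ⟨h2, h1, h3.symm⟩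
  rw [Over.unique hα hg h ⟨i, _, hu, rfl, hf, e1⟩, e]
  exact ⟨j, _, hu', rfl, by rw [hM.2.1, hf], e2⟩

lemma exists_iota : ∃ ι : U p.g → p.surf.Surface, ∀ f v hv (hU : X f v hv ∈ U p.g) y,
    Over y f (p.F v) → ι ⟨X f v hv, hU⟩ = y := by
  classical
  have hex : ∀ f, ∀ v ∈ rect, ∃ y : p.surf.Surface, Over y f (p.F v) := fun f v hv => by
    obtain ⟨kk, h1, h2⟩ := exists_kk (p := p) hv; exact ⟨_, over_unplace hα h1 h2⟩
  have hne : Nonempty p.surf.Surface := by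
    obtain ⟨kk, h1, h2⟩ := exists_kk (p := p) Near.one_mem
    exact ⟨pt (G := p.surf) _ _ (unplace_mem hα (f := false) h1 h2)⟩
  choose! ψ hψ using hex
  obtain ⟨φ, hφ⟩ := exists_lift (fun f v => if Dropped p.g v then hne.some else ψ f v)
    (fun f s t ht h h' => by
      simp only [dropped_at'_iff ht h, dropped_at'_iff ht h', Slot.kept_ps]; split_ifs with hk
      · refine (Over.unique hα h' (hψ _ _ h'.1) ?_).symm; exact Over.slot hα hk ht h (hψ _ _ h.1)
      · rfl)
  refine ⟨fun x => φ x, fun f v hv hU y hy => ?_⟩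
  change φ (X f v hv) = y
  rw [hφ, if_neg (X_mem_U.1 hU)]; exact Over.unique hα hv (hψ f v hv.1) hy

/-- The subset of `X_g` that corresponds to a subset of the limit surface. -/
lemma exists_preimage {O : Set limitSurface.Surface} (hO : O ⊆ U p.g) : ∃ O' : Set p.surf.Surface,
    ∀ (i : Bool × ℕ) z (hz : z ∈ triangle p.g i), pt (G := p.surf) i z hz ∈ O' ↔
      ∃ hv : p.F.symm (p.place i z) ∈ good, X (p.sheet i) _ hv ∈ O := by
  refine ⟨{y | Quot.lift (fun q : p.surf.Pt => ∃ hv : p.F.symm (p.place q.1 q.2) ∈ good,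
    X (p.sheet q.1) _ hv ∈ O) ?_ y}, fun i z hz => Iff.rfl⟩
  rintro ⟨i, z, hz⟩ ⟨j, z', hz'⟩ ⟨a, b, c, d, hgl, hs, ht⟩
  change Glue p.g i a b j c d at hgl
  change z ∈ segment ℝ a b at hs
  change z' = z + (c - a) at ht
  simp only [eq_iff_iff]; rw [segment_eq_image_lineMap] at hs; obtain ⟨θ, hθ, rfl⟩ := hs
  obtain rfl : z' = lineMap c d θ := by
    have e := glue_translation p.three_le _ _ _ _ _ _ hgl; rw [ht]
    simp only [lineMap_apply, vsub_eq_sub, vadd_eq_add, e]; ring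
  rcases (match_of_glue hα hgl).point hθ (p.F.apply_symm_apply _) (p.F.apply_symm_apply _) with
    ⟨e1, e2⟩ | ⟨s, t, ht', e1, e2, e3⟩ | ⟨h1, h2⟩
  · rw [e1, e2]
  · rw [e1, e2, e3]; constructor
    · rintro ⟨hv, h⟩; have hv' := (s.ps.at'_mem_good_iff ht').2 ((s.at'_mem_good_iff ht').1 hv)
      exact ⟨hv', by rwa [← X_at' _ s ht' hv hv']⟩
    · rintro ⟨hv, h⟩; have hv' := (s.at'_mem_good_iff ht').2 ((s.ps.at'_mem_good_iff ht').1 hv)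
      exact ⟨hv', by rwa [X_at' _ s ht' hv' hv]⟩
  · have no : ∀ f v, v ∈ Lost p.g → ¬ ∃ hv : v ∈ good, X f v hv ∈ O := by
      rintro f v (h | h) ⟨hv, hX⟩
      · exact X_mem_U.1 (hO hX) h
      · exact hv.2 h
    exact iff_of_false (no _ _ h1) (no _ _ h2)

omit hα in
lemma isOpen_surf_iff {O : Set p.surf.Surface} :
    IsOpen O ↔ ∀ i, IsOpen {z : triangle p.g i | pt (G := p.surf) i z z.2 ∈ O} := by
  have h1 : IsOpen O ↔ IsOpen ((Quot.mk p.surf.Rel) ⁻¹' O) := Iff.rfl; rw [h1, isOpen_sigma_iff]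
  rfl

lemma isEmbedding_iota {ι : U p.g → p.surf.Surface} (hι : ∀ f v hv (hU : X f v hv ∈ U p.g) y,
    Over y f (p.F v) → ι ⟨X f v hv, hU⟩ = y) : IsEmbedding ι := by
  have hover : ∀ x : U p.g, ∃ f v hv i z, ∃ hz : z ∈ triangle p.g i, x.1 = X f v hv ∧
      ι x = pt (G := p.surf) i z hz ∧ p.sheet i = f ∧ p.F.symm (p.place i z) = v := by
    rintro ⟨x, hx⟩; obtain ⟨f, v, hv, rfl⟩ := X_surjective x
    obtain ⟨kk, h1, h2⟩ := exists_kk (p := p) hv.1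
    refine ⟨f, v, hv, _, _, unplace_mem hα h1 h2, rfl, hι f v hv hx _ (over_unplace hα h1 h2),
      p.sheet_piece _ _, ?_⟩
    rw [place_unplace, p.F.symm_apply_apply]
  have himage : ∀ O : Set (U p.g), ∃ O' : Set p.surf.Surface, O' = ι '' O ∧
      ∀ (i : Bool × ℕ) z (hz : z ∈ triangle p.g i), pt (G := p.surf) i z hz ∈ O' ↔
        ∃ hv : p.F.symm (p.place i z) ∈ good, X (p.sheet i) _ hv ∈ Subtype.val '' O := by
    intro O
    obtain ⟨O', hO'⟩ := exists_preimage hα (O := Subtype.val '' O) (by rintro _ ⟨x, -, rfl⟩; exact x.2)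
    refine ⟨O', Subset.antisymm ?_ ?_, hO'⟩
    · intro y hy
      induction y using Quot.ind with
      | mk q =>
        obtain ⟨hv, ⟨x, hx⟩, hxO, rfl⟩ := (hO' q.1 q.2 q.2.2).1 hy
        exact ⟨_, hxO, hι _ _ hv _ _ ⟨_, _, q.2.2, rfl, rfl, (p.F.apply_symm_apply _).symm⟩⟩
    · rintro _ ⟨x, hx, rfl⟩; obtain ⟨f, v, hv, i, z, hz, e1, e2, rfl, rfl⟩ := hover x; rw [e2, hO']
      exact ⟨hv, x, hx, e1⟩
  refine (IsOpenEmbedding.of_continuous_injective_isOpenMap ?_ ?_ ?_).isEmbedding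
  · rw [continuous_def]; intro O hO
    suffices h : IsOpen {x | ∃ hx : x ∈ U p.g, ι ⟨x, hx⟩ ∈ O} by
      refine isOpen_induced_iff.2 ⟨_, h, ?_⟩; ext x; exact ⟨fun h => h.2, fun h => ⟨x.2, h⟩⟩
    rw [isOpen_limit_iff]; intro f
    let C : ℕ → Set ℂ := fun kk => Subtype.val '' {z : triangle p.g (p.piece f kk) | pt (G := p.surf) _ z z.2 ∉ O}
    have hC : ∀ kk, IsClosed ((fun v : good => p.unplace f kk (p.F v)) ⁻¹' C kk) := fun kk => by
      refine IsClosed.preimage ?_ ?_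
      · have : Continuous (p.unplace f kk) := (Isometry.of_dist_eq (p.dist_unplace f kk)).continuous
        exact this.comp (p.F.continuous.comp continuous_subtype_val)
      · refine (isClosed_triangle _ _).isClosedEmbedding_subtypeVal.isClosedMap _ ?_
        exact (isOpen_surf_iff.1 hO _).isClosed_compl
    have hD : IsOpen {v : good | ¬ Dropped p.g v} := by
      have := (isClosed_dropped p.g).isOpen_compl.preimage (continuous_subtype_val (p := (· ∈ good)))
      convert this using 1
      ext v; simp [v.2.2]
    convert hD.inter (isClosed_biUnion_finset (s := Finset.Ico 1 (2 * p.g + 1)) fun kk _ => hC kk).isOpen_compl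
      using 1
    ext ⟨v, hv⟩
    simp only [mem_ofPred_eq, mem_inter_iff, mem_compl_iff, mem_iUnion, mem_preimage, not_exists]
    constructor
    · rintro ⟨hx, h⟩; refine ⟨X_mem_U.1 hx, fun kk h1 h2 => ?_⟩; obtain ⟨⟨z, hz⟩, h3, h4⟩ := h2
      change z = _ at h4
      subst h4; refine h3 ?_
      rwa [← hι f v hv hx _ ⟨_, _, hz, rfl, p.sheet_piece _ _, p.place_unplace _ _ _⟩]
    · rintro ⟨hx, h⟩; have hU := X_mem_U (f := f) (hv := hv).2 hx; refine ⟨hU, ?_⟩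
      obtain ⟨kk, h1, h2⟩ := exists_kk (p := p) hv.1; rw [hι f v hv hU _ (over_unplace hα h1 h2)]
      by_contra hn; exact h kk h1 ⟨⟨_, unplace_mem hα h1 h2⟩, hn, rfl⟩
  · intro x y hxy; obtain ⟨O', h1, h2⟩ := himage {x}
    have hy : ι y ∈ O' := by rw [← hxy, h1]; exact ⟨x, rfl, rfl⟩
    obtain ⟨f, v, hv, i, z, hz, e1, e2, rfl, rfl⟩ := hover y; rw [e2, h2] at hy
    obtain ⟨_, x', hx, hx'⟩ := hy
    exact Subtype.ext ((congrArg _ hx).symm.trans (hx'.trans e1.symm))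
  · intro O hO; obtain ⟨O', h1, h2⟩ := himage O; rw [← h1, isOpen_surf_iff]; intro i
    have hO2 := (isOpen_U p.g).isOpenMap_subtype_val _ hO
    obtain ⟨V, hV, hV2⟩ := isOpen_induced_iff.1 (isOpen_limit_iff.1 hO2 (p.sheet i))
    have hVr := hV.inter isClosed_removed.isOpen_compl
    convert (hVr.preimage p.F.symm.continuous).preimage ((p.continuous_place i).comp continuous_subtype_val)
      using 1
    ext ⟨z, hz⟩
    have hV3 : ∀ hv : p.F.symm (p.place i z) ∈ good, p.F.symm (p.place i z) ∈ V ↔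
        X (p.sheet i) _ hv ∈ Subtype.val '' O := fun hv => by
      exact Set.ext_iff.1 hV2 ⟨_, hv⟩
    refine (h2 i z hz).trans ?_
    simp only [mem_preimage, mem_inter_iff, mem_compl_iff, Function.comp_apply]; constructor
    · rintro ⟨hv, h⟩; exact ⟨(hV3 hv).2 h, hv.2⟩
    · rintro ⟨h, h'⟩
      have hv : p.F.symm (p.place i z) ∈ good :=
        ⟨mem_rect_of_triangle hα hz (p.F.apply_symm_apply _), h'⟩
      exact ⟨hv, (hV3 hv).1 h⟩

end Par

namespace ArnouxYoccoz

/-- `chart f` as an affine map. -/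
def chartAff (f : Bool) : ℂ →ᵃ[ℝ] ℂ :=
  (mirLM f).toAffineMap + AffineMap.const ℝ ℂ (if f then ⟨-1 / 2, 1⟩ else 0)

/-- `unchart f` as an affine map. -/
def unchartAff (f : Bool) : ℂ →ᵃ[ℝ] ℂ :=
  (mirLM f).toAffineMap + AffineMap.const ℝ ℂ (if f then ⟨1 / 2, 1⟩ else 0)

lemma chartAff_apply (f : Bool) (z : ℂ) : chartAff f z = chart f z := by
  cases f <;> apply Complex.ext <;> simp [chartAff, chart, mirLM_apply, mir] <;> ring

lemma unchartAff_apply (f : Bool) (z : ℂ) : unchartAff f z = unchart f z := by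
  cases f <;> apply Complex.ext <;> simp [unchartAff, unchart, mirLM_apply, mir]; ring

/-- `cr u v` as an affine map. -/
def crAff (u v : ℂ) : ℂ →ᵃ[ℝ] ℝ := ((v.re - u.re) • imLm - (v.im - u.im) • reLm).toAffineMap +
    AffineMap.const ℝ ℂ ((v.im - u.im) * u.re - (v.re - u.re) * u.im)

lemma crAff_apply (u v z : ℂ) : crAff u v z = cr u v z := by simp [crAff, cr]; ring

/-- The half planes whose intersection is the upper rectangle. -/
def rectSides : List (ℂ →ᵃ[ℝ] ℝ) :=
  [crAff 0 ⟨0, -1⟩, crAff 1 ⟨1, 1⟩, crAff ⟨0, 1 / 2⟩ ⟨1, 1 / 2⟩, crAff ⟨1, 1⟩ ⟨0, 1⟩]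

lemma rectSides_nonneg {z : ℂ} : (∀ a ∈ rectSides, 0 ≤ a z) ↔ z ∈ rect := by
  simp only [rectSides, List.forall_mem_cons, crAff_apply, cr]; simp [rect]; tauto

end ArnouxYoccoz

namespace Par

variable {p : Par}

/-- `unplace f kk` as an affine map. -/
def unplaceAff (p : Par) (f : Bool) (kk : ℕ) : ℂ →ᵃ[ℝ] ℂ :=
  (mirLM f).toAffineMap + AffineMap.const ℝ ℂ (-mir f (p.tr kk))

lemma unplaceAff_apply (f : Bool) (kk : ℕ) (w : ℂ) : p.unplaceAff f kk w = p.unplace f kk w := by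
  rw [unplace, ← mir_sub_mir]; simp [unplaceAff, mirLM_apply, sub_eq_add_neg]

variable (hα : p.a = alpha p.g) {ι : U p.g → p.surf.Surface}
  (hι : ∀ f v hv (hU : X f v hv ∈ U p.g) y, Over y f (p.F v) → ι ⟨X f v hv, hU⟩ = y)

include hα hι

lemma isPiecewiseAffine_iota : IsPiecewiseAffine ι := by
  classical
  obtain ⟨κ, _, H, A, hA⟩ := p.isPL_F
  have hpoly : ∀ k : Bool × Finset.Ico 1 (2 * p.g + 1) × κ, ∃ S : Finset ℂ, convexHull ℝ (S : Set ℂ) =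
      chart k.1 '' {v | v ∈ rect ∧ (∀ a ∈ H k.2.2, 0 ≤ a v) ∧ A k.2.2 v ∈ p.tile k.2.1} := by
    rintro ⟨f, ⟨kk, hkk⟩, c⟩
    let L := rectSides ++ (H c ++ [crAff (p.tP kk) (p.tB kk), crAff (p.tB kk) (p.tC kk),
      crAff (p.tC kk) (p.tP kk)].map fun a => a.comp (A c))
    have hL : {v | ∀ a ∈ L, 0 ≤ a v} = {v | v ∈ rect ∧ (∀ a ∈ H c, 0 ≤ a v) ∧ A c v ∈ p.tile kk} := by
      ext v
      simp only [L, List.forall_mem_append, rectSides_nonneg, mem_ofPred_eq, tile,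
        mem_convexHull_iff_cr (p.cr_tile hkk)]
      simp [crAff_apply]
    have hb : Bornology.IsBounded {v | ∀ a ∈ L, 0 ≤ a v} := by
      rw [hL]; refine (isBounded_closedBall (x := (0 : ℂ)) (r := 2)).subset fun v hv => ?_
      rw [mem_closedBall_zero_iff]; refine (norm_le_abs_re_add_abs_im v).trans ?_
      rw [abs_of_nonneg hv.1.1.1, abs_of_nonneg (by linarith [hv.1.2.1])]
      linarith [hv.1.1.2, hv.1.2.2]
    obtain ⟨S, hS⟩ := exists_finset_convexHull_eq_polyhedron L hb; refine ⟨S.image (chart f), ?_⟩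
    have e : chart f = chartAff f := funext fun z => (chartAff_apply f z).symm
    rw [← hL, ← hS, Finset.coe_image, e, AffineMap.image_convexHull]
  choose S hS using hpoly
  let e := (Fintype.equivFin (Bool × Finset.Ico 1 (2 * p.g + 1) × κ)).symm
  refine ⟨_, fun k => !(e k).1, fun k => S (e k), fun k => p.piece (e k).1 (e k).2.1,
    fun k => (p.unplaceAff (e k).1 (e k).2.1).comp ((A (e k).2.2).comp (unchartAff (e k).1)), ?_, ?_⟩
  · intro i₀ q hq hU; obtain ⟨f, v, hv, rfl, rfl, -⟩ := exists_eq_X i₀ q hq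
    obtain ⟨kk, h1, h2⟩ := exists_kk (p := p) hv.1; obtain ⟨c, hc⟩ := (hA v).1
    refine ⟨e.symm (f, ⟨kk, h1⟩, c), ?_, ?_⟩
    · change (!(e (e.symm _)).1) = _; rw [e.apply_symm_apply]
    · change _ ∈ convexHull ℝ (S (e (e.symm _)) : Set ℂ)
      rw [e.apply_symm_apply, hS]; exact ⟨v, ⟨hv.1, hc, (hA v).2 c hc ▸ h2⟩, rfl⟩
  · intro k; dsimp only
    generalize e k = k'
    obtain ⟨f, ⟨kk, hkk⟩, c⟩ := k'; intro q hq hU hqS; rw [hS] at hqS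
    obtain ⟨v, ⟨-, h2, h3⟩, rfl⟩ := hqS
    have hv : v ∈ good := by
      have : chart f v ∈ limitSurface.region (!f) := hq; rw [region_eq] at this
      obtain ⟨v', hv', e'⟩ := this; rwa [← chart_injective f e']
    have hF : p.unplaceAff f kk (A c (unchartAff f (chart f v))) = p.unplace f kk (A c v) := by
      rw [unplaceAff_apply, unchartAff_apply, unchart_chart]
    have hm := unplace_mem hα (f := f) hkk h3
    refine ⟨by simp only [AffineMap.comp_apply, hF]; exact hm, ?_⟩
    have := hι f v hv hU _ ⟨_, _, hm, rfl, p.sheet_piece _ _, (p.place_unplace _ _ _).trans ((hA v).2 c h2).symm⟩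
    refine this.trans ?_; simp only [AffineMap.comp_apply, hF]

lemma eventually_flatDist_iota_le {f : Bool} {v : ℂ} {hv : v ∈ good} (hU : X f v hv ∈ U p.g) :
    ∀ᶠ v' in 𝓝 v, ∀ hv' (hU' : X f v' hv' ∈ U p.g),
      flatDist (ι ⟨_, hU⟩) (ι ⟨_, hU'⟩) ≤ ofReal (dist (p.F v) (p.F v')) := by
  have hev : ∀ᶠ v' in 𝓝 v, ∀ kk ∈ Finset.Ico 1 (2 * p.g + 1), p.F v' ∈ p.tile kk → p.F v ∈ p.tile kk := by
    rw [eventually_all_finset]; intro kk _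
    by_cases h : p.F v ∈ p.tile kk
    · exact Eventually.of_forall fun _ _ => h
    · have hc : IsClosed (p.tile kk) := (Set.toFinite _).isClosed_convexHull ℝ
      filter_upwards [(hc.isOpen_compl.preimage p.F.continuous).mem_nhds h] with v' h1 h2 using absurd h2 h1
  filter_upwards [hev] with v' h hv' hU'
  obtain ⟨kk, h1, h2⟩ := exists_kk (p := p) hv'.1; have h3 := h kk h1 h2
  rw [hι f v hv hU _ (over_unplace hα h1 h3), hι f v' hv' hU' _ (over_unplace hα h1 h2),
    ← p.dist_unplace f kk]
  exact flatDist_pt_le _ _ ((convex_triangle _ _).segment_subset (unplace_mem hα h1 h3) (unplace_mem hα h1 h2))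

lemma sheetBound_iota : SheetBound p.g (fun x y => ⨅ (hx : x ∈ U p.g) (hy : y ∈ U p.g),
    flatDist (ι ⟨x, hx⟩) (ι ⟨y, hy⟩)) 1080 := by
  classical
  refine ⟨by norm_num, fun x y => ?_, fun x hx y hy z hz => ?_, fun f u v hu hv hu' hv' => ?_⟩
  · rw [iInf_comm]; simp only [flatDist_comm]
  · simp only [hx, hy, hz, iInf_pos]; exact flatDist_triangle _ _ _
  simp only [hu', hv', iInf_pos]
  let S : Set ℂ := {v | ∃ hv : v ∈ good, X f v hv ∈ U p.g}
  let Φ : ℂ → p.surf.Surface := fun v => if h : v ∈ S then ι ⟨_, h.2⟩ else ι ⟨_, hu'⟩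
  have hΦ : ∀ v hv (hU : X f v hv ∈ U p.g), Φ v = ι ⟨_, hU⟩ := fun v hv hU => dif_pos ⟨hv, hU⟩
  have := le_of_segment_subset (S := S) (fun w hw => ⟨openRect_subset_good hw,
    X_mem_U.2 (not_dropped_of_mem_openRect hw)⟩) (fun w hw => hw.1.1) (D := fun u v => flatDist (Φ u) (Φ v))
    (C := 1080) (fun u _ v _ w _ => flatDist_triangle _ _ _) (by norm_num) ?_ ⟨hu, hu'⟩ ⟨hv, hv'⟩
  · simpa only [hΦ u hu hu', hΦ v hv hv'] using this
  intro a ha b hb hs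
  have key := le_ofReal_mul_of_eventually (D := flatDist (G := p.surf)) flatDist_triangle
    (γ := fun t => Φ (lineMap a b t)) (c := 1080 * dist a b) (by positivity) (zero_le_one' ℝ)
    (flatDist_self _) ?_
  · simpa using key
  intro t ht
  have hm : ∀ t ∈ Icc (0 : ℝ) 1, lineMap a b t ∈ S := fun t ht =>
    hs (by rw [segment_eq_image_lineMap]; exact ⟨t, ht, rfl⟩)
  have hcont : ContinuousAt (fun t : ℝ => (lineMap a b t : ℂ)) t :=
    (AffineMap.lineMap_continuous (R := ℝ)).continuousAt
  obtain ⟨h1, h2⟩ := hm t ht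
  filter_upwards [self_mem_nhdsWithin, nhdsWithin_le_nhds (hcont.eventually
    (eventually_flatDist_iota_le hα hι h2))] with s hs1 hs2
  obtain ⟨h3, h4⟩ := hm s hs1
  have h5 : flatDist (Φ (lineMap a b t)) (Φ (lineMap a b s)) ≤
      ofReal (1080 * dist a b * |s - t|) := by
    rw [hΦ _ h1 h2, hΦ _ h3 h4]
    refine (hs2 h3 h4).trans (ofReal_le_ofReal ((p.dist_F_le _ _).trans ?_))
    rw [dist_lineMap_lineMap, Real.dist_eq, abs_sub_comm t]; apply le_of_eq; ring
  exact ⟨h5, by rwa [flatDist_comm]⟩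

end Par

namespace Par

variable (p : Par)

/-- A bound for the deviation of `F` from a translation. -/
def err : ℝ := 16 * (p.k + 1) * (121 / 200) ^ p.k

lemma exists_err_le {ε : ℝ} (hε : 0 < ε) : ∃ n : ℕ, ∀ p : Par, n ≤ p.g → p.err ≤ ε ∧ p.lam ≤ ε := by
  have h1 : Tendsto (fun n : ℕ => (16 * (n + 1) * (121 / 200) ^ n : ℝ)) atTop (𝓝 0) := by
    have h := ((tendsto_self_mul_const_pow_of_lt_one (r := (121 / 200 : ℝ)) (by norm_num)
      (by norm_num)).add (tendsto_pow_atTop_nhds_zero_of_lt_one (r := (121 / 200 : ℝ)) (by norm_num)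
      (by norm_num))).const_mul 16
    simp only [add_zero, mul_zero] at h; exact h.congr fun n => by ring
  have h2 := tendsto_one_div_add_atTop_nhds_zero_nat (𝕜 := ℝ)
  obtain ⟨n, hn⟩ := eventually_atTop.1 ((h1.eventually_le_const hε).and (h2.eventually_le_const hε))
  refine ⟨2 * n + 1, fun p hp => ?_⟩; have := p.hNk; exact hn p.k (by unfold g at hp; omega)

lemma r_pow_le : (121 / 200) ^ p.k * 16 ≤ p.err := by
  have : (0 : ℝ) < (121 / 200) ^ p.k := by positivity
  unfold err; nlinarith [mul_nonneg (Nat.cast_nonneg (α := ℝ) p.k) this.le]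

lemma x_le_pow : p.x ≤ (121 / 400) ^ p.k := by
  rw [← p.a_pow]
  calc p.a ^ (p.g + 1) ≤ p.a ^ (2 * p.k) := p.amono (by have := p.hkN; unfold g; omega)
    _ ≤ (11 / 20) ^ (2 * p.k) := p.pow_le_num _
    _ = _ := by rw [pow_mul]; norm_num

lemma s_le_err : p.s ≤ p.err := by
  have h1 : ((p.g : ℝ) + 1) ≤ 2 * (p.k + 1) := by
    exact_mod_cast (by have := p.hNk; unfold g; omega : p.g + 1 ≤ 2 * (p.k + 1))
  have h2 : p.x ≤ (121 / 200) ^ p.k := p.x_le_pow.trans (by gcongr; norm_num); have h3 := p.x_pos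
  unfold s err
  calc 8 * ((p.g : ℝ) + 1) * p.x ≤ 8 * (2 * (p.k + 1)) * (121 / 200) ^ p.k := by gcongr
    _ = _ := by ring

lemma M_div_w_le_err : p.M / p.w ≤ p.err := by
  have h : p.x / p.w ≤ (121 / 200) ^ p.k := by
    rw [w, div_le_iff₀ (by positivity), ← mul_pow]; exact p.x_le_pow.trans (by gcongr; norm_num)
  have := p.r_pow_le
  have h2 : p.M / p.w ≤ 20 / 9 * p.x / p.w := div_le_div_of_nonneg_right p.M_le_x p.w_pos.le
  rw [mul_div_assoc] at h2; have : (0 : ℝ) < (121 / 200) ^ p.k := by positivity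
  linarith

lemma a_pow_div_le_err {n : ℕ} (hn : p.k ≤ n) : p.a ^ n / (1 - p.a) ≤ p.lam * p.err := by
  have h : p.a ^ n ≤ (121 / 200) ^ p.k := (p.amono hn).trans
    ((p.pow_le_num _).trans (pow_le_pow_left₀ (by norm_num) (by norm_num) _))
  have h1 : p.lam * p.err = 16 * (121 / 200) ^ p.k := by
    have : (p.k : ℝ) + 1 ≠ 0 := by positivity
    unfold lam err; field_simp
  have := p.le_a; have : (0 : ℝ) < (121 / 200) ^ p.k := by positivity
  rw [h1, div_le_iff₀ p.one_sub_pos]; nlinarith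

lemma bump_le_err : p.bump ≤ p.lam * p.err :=
  (div_le_div_of_nonneg_right (sub_le_self _ p.x_pos.le) p.one_sub_pos.le).trans
    (p.a_pow_div_le_err (Nat.le_succ _))

lemma depth_le_err : p.depth ≤ p.lam * p.err := p.a_pow_div_le_err (by have := p.hkN; omega)

lemma w_le_err : p.w ≤ p.err := by
  have h := p.r_pow_le
  have : p.w ≤ (121 / 200) ^ p.k := pow_le_pow_left₀ (by norm_num) (by norm_num) _
  have : (0 : ℝ) < (121 / 200) ^ p.k := by positivity
  linarith

lemma sig_le_of_lt {m : ℕ} (hm : m ≤ p.N) {r c : ℝ} (hr : 0 < r) (h : r < (1 / 2) ^ m)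
    (hc : 16 * p.x ≤ c * r ^ 2) : p.sig m ≤ c := by
  have h4 : (4 : ℝ) ^ m * ((1 / 2) ^ m * (1 / 2) ^ m) = 1 := by rw [← mul_pow, ← mul_pow]; norm_num
  have h1 : 4 ^ m * r ^ 2 ≤ 1 := by rw [← h4, sq]; gcongr
  have hc0 : 0 < c := pos_of_mul_pos_left (lt_of_lt_of_le (by linarith [p.x_pos]) hc) (by positivity)
  calc p.sig m ≤ 16 * p.x * 4 ^ m := p.sig_le m hm
    _ ≤ c * r ^ 2 * 4 ^ m := by gcongr
    _ = c * (4 ^ m * r ^ 2) := by ring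
    _ ≤ c * 1 := by gcongr
    _ = c := mul_one c

lemma abs_leftNode_sub_le {m n : ℕ} (h : m ≤ n) : |leftNode n - 2 / 3| ≤ 1 / 3 * (1 / 2) ^ m := by
  rw [leftNode, add_sub_cancel_left, abs_mul, abs_pow]
  rw [show |(-1 / 2 : ℝ)| = 1 / 2 by norm_num [abs_div], show |(1 / 3 : ℝ)| = 1 / 3 by norm_num]
  exact mul_le_mul_of_nonneg_left (pow_le_pow_of_le_one (by norm_num) (by norm_num) h) (by norm_num)

lemma dsl_le_of_lt {j : ℕ} {r c : ℝ} (hr : 0 < r) (h : p.dentx j ≤ 1 - r)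
    (hc : 16 * p.x ≤ c * r ^ 2) : p.dsl j ≤ c := by
  have ha := p.le_a; have ha' := p.half_lt
  have h1 : p.ptx (j / 2) ≤ p.dentx j := by
    unfold dentx; split_ifs
    · exact le_rfl
    · rw [qx_succ]; linarith [p.apos (j / 2 + 1)]
  have h2 := p.one_sub_pos
  have h3 : r * (1 - p.a) ≤ p.a ^ (j / 2 + 1) := by
    rw [← le_div_iff₀ h2]; linarith [p.ptx_eq (j / 2), p.M_pos]
  have hx := p.x_pos
  have hc0 : 0 < c := pos_of_mul_pos_left (lt_of_lt_of_le (by linarith) hc) (by positivity)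
  have h5 : (r * (1 - p.a)) ^ 2 ≤ (p.a ^ (j / 2 + 1)) ^ 2 := pow_le_pow_left₀ (by positivity) h3 2
  have h6 : 0 < p.a ^ (j / 2 + 1) := p.apos _
  rw [dsl, div_div, ← mul_div_assoc, div_le_iff₀ (by positivity)]
  have h7 : 9 / 100 ≤ (1 - p.a) ^ 2 * (1 - p.a) := by nlinarith
  calc 2 * (p.a * p.x) ≤ c * r ^ 2 * (9 / 100) := by nlinarith
    _ ≤ c * r ^ 2 * ((1 - p.a) ^ 2 * (1 - p.a)) := by gcongr
    _ = c * ((r * (1 - p.a)) ^ 2 * (1 - p.a)) := by ring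
    _ ≤ _ := by gcongr

lemma Hf_le {z : ℂ} (hz : z ∈ rect) : p.Hf z ≤ z.re + p.M := by
  have h1 := (p.phi_mem hz.1).2; have h2 := p.apos p.g
  have h3 : 0 ≤ p.a ^ p.g * (1 - z.im) := mul_nonneg h2.le (by linarith [hz.2.2])
  have h4 := min_le_left (z.re + p.phi z.re) (z.re + p.M * (2 * z.im - 1))
  have h5 := min_le_left 0 (p.rL z.im + p.lam * z.re)
  have h6 := min_le_left 0 (p.rR z.im + p.lam * (1 - z.re)); unfold Hf; linarith

lemma lipOn_min_zero {S : Set ℂ} {c : ℝ} (hc : 0 ≤ c) {f : ℂ → ℝ} (h : ∀ z ∈ S, 0 ≤ f z) :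
    LipOn S c fun z => min 0 (f z) :=
  (LipOn.const' 0 hc).congr fun z hz => min_eq_left (h z hz)

variable {p}

lemma F_near_translation {S : Set ℂ} (hS : S ⊆ rect) {δ c : ℝ} (hδ : 0 < δ) (hδ1 : δ ≤ 1)
    (hc : 0 < c) (hc1 : c ≤ 1)
    (hR : (∀ z ∈ S, z.re ≤ 1 - δ) ∨ ∀ z ∈ S, z.im ≤ 1 - δ)
    (hL : (∀ z ∈ S, δ ≤ z.re) ∨ (∀ z ∈ S, z.im ≤ 2 / 3 - δ) ∨ ∀ z ∈ S, 2 / 3 + δ ≤ z.im)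
    (he : p.err ≤ c * δ ^ 2 / 10) (hl : p.lam ≤ c) {z w : ℂ} (hz : z ∈ S) (hw : w ∈ S) :
    dist (p.F z - p.F w) (z - w) ≤ 200 * c * dist z w := by
  have hc0 := hc.le; have hx := p.x_pos; have hxs := p.x_le_s.trans p.s_le_err
  have hec : p.err ≤ c / 10 := he.trans (by nlinarith [mul_le_mul hδ1 hδ1 hδ.le zero_le_one])
  have heδ : p.err ≤ δ / 10 := he.trans (by nlinarith [mul_le_of_le_one_left hδ.le hδ1])
  have hM := p.M_le_x; have hgc : p.a ^ p.g ≤ c := by linarith [p.a_pow_g_le]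
  have hCf : ∀ z ∈ S, p.Cf z = z.im := by
    intro z hz; obtain ⟨h1, h2⟩ := hS hz; rcases hR with h | h
    · exact p.C_of_left (by linarith [h z hz, p.w_le_err]) h2.2
    · exact p.C_of_low h1.2 (by linarith [h z hz, p.h_le_w, p.w_le_err])
  have hlip : LipOn S (4 * (3 * c)) fun z => p.Hf z - z.re := by
    refine p.Hf_sub_lip (fun n hn => ?_) ?_ ?_ (hgc.trans (by linarith)) ?_ ?_
    · linarith [p.two_a_pow_sub_le hn, p.s_le_err]
    · linarith [p.M_div_w_le_err]
    · linarith
    · rcases hL with h | h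
      · refine lipOn_min_zero (by linarith) fun z hz => ?_
        have := p.le_rL (hS hz).2; nlinarith [p.bump_le_err, h z hz, p.lam_pos]
      · refine p.rL_lip hc0 (fun z hz w hw => ?_) hgc hl
        have key : |p.Lx z.im - p.Lx w.im| ≤ c * |z.im - w.im| := by
          refine p.abs_Lx_sub_le hc0 fun m hm h1 h2 => ?_
          refine p.sig_le_of_lt hm (r := 3 * δ) (by linarith) ?_ (by nlinarith)
          have hm' : m ≤ leftEndIdx p.N m := by unfold leftEndIdx; split_ifs <;> omega
          have e1 := abs_le.1 (abs_leftNode_sub_le (le_refl m))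
          have e2 := abs_le.1 (abs_leftNode_sub_le hm'); rcases h with h | h
          · have := max_le (h w hw) (h z hz)
            have := le_min (by linarith : 2 / 3 - 1 / 3 * (1 / 2 : ℝ) ^ m ≤ leftNode m)
              (by linarith : _ ≤ leftNode (leftEndIdx p.N m))
            linarith
          · have := le_min (h w hw) (h z hz)
            have := max_le (by linarith : leftNode m ≤ 2 / 3 + 1 / 3 * (1 / 2 : ℝ) ^ m)
              (by linarith : leftNode (leftEndIdx p.N m) ≤ _)
            linarith
        exact key.trans (mul_le_mul_of_nonneg_left (abs_im_sub_le z w) hc0)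
    · rcases hR with h | h
      · refine lipOn_min_zero (by linarith) fun z hz => ?_
        have := p.le_rR (hS hz).2; nlinarith [p.bump_le_err, h z hz, p.lam_pos]
      · refine (p.rR_lip hc0 le_rfl (fun z hz w hw => ?_) ((LipOn.const 0).congr fun z hz => ?_)
          hgc hl).mono (by linarith)
        · have key : |p.Rx z.im - p.Rx w.im| ≤ c * |z.im - w.im| := by
            refine p.abs_Rx_sub_le hc0 fun m hm h1 => ?_
            refine p.sig_le_of_lt hm (r := 2 * δ) (by linarith) ?_ (by nlinarith)
            have := max_le (h w hw) (h z hz); rw [pow_succ] at h1; linarith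
          exact key.trans (mul_le_mul_of_nonneg_left (abs_im_sub_le z w) hc0)
        · exact p.q_of_le (by linarith [h z hz, p.h_le_w, p.w_le_err])
  have hV : LipOn (hShear p.Hf '' S) (5 * (2 * c)) fun z => p.Vf z - z.im := by
    refine p.Vf_sub_lip ?_ (fun m hm => ?_) ?_ ?_ ?_
    · linarith [p.κ_sub_le]
    · linarith [p.abs_mu_le_s hm, p.s_le_err]
    · linarith
    · linarith [p.e0_le_x]
    · rcases hR with h | h
      · have hle : ∀ z ∈ hShear p.Hf '' S, z.re ≤ 1 - δ / 2 := by
          rintro _ ⟨z, hz, rfl⟩; have := p.Hf_le (hS hz); have := h z hz; simp only [hShear]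
          linarith
        have key : LipOn (hShear p.Hf '' S) c fun z => p.tau z.re := by
          intro z hz w hw
          have key : |p.tau z.re - p.tau w.re| ≤ c * |z.re - w.re| := by
            refine p.abs_tau_sub_le hc0 fun j _ h1 _ => ?_
            refine p.dsl_le_of_lt (r := δ / 2) (by linarith)
              (h1.le.trans (max_le (hle w hw) (hle z hz))) (by nlinarith)
          exact key.trans (mul_le_mul_of_nonneg_left (abs_re_sub_le z w) hc0)
        have h1 : LipOn (hShear p.Hf '' S) c fun z : ℂ => p.lam * (1 - z.im) :=
          ((LipOn.const 1).sub LipOn.im).const_mul_le p.lam_pos.le (by linarith)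
        exact (LipOn.const' 0 (by linarith)).min ((key.add h1).mono (by linarith))
      · refine lipOn_min_zero (by linarith) fun z hz => ?_
        obtain ⟨z, hz, rfl⟩ := hz; have := (p.tau_mem (hShear p.Hf z).re).1; have := h z hz
        simp only [hShear] at *; nlinarith [p.depth_le_err, p.lam_pos]
  have hF : ∀ z ∈ S, p.F z = ⟨p.Hf z, p.Vf (hShear p.Hf z)⟩ := by
    intro z hz; rw [F_apply, Fmap, vShear, vShear, hCf z hz, hShear]
  have h1 := hlip z hz w hw; have h2 := hV _ ⟨z, hz, rfl⟩ _ ⟨w, hw, rfl⟩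
  have h3 : dist (hShear p.Hf z) (hShear p.Hf w) ≤ (1 + 12 * c) * dist z w + dist z w := by
    have := dist_le_abs_add_abs (hShear p.Hf z) (hShear p.Hf w)
    have e1 := abs_re_sub_le z w; have e2 := abs_im_sub_le z w
    simp only [hShear] at this ⊢
    have e3 := abs_add_le (p.Hf z - z.re - (p.Hf w - w.re)) (z.re - w.re)
    rw [show p.Hf z - z.re - (p.Hf w - w.re) + (z.re - w.re) = p.Hf z - p.Hf w by ring] at e3
    linarith
  have h4 := dist_le_abs_add_abs (p.F z - p.F w) (z - w); rw [hF z hz, hF w hw] at h4 ⊢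
  simp only [sub_re, sub_im] at h4
  have e1 : p.Hf z - p.Hf w - (z.re - w.re) = p.Hf z - z.re - (p.Hf w - w.re) := by ring
  have e2 : p.Vf (hShear p.Hf z) - p.Vf (hShear p.Hf w) - (z.im - w.im) =
      p.Vf (hShear p.Hf z) - z.im - (p.Vf (hShear p.Hf w) - w.im) := by ring
  rw [e1, e2] at h4; simp only [hShear] at h1 h2 h3 h4 ⊢
  have h5 : 0 ≤ c * dist z w := by positivity
  nlinarith [mul_le_mul_of_nonneg_left h3 hc0, mul_le_mul_of_nonneg_left hc1 h5]

/-- Away from the two limit points of the removed set, `F` is close to a translation. -/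
lemma exists_F_near_translation {r θ : ℝ} (hr : 0 < r) (hθ : 0 < θ) : ∃ n : ℕ, ∀ p : Par, n ≤ p.g →
    ∀ v w, v ∈ rect → w ∈ rect → r ≤ infDist v removed → dist v w < r / 4 →
      |dist (p.F v) (p.F w) - dist v w| ≤ θ * dist v w := by
  set δ := min (r / 4) 1; set c := min (θ / 200) 1; have hδ : 0 < δ := lt_min (by linarith) one_pos
  have hc : 0 < c := lt_min (by linarith) one_pos; have hδr : δ ≤ r / 4 := min_le_left _ _
  obtain ⟨n, hn⟩ := exists_err_le (ε := min (c * δ ^ 2 / 10) c) (lt_min (by positivity) hc)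
  refine ⟨n, fun p hp v w hv hw hvr hvw => ?_⟩; obtain ⟨h1, h2⟩ := hn p hp
  have hfar : ∀ e ∈ removed, r ≤ |v.re - e.re| + |v.im - e.im| := fun e he =>
    (hvr.trans (infDist_le_dist_of_mem he)).trans (dist_le_abs_add_abs v e)
  have h3 := hfar _ one_one_mem_removed; have h4 := hfar _ two_thirds_mem_removed
  simp only [sub_zero] at h3 h4
  rw [abs_sub_comm, abs_sub_comm v.im, abs_of_nonneg (by linarith [hv.1.2]),
    abs_of_nonneg (by linarith [hv.2.2])] at h3
  rw [abs_of_nonneg hv.1.1] at h4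
  have h5 := abs_le.1 ((abs_re_sub_le v w).trans hvw.le)
  have h6 := abs_le.1 ((abs_im_sub_le v w).trans hvw.le)
  have key := F_near_translation (p := p) (S := {v, w})
    (by rintro _ (rfl | rfl) <;> assumption) hδ (min_le_right _ _) hc (min_le_right _ _) ?_ ?_
    (h1.trans (min_le_left _ _)) (h2.trans (min_le_right _ _)) (mem_insert v _) (mem_insert_of_mem _ rfl)
  · calc |dist (p.F v) (p.F w) - dist v w| ≤ dist (p.F v - p.F w) (v - w) := by
          rw [dist_eq_norm, dist_eq_norm v, dist_eq_norm]; exact abs_norm_sub_norm_le _ _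
      _ ≤ 200 * c * dist v w := key
      _ ≤ θ * dist v w := by gcongr; linarith [min_le_left (θ / 200) 1]
  · by_cases h : v.re ≤ 1 - r / 2
    · left; rintro _ (rfl | rfl) <;> linarith
    · right; rintro _ (rfl | rfl) <;> linarith
  · by_cases h : r / 2 ≤ v.re
    · left; rintro _ (rfl | rfl) <;> linarith
    · right; rcases le_abs.1 (show r / 2 ≤ |v.im - 2 / 3| by linarith) with h | h
      · right; rintro _ (rfl | rfl) <;> linarith
      · left; rintro _ (rfl | rfl) <;> linarith

end Par

/-- Paths either avoid the set `W` or pass through it; in the second case the jump within `W` is small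
compared to the length.  Only the values of the pseudo-distance `D` on `S` matter. -/
lemma TranslationGluing.PolyPath.le_of_far {G : TranslationGluing}
    {D : G.Surface → G.Surface → ENNReal} {S W : Set G.Surface} {c r r' b κ σ : ℝ}
    (htri : ∀ x y z, D x z ≤ D x y + D y z) (hsymm : ∀ x y, D x y = D y x) (hself : ∀ x, D x x = 0)
    (hWS : Wᶜ ⊆ S) (hW : ∀ w ∈ W ∩ S, ∀ w' ∈ W ∩ S, D w w' ≤ ofReal σ)
    (η : G.Piece → ℂ → ℝ) (hη : ∀ i, ContinuousOn (η i) (G.region i)) (hc : 0 ≤ c) (hr : r < r')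
    (hS : ∀ i z (hz : z ∈ G.region i), r < η i z → pt i z hz ∈ S)
    (hloc : ∀ i z (hz : z ∈ G.region i), r < η i z → ∀ᶠ w in 𝓝[G.region i] z,
      ∀ hw : w ∈ G.region i, r < η i w → D (pt i z hz) (pt i w hw) ≤ ofReal (c * dist z w))
    (hsmall : ∀ i z (hz : z ∈ G.region i), η i z ≤ r' → pt i z hz ∈ W)
    (hb : 0 ≤ b) (hκ : 0 ≤ κ) (hσ : σ ≤ 2 * b * κ)
    {x y : G.Surface} {l : ℝ} (h : PolyPath x y l) (hx : x ∉ W) (hy : y ∉ W)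
    (hxW : ∀ w ∈ W ∩ S, ofReal b ≤ D x w) (hyW : ∀ w ∈ W ∩ S, ofReal b ≤ D y w) :
    D x y ≤ ofReal ((1 + κ) * (c * l)) := by
  classical
  have hl : 0 ≤ c * l := mul_nonneg hc h.nonneg
  let E : G.Surface → G.Surface → ENNReal := fun x y => if x ∈ S ∧ y ∈ S then D x y else ⊤
  have hE : ∀ {x y}, x ∈ S → y ∈ S → E x y = D x y := fun hx hy => if_pos ⟨hx, hy⟩
  let e : G.Surface → ENNReal := fun x => if x ∈ W then 0 else ⨅ w : ↥(W ∩ S), D x w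
  have he : ∀ x ∉ W, e x = ⨅ w : ↥(W ∩ S), D x w := fun x hx => if_neg hx
  have key := h.dichotomy (D := E) (e := e) (fun x y z => ?_) (fun x y => ?_) (fun x y => ?_)
    (fun x => ?_) η hη hc hr (fun i z hz hzr => ?_) (fun i z hz h => if_pos (hsmall i z hz h))
  · rw [hE (hWS hx) (hWS hy), he x hx, he y hy] at key; rcases key with h1 | h1
    · refine h1.trans (ofReal_le_ofReal ?_); nlinarith
    · have h4 : b + b ≤ c * l := by
        have := (add_le_add (le_iInf fun w : ↥(W ∩ S) => hxW w w.2)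
          (le_iInf fun w : ↥(W ∩ S) => hyW w w.2)).trans h1
        rwa [← ofReal_add hb hb, ENNReal.ofReal_le_ofReal_iff hl] at this
      have h5 : D x y ≤ (⨅ w : ↥(W ∩ S), D x w) + ofReal σ + ⨅ w : ↥(W ∩ S), D y w := by
        simp_rw [add_iInf, iInf_add]
        refine le_iInf fun w' => le_iInf fun w => (htri x w y).trans ?_
        rw [add_assoc, hsymm y]; gcongr
        exact (htri _ w' _).trans (by gcongr; exact hW _ w.2 _ w'.2)
      rw [add_right_comm] at h5
      refine h5.trans ((add_le_add h1 (ofReal_le_ofReal (?_ : σ ≤ κ * (c * l)))).trans_eq ?_)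
      · nlinarith
      · rw [← ofReal_add hl (by positivity)]; congr 1; ring
  · by_cases h : (x ∈ S ∧ y ∈ S) ∧ y ∈ S ∧ z ∈ S
    · rw [hE h.1.1 h.2.2, hE h.1.1 h.1.2, hE h.1.2 h.2.2]; exact htri x y z
    · rcases not_and_or.1 h with h | h <;> simp [E, h]
  · simp only [E, hsymm x y, and_comm]
  · by_cases h : x ∈ S ∧ y ∈ S
    · rw [hE h.1 h.2]
      by_cases h1 : x ∈ W
      · simp [e, h1]
      rw [he x h1]
      by_cases h2 : y ∈ W
      · exact (iInf_le _ ⟨y, h2, h.2⟩).trans le_self_add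
      · rw [he y h2, add_iInf]; exact le_iInf fun w => (iInf_le _ w).trans (htri _ _ _)
    · simp [E, h]
  · by_cases hx : x ∈ W
    · exact Or.inr (if_pos hx)
    · exact Or.inl (by rw [hE (hWS hx) (hWS hx), hself])
  · filter_upwards [hloc i z hz hzr, (hη i z hz).eventually (lt_mem_nhds hzr)] with w h1 h2 hw
    rw [hE (hS i z hz hzr) (hS i w hw h2)]; exact h1 hw h2

namespace Par

variable {p : Par} (hα : p.a = alpha p.g) {ι : U p.g → p.surf.Surface}
  (hι : ∀ f v hv (hU : X f v hv ∈ U p.g) y, Over y f (p.F v) → ι ⟨X f v hv, hU⟩ = y)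
  {h : limitSurface.Surface → ℝ} (hh : ∀ f v hv, h (X f v hv) = infDist v removed)
  (hl : ∀ x y l, PolyPath x y l → h x ≤ h y + l)

include hh in
lemma _root_.ArnouxYoccoz.mem_U_of_lt {g : ℕ} {x : limitSurface.Surface}
    (hx : (1 / 2) ^ ((g - 1) / 2) < h x) : x ∈ U g := by
  obtain ⟨f, v, hv, rfl⟩ := X_surjective x; rw [hh] at hx
  exact X_mem_U.2 (not_dropped_of_lt_infDist hx)

include hl in
lemma _root_.ArnouxYoccoz.sub_le_flatDist (x y : limitSurface.Surface) :
    ofReal (h x - h y) ≤ flatDist x y :=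
  le_iInf₂ fun l hp => ofReal_le_ofReal (by linarith [hl x y l hp])

lemma _root_.ArnouxYoccoz.sheetBound_flatDist (g : ℕ) : SheetBound g (flatDist (G := limitSurface)) 1 :=
  ⟨zero_le_one, flatDist_comm, fun _ _ _ _ _ _ => flatDist_triangle _ _ _, fun f u v hu hv _ _ => by
    simpa using flatDist_X_le f hu hv⟩

include hα hι hh hl

/-- The distances in the limit surface are bounded by the lengths of the paths in `X_g`. -/
lemma flatDist_le_of_polyPath {ρ r r' σ θ κ : ℝ} (hr : r < r') (hρ : r' < ρ)
    (hg : (1 / 2) ^ ((p.g - 1) / 2) < r) (hθ1 : θ < 1)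
    (hF : ∀ v w, v ∈ rect → w ∈ rect → r ≤ infDist v removed → dist v w < r / 4 →
      |dist (p.F v) (p.F w) - dist v w| ≤ θ * dist v w)
    (hσ : ∀ x ∈ U p.g, ∀ y ∈ U p.g, h x ≤ r' → h y ≤ r' → flatDist x y ≤ ofReal σ)
    (hκ : 0 ≤ κ) (hσκ : σ ≤ 2 * (ρ - r') * κ) {x y : U p.g} (hx : ρ ≤ h x) (hy : ρ ≤ h y) {l : ℝ}
    (hp : PolyPath (ι x) (ι y) l) :
    flatDist x.1 y.1 ≤ ofReal ((1 + κ) * ((1 - θ)⁻¹ * l)) := by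
  have hr0 : 0 < r := lt_trans (by positivity) hg; have hinj := (isEmbedding_iota hα hι).injective
  have hO : {x | r' < h x} ⊆ U p.g := fun x hx => mem_U_of_lt hh (hg.trans (hr.trans hx))
  obtain ⟨O', hO'⟩ := exists_preimage hα hO
  have hover : ∀ (i : Bool × ℕ) z (hz : z ∈ triangle p.g i) hv
      (hU : X (p.sheet i) (p.F.symm (p.place i z)) hv ∈ U p.g), ι ⟨_, hU⟩ = pt (G := p.surf) i z hz :=
    fun i z hz hv hU => hι _ _ _ _ _ ⟨i, z, hz, rfl, rfl, by simp⟩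
  have hmem : ∀ u : U p.g, ι u ∈ O' ↔ r' < h u := by
    rintro ⟨u, hu⟩; obtain ⟨f, v, hv, rfl⟩ := X_surjective u
    obtain ⟨kk, h1, h2⟩ := exists_kk (p := p) hv.1; rw [hι f v hv hu _ (over_unplace hα h1 h2), hO']
    simp only [place_unplace, sheet_piece, Homeomorph.symm_apply_apply]
    exact ⟨fun ⟨_, h⟩ => h, fun h => ⟨hv, h⟩⟩
  have hsurj : ∀ z ∈ O', ∃ u, ι u = z := by
    intro z hz
    induction z using Quot.ind with
    | mk q =>
      obtain ⟨i, z, hz'⟩ := q; obtain ⟨hv, h1⟩ := (hO' i z hz').1 hz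
      exact ⟨⟨_, hO h1⟩, hover i z hz' hv _⟩
  have hcont : ∀ i, Continuous fun w => p.F.symm (p.place i w) := fun i =>
    p.F.symm.continuous.comp (p.continuous_place i)
  have hgood : ∀ (i : Bool × ℕ) w (hw : w ∈ triangle p.g i),
      r < infDist (p.F.symm (p.place i w)) removed → ∃ hv : p.F.symm (p.place i w) ∈ good,
        ∃ hU : X (p.sheet i) _ hv ∈ U p.g, pt (G := p.surf) i w hw = ι ⟨_, hU⟩ := fun i w hw hrw => by
    have hv : p.F.symm (p.place i w) ∈ good := ⟨mem_rect_of_triangle hα hw (by simp), fun hm => by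
      rw [infDist_zero_of_mem hm] at hrw; linarith⟩
    have hU : X (p.sheet i) _ hv ∈ U p.g := mem_U_of_lt hh (by rw [hh]; exact hg.trans hrw)
    exact ⟨hv, hU, (hover i w hw hv hU).symm⟩
  set j : p.surf.Surface → limitSurface.Surface := Function.extend ι Subtype.val fun _ => x.1
  have hj : ∀ u, j (ι u) = u := fun u => hinj.extend_apply _ _ _
  have key := hp.le_of_far (D := fun z z' => flatDist (j z) (j z')) (S := range ι) (W := O'ᶜ) (σ := σ)
    (r := r) (r' := r') (b := ρ - r') (κ := κ) (c := (1 - θ)⁻¹) (fun _ _ _ => flatDist_triangle _ _ _)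
    (fun _ _ => flatDist_comm _ _) (fun _ => flatDist_self _) (fun z hz => hsurj z (not_not.1 hz)) ?_
    (fun i z => infDist (p.F.symm (p.place i z)) removed)
    (fun i => ((continuous_infDist_pt _).comp (hcont i)).continuousOn)
    (by rw [inv_nonneg]; linarith) hr ?_ ?_ ?_ (by linarith) hκ hσκ ?_ ?_ ?_ ?_
  · rwa [hj, hj] at key
  · rintro _ ⟨hw, u, rfl⟩ _ ⟨hw', u', rfl⟩; rw [mem_compl_iff, hmem, not_lt] at hw hw'; rw [hj, hj]
    exact hσ _ u.2 _ u'.2 hw hw'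
  · intro (i : Bool × ℕ) z (hz : z ∈ triangle p.g i) hrz; obtain ⟨_, _, h1⟩ := hgood i z hz hrz
    exact Eq.symm h1 ▸ mem_range_self _
  · intro (i : Bool × ℕ) z (hz : z ∈ triangle p.g i) hrz
    have ev := (hcont i).continuousAt.eventually
      (ball_mem_nhds (p.F.symm (p.place i z)) (show 0 < r / 4 by linarith))
    refine nhdsWithin_le_nhds ?_
    filter_upwards [ev] with w hzw (hw : w ∈ triangle p.g i) hrw
    obtain ⟨hv, hU, h1⟩ := hgood i z hz hrz; obtain ⟨hv', hU', h2⟩ := hgood i w hw hrw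
    rw [h1, h2, hj, hj]; refine (flatDist_X_le _ hv hv').trans (ofReal_le_ofReal ?_)
    have h1 := (abs_le.1 (hF _ _ hv.1 hv'.1 hrz.le (by rwa [dist_comm]))).1
    simp only [Homeomorph.apply_symm_apply, dist_place] at h1
    rw [inv_mul_eq_div, le_div_iff₀ (by linarith)]; linarith
  · intro i z hz hrz; rw [mem_compl_iff, hO' i z hz]; rintro ⟨hv, h1⟩; rw [mem_ofPred_eq, hh] at h1
    exact absurd hrz (not_le.2 h1)
  · simpa [hmem] using hρ.trans_le hx
  · simpa [hmem] using hρ.trans_le hy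
  all_goals
    rintro _ ⟨hw, u, rfl⟩; rw [mem_compl_iff, hmem, not_lt] at hw; rw [hj, hj]
    exact (ofReal_le_ofReal (by linarith)).trans (sub_le_flatDist hl _ _)

end Par

namespace Par

variable {p : Par} (hα : p.a = alpha p.g) {ι : U p.g → p.surf.Surface}
  (hι : ∀ f v hv (hU : X f v hv ∈ U p.g) y, Over y f (p.F v) → ι ⟨X f v hv, hU⟩ = y)
  {h : limitSurface.Surface → ℝ} (hh : ∀ f v hv, h (X f v hv) = infDist v removed)

include hα hι hh

/-- The distances in `X_g` are bounded by the lengths of the paths in the limit surface. -/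
lemma flatDist_iota_le_of_polyPath (hcont : Continuous h) (hpos : ∀ x, 0 < h x)
    {ρ r r' σ θ κ : ℝ} (hr : r < r') (hρ : r' < ρ)
    (hg : (1 / 2) ^ ((p.g - 1) / 2) < r) (hθ : 0 ≤ θ)
    (hF : ∀ v w, v ∈ rect → w ∈ rect → r ≤ infDist v removed → dist v w < r / 4 →
      |dist (p.F v) (p.F w) - dist v w| ≤ θ * dist v w)
    (hσ : ∀ x y : U p.g, h x ≤ r' → h y ≤ r' → flatDist (ι x) (ι y) ≤ ofReal σ)
    (hσr : r' ≤ σ) (hκ : 0 ≤ κ) (hσκ : σ ≤ 2 * (ρ - r') * κ) {x y : U p.g} (hx : ρ ≤ h x) (hy : ρ ≤ h y)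
    {l : ℝ} (hp : PolyPath x.1 y.1 l) :
    flatDist (ι x) (ι y) ≤ ofReal ((1 + κ) * ((1 + θ) * l)) := by
  classical
  have hr0 : 0 < r := lt_trans (by positivity) hg
  have hU : ∀ x, r < h x → x ∈ U p.g := fun x hx => mem_U_of_lt hh (hg.trans hx)
  set j : limitSurface.Surface → p.surf.Surface := fun z => if hz : z ∈ U p.g then ι ⟨z, hz⟩ else ι x
  have hj : ∀ u (hu : u ∈ U p.g), j u = ι ⟨u, hu⟩ := fun u hu => dif_pos hu
  have key := hp.le_of_far
    (D := fun x y => max (flatDist (j x) (j y)) (ofReal |h x - h y|)) (S := U p.g)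
    (W := {x | h x ≤ r'}) (σ := σ) (r := r) (r' := r') (b := ρ - r') (κ := κ) (c := 1 + θ)
    (fun x y z => max_le ((flatDist_triangle _ _ _).trans (add_le_add (le_max_left _ _) (le_max_left _ _)))
      (((ofReal_le_ofReal (abs_sub_le _ (h y) _)).trans ENNReal.ofReal_add_le).trans
        (add_le_add (le_max_right _ _) (le_max_right _ _))))
    (fun x y => by simp only [flatDist_comm, abs_sub_comm]) (fun x => by simp [flatDist_self])
    (fun x hx => hU x (hr.trans (not_le.1 hx))) ?_
    (fun i z => if hz : z ∈ limitSurface.region i then h (pt i z hz) else 0) ?_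
    (by linarith) hr (fun i z hz hrz => hU _ (by rwa [dif_pos hz] at hrz)) ?_
    (fun i z hz hrz => by rwa [dif_pos hz] at hrz) (by linarith) hκ hσκ (not_le.2 (hρ.trans_le hx))
    (not_le.2 (hρ.trans_le hy)) ?_ ?_
  · rw [hj _ x.2, hj _ y.2] at key; exact (le_max_left _ _).trans key
  · rintro w ⟨hw, h1⟩ w' ⟨hw', h2⟩; rw [hj w h1, hj w' h2]
    refine max_le (hσ _ _ hw hw') (ofReal_le_ofReal (le_trans ?_ hσr)); rw [mem_ofPred_eq] at hw hw'
    rw [abs_le]; constructor <;> linarith [hpos w, hpos w']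
  · intro i; rw [continuousOn_iff_continuous_domRestrict]
    have : Continuous fun z : limitSurface.region i => h (pt i z z.2) :=
      by
      have h2 : Continuous fun z : limitSurface.region i => (⟨i, z⟩ : limitSurface.Pt) :=
        continuous_sigmaMk (σ := fun i => ↥(limitSurface.region i))
      exact hcont.comp (continuous_quot_mk.comp h2)
    exact this.congr fun z => by simp
  · intro i z hz hrz; rw [dif_pos hz] at hrz; obtain ⟨f, v, hv, rfl, rfl, h1⟩ := exists_eq_X i z hz
    have hUv := hU _ hrz; rw [h1] at hrz hUv; rw [hh] at hrz
    have ev := (eventually_flatDist_iota_le hα hι hUv).and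
      (ball_mem_nhds v (show 0 < r / 4 by linarith))
    have hun : Tendsto (unchart f) (𝓝 (chart f v)) (𝓝 v) := by
      have := (continuous_unchart f).tendsto (chart f v); rwa [unchart_chart] at this
    refine nhdsWithin_le_nhds ?_
    filter_upwards [hun.eventually ev] with w hw hwr hw1
    obtain ⟨f', v', hv', hf, rfl, h2⟩ := exists_eq_X _ w hwr
    obtain rfl : f = f' := by simpa using hf
    rw [unchart_chart] at hw; obtain ⟨hw2, hw3⟩ := hw; rw [dif_pos hwr, h2] at hw1
    have hUv' := hU _ hw1; rw [h1, h2, dist_chart, hj _ hUv, hj _ hUv', hh, hh]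
    rw [dist_comm] at hw3; have h3 := (abs_le.1 (hF v v' hv.1 hv'.1 hrz.le hw3)).2
    refine max_le ((hw2 hv' hUv').trans (ofReal_le_ofReal (by linarith)))
      (ofReal_le_ofReal ?_)
    have h4 := (lipschitz_infDist_pt removed).dist_le_mul v v'
    rw [Real.dist_eq, NNReal.coe_one] at h4; nlinarith [dist_nonneg (x := v) (y := v')]
  all_goals
    rintro w ⟨hw, -⟩; refine (ofReal_le_ofReal ?_).trans (le_max_right _ _)
    rw [mem_ofPred_eq] at hw; exact le_trans (by linarith) (le_abs_self _)

omit hα hι in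
lemma exists_flatDist_bounds (hcont : Continuous h) (hpos : ∀ x, 0 < h x)
    (hl : ∀ x y l, PolyPath x y l → h x ≤ h y + l) {ρ ε : ℝ} (hρ : 0 < ρ) (hε : 0 < ε) (hε1 : ε ≤ 1) :
    ∃ n : ℕ, ∀ p : Par, p.a = alpha p.g → n ≤ p.g → ∀ ι : U p.g → p.surf.Surface,
      (∀ f v hv (hU : X f v hv ∈ U p.g) y, Over y f (p.F v) → ι ⟨X f v hv, hU⟩ = y) →
      (∀ x, ρ ≤ h x → x ∈ U p.g) ∧ ∀ x y : U p.g, ρ ≤ h x → ρ ≤ h y →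
        ofReal (1 - ε) * flatDist x.1 y.1 ≤ flatDist (ι x) (ι y) ∧
          flatDist (ι x) (ι y) ≤ ofReal (1 + ε) * flatDist x.1 y.1 := by
  set κ := ε / 3; have hκ : 0 < κ := by positivity
  have hκ1 : κ ≤ 1 / 3 := by simp only [κ]; linarith
  set σ := ρ * κ; have hσ0 : 0 < σ := mul_pos hρ hκ; have hσρ : σ ≤ ρ := by simp only [σ]; nlinarith
  obtain ⟨m, hm⟩ := exists_pow_lt_of_lt_one (show 0 < σ / 100000 by positivity)
    (show (1 / 2 : ℝ) < 1 by norm_num)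
  obtain ⟨n, hn⟩ := exists_F_near_translation (r := σ / 20000) (θ := κ) (by positivity) hκ
  refine ⟨max n (2 * (m + 3) + 1), fun p hα hp ι hι => ?_⟩
  have hM : m + 3 ≤ (p.g - 1) / 2 := by omega
  have hpow : (1 / 2 : ℝ) ^ (m + 3) ≤ σ / 100000 :=
    (pow_le_pow_of_le_one (by norm_num) (by norm_num) (by omega)).trans hm.le
  have hg : (1 / 2 : ℝ) ^ ((p.g - 1) / 2) < σ / 20000 :=
    (pow_le_pow_of_le_one (by norm_num) (by norm_num) hM).trans_lt (by linarith)
  have hF := hn p (by omega)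
  have small : ∀ {D : limitSurface.Surface → limitSurface.Surface → ENNReal} {C : ℝ},
      SheetBound p.g D C → C ≤ 1080 → ∀ x ∈ U p.g, ∀ y ∈ U p.g, h x ≤ σ / 10000 → h y ≤ σ / 10000 →
        D x y ≤ ofReal σ := by
    intro D C H hC x hx y hy h1 h2; obtain ⟨f, v, hv, rfl⟩ := X_surjective x
    obtain ⟨f', v', hv', rfl⟩ := X_surjective y; rw [hh] at h1 h2
    refine (H.le_of_infDist_lt hM (by omega) hx hy (r := σ / 5000) (by linarith) (by linarith)).trans
      (ofReal_le_ofReal ?_)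
    have : 0 ≤ 2 * (σ / 5000) + 14 * (1 / 2 : ℝ) ^ (m + 3) := by positivity
    nlinarith
  have hσκ : σ ≤ 2 * (ρ - σ / 10000) * κ := by simp only [σ] at hσρ ⊢; nlinarith
  refine ⟨fun x hx => mem_U_of_lt hh (hg.trans (by linarith)), fun x y hx hy => ⟨?_, ?_⟩⟩
  · refine le_iInf₂ fun l hp => ?_
    have := flatDist_le_of_polyPath hα hι hh hl (r := σ / 20000) (r' := σ / 10000) (θ := κ)
      (by linarith) (by linarith) hg (by linarith) hF (small (sheetBound_flatDist _) (by norm_num)) hκ.le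
      hσκ hx hy hp
    refine (mul_le_mul_right this _).trans ?_; have hl0 : 0 ≤ l := hp.nonneg
    rw [← ENNReal.ofReal_mul (by linarith)]; refine ofReal_le_ofReal ?_
    have e : (1 - ε) * ((1 + κ) * ((1 - κ)⁻¹ * l)) = (1 - ε) * (1 + κ) * l / (1 - κ) := by
      rw [div_eq_mul_inv]; ring
    rw [e, div_le_iff₀ (by linarith), mul_comm l]; refine mul_le_mul_of_nonneg_right ?_ hl0
    simp only [κ] at hκ hκ1 ⊢; nlinarith
  · have hsmall := small (sheetBound_iota hα hι) le_rfl
    rw [flatDist, flatDist, mul_iInf_of_ne (by simpa using by linarith) ENNReal.ofReal_ne_top]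
    refine le_iInf fun l => ?_
    rw [mul_iInf_of_ne (by simpa using by linarith) ENNReal.ofReal_ne_top]
    refine le_iInf fun hp => ?_
    refine (flatDist_iota_le_of_polyPath hα hι hh hcont hpos (r := σ / 20000) (r' := σ / 10000) (θ := κ)
      (by linarith) (by linarith) hg hκ.le hF (fun x y h1 h2 => ?_) (by linarith) hκ.le hσκ hx hy
      hp).trans ?_
    · simpa using hsmall x.1 x.2 y.1 y.2 h1 h2
    · have hl0 : 0 ≤ l := hp.nonneg; rw [← ENNReal.ofReal_mul (by linarith), ← mul_assoc]
      refine ofReal_le_ofReal (mul_le_mul_of_nonneg_right ?_ hl0); simp only [κ] at hκ hκ1 ⊢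
      nlinarith

end Par

open ArnouxYoccoz TranslationGluing in
theorem theoremT : (∀ g : ℕ, 3 ≤ g → IsOpen (U g) ∧ Dense (U g) ∧ U g ⊆ U (g + 1)) ∧
    (∀ x : limitSurface.Surface, ∃ g : ℕ, 3 ≤ g ∧ x ∈ U g) ∧
    ∃ ι : ∀ (g : ℕ) (hg : 3 ≤ g), U g → (surface g hg).Surface,
      (∀ (g : ℕ) (hg : 3 ≤ g), IsEmbedding (ι g hg) ∧ IsPiecewiseAffine (ι g hg)) ∧
      ∀ K : Set limitSurface.Surface, IsCompact K → ∀ ε : ℝ, 0 < ε →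
        ∃ N : ℕ, ∀ (g : ℕ) (hg : 3 ≤ g), N ≤ g →
          ∃ hK : K ⊆ U g, ∀ (x y : limitSurface.Surface) (hx : x ∈ K) (hy : y ∈ K),
            ofReal (1 - ε) * flatDist x y ≤ flatDist (ι g hg ⟨x, hK hx⟩) (ι g hg ⟨y, hK hy⟩) ∧
              flatDist (ι g hg ⟨x, hK hx⟩) (ι g hg ⟨y, hK hy⟩) ≤ ofReal (1 + ε) * flatDist x y := by
  refine ⟨fun g hg => ⟨isOpen_U g, dense_U g, U_mono g⟩, exists_mem_U, ?_⟩
  obtain ⟨h, hh, hcont, hpos, hl⟩ := exists_height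
  choose N hN using fun (ρ ε : ℝ) (hρ : 0 < ρ) (hε : 0 < ε) (hε1 : ε ≤ 1) =>
    Par.exists_flatDist_bounds hh hcont hpos hl hρ hε hε1
  have hex : ∀ g (hg : 3 ≤ g), ∃ ι : U g → (surface g hg).Surface, (IsEmbedding ι ∧ IsPiecewiseAffine ι) ∧
      ∀ (ρ ε : ℝ) (hρ : 0 < ρ) (hε : 0 < ε) (hε1 : ε ≤ 1), N ρ ε hρ hε hε1 ≤ g →
        (∀ x, ρ ≤ h x → x ∈ U g) ∧ ∀ x y : U g, ρ ≤ h x → ρ ≤ h y →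
          ofReal (1 - ε) * flatDist x.1 y.1 ≤ flatDist (ι x) (ι y) ∧
            flatDist (ι x) (ι y) ≤ ofReal (1 + ε) * flatDist x.1 y.1 := by
    intro g hg; obtain ⟨p, rfl, hα⟩ := exists_par hg; obtain ⟨ι, hι⟩ := Par.exists_iota hα
    exact ⟨ι, ⟨Par.isEmbedding_iota hα hι, Par.isPiecewiseAffine_iota hα hι⟩,
      fun ρ ε hρ hε hε1 hg => hN ρ ε hρ hε hε1 p hα hg ι hι⟩
  choose ι hι hb using hex
  refine ⟨ι, hι, fun K hK ε hε => ?_⟩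
  obtain ⟨ρ, hρ, hKρ⟩ : ∃ ρ > 0, ∀ x ∈ K, ρ ≤ h x := by
    rcases K.eq_empty_or_nonempty with rfl | hne
    · exact ⟨1, one_pos, fun x hx => hx.elim⟩
    · obtain ⟨x, hx, hmin⟩ := hK.exists_isMinOn hne hcont.continuousOn
      exact ⟨h x, hpos x, fun y hy => hmin hy⟩
  refine ⟨N ρ (min ε 1) hρ (lt_min hε one_pos) (min_le_right _ _), fun g hg hNg => ?_⟩
  obtain ⟨h1, h2⟩ := hb g hg _ _ _ _ _ hNg
  refine ⟨fun x hx => h1 x (hKρ x hx), fun x y hx hy => ?_⟩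
  obtain ⟨h3, h4⟩ := h2 ⟨x, h1 x (hKρ x hx)⟩ ⟨y, h1 y (hKρ y hy)⟩ (hKρ x hx) (hKρ y hy); constructor
  · refine le_trans ?_ h3; gcongr; exact min_le_left _ _
  · refine h4.trans ?_; gcongr; exact min_le_left _ _

end
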